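/- **Conventions.** Let $\mathbb{R}^{2,1}$ be $\mathbb{R}^3$ with $\langle\xi,\zeta\rangle=\xi_1\zeta_1+\xi_2\zeta_2-\xi_0\zeta_0$ and coordinates ordered $(\xi_1,\xi_2,\xi_0)$. Let $\mathbb{C}'=\{z=x+jy: x,y\in\mathbb{R}\}$, $j^2=1$, be the paracomplex numbers, with $e^z,\cosh,\sinh,\cos,\sin$ given by their power series, $\tanh=\sinh/\cosh$, $\tan=\sin/\cos$. For Weierstrass data $(h,\eta\,dz)$ put $$W[h,\eta](x,y)=\operatorname{Re}\int_0^{x+jy}\bigl(2h,\,1-h^2,\,-j(1+h^2)\bigr)\eta\,dz .$$ A *timelike minimal surface with planar curvature lines* is a $C^4$ timelike immersion of an open subset of $\mathbb{R}^2$ into $\mathbb{R}^{2,1}$ with zero mean curvature, whose shape operator is diagonalizable at every point and each of whose curvature lines lies in a plane. A *generalized timelike minimal surface with planar curvature lines* is a $C^4$ map $F$ on an open subset of $\mathbb{R}^2$ with $F_{xx}=F_{yy}$, $\langle F_x,F_x\rangle+\langle F_y,F_y\rangle=0=\langle F_x,F_y\rangle$ and $F_x\pm F_y\ne0$ everywhere,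 which is a timelike immersion on a dense subset, and there is a timelike minimal surface with planar curvature lines. A family of maps is a *continuous deformation* if it depends continuously on its parameter with respect to uniform convergence on compacta in each component. A *similarity* of $\mathbb{R}^{2,1}$ is a positive homothety composed with an isometry. A surface $F$ on $U$ is a *piece* of $G:\mathbb{R}^2\to\mathbb{R}^{2,1}$ if there is a similarity $T$ such that near each point of $U$ one has $F=T\circ G\circ\Phi$ for some local diffeomorphism $\Phi$. **Families.** For $G:\mathbb{R}^2\to\mathbb{R}^{2,1}$ write $G^{\#}(x,y)=G(x,y-2^{1/4})+\bigl(\tfrac1{\sqrt2},0,-\tfrac{2\sqrt2}{3}\bigr)$. Put $h_5=\frac{z+j}{1-jz}$ and $\eta_5=\frac14(jz-1)^2$. * $\mathrm{BL2}$, $t\in[0,1]$: $W[e^{2^{1/4}z}+jt,\;2^{-5/4}e^{-2^{1/4}z}]$ followed by the rotation $(\xi_1,\xi_2,\xi_0)\mapsto(-\xi_2,\xi_1,\xi_0)$. * $\mathrm P$, $t\in[-\frac\pi4,\frac{3\pi}4]$: for $t$ in the open interval $R_t\,W[h,\eta]$ with $R_t=(1-\sin(t+\frac\pi4))|\cos2t|+\sin(t+\frac\pi4)$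 and $h=\frac{\sqrt{\cos2t}}{\cos t-\sin t}\tanh\bigl(2^{-3/4}\sqrt{\cos2t}\,z\bigr)$, $\eta=\frac{\cosh^2(2^{-3/4}\sqrt{\cos2t}\,z)}{2^{1/4}(\cos t+\sin t)}$ if $t<\frac\pi4$; $h=2^{-1/4}z$, $\eta=2^{-3/4}$ if $t=\frac\pi4$; $h=-\frac{\sqrt{-\cos2t}}{\cos t-\sin t}\tan\bigl(2^{-3/4}\sqrt{-\cos2t}\,z\bigr)$, $\eta=\frac{\cos^2(2^{-3/4}\sqrt{-\cos2t}\,z)}{2^{1/4}(\cos t+\sin t)}$ if $t>\frac\pi4$. At both end points the surface is the timelike plane $(0,\,3\cdot2^{-3/4}x,\,-3\cdot2^{-3/4}y)$. * $\mathrm{S2}$, $t\in[-\frac\pi2,\frac\pi4]$: $W[h,\eta]^{\#}$ with, for $a_0=\sqrt{\cos t}$, $a_1=\sqrt{\cos t-\sin t}$, $h=j\bigl((\frac{a_0}{a_1}+1)e^{a_1jz}-\frac{a_0}{a_1}\bigr)$, $\eta=\frac{e^{-a_1jz}}{2(a_1+a_0)}$ if $t\ne\frac\pi4$, and $h=2^{-1/4}z+j$,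 $\eta=2^{-3/4}$ if $t=\frac\pi4$. * $\mathrm{CL}$, $t\in[0,\infty)$: $W[h,\eta]^{\#}$ with $h=\frac{j((t+1)e^{jtz}-1)}{(t-1)e^{jtz}+1}$, $\eta=\frac1{4t^2}e^{-jtz}\bigl((t-1)e^{jtz}+1\bigr)^2$ if $t>0$, and $h=h_5$, $\eta=\eta_5$ if $t=0$. * $\mathrm A$, $t\in\mathbb{R}$: $W[h_5,\,e^{2jt}\eta_5]^{\#}$. * $\mathrm{S4}$, $t\in[0,\infty)$: $W[je^{jz}+t,\;\frac12e^{-jz}]^{\#}$. * $\mathrm M$, $t\in[0,\infty)$: $W[je^{jz}+jt,\;\frac12e^{-jz}]^{\#}$. **Theorem.** There is a continuous deformation consisting exactly of all timelike minimal surfaces with planar curvature lines. Namely: 1. Each of the seven families is a continuous deformation. 2. They are joined to each other: $\mathrm{BL2}_0=\mathrm P_0$, $\mathrm P_{\pi/4}=\mathrm{S2}_{\pi/4}$, $\mathrm{S2}_0=\mathrm{CL}_1$, $\mathrm{CL}_0=\mathrm A_0$, $\mathrm{S2}_{-\pi/2}=\mathrm{S4}_0$, $\mathrm{S4}_0=\mathrm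 M_0$. Consequently any two members of the families are joined by a continuous deformation, with parameter in $[0,1]$, all of whose surfaces are members. 3. Every member is a generalized timelike minimal surface with planar curvature lines, defined on all of $\mathbb{R}^2$. 4. Conversely, every timelike minimal surface with planar curvature lines on a (nonempty) connected open set, in arbitrary coordinates, is a piece of a member, and so is every generalized timelike minimal surface with planar curvature lines on a connected open set. 5. Each of the surfaces with the following data $(h,\eta\,dz)$ is a member up to a similarity of $\mathbb{R}^{2,1}$ and a homothety and translation $p\mapsto sp+p_0$, $s\neq0$, of the $(x,y)$-plane: the plane $(0,dz)$; the catenoids $(\tan z,\frac12\cos^2z\,dz)$, $(e^z,\frac12e^{-z}dz)$, $(je^{jz},\frac12e^{-jz}dz)$ and $(h_5,\eta_5\,dz)$, and the associated family $(h_5,e^{j\varphi}\eta_5\,dz)$, $\varphi\in\mathbb{R}$, of the last one; the Enneper-type surface $(\sqrt2z,\frac1{2\sqrt2}dz)$; the Bonnet-type surfaces $(c\tan z,\frac1{2c}\cos^2z\,dz)$ with $c>1$, $(je^{jz}-jc,\frac12e^{-jz}dz)$ with $0<c<1$, $c=1$ or $c>1$, $(e^z+j,\frac12e^{-z}dz)$,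 and $(je^{jz}+c,\frac12e^{-jz}dz)$ with $c>0$. -/

import Mathlib

open Set Filter Topology

noncomputable section

namespace PlanarCurvature

/-! ### Paracomplex numbers -/

/-- The paracomplex numbers `x + j y`, `j ^ 2 = 1`. -/
abbrev Para : Type := QuadraticAlgebra ℝ 1 0

/-- The paracomplex unit `j`. -/
def j : Para := ⟨0, 1⟩

/-- A real number as a paracomplex number. -/
def ofReal (r : ℝ) : Para := ⟨r, 0⟩

/-- The sum of the power series `∑ a n * z ^ n`, taken separately in the real and the imaginary
part. -/
def powerSeries (a : ℕ → ℝ) (z : Para) : Para :=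
  ⟨∑' n, a n * (z ^ n).re, ∑' n, a n * (z ^ n).im⟩

/-- `e ^ z = ∑ z ^ n / n!`. -/
def pexp (z : Para) : Para := powerSeries (fun n => 1 / (n.factorial : ℝ)) z

/-- `cosh z = ∑ z ^ (2 n) / (2 n)!`. -/
def pcosh (z : Para) : Para :=
  powerSeries (fun n => if Even n then 1 / (n.factorial : ℝ) else 0) z

/-- `sinh z = ∑ z ^ (2 n + 1) / (2 n + 1)!`. -/
def psinh (z : Para) : Para :=
  powerSeries (fun n => if Even n then 0 else 1 / (n.factorial : ℝ)) z

/-- `cos z = ∑ (-1) ^ n z ^ (2 n) / (2 n)!`. -/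
def pcos (z : Para) : Para :=
  powerSeries (fun n => if Even n then (-1) ^ (n / 2) / (n.factorial : ℝ) else 0) z

/-- `sin z = ∑ (-1) ^ n z ^ (2 n + 1) / (2 n + 1)!`. -/
def psin (z : Para) : Para :=
  powerSeries (fun n => if Even n then 0 else (-1) ^ (n / 2) / (n.factorial : ℝ)) z

/-- The quotient `z / w`. It is only meaningful where `w` is invertible (and is given the value `0`
elsewhere). -/
def pdiv (z w : Para) : Para := z * Ring.inverse w

def ptanh (z : Para) : Para := pdiv (psinh z) (pcosh z)

def ptan (z : Para) : Para := pdiv (psin z) (pcos z)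

/-! ### Minkowski space and surfaces -/

/-- Points of Minkowski space `ℝ^{2,1}`; the coordinates `0, 1, 2` are `ξ₁, ξ₂, ξ₀`. -/
abbrev Mink : Type := Fin 3 → ℝ

/-- The Lorentzian scalar product `ξ₁ ζ₁ + ξ₂ ζ₂ - ξ₀ ζ₀`. -/
def mink (a b : Mink) : ℝ := a 0 * b 0 + a 1 * b 1 - a 2 * b 2

/-- A similarity of Minkowski space: a homothety composed with an isometry. -/
def IsSimilarity (T : Mink → Mink) : Prop :=
  ∃ (r : ℝ) (A : Mink →ₗ[ℝ] Mink) (b : Mink), 0 < r ∧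
    (∀ v w, mink (A v) (A w) = mink v w) ∧ ∀ p, T p = r • A p + b

/-- The derivative of `F` at `p` in the direction `v`. -/
def d1 (F : ℝ × ℝ → Mink) (p v : ℝ × ℝ) : Mink := fderiv ℝ F p v

/-- The second derivative of `F` at `p` in the directions `v` and `w`. -/
def d2 (F : ℝ × ℝ → Mink) (p v w : ℝ × ℝ) : Mink := fderiv ℝ (fun q => d1 F q w) p v

/-- The first fundamental form. -/
def firstForm (F : ℝ × ℝ → Mink) (p v w : ℝ × ℝ) : ℝ := mink (d1 F p v) (d1 F p w)

/-- The second fundamental form with respect to the normal vector `n` at `p`. -/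
def secondForm (F : ℝ × ℝ → Mink) (p : ℝ × ℝ) (n : Mink) (v w : ℝ × ℝ) : ℝ :=
  mink (d2 F p v w) n

/-- The determinant of the first fundamental form in the coordinates `(x, y)`. -/
def gramDet (F : ℝ × ℝ → Mink) (p : ℝ × ℝ) : ℝ :=
  firstForm F p (1, 0) (1, 0) * firstForm F p (0, 1) (0, 1) - firstForm F p (1, 0) (0, 1) ^ 2

/-- The first fundamental form at `p` is Lorentzian. (In particular `F` is immersed at `p`.) -/
def TimelikeAt (F : ℝ × ℝ → Mink) (p : ℝ × ℝ) : Prop := gramDet F p < 0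

/-- `n` is one of the two (spacelike) unit normal vectors of `F` at `p`. -/
def IsUnitNormal (F : ℝ × ℝ → Mink) (p : ℝ × ℝ) (n : Mink) : Prop :=
  mink n n = 1 ∧ ∀ v, mink (d1 F p v) n = 0

/-- The mean curvature `(L G - 2 M F + N E) / (2 (E G - F ^ 2))`. -/
def meanCurvature (F : ℝ × ℝ → Mink) (p : ℝ × ℝ) (n : Mink) : ℝ :=
  (secondForm F p n (1, 0) (1, 0) * firstForm F p (0, 1) (0, 1)
    - 2 * secondForm F p n (1, 0) (0, 1) * firstForm F p (1, 0) (0, 1)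
    + secondForm F p n (0, 1) (0, 1) * firstForm F p (1, 0) (1, 0)) / (2 * gramDet F p)

/-- `v` is an eigenvector of the shape operator of `F` at `p`. -/
def IsPrincipal (F : ℝ × ℝ → Mink) (p v : ℝ × ℝ) : Prop :=
  v ≠ 0 ∧ ∀ n, IsUnitNormal F p n → ∃ k : ℝ, ∀ w, secondForm F p n v w = k * firstForm F p v w

/-- A timelike minimal surface `F : U → ℝ^{2,1}`: a timelike immersion with mean curvature zero. -/
structure IsTimelikeMinimal (F : ℝ × ℝ → Mink) (U : Set (ℝ × ℝ)) : Prop where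
  isOpen : IsOpen U
  contDiffOn : ContDiffOn ℝ 4 F U
  timelike : ∀ p ∈ U, TimelikeAt F p
  minimal : ∀ p ∈ U, ∀ n, IsUnitNormal F p n → meanCurvature F p n = 0

/-- `F` has planar curvature lines on `U`: the shape operator is diagonalizable at every point (so
that there are curvature lines through every point in two independent directions), and each
curvature line lies in a plane of `ℝ^{2,1}`. -/
structure HasPlanarCurvatureLines (F : ℝ × ℝ → Mink) (U : Set (ℝ × ℝ)) : Prop where
  exists_principal : ∀ p ∈ U, ∃ v w : ℝ × ℝ,
    LinearIndependent ℝ ![v, w] ∧ IsPrincipal F p v ∧ IsPrincipal F p w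
  planar : ∀ (a b : ℝ) (γ : ℝ → ℝ × ℝ), a < b → ContDiffOn ℝ 1 γ (Ioo a b) →
    MapsTo γ (Ioo a b) U → (∀ t ∈ Ioo a b, IsPrincipal F (γ t) (deriv γ t)) →
    ∃ (m : Mink) (c : ℝ), m ≠ 0 ∧ ∀ t ∈ Ioo a b, ∑ i, m i * F (γ t) i = c

/-- A timelike minimal surface with planar curvature lines, in arbitrary coordinates. -/
def IsTimelikeMinimalPCL (F : ℝ × ℝ → Mink) (U : Set (ℝ × ℝ)) : Prop :=
  IsTimelikeMinimal F U ∧ HasPlanarCurvatureLines F U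

/-- A generalized timelike minimal surface (a timelike minimal surface with singular points where
the metric degenerates), in Lorentz conformal coordinates `(x, y)`: the sum of two regular null
curves, one in `u = x + y` and one in `v = x - y`, that is a timelike immersion on a dense set. -/
structure IsGeneralizedTimelikeMinimal (F : ℝ × ℝ → Mink) (U : Set (ℝ × ℝ)) : Prop where
  isOpen : IsOpen U
  contDiffOn : ContDiffOn ℝ 4 F U
  wave : ∀ p ∈ U, d2 F p (1, 0) (1, 0) = d2 F p (0, 1) (0, 1)
  conformal : ∀ p ∈ U, firstForm F p (1, 0) (1, 0) + firstForm F p (0, 1) (0, 1) = 0 ∧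
    firstForm F p (1, 0) (0, 1) = 0
  regular : ∀ p ∈ U, d1 F p (1, 1) ≠ 0 ∧ d1 F p (1, -1) ≠ 0
  dense : U ⊆ closure (U ∩ {p | TimelikeAt F p})

/-- A generalized timelike minimal surface with planar curvature lines: off its singular points it
is a timelike minimal surface with planar curvature lines. -/
def IsGeneralizedPCL (F : ℝ × ℝ → Mink) (U : Set (ℝ × ℝ)) : Prop :=
  IsGeneralizedTimelikeMinimal F U ∧ IsTimelikeMinimalPCL F (U ∩ {p | TimelikeAt F p})

/-- `F : U → ℝ^{2,1}` is a piece of the surface `G : ℝ² → ℝ^{2,1}`: after one similarity of the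
ambient space, `F` is locally a reparametrization of `G` by a local diffeomorphism. -/
def IsPieceOf (F : ℝ × ℝ → Mink) (U : Set (ℝ × ℝ)) (G : ℝ × ℝ → Mink) : Prop :=
  ∃ T : Mink → Mink, IsSimilarity T ∧ ∀ p ∈ U, ∃ (V : Set (ℝ × ℝ)) (Φ : ℝ × ℝ → ℝ × ℝ),
    IsOpen V ∧ p ∈ V ∧ V ⊆ U ∧ ContDiffOn ℝ 1 Φ V ∧
    (∀ q ∈ V, Function.Bijective (fderiv ℝ Φ q)) ∧ ∀ q ∈ V, F q = T (G (Φ q))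

/-! ### The Weierstrass-type representation -/

/-- `(2 h, 1 - h ^ 2, - j (1 + h ^ 2)) η`. -/
def weierstrassForm (h η : Para → Para) (z : Para) : Fin 3 → Para :=
  ![2 * h z * η z, (1 - h z ^ 2) * η z, -(j * (1 + h z ^ 2) * η z)]

/-- The surface `Re ∫ (2 h, 1 - h ^ 2, - j (1 + h ^ 2)) η dz` with Weierstrass data `(h, η dz)`,
integrated from `0` to `z = x + j y` along the segment; it maps the origin to the origin. A
denominator of `h` may be non-invertible at isolated points of the segment, which do not contribute
to the integral. -/
def weierstrass (h η : Para → Para) (p : ℝ × ℝ) : Mink := fun i =>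
  ∫ t in (0 : ℝ)..1, (weierstrassForm h η ⟨t * p.1, t * p.2⟩ i * ⟨p.1, p.2⟩).re

/-! ### The deformation -/

/-- The family `Ψ t`, `t ∈ I`, of maps is a continuous deformation: it depends continuously on the
parameter with respect to uniform convergence on compacta of each component. -/
def IsContinuousDeformation (I : Set ℝ) (Ψ : ℝ → ℝ × ℝ → Mink) : Prop :=
  ∀ t ∈ I, ∀ K : Set (ℝ × ℝ), IsCompact K → ∀ i : Fin 3,
    TendstoUniformlyOn (fun s p => Ψ s p i) (fun p => Ψ t p i) (𝓝[I] t) K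

/-- `2 ^ (k / 4)`. -/
def q2 (k : ℝ) : ℝ := (2 : ℝ) ^ (k / 4)

def hP (t : ℝ) (z : Para) : Para :=
  if t < Real.pi / 4 then
    (√(Real.cos (2 * t)) / (Real.cos t - Real.sin t)) •
      ptanh ((√(Real.cos (2 * t)) / q2 3) • z)
  else if t = Real.pi / 4 then (1 / q2 1) • z
  else -((√(-Real.cos (2 * t)) / (Real.cos t - Real.sin t)) •
      ptan ((√(-Real.cos (2 * t)) / q2 3) • z))

def ηP (t : ℝ) (z : Para) : Para :=
  if t < Real.pi / 4 then
    (1 / (q2 1 * (Real.cos t + Real.sin t))) • pcosh ((√(Real.cos (2 * t)) / q2 3) • z) ^ 2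
  else if t = Real.pi / 4 then ofReal (1 / q2 3)
  else (1 / (q2 1 * (Real.cos t + Real.sin t))) • pcos ((√(-Real.cos (2 * t)) / q2 3) • z) ^ 2

/-- The homothety factor `(1 - sin (t + π / 4)) |cos 2t| + sin (t + π / 4)`. -/
def scaleP (t : ℝ) : ℝ :=
  (1 - Real.sin (t + Real.pi / 4)) * |Real.cos (2 * t)| + Real.sin (t + Real.pi / 4)

/-- The family through the timelike plane (at both end points `t = -π / 4` and `t = 3 π / 4`),
the catenoids `C_S1` (`t = 0`) and `C_T` (`t = π / 2`) and the Enneper-type surface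
(`t = π / 4`). -/
def surfaceP (t : ℝ) (p : ℝ × ℝ) : Mink :=
  if t = -(Real.pi / 4) ∨ t = 3 * Real.pi / 4 then ![0, 3 / q2 3 * p.1, -(3 / q2 3 * p.2)]
  else scaleP t • weierstrass (hP t) (ηP t) p

def a0 (t : ℝ) : ℝ := √(Real.cos t)

def a1 (t : ℝ) : ℝ := √(Real.cos t - Real.sin t)

def hS2 (t : ℝ) (z : Para) : Para :=
  if t = Real.pi / 4 then (1 / q2 1) • z + j
  else j * ((a0 t / a1 t + 1) • pexp (a1 t • (j * z)) - ofReal (a0 t / a1 t))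

def ηS2 (t : ℝ) (z : Para) : Para :=
  if t = Real.pi / 4 then ofReal (1 / q2 3)
  else (1 / (2 * (a1 t + a0 t))) • pexp (-(a1 t • (j * z)))

def h5 (z : Para) : Para := pdiv (z + j) (1 - j * z)

def η5 (z : Para) : Para := (1 / 4 : ℝ) • (j * z - 1) ^ 2

def hCL (c : ℝ) (z : Para) : Para :=
  if c = 0 then h5 z
  else pdiv (j * ((c + 1) • pexp (c • (j * z)) - 1)) ((c - 1) • pexp (c • (j * z)) + 1)

def ηCL (c : ℝ) (z : Para) : Para :=
  if c = 0 then η5 z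
  else (1 / (4 * c ^ 2)) • (pexp (-(c • (j * z))) * ((c - 1) • pexp (c • (j * z)) + 1) ^ 2)

/-- The translation of the parameter plane and of Minkowski space that lets the families below start
at the Enneper-type surface of the family `surfaceP`. -/
def align (G : ℝ × ℝ → Mink) (p : ℝ × ℝ) : Mink :=
  G (p.1, p.2 - q2 1) + ![1 / √2, 0, -(2 * √2 / 3)]

/-- The explicit families that make up the deformation. -/
inductive Branch
  | BL2 | P | S2 | CL | A | S4 | M

open Branch

/-- The parameter interval of each family. -/
def params : Branch → Set ℝ
  | BL2 => Icc 0 1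
  | P => Icc (-(Real.pi / 4)) (3 * Real.pi / 4)
  | S2 => Icc (-(Real.pi / 2)) (Real.pi / 4)
  | CL => Ici 0
  | A => univ
  | S4 => Ici 0
  | M => Ici 0

/-- The rotation about the timelike axis by a right angle. -/
def rot (v : Mink) : Mink := ![-v 1, v 0, v 2]

/-- The surface with parameter `t` in each family. -/
def surface : Branch → ℝ → ℝ × ℝ → Mink
  | BL2, t => fun p => rot (weierstrass (fun z => pexp (q2 1 • z) + t • j)
      (fun z => (1 / q2 5) • pexp (-(q2 1 • z))) p)
  | P, t => surfaceP t
  | S2, t => align (weierstrass (hS2 t) (ηS2 t))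
  | CL, t => align (weierstrass (hCL t) (ηCL t))
  | A, t => align (weierstrass h5 (fun z => pexp ((2 * t) • j) * η5 z))
  | S4, t => align (weierstrass (fun z => j * pexp (j * z) + ofReal t)
      (fun z => (1 / 2 : ℝ) • pexp (-(j * z))))
  | M, t => align (weierstrass (fun z => j * pexp (j * z) + t • j)
      (fun z => (1 / 2 : ℝ) • pexp (-(j * z))))

/-- All surfaces that occur in the deformation. -/
def members : Set (ℝ × ℝ → Mink) := {G | ∃ b, ∃ t ∈ params b, G = surface b t}

/-- The named surfaces, by their Weierstrass data `(h, η dz)`. -/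
inductive IsNamed : (Para → Para) → (Para → Para) → Prop
  | plane : IsNamed (fun _ => 0) (fun _ => 1)
  | CT : IsNamed ptan (fun z => (1 / 2 : ℝ) • pcos z ^ 2)
  | BTper (c : ℝ) (hc : 1 < c) :
      IsNamed (fun z => c • ptan z) (fun z => (1 / (2 * c)) • pcos z ^ 2)
  | E : IsNamed (fun z => √2 • z) (fun _ => ofReal (1 / (2 * √2)))
  | BT1 (c : ℝ) (hc : 1 < c) :
      IsNamed (fun z => j * pexp (j * z) - c • j) (fun z => (1 / 2 : ℝ) • pexp (-(j * z)))
  | CS1 : IsNamed pexp (fun z => (1 / 2 : ℝ) • pexp (-z))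
  | BL1 : IsNamed (fun z => j * pexp (j * z) - j) (fun z => (1 / 2 : ℝ) • pexp (-(j * z)))
  | BS (c : ℝ) (hc : 0 < c) (hc' : c < 1) :
      IsNamed (fun z => j * pexp (j * z) - c • j) (fun z => (1 / 2 : ℝ) • pexp (-(j * z)))
  | CS2 : IsNamed (fun z => j * pexp (j * z)) (fun z => (1 / 2 : ℝ) • pexp (-(j * z)))
  | BL2 : IsNamed (fun z => pexp z + j) (fun z => (1 / 2 : ℝ) • pexp (-z))
  | BT2 (c : ℝ) (hc : 0 < c) :
      IsNamed (fun z => j * pexp (j * z) + ofReal c) (fun z => (1 / 2 : ℝ) • pexp (-(j * z)))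
  | CL : IsNamed h5 η5
  | assocCL (φ : ℝ) : IsNamed h5 (fun z => pexp (φ • j) * η5 z)

end PlanarCurvature

end

/-! The map z ↦ (re + im, re - im) identifies `Para` with ℝ × ℝ, and power series act on the two
null components separately. In the null coordinates u = x + y, v = x - y a Weierstrass surface is
therefore the sum of a curve in u and a curve in v with light-like velocities. A light-like vector
is a quadratic expression in a spinor: the velocities are `nullX (p u) (q u)` and `nullY (r v) (s
v)`, where q² and s² are the components of η, p = h q and r = h s. The poles of h become harmless
zeros of q and s. The geometry is encoded in two pairs of real functions: the metric is ρ² du dv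
with the pairing ρ = q s + p r, so singular points are the zeros of ρ, and the second fundamental
form is, up to a factor, W_X du² + W_Y dv² with the Wronskians W_X = q p' - p q' and W_Y = s r' - r
s' (`NullChartAt.isPrincipal_iff`).

For every member the four spinors solve f'' = κ f with one common constant κ (`surface_eq`), and κ
and the initial values depend continuously on the family parameter. The fundamental solutions `cs`
and `sn` are jointly continuous in κ and u, also at κ = 0, so the families are continuous
deformations, and the joints are identities between data or initial values. Along a curvature line u
= μ v + const the velocity is a multiple of μ X + Y, a quadratic form in `cs` and `sn` with three
vector coefficients. Their determinant contains a factor that vanishes exactly because the direction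
is principal (`det_pencil`), so the line is planar (`planar_cspin`).

Conversely, zero mean curvature makes the Hodge dual of dF closed, and dF splits into the closed
light-like forms (dF ± ⋆dF) / 2 (`IsTimelikeMinimal.exists_isNullSplit`); for generalized surfaces
the wave equation gives the same. Time components of primitives serve as null coordinates, and
spinors exist locally. A diagonalizable shape operator means that the Wronskians both vanish or have
the same sign, and this alternative is uniform near each point (`wronskian_dichotomy`). If both
vanish, the surface is a plane. Otherwise the null coordinates can be chosen with both Wronskians
equal to the same sign ±1; then p''/p = q''/q is a function f(u), r''/r = s''/s is a function g(v),
and planarity of the curvature lines forces f(u) = g(v), a constant κ (`IsSquare.exists_potential`).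
The normalized local forms are analytic and unique up to translations, so they glue over a connected
domain (`IsNullSplit.exists_global`).

It remains to classify the models. A linear map of the first spinor pair and the contragredient map
of the second one realize a conformal linear map of space, so a model with nonzero Wronskian is
determined up to similarity by κ, the 2 × 2 Gram matrix of pairings of initial data and the square
of a Wronskian (`homSimilar_of_gram`). Translations, homotheties and reflections of the plane reduce
this matrix: by diagonal scalings in the exponential basis for κ > 0, by a singular value
decomposition for κ < 0, by affine changes for κ = 0. Every normal form is that of a member
(`IsCore.isMemberLike`). -/

noncomputable section

namespace PlanarCurvature

open scoped QuadraticAlgebra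

/-! ### Null components of paracomplex numbers -/

/-- The null component `re + im`. -/
def pl (z : Para) : ℝ := z.re + z.im

/-- The null component `re - im`. -/
def mi (z : Para) : ℝ := z.re - z.im

@[simp] lemma pl_add (z w : Para) : pl (z + w) = pl z + pl w := by simp [pl]; ring
@[simp] lemma mi_add (z w : Para) : mi (z + w) = mi z + mi w := by simp [mi]; ring
@[simp] lemma pl_sub (z w : Para) : pl (z - w) = pl z - pl w := by simp [pl]; ring
@[simp] lemma mi_sub (z w : Para) : mi (z - w) = mi z - mi w := by simp [mi]; ring
@[simp] lemma pl_neg (z : Para) : pl (-z) = -pl z := by simp [pl]; ring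
@[simp] lemma mi_neg (z : Para) : mi (-z) = -mi z := by simp [mi]; ring
@[simp] lemma pl_mul (z w : Para) : pl (z * w) = pl z * pl w := by simp [pl]; ring
@[simp] lemma mi_mul (z w : Para) : mi (z * w) = mi z * mi w := by simp [mi]; ring
@[simp] lemma pl_smul (a : ℝ) (z : Para) : pl (a • z) = a * pl z := by simp [pl]; ring
@[simp] lemma mi_smul (a : ℝ) (z : Para) : mi (a • z) = a * mi z := by simp [mi]; ring
@[simp] lemma pl_one : pl 1 = 1 := by simp [pl]
@[simp] lemma mi_one : mi 1 = 1 := by simp [mi]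
@[simp] lemma pl_zero : pl 0 = 0 := by simp [pl]
@[simp] lemma mi_zero : mi 0 = 0 := by simp [mi]
@[simp] lemma pl_j : pl j = 1 := by simp [pl, j]
@[simp] lemma mi_j : mi j = -1 := by simp [mi, j]
@[simp] lemma pl_ofReal (a : ℝ) : pl (ofReal a) = a := by simp [pl, ofReal]
@[simp] lemma mi_ofReal (a : ℝ) : mi (ofReal a) = a := by simp [mi, ofReal]

@[simp] lemma pl_pow (z : Para) (n : ℕ) : pl (z ^ n) = pl z ^ n := by
  induction n with
  | zero => simp
  | succ n ih => rw [pow_succ, pl_mul, ih, pow_succ]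

@[simp] lemma mi_pow (z : Para) (n : ℕ) : mi (z ^ n) = mi z ^ n := by
  induction n with
  | zero => simp
  | succ n ih => rw [pow_succ, mi_mul, ih, pow_succ]

lemma re_eq (z : Para) : z.re = (pl z + mi z) / 2 := by simp [pl, mi]
lemma im_eq (z : Para) : z.im = (pl z - mi z) / 2 := by simp [pl, mi]

lemma para_ext {z w : Para} (h₁ : pl z = pl w) (h₂ : mi z = mi w) : z = w := by
  ext
  · rw [re_eq, re_eq, h₁, h₂]
  · rw [im_eq, im_eq, h₁, h₂]

/-- Taking null components is multiplicative, so the real and imaginary parts of zⁿ are half the sum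
and half the difference of two real n-th powers. Convergence of both parts is inherited from two
real series. -/
lemma powerSeries_components {a : ℕ → ℝ} {f : ℝ → ℝ} (h : ∀ x, HasSum (fun n => a n * x ^ n) (f x))
    (z : Para) : pl (powerSeries a z) = f (pl z) ∧ mi (powerSeries a z) = f (mi z) := by
  have h₁ := h (pl z)
  have h₂ := h (mi z)
  have hre : HasSum (fun n => a n * (z ^ n).re) ((f (pl z) + f (mi z)) / 2) := by
    have e : (fun n => a n * (z ^ n).re) = fun n => (a n * pl z ^ n + a n * mi z ^ n) / 2 := by
      funext n
      rw [re_eq, pl_pow, mi_pow]; ring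
    rw [e]
    exact (h₁.add h₂).div_const 2
  have him : HasSum (fun n => a n * (z ^ n).im) ((f (pl z) - f (mi z)) / 2) := by
    have e : (fun n => a n * (z ^ n).im) = fun n => (a n * pl z ^ n - a n * mi z ^ n) / 2 := by
      funext n
      rw [im_eq, pl_pow, mi_pow]; ring
    rw [e]
    exact (h₁.sub h₂).div_const 2
  rw [powerSeries, hre.tsum_eq, him.tsum_eq]
  constructor
  · rw [pl]; ring
  · rw [mi]; ring

lemma hasSum_exp (x : ℝ) : HasSum (fun n : ℕ => 1 / (n.factorial : ℝ) * x ^ n) (Real.exp x) := by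
  have := NormedSpace.expSeries_div_hasSum_exp (𝔸 := ℝ) x
  rw [← Real.exp_eq_exp_ℝ] at this
  simpa [div_eq_inv_mul] using this

lemma hasSum_of_even {a : ℕ → ℝ} {x y : ℝ} (h : HasSum (fun n => a (2 * n) * x ^ (2 * n)) y)
    (h' : ∀ n, a (2 * n + 1) = 0) : HasSum (fun n => a n * x ^ n) y := by
  have h0 : HasSum (fun n => a (2 * n + 1) * x ^ (2 * n + 1)) 0 := by simp [h', hasSum_zero]
  simpa using HasSum.even_add_odd (f := fun n => a n * x ^ n) h h0

lemma hasSum_of_odd {a : ℕ → ℝ} {x y : ℝ}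
    (h : HasSum (fun n => a (2 * n + 1) * x ^ (2 * n + 1)) y)
    (h' : ∀ n, a (2 * n) = 0) : HasSum (fun n => a n * x ^ n) y := by
  have h0 : HasSum (fun n => a (2 * n) * x ^ (2 * n)) 0 := by simp [h', hasSum_zero]
  simpa using HasSum.even_add_odd (f := fun n => a n * x ^ n) h0 h

@[simp] lemma pl_pexp (z : Para) : pl (pexp z) = Real.exp (pl z) :=
  (powerSeries_components hasSum_exp z).1
@[simp] lemma mi_pexp (z : Para) : mi (pexp z) = Real.exp (mi z) :=
  (powerSeries_components hasSum_exp z).2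

lemma hasSum_cosh' (x : ℝ) :
    HasSum (fun n : ℕ => (if Even n then 1 / (n.factorial : ℝ) else 0) * x ^ n) (Real.cosh x) := by
  refine hasSum_of_even ?_ (by simp)
  simpa [div_eq_inv_mul] using Real.hasSum_cosh x

lemma hasSum_sinh' (x : ℝ) :
    HasSum (fun n : ℕ => (if Even n then 0 else 1 / (n.factorial : ℝ)) * x ^ n) (Real.sinh x) := by
  refine hasSum_of_odd ?_ (by simp)
  simpa [div_eq_inv_mul] using Real.hasSum_sinh x

lemma hasSum_cos' (x : ℝ) :
    HasSum (fun n : ℕ => (if Even n then (-1) ^ (n / 2) / (n.factorial : ℝ) else 0) * x ^ n)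
      (Real.cos x) := by
  refine hasSum_of_even ?_ (by simp)
  convert Real.hasSum_cos x using 2 with n
  simp; ring

lemma hasSum_sin' (x : ℝ) :
    HasSum (fun n : ℕ => (if Even n then 0 else (-1) ^ (n / 2) / (n.factorial : ℝ)) * x ^ n)
      (Real.sin x) := by
  refine hasSum_of_odd ?_ (by simp)
  convert Real.hasSum_sin x using 2 with n
  have : (2 * n + 1) / 2 = n := by omega
  simp [this]; ring

@[simp] lemma pl_pcosh (z : Para) : pl (pcosh z) = Real.cosh (pl z) :=
  (powerSeries_components hasSum_cosh' z).1
@[simp] lemma mi_pcosh (z : Para) : mi (pcosh z) = Real.cosh (mi z) :=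
  (powerSeries_components hasSum_cosh' z).2
@[simp] lemma pl_psinh (z : Para) : pl (psinh z) = Real.sinh (pl z) :=
  (powerSeries_components hasSum_sinh' z).1
@[simp] lemma mi_psinh (z : Para) : mi (psinh z) = Real.sinh (mi z) :=
  (powerSeries_components hasSum_sinh' z).2
@[simp] lemma pl_pcos (z : Para) : pl (pcos z) = Real.cos (pl z) :=
  (powerSeries_components hasSum_cos' z).1
@[simp] lemma mi_pcos (z : Para) : mi (pcos z) = Real.cos (mi z) :=
  (powerSeries_components hasSum_cos' z).2
@[simp] lemma pl_psin (z : Para) : pl (psin z) = Real.sin (pl z) :=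
  (powerSeries_components hasSum_sin' z).1
@[simp] lemma mi_psin (z : Para) : mi (psin z) = Real.sin (mi z) :=
  (powerSeries_components hasSum_sin' z).2

lemma isUnit_para {w : Para} (h₁ : pl w ≠ 0) (h₂ : mi w ≠ 0) : IsUnit w := by
  refine IsUnit.of_mul_eq_one (⟨(1 / pl w + 1 / mi w) / 2, (1 / pl w - 1 / mi w) / 2⟩ : Para) ?_
  apply para_ext
  · rw [pl_mul, pl_one, show pl (⟨(1 / pl w + 1 / mi w) / 2, (1 / pl w - 1 / mi w) / 2⟩ : Para)
      = 1 / pl w by simp only [pl]; ring]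
    field_simp
  · rw [mi_mul, mi_one, show mi (⟨(1 / pl w + 1 / mi w) / 2, (1 / pl w - 1 / mi w) / 2⟩ : Para)
      = 1 / mi w by simp only [mi]; ring]
    field_simp

/-- Nonvanishing null components make `w` a unit, so the default value of `Ring.inverse` does not
enter. -/
lemma pdiv_components {z w : Para} (h₁ : pl w ≠ 0) (h₂ : mi w ≠ 0) :
    pl (pdiv z w) = pl z / pl w ∧ mi (pdiv z w) = mi z / mi w := by
  have h : pdiv z w * w = z := by
    rw [pdiv, mul_assoc, Ring.inverse_mul_cancel _ (isUnit_para h₁ h₂), mul_one]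
  constructor
  · rw [eq_div_iff h₁, ← pl_mul, h]
  · rw [eq_div_iff h₂, ← mi_mul, h]

/-! ### Surfaces with given spinors -/

/-- The past directed null vector with spinor `(p, q)`. -/
def nullX (p q : ℝ) : Mink := ![p * q, (q ^ 2 - p ^ 2) / 2, -(q ^ 2 + p ^ 2) / 2]

/-- The future directed null vector with spinor `(r, s)`. -/
def nullY (r s : ℝ) : Mink := ![r * s, (s ^ 2 - r ^ 2) / 2, (s ^ 2 + r ^ 2) / 2]

/-- The sum of the null curves with the velocities `nullX (p u) (q u)` and `nullY (r v) (s v)`. -/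
def sig (p q r s : ℝ → ℝ) (u v : ℝ) : Mink := fun i =>
  (∫ t in (0 : ℝ)..u, nullX (p t) (q t) i) + ∫ t in (0 : ℝ)..v, nullY (r t) (s t) i

/-- The surface with spinors `p, q, r, s` in the coordinates `(x, y)`. -/
def spin (p q r s : ℝ → ℝ) (z : ℝ × ℝ) : Mink := sig p q r s (z.1 + z.2) (z.1 - z.2)

lemma continuous_nullX {X : Type*} [TopologicalSpace X] {p q : X → ℝ} (hp : Continuous p)
    (hq : Continuous q) (i : Fin 3) : Continuous fun t => nullX (p t) (q t) i := by
  fin_cases i <;> simp [nullX] <;> fun_prop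

lemma continuous_nullY {X : Type*} [TopologicalSpace X] {p q : X → ℝ} (hp : Continuous p)
    (hq : Continuous q) (i : Fin 3) : Continuous fun t => nullY (p t) (q t) i := by
  fin_cases i <;> simp [nullY] <;> fun_prop

/-- On the two null components `j` is 1 and -1, which gives the last coordinates of `nullX` and
`nullY` their opposite signs. The factor 1/2 in them comes from re = (pl + mi) / 2. -/
lemma re_weierstrassForm_mul (h η : Para → Para) (z w : Para) {p q r s : ℝ}
    (hp : pl (h z) * q = p) (hq : pl (η z) = q ^ 2) (hr : mi (h z) * s = r)
    (hs : mi (η z) = s ^ 2) (i : Fin 3) :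
    (weierstrassForm h η z i * w).re = pl w * nullX p q i + mi w * nullY r s i := by
  have h2p : pl 2 = 2 := by rw [show (2 : Para) = 1 + 1 by norm_num]; simp; norm_num
  have h2m : mi 2 = 2 := by rw [show (2 : Para) = 1 + 1 by norm_num]; simp; norm_num
  rw [re_eq, pl_mul, mi_mul]
  fin_cases i <;>
    simp [weierstrassForm, nullX, nullY, hq, hs, h2p, h2m, ← hp, ← hr] <;> ring

/-- The segment may be constant in one null coordinate. It then stays at 0, and `q 0 ≠ 0` keeps the
exceptional set from being all of ℝ. -/
lemma countable_preimage_mul {q : ℝ → ℝ} (hq : {u | q u = 0}.Countable) (h0 : q 0 ≠ 0) (u : ℝ) :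
    {t : ℝ | q (t * u) = 0}.Countable := by
  rcases eq_or_ne u 0 with rfl | hu
  · simp [h0]
  · exact hq.preimage (mul_left_injective₀ hu)

/-- The data need to match the spinors only where `q` and `s` are nonzero, that is, off the poles of
`h`: these meet a segment from the origin in countably many parameters, a null set. The
substitutions t ↦ t u and t ↦ t v then turn the segment integral into two one-variable integrals. -/
theorem weierstrass_eq_spin {h η : Para → Para} {p q r s : ℝ → ℝ} (hpc : Continuous p)
    (hqc : Continuous q) (hrc : Continuous r) (hsc : Continuous s)
    (hq : {u | q u = 0}.Countable) (hs : {u | s u = 0}.Countable) (hq0 : q 0 ≠ 0) (hs0 : s 0 ≠ 0)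
    (H : ∀ z, q (pl z) ≠ 0 → s (mi z) ≠ 0 →
      pl (h z) * q (pl z) = p (pl z) ∧ mi (h z) * s (mi z) = r (mi z) ∧
      pl (η z) = q (pl z) ^ 2 ∧ mi (η z) = s (mi z) ^ 2) :
    weierstrass h η = spin p q r s := by
  funext z i
  set u := z.1 + z.2 with hu
  set v := z.1 - z.2 with hv
  have key : ∫ t in (0 : ℝ)..1, (weierstrassForm h η ⟨t * z.1, t * z.2⟩ i * ⟨z.1, z.2⟩).re =
      ∫ t in (0 : ℝ)..1, (u * nullX (p (t * u)) (q (t * u)) i +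
        v * nullY (r (t * v)) (s (t * v)) i) := by
    apply intervalIntegral.integral_congr_ae
    have hc : ({t : ℝ | q (t * u) = 0} ∪ {t : ℝ | s (t * v) = 0}).Countable :=
      (countable_preimage_mul hq hq0 u).union (countable_preimage_mul hs hs0 v)
    filter_upwards [hc.ae_notMem MeasureTheory.volume] with t ht _
    simp only [mem_union, mem_ofPred_eq, not_or] at ht
    have e1 : pl (⟨t * z.1, t * z.2⟩ : Para) = t * u := by simp [pl, hu]; ring
    have e2 : mi (⟨t * z.1, t * z.2⟩ : Para) = t * v := by simp [mi, hv]; ring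
    obtain ⟨h1, h2, h3, h4⟩ := H ⟨t * z.1, t * z.2⟩ (by rw [e1]; exact ht.1)
      (by rw [e2]; exact ht.2)
    rw [e1] at h1 h3
    rw [e2] at h2 h4
    rw [re_weierstrassForm_mul h η _ _ h1 h3 h2 h4]
    rfl
  have hX := continuous_nullX hpc hqc i
  have hY := continuous_nullY hrc hsc i
  rw [weierstrass, key, intervalIntegral.integral_add]
  · simp only [spin, sig]
    rw [intervalIntegral.integral_const_mul, intervalIntegral.integral_const_mul]
    congr 1
    · have := intervalIntegral.mul_integral_comp_mul_right (a := 0) (b := 1)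
        (f := fun t => nullX (p t) (q t) i) (c := u)
      simpa using this
    · have := intervalIntegral.mul_integral_comp_mul_right (a := 0) (b := 1)
        (f := fun t => nullY (r t) (s t) i) (c := v)
      simpa using this
  · exact (continuous_const.mul (hX.comp (continuous_id.mul continuous_const))).intervalIntegrable
      _ _
  · exact (continuous_const.mul (hY.comp (continuous_id.mul continuous_const))).intervalIntegrable
      _ _

/-- Simple zeros are isolated, and a discrete subspace of ℝ is countable. -/
lemma countable_zeros {q q' : ℝ → ℝ} (h : ∀ u, HasDerivAt q (q' u) u)
    (h' : ∀ u, q u = 0 → q' u ≠ 0) : {u | q u = 0}.Countable := by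
  have : DiscreteTopology {u | q u = 0} := by
    rw [discreteTopology_subtype_iff]
    intro x hx
    have := (h x).eventually_ne (c := 0) (h' x hx)
    rw [← disjoint_iff, Filter.disjoint_principal_right]
    exact this
  exact countable_of_Lindelof_of_discrete

/-! ### The solutions of `f'' = κ f` -/

/-- The solution of `f'' = κ f` with `f 0 = 1`, `f' 0 = 0`. -/
def cs (κ u : ℝ) : ℝ := Real.cosh (√κ * u) * Real.cos (√(-κ) * u)

/-- The solution of `f'' = κ f` with `f 0 = 0`, `f' 0 = 1`. -/
def sn (κ u : ℝ) : ℝ := ∫ t in (0 : ℝ)..u, cs κ t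

/-- Since `√` vanishes on negative numbers, one of the two factors of `cs` is always 1. The product
thus joins the hyperbolic and the trigonometric regime continuously at κ = 0, and all continuity of
the families rests on this. -/
lemma continuous_cs : Continuous fun x : ℝ × ℝ => cs x.1 x.2 := by
  unfold cs
  have := Real.continuous_sqrt
  have := Real.continuous_cosh
  fun_prop

/-- Having `sn` as an integral of `cs`, not as a quotient by √κ, makes joint continuity at κ = 0 an
instance of continuity of parametric integrals. -/
lemma continuous_sn : Continuous fun x : ℝ × ℝ => sn x.1 x.2 := by
  have h := intervalIntegral.continuous_parametric_intervalIntegral_of_continuous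
    (μ := MeasureTheory.volume) (a₀ := 0) (f := fun κ t => cs κ t) (X := ℝ) continuous_cs
    continuous_id
  have h' : Continuous fun x : ℝ × ℝ => ∫ t in (0 : ℝ)..x.2, cs x.1 t :=
    intervalIntegral.continuous_parametric_intervalIntegral_of_continuous
      (f := fun (x : ℝ × ℝ) t => cs x.1 t)
      (continuous_cs.comp (by fun_prop : Continuous fun p : (ℝ × ℝ) × ℝ => (p.1.1, p.2)))
      continuous_snd
  exact h'

@[simp] lemma cs_zero (κ : ℝ) : cs κ 0 = 1 := by simp [cs]
@[simp] lemma sn_zero (κ : ℝ) : sn κ 0 = 0 := by simp [sn]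

lemma hasDerivAt_sn (κ u : ℝ) : HasDerivAt (sn κ) (cs κ u) u := by
  have hc : Continuous (cs κ) := continuous_cs.comp (by fun_prop : Continuous fun t : ℝ => (κ, t))
  exact intervalIntegral.integral_hasDerivAt_right (hc.intervalIntegrable _ _)
    (hc.stronglyMeasurableAtFilter _ _) hc.continuousAt

lemma sqrt_mul_sn_of_nonneg {κ : ℝ} (h : 0 ≤ κ) (u : ℝ) : √κ * sn κ u = Real.sinh (√κ * u) := by
  have hc : Continuous (cs κ) := continuous_cs.comp (by fun_prop : Continuous fun t : ℝ => (κ, t))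
  rw [sn, ← intervalIntegral.integral_const_mul,
    intervalIntegral.integral_eq_sub_of_hasDerivAt (f := fun t => Real.sinh (√κ * t))]
  · simp
  · intro x _
    have := ((hasDerivAt_id x).const_mul √κ).sinh
    simp only [cs, Real.sqrt_eq_zero_of_nonpos (neg_nonpos.2 h)]
    simpa [mul_comm] using this
  · exact (continuous_const.mul hc).intervalIntegrable _ _

lemma sqrt_mul_sn_of_nonpos {κ : ℝ} (h : κ ≤ 0) (u : ℝ) : √(-κ) * sn κ u = Real.sin (√(-κ) * u) := by
  have hc : Continuous (cs κ) := continuous_cs.comp (by fun_prop : Continuous fun t : ℝ => (κ, t))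
  rw [sn, ← intervalIntegral.integral_const_mul,
    intervalIntegral.integral_eq_sub_of_hasDerivAt (f := fun t => Real.sin (√(-κ) * t))]
  · simp
  · intro x _
    have := ((hasDerivAt_id x).const_mul √(-κ)).sin
    simp only [cs, Real.sqrt_eq_zero_of_nonpos h]
    simpa [mul_comm] using this
  · exact (continuous_const.mul hc).intervalIntegrable _ _

lemma cs_of_nonneg {κ : ℝ} (h : 0 ≤ κ) (u : ℝ) : cs κ u = Real.cosh (√κ * u) := by
  simp [cs, Real.sqrt_eq_zero_of_nonpos (neg_nonpos.2 h)]

lemma cs_of_nonpos {κ : ℝ} (h : κ ≤ 0) (u : ℝ) : cs κ u = Real.cos (√(-κ) * u) := by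
  simp [cs, Real.sqrt_eq_zero_of_nonpos h]

lemma hasDerivAt_cs (κ u : ℝ) : HasDerivAt (cs κ) (κ * sn κ u) u := by
  rcases le_total 0 κ with h | h
  · have := ((hasDerivAt_id u).const_mul √κ).cosh
    rw [show cs κ = fun t => Real.cosh (√κ * t) from funext fun t => cs_of_nonneg h t]
    refine this.congr_deriv ?_
    rw [id_eq, ← sqrt_mul_sn_of_nonneg h]
    linear_combination (sn κ u) * Real.mul_self_sqrt h
  · have := ((hasDerivAt_id u).const_mul √(-κ)).cos
    rw [show cs κ = fun t => Real.cos (√(-κ) * t) from funext fun t => cs_of_nonpos h t]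
    refine this.congr_deriv ?_
    rw [id_eq, ← sqrt_mul_sn_of_nonpos h]
    linear_combination (-sn κ u) * Real.mul_self_sqrt (neg_nonneg.2 h)

lemma cs_sq_sub (κ u : ℝ) : cs κ u ^ 2 - κ * sn κ u ^ 2 = 1 := by
  rcases le_total 0 κ with h | h
  · have h1 := Real.cosh_sq (√κ * u)
    rw [← sqrt_mul_sn_of_nonneg h, mul_pow, Real.sq_sqrt h] at h1
    rw [cs_of_nonneg h, h1]; ring
  · have h1 := Real.sin_sq_add_cos_sq (√(-κ) * u)
    rw [← sqrt_mul_sn_of_nonpos h, mul_pow, Real.sq_sqrt (neg_nonneg.2 h)] at h1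
    rw [cs_of_nonpos h]; linarith

end PlanarCurvature
end

/-! ### Solutions of `f'' = κ f` with arbitrary initial values, and surfaces built from them -/

noncomputable section

namespace PlanarCurvature

/-- The solution of `f'' = κ f` with `f 0 = a` and `f' 0 = b`. -/
def sol (κ a b u : ℝ) : ℝ := a * cs κ u + b * sn κ u

lemma continuous_sol {X : Type*} [TopologicalSpace X] {κ a b u : X → ℝ} (hκ : Continuous κ)
    (ha : Continuous a) (hb : Continuous b) (hu : Continuous u) :
    Continuous fun x => sol (κ x) (a x) (b x) (u x) := by
  have h1 : Continuous fun x => cs (κ x) (u x) := continuous_cs.comp (hκ.prodMk hu)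
  have h2 : Continuous fun x => sn (κ x) (u x) := continuous_sn.comp (hκ.prodMk hu)
  exact (ha.mul h1).add (hb.mul h2)

lemma hasDerivAt_sol (κ a b u : ℝ) : HasDerivAt (sol κ a b) (sol κ b (κ * a) u) u := by
  have h := ((hasDerivAt_cs κ u).const_mul a).add ((hasDerivAt_sn κ u).const_mul b)
  refine (HasDerivAt.congr_deriv (f := sol κ a b) h ?_)
  simp only [sol]; ring

lemma hasDerivAt_sol' (κ a b u : ℝ) : HasDerivAt (sol κ b (κ * a)) (κ * sol κ a b u) u := by
  refine (hasDerivAt_sol κ _ _ u).congr_deriv ?_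
  simp only [sol]; ring

@[simp] lemma sol_zero (κ a b : ℝ) : sol κ a b 0 = a := by simp [sol]

@[fun_prop]
lemma continuous_sol_const (κ a b : ℝ) : Continuous (sol κ a b) :=
  continuous_sol continuous_const continuous_const continuous_const continuous_id

lemma sol_wronskian (κ a b c d u : ℝ) :
    sol κ a b u * sol κ d (κ * c) u - sol κ c d u * sol κ b (κ * a) u = a * d - c * b := by
  have := cs_sq_sub κ u
  simp only [sol]
  linear_combination (a * d - c * b) * this

/-- Variation of constants: with `cs`, `sn` taken at u - u₀, the functions f cs - f' sn and f' cs -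
κ f sn have zero derivative on `I`, so they keep their values f u₀ and f' u₀. Solving for f u uses
cs² - κ sn² = 1. -/
theorem eq_sol_of_hasDerivAt {I : Set ℝ} (hI : IsOpen I) (hI' : IsPreconnected I) {κ : ℝ}
    {f f' : ℝ → ℝ} (h : ∀ u ∈ I, HasDerivAt f (f' u) u) (h' : ∀ u ∈ I, HasDerivAt f' (κ * f u) u)
    {u₀ : ℝ} (hu₀ : u₀ ∈ I) {u : ℝ} (hu : u ∈ I) : f u = sol κ (f u₀) (f' u₀) (u - u₀) := by
  have hc : ∀ t, HasDerivAt (fun t => cs κ (t - u₀)) (κ * sn κ (t - u₀)) t := fun t =>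
    (hasDerivAt_cs κ (t - u₀)).comp_sub_const t u₀
  have hs : ∀ t, HasDerivAt (fun t => sn κ (t - u₀)) (cs κ (t - u₀)) t := fun t =>
    (hasDerivAt_sn κ (t - u₀)).comp_sub_const t u₀
  have key : ∀ (g g' : ℝ → ℝ), (∀ t ∈ I, HasDerivAt g (g' t) t) → (∀ t ∈ I, g' t = 0) →
      g u = g u₀ := fun g g' hg hg' =>
    hI.is_const_of_deriv_eq_zero hI' (fun t ht => (hg t ht).differentiableAt.differentiableWithinAt)
      (fun t ht => by rw [(hg t ht).deriv, hg' t ht]; rfl) hu hu₀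
  have e1 := key (fun t => f t * cs κ (t - u₀) - f' t * sn κ (t - u₀)) _
    (fun t ht => ((h t ht).mul (hc t)).sub ((h' t ht).mul (hs t))) (fun t _ => by ring)
  have e2 := key (fun t => f' t * cs κ (t - u₀) - κ * f t * sn κ (t - u₀)) _
    (fun t ht => ((h' t ht).mul (hc t)).sub (((h t ht).const_mul κ).mul (hs t)))
    (fun t _ => by ring)
  simp only [sub_self, cs_zero, sn_zero, mul_one, mul_zero, sub_zero] at e1 e2
  have := cs_sq_sub κ (u - u₀)
  rw [sol, ← e1, ← e2]
  linear_combination (-f u) * this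

lemma sol_add (κ a b τ u : ℝ) :
    sol κ a b (u + τ) = sol κ (sol κ a b τ) (sol κ b (κ * a) τ) u := by
  have := eq_sol_of_hasDerivAt isOpen_univ isPreconnected_univ (κ := κ)
    (f := fun u => sol κ a b (u + τ)) (f' := fun u => sol κ b (κ * a) (u + τ))
    (fun t _ => (hasDerivAt_sol κ a b (t + τ)).comp_add_const t τ)
    (fun t _ => by
      simpa using (hasDerivAt_sol' κ a b (t + τ)).comp_add_const t τ)
    (mem_univ 0) (mem_univ u)
  simpa using this

/-- `e ^ (x u)` as a solution of `f'' = x ^ 2 f`. -/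
lemma exp_eq_sol (x u : ℝ) : Real.exp (x * u) = sol (x ^ 2) 1 x u := by
  have h : ∀ t, HasDerivAt (fun t => Real.exp (x * t)) (x * Real.exp (x * t)) t := fun t => by
    have := ((hasDerivAt_id t).const_mul x).exp
    simpa [mul_comm] using this
  have := eq_sol_of_hasDerivAt isOpen_univ isPreconnected_univ (κ := x ^ 2)
    (f := fun u => Real.exp (x * u)) (f' := fun u => x * Real.exp (x * u))
    (fun t _ => h t) (fun t _ => ((h t).const_mul x).congr_deriv (by ring)) (mem_univ 0) (mem_univ u)
  simpa using this

/-! ### Translations -/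

lemma integral_shift {f : ℝ → ℝ} (hf : Continuous f) (a u : ℝ) :
    ∫ t in (0 : ℝ)..u + a, f t = (∫ t in (0 : ℝ)..u, f (t + a)) + ∫ t in (0 : ℝ)..a, f t := by
  rw [intervalIntegral.integral_comp_add_right, zero_add, add_comm (intervalIntegral _ _ _ _),
    intervalIntegral.integral_add_adjacent_intervals (hf.intervalIntegrable _ _)
    (hf.intervalIntegrable _ _)]

lemma sig_add {p q r s : ℝ → ℝ} (hp : Continuous p) (hq : Continuous q) (hr : Continuous r)
    (hs : Continuous s) (a b u v : ℝ) : sig p q r s (u + a) (v + b) =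
      sig (fun t => p (t + a)) (fun t => q (t + a)) (fun t => r (t + b)) (fun t => s (t + b)) u v
        + sig p q r s a b := by
  funext i
  simp only [sig, Pi.add_apply]
  rw [integral_shift (continuous_nullX hp hq i), integral_shift (continuous_nullY hr hs i)]
  ring

/-! ### Surfaces with spinors that solve `f'' = κ f` -/

/-- The surface with the spinors `sol κ p₀ p₁`, ..., `sol κ s₀ s₁` for
`c = (κ, p₀, p₁, q₀, q₁, r₀, r₁, s₀, s₁)`. -/
def cspin (c : Fin 9 → ℝ) : ℝ × ℝ → Mink :=
  spin (sol (c 0) (c 1) (c 2)) (sol (c 0) (c 3) (c 4)) (sol (c 0) (c 5) (c 6))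
    (sol (c 0) (c 7) (c 8))

/-- The Wronskian of the first pair of spinors. -/
def wX (c : Fin 9 → ℝ) : ℝ := c 3 * c 2 - c 1 * c 4

/-- The Wronskian of the second pair of spinors. -/
def wY (c : Fin 9 → ℝ) : ℝ := c 7 * c 6 - c 5 * c 8

lemma continuous_cspin : Continuous fun x : (Fin 9 → ℝ) × (ℝ × ℝ) => cspin x.1 x.2 := by
  refine continuous_pi fun i => ?_
  have hs : ∀ m n, Continuous fun x : ((Fin 9 → ℝ) × (ℝ × ℝ)) × ℝ =>
      sol (x.1.1 0) (x.1.1 m) (x.1.1 n) x.2 := fun m n =>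
    continuous_sol (by fun_prop) (by fun_prop) (by fun_prop) (by fun_prop)
  refine Continuous.add ?_ ?_
  · exact intervalIntegral.continuous_parametric_intervalIntegral_of_continuous
      (f := fun (x : (Fin 9 → ℝ) × (ℝ × ℝ)) t => nullX (sol (x.1 0) (x.1 1) (x.1 2) t)
        (sol (x.1 0) (x.1 3) (x.1 4) t) i)
      (continuous_nullX (hs 1 2) (hs 3 4) i) (by fun_prop)
  · exact intervalIntegral.continuous_parametric_intervalIntegral_of_continuous
      (f := fun (x : (Fin 9 → ℝ) × (ℝ × ℝ)) t => nullY (sol (x.1 0) (x.1 5) (x.1 6) t)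
        (sol (x.1 0) (x.1 7) (x.1 8) t) i)
      (continuous_nullY (hs 5 6) (hs 7 8) i) (by fun_prop)

/-- A double zero would annihilate the constant Wronskian with any second solution, so all zeros are
simple. -/
lemma countable_zeros_sol {κ a b c d : ℝ} (h : a * d - c * b ≠ 0) :
    {u | sol κ a b u = 0}.Countable := by
  refine countable_zeros (hasDerivAt_sol κ a b) fun u hu hu' => h ?_
  rw [← sol_wronskian κ a b c d u, hu, hu']; ring

theorem weierstrass_eq_cspin {h η : Para → Para} (c : Fin 9 → ℝ) (hX : wX c ≠ 0) (hY : wY c ≠ 0)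
    (hq : c 3 ≠ 0) (hs : c 7 ≠ 0)
    (H : ∀ z, sol (c 0) (c 3) (c 4) (pl z) ≠ 0 → sol (c 0) (c 7) (c 8) (mi z) ≠ 0 →
      pl (h z) * sol (c 0) (c 3) (c 4) (pl z) = sol (c 0) (c 1) (c 2) (pl z) ∧
      mi (h z) * sol (c 0) (c 7) (c 8) (mi z) = sol (c 0) (c 5) (c 6) (mi z) ∧
      pl (η z) = sol (c 0) (c 3) (c 4) (pl z) ^ 2 ∧
      mi (η z) = sol (c 0) (c 7) (c 8) (mi z) ^ 2) :
    weierstrass h η = cspin c :=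
  weierstrass_eq_spin (by fun_prop) (by fun_prop) (by fun_prop) (by fun_prop)
    (countable_zeros_sol hX) (countable_zeros_sol hY) (by simpa) (by simpa) H

/-- The spinors of `cspin c` translated by `a` and `b`. -/
def shiftc (c : Fin 9 → ℝ) (a b : ℝ) : Fin 9 → ℝ :=
  ![c 0, sol (c 0) (c 1) (c 2) a, sol (c 0) (c 2) (c 0 * c 1) a,
    sol (c 0) (c 3) (c 4) a, sol (c 0) (c 4) (c 0 * c 3) a,
    sol (c 0) (c 5) (c 6) b, sol (c 0) (c 6) (c 0 * c 5) b,
    sol (c 0) (c 7) (c 8) b, sol (c 0) (c 8) (c 0 * c 7) b]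

/-- A translate of a solution of f'' = κ f is again a solution, so translating the parameter plane
only changes the initial values and adds a constant vector. This is how `align` stays within the
surfaces `cspin`. -/
lemma cspin_add (c : Fin 9 → ℝ) (z w : ℝ × ℝ) :
    cspin c (z + w) = cspin (shiftc c (w.1 + w.2) (w.1 - w.2)) z + cspin c w := by
  set a := w.1 + w.2 with ha
  set b := w.1 - w.2 with hb
  have := sig_add (continuous_sol_const (c 0) (c 1) (c 2)) (continuous_sol_const (c 0) (c 3) (c 4))
    (continuous_sol_const (c 0) (c 5) (c 6)) (continuous_sol_const (c 0) (c 7) (c 8))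
    a b (z.1 + z.2) (z.1 - z.2)
  simp only [sol_add] at this
  unfold cspin spin
  rw [show (z + w).1 + (z + w).2 = z.1 + z.2 + a by simp [ha]; ring,
    show (z + w).1 - (z + w).2 = z.1 - z.2 + b by simp [hb]; ring]
  exact this

lemma wX_shiftc (c : Fin 9 → ℝ) (a b : ℝ) : wX (shiftc c a b) = wX c := by
  simpa [wX, shiftc] using sol_wronskian (c 0) (c 3) (c 4) (c 1) (c 2) a

lemma wY_shiftc (c : Fin 9 → ℝ) (a b : ℝ) : wY (shiftc c a b) = wY c := by
  simpa [wY, shiftc] using sol_wronskian (c 0) (c 7) (c 8) (c 5) (c 6) b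

lemma align_cspin (c : Fin 9 → ℝ) : align (cspin c) = fun z =>
    (cspin c (0, -q2 1) + ![1 / √2, 0, -(2 * √2 / 3)]) + cspin (shiftc c (-q2 1) (q2 1)) z := by
  funext z
  have := cspin_add c z (0, -q2 1)
  simp only [zero_add, zero_sub, neg_neg] at this
  rw [align, show (z.1, z.2 - q2 1) = z + (0, -q2 1) by ext <;> simp [sub_eq_add_neg], this]
  abel

end PlanarCurvature
end

/-! ### From explicit Weierstrass data to spinors -/

noncomputable section

namespace PlanarCurvature

lemma sol_exp_neg (x u : ℝ) : Real.exp (-(x * u)) = sol (x ^ 2) 1 (-x) u := by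
  have := exp_eq_sol (-x) u
  rwa [neg_sq, neg_mul] at this

lemma cos_eq_sol (x u : ℝ) : Real.cos (x * u) = sol (-x ^ 2) 1 0 u := by
  have h : ∀ t, HasDerivAt (fun t => Real.cos (x * t)) (-x * Real.sin (x * t)) t := fun t => by
    have := ((hasDerivAt_id t).const_mul x).cos
    simpa [mul_comm] using this
  have h' : ∀ t, HasDerivAt (fun t => Real.sin (x * t)) (x * Real.cos (x * t)) t := fun t => by
    have := ((hasDerivAt_id t).const_mul x).sin
    simpa [mul_comm] using this
  have := eq_sol_of_hasDerivAt isOpen_univ isPreconnected_univ (κ := -x ^ 2)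
    (fun t _ => h t) (fun t _ => ((h' t).const_mul (-x)).congr_deriv (by ring)) (mem_univ 0)
    (mem_univ u)
  simpa using this

lemma sin_eq_sol (x u : ℝ) : Real.sin (x * u) = sol (-x ^ 2) 0 x u := by
  have h : ∀ t, HasDerivAt (fun t => Real.cos (x * t)) (-x * Real.sin (x * t)) t := fun t => by
    have := ((hasDerivAt_id t).const_mul x).cos
    simpa [mul_comm] using this
  have h' : ∀ t, HasDerivAt (fun t => Real.sin (x * t)) (x * Real.cos (x * t)) t := fun t => by
    have := ((hasDerivAt_id t).const_mul x).sin
    simpa [mul_comm] using this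
  have := eq_sol_of_hasDerivAt isOpen_univ isPreconnected_univ (κ := -x ^ 2)
    (fun t _ => h' t) (fun t _ => ((h t).const_mul x).congr_deriv (by ring)) (mem_univ 0)
    (mem_univ u)
  simpa using this

lemma cosh_eq_sol (x u : ℝ) : Real.cosh (x * u) = sol (x ^ 2) 1 0 u := by
  rw [Real.cosh_eq, exp_eq_sol, sol_exp_neg]; simp only [sol]; ring

lemma sinh_eq_sol (x u : ℝ) : Real.sinh (x * u) = sol (x ^ 2) 0 x u := by
  rw [Real.sinh_eq, exp_eq_sol, sol_exp_neg]; simp only [sol]; ring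

/-! ### Weierstrass data and spinors -/

/-- All data are treated in one way: `q` and `s` are square roots of the components of η, and
multiplication by h gives `p` and `r`, which are entire even where h has poles. Here q = m cos (k u)
and p = m A sin (k u), so κ = -k². -/
theorem weierstrass_tan {A k m : ℝ} (hA : A ≠ 0) (hk : k ≠ 0) (hm : m ≠ 0) {h η : Para → Para}
    (hh : ∀ z, h z = A • ptan (k • z)) (hη : ∀ z, η z = m ^ 2 • pcos (k • z) ^ 2) :
    weierstrass h η =
      cspin ![-k ^ 2, 0, m * (A * k), m, 0, 0, m * (A * k), m, 0] := by
  have e1 : ∀ u, sol (-k ^ 2) m 0 u = m * Real.cos (k * u) := fun u => by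
    rw [cos_eq_sol]; simp only [sol]; ring
  have e2 : ∀ u, sol (-k ^ 2) 0 (m * (A * k)) u = m * A * Real.sin (k * u) := fun u => by
    rw [sin_eq_sol]; simp only [sol]; ring
  refine weierstrass_eq_cspin _ ?_ ?_ (by simpa) (by simpa) fun z h1 h2 => ?_
  · simp [wX, hA, hk, hm]
  · simp [wY, hA, hk, hm]
  · simp only [Matrix.cons_val, e1, e2] at h1 h2 ⊢
    have c1 := right_ne_zero_of_mul h1
    have c2 := right_ne_zero_of_mul h2
    obtain ⟨d1, d2⟩ := pdiv_components (z := psin (k • z)) (w := pcos (k • z)) (by simpa) (by simpa)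
    simp only [hh, hη, ptan, pl_smul, mi_smul, d1, d2, pl_pow, mi_pow, pl_pcos, mi_pcos, pl_psin,
      mi_psin]
    refine ⟨?_, ?_, ?_, ?_⟩ <;> field_simp

theorem weierstrass_tanh {A k m : ℝ} (hA : A ≠ 0) (hk : k ≠ 0) (hm : m ≠ 0) {h η : Para → Para}
    (hh : ∀ z, h z = A • ptanh (k • z)) (hη : ∀ z, η z = m ^ 2 • pcosh (k • z) ^ 2) :
    weierstrass h η =
      cspin ![k ^ 2, 0, m * (A * k), m, 0, 0, m * (A * k), m, 0] := by
  have e1 : ∀ u, sol (k ^ 2) m 0 u = m * Real.cosh (k * u) := fun u => by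
    rw [cosh_eq_sol]; simp only [sol]; ring
  have e2 : ∀ u, sol (k ^ 2) 0 (m * (A * k)) u = m * A * Real.sinh (k * u) := fun u => by
    rw [sinh_eq_sol]; simp only [sol]; ring
  refine weierstrass_eq_cspin _ ?_ ?_ (by simpa) (by simpa) fun z h1 h2 => ?_
  · simp [wX, hA, hk, hm]
  · simp [wY, hA, hk, hm]
  · simp only [Matrix.cons_val, e1, e2] at h1 h2 ⊢
    have c1 := right_ne_zero_of_mul h1
    have c2 := right_ne_zero_of_mul h2
    obtain ⟨d1, d2⟩ := pdiv_components (z := psinh (k • z)) (w := pcosh (k • z)) (by simpa)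
      (by simpa)
    simp only [hh, hη, ptanh, pl_smul, mi_smul, d1, d2, pl_pow, mi_pow, pl_pcosh, mi_pcosh,
      pl_psinh, mi_psinh]
    refine ⟨?_, ?_, ?_, ?_⟩ <;> field_simp

theorem weierstrass_linear {A m : ℝ} (hA : A ≠ 0) (hm : m ≠ 0) {h η : Para → Para}
    (hh : ∀ z, h z = A • z) (hη : ∀ z, η z = ofReal (m ^ 2)) :
    weierstrass h η = cspin ![0, 0, m * A, m, 0, 0, m * A, m, 0] := by
  refine weierstrass_eq_cspin _ ?_ ?_ (by simpa) (by simpa) fun z h1 h2 => ?_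
  · simp [wX, hA, hm]
  · simp [wY, hA, hm]
  · have e : ∀ u, sn 0 u = u := fun u => by simp [sn, cs]
    have e' : ∀ u, cs 0 u = 1 := fun u => by simp [cs]
    simp [hh, hη, sol, e, e']
    constructor <;> ring

/-- The square root of η halves the exponent, hence κ = (k / 2)². The summand t j contributes t in
one null component and -t in the other. -/
theorem weierstrass_exp {k m t : ℝ} (hk : k ≠ 0) (hm : m ≠ 0) {h η : Para → Para}
    (hh : ∀ z, h z = pexp (k • z) + t • j) (hη : ∀ z, η z = m ^ 2 • pexp (-(k • z))) :
    weierstrass h η = cspin ![(k / 2) ^ 2, m * (1 + t), m * (k / 2 * (1 - t)), m, -(m * (k / 2)),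
      m * (1 - t), m * (k / 2 * (1 + t)), m, -(m * (k / 2))] := by
  have e1 : ∀ u, sol ((k / 2) ^ 2) m (-(m * (k / 2))) u = m * Real.exp (-(k / 2 * u)) := fun u => by
    rw [sol_exp_neg]; simp only [sol]; ring
  have e2 : ∀ t u, sol ((k / 2) ^ 2) (m * (1 + t)) (m * (k / 2 * (1 - t))) u =
      m * (Real.exp (k / 2 * u) + t * Real.exp (-(k / 2 * u))) := fun t u => by
    rw [sol_exp_neg, exp_eq_sol]; simp only [sol]; ring
  have e3 : ∀ u, sol ((k / 2) ^ 2) (m * (1 - t)) (m * (k / 2 * (1 + t))) u =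
      m * (Real.exp (k / 2 * u) + (-t) * Real.exp (-(k / 2 * u))) := fun u => by
    rw [← e2]; simp only [sol]; ring
  have E : ∀ u, Real.exp (k * u) = Real.exp (k / 2 * u) ^ 2 := fun u => by
    rw [← Real.exp_nat_mul]; congr 1; push_cast; ring
  refine weierstrass_eq_cspin _ ?_ ?_ (by simpa) (by simpa) fun z h1 h2 => ?_
  · simp only [wX, Matrix.cons_val]
    rw [show m * (m * (k / 2 * (1 - t))) - m * (1 + t) * -(m * (k / 2)) = m ^ 2 * k by ring]
    positivity
  · simp only [wY, Matrix.cons_val]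
    rw [show m * (m * (k / 2 * (1 + t))) - m * (1 - t) * -(m * (k / 2)) = m ^ 2 * k by ring]
    positivity
  · simp only [Matrix.cons_val, e1, e2, e3]
    simp only [hh, hη, pl_add, mi_add, pl_smul, mi_smul, pl_pexp, mi_pexp, pl_neg, mi_neg, pl_j,
      mi_j, Real.exp_neg, E]
    refine ⟨?_, ?_, ?_, ?_⟩ <;> field_simp

/-- One computation for the family S4 (t' = 0), the family M (t = 0) and the named surfaces with the
summand -c j (t = 0, t' = -c): in the null components the constant appears as t + t' and t - t'. -/
theorem weierstrass_jexp {m t t' : ℝ} (hm : m ≠ 0) {h η : Para → Para}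
    (hh : ∀ z, h z = j * pexp (j * z) + ofReal t + t' • j)
    (hη : ∀ z, η z = m ^ 2 • pexp (-(j * z))) :
    weierstrass h η = cspin ![(1 / 2) ^ 2, m * (1 + (t + t')), m * ((1 - (t + t')) / 2), m,
      -(m * (1 / 2)), -(m * (1 - (t - t'))), m * ((1 + (t - t')) / 2), m, m * (1 / 2)] := by
  have e1 : ∀ u, sol ((1 / 2) ^ 2) m (-(m * (1 / 2))) u = m * Real.exp (-(1 / 2 * u)) := fun u => by
    rw [sol_exp_neg]; simp only [sol]; ring
  have e2 : ∀ u, sol ((1 / 2) ^ 2) m (m * (1 / 2)) u = m * Real.exp (1 / 2 * u) := fun u => by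
    rw [exp_eq_sol]; simp only [sol]; ring
  have e3 : ∀ u, sol ((1 / 2) ^ 2) (m * (1 + (t + t'))) (m * ((1 - (t + t')) / 2)) u =
      m * (Real.exp (1 / 2 * u) + (t + t') * Real.exp (-(1 / 2 * u))) := fun u => by
    rw [sol_exp_neg, exp_eq_sol]; simp only [sol]; ring
  have e4 : ∀ u, sol ((1 / 2) ^ 2) (-(m * (1 - (t - t')))) (m * ((1 + (t - t')) / 2)) u =
      m * (-Real.exp (-(1 / 2 * u)) + (t - t') * Real.exp (1 / 2 * u)) := fun u => by
    rw [sol_exp_neg, exp_eq_sol]; simp only [sol]; ring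
  have E : ∀ u, Real.exp u = Real.exp (1 / 2 * u) ^ 2 := fun u => by
    rw [← Real.exp_nat_mul]; congr 1; push_cast; ring
  refine weierstrass_eq_cspin _ ?_ ?_ (by simpa) (by simpa) fun z h1 h2 => ?_
  · simp only [wX, Matrix.cons_val]
    rw [show m * (m * ((1 - (t + t')) / 2)) - m * (1 + (t + t')) * -(m * (1 / 2)) = m ^ 2 by ring]
    positivity
  · simp only [wY, Matrix.cons_val]
    rw [show m * (m * ((1 + (t - t')) / 2)) - -(m * (1 - (t - t'))) * (m * (1 / 2)) = m ^ 2 by ring]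
    positivity
  · simp only [Matrix.cons_val, e1, e2, e3, e4]
    simp only [hh, hη, pl_add, mi_add, pl_smul, mi_smul, pl_pexp, mi_pexp, pl_neg, mi_neg, pl_j,
      mi_j, pl_mul, mi_mul, pl_ofReal, mi_ofReal, Real.exp_neg, one_mul, neg_one_mul, neg_neg,
      E (pl z), E (mi z)]
    refine ⟨?_, ?_, ?_, ?_⟩ <;> field_simp <;> ring

/-- The spinors are affine, κ = 0. The factor e^{2φj} of η multiplies one spinor pair by e^φ and the
other by e^{-φ}; the Wronskians become e^{2φ} / 2 and e^{-2φ} / 2, unequal unless φ = 0. -/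
theorem weierstrass_h5 {φ : ℝ} {η : Para → Para} (hη : ∀ z, η z = pexp ((2 * φ) • j) * η5 z) :
    weierstrass h5 η = cspin ![0, Real.exp φ / 2, Real.exp φ / 2, Real.exp φ / 2, -(Real.exp φ / 2),
      -(Real.exp (-φ) / 2), Real.exp (-φ) / 2, Real.exp (-φ) / 2, Real.exp (-φ) / 2] := by
  have E : ∀ x : ℝ, Real.exp (2 * x) = Real.exp x ^ 2 := fun x => by
    rw [← Real.exp_nat_mul]; simp
  have e : ∀ u, sn 0 u = u := fun u => by simp [sn, cs]
  have e' : ∀ u, cs 0 u = 1 := fun u => by simp [cs]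
  have x1 := Real.exp_pos φ
  have x2 := Real.exp_pos (-φ)
  refine weierstrass_eq_cspin _ ?_ ?_ (by simp) (by simp) fun z h1 h2 => ?_
  · simp only [wX, Matrix.cons_val]
    nlinarith [mul_pos x1 x1]
  · simp only [wY, Matrix.cons_val]
    nlinarith [mul_pos x2 x2]
  · simp only [Matrix.cons_val, sol, e, e'] at h1 h2 ⊢
    have c1 : 1 - pl z ≠ 0 := fun h => h1 (by linear_combination Real.exp φ / 2 * h)
    have c2 : 1 + mi z ≠ 0 := fun h => h2 (by linear_combination Real.exp (-φ) / 2 * h)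
    obtain ⟨d1, d2⟩ := pdiv_components (z := z + j) (w := 1 - j * z) (by simpa) (by simpa)
    simp only [h5, hη, η5, d1, d2, pl_add, mi_add, pl_smul, mi_smul, pl_pexp, mi_pexp,
      pl_j, mi_j, pl_mul, mi_mul, pl_sub, mi_sub, pl_pow, mi_pow, pl_one, mi_one, mul_one,
      one_mul, mul_neg_one, neg_one_mul, sub_neg_eq_add]
    rw [show -(2 * φ) = 2 * -φ by ring, E, E]
    refine ⟨?_, ?_, ?_, ?_⟩ <;> field_simp <;> ring

/-- The quotients b / a of the data cancel in the initial values, which therefore extend to a = 0,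
the Enneper-type end of the family. The scalar in front of the vector also multiplies entry 0, which
has to be κ, so that entry carries the compensating root. -/
theorem weierstrass_S2 {a b : ℝ} (ha : a ≠ 0) (hb : 0 < b + a) {h η : Para → Para}
    (hh : ∀ z, h z = j * ((b / a + 1) • pexp (a • (j * z)) - ofReal (b / a)))
    (hη : ∀ z, η z = (1 / (2 * (a + b))) • pexp (-(a • (j * z)))) :
    weierstrass h η = cspin ((√(2 * (a + b)))⁻¹ • ![(a / 2) ^ 2 * √(2 * (a + b)), 1, a / 2 + b, 1,
      -(a / 2), -1, a / 2 + b, 1, a / 2]) := by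
  have hD : 0 < 2 * (a + b) := by linarith
  have hD' := Real.sqrt_pos.2 hD
  set D := √(2 * (a + b)) with hDdef
  have hDD : D ^ 2 = 2 * (a + b) := Real.sq_sqrt hD.le
  have hκ : D⁻¹ * ((a / 2) ^ 2 * D) = (a / 2) ^ 2 := by field_simp
  have e1 : ∀ u, sol ((a / 2) ^ 2) (D⁻¹ * 1) (D⁻¹ * -(a / 2)) u = D⁻¹ * Real.exp (-(a / 2 * u)) :=
    fun u => by rw [sol_exp_neg]; simp only [sol]; ring
  have e2 : ∀ u, sol ((a / 2) ^ 2) (D⁻¹ * 1) (D⁻¹ * (a / 2)) u = D⁻¹ * Real.exp (a / 2 * u) :=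
    fun u => by rw [exp_eq_sol]; simp only [sol]; ring
  have e3 : ∀ u, sol ((a / 2) ^ 2) (D⁻¹ * 1) (D⁻¹ * (a / 2 + b)) u =
      D⁻¹ * ((1 + b / a) * Real.exp (a / 2 * u) - b / a * Real.exp (-(a / 2 * u))) := fun u => by
    rw [sol_exp_neg, exp_eq_sol]; simp only [sol]; field_simp; ring
  have e4 : ∀ u, sol ((a / 2) ^ 2) (D⁻¹ * -1) (D⁻¹ * (a / 2 + b)) u =
      D⁻¹ * (-(1 + b / a) * Real.exp (-(a / 2 * u)) + b / a * Real.exp (a / 2 * u)) := fun u => by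
    rw [sol_exp_neg, exp_eq_sol]; simp only [sol]; field_simp; ring
  have E : ∀ u, Real.exp (a * u) = Real.exp (a / 2 * u) ^ 2 := fun u => by
    rw [← Real.exp_nat_mul]; congr 1; push_cast; ring
  refine weierstrass_eq_cspin _ ?_ ?_ (by simp [hD'.ne']) (by simp [hD'.ne']) fun z h1 h2 => ?_
  · simp only [wX, Pi.smul_apply, Matrix.cons_val, smul_eq_mul]
    rw [show D⁻¹ * 1 * (D⁻¹ * (a / 2 + b)) - D⁻¹ * 1 * (D⁻¹ * -(a / 2)) =
      D⁻¹ ^ 2 * (b + a) by ring]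
    positivity
  · simp only [wY, Pi.smul_apply, Matrix.cons_val, smul_eq_mul]
    rw [show D⁻¹ * 1 * (D⁻¹ * (a / 2 + b)) - D⁻¹ * -1 * (D⁻¹ * (a / 2)) =
      D⁻¹ ^ 2 * (b + a) by ring]
    positivity
  · simp only [Pi.smul_apply, Matrix.cons_val, smul_eq_mul, hκ, e1, e2, e3, e4]
    simp only [hh, hη, ← hDD, pl_sub, mi_sub, pl_smul, mi_smul, pl_pexp, mi_pexp, pl_neg, mi_neg,
      pl_j, mi_j, pl_mul, mi_mul, pl_ofReal, mi_ofReal, one_mul, neg_one_mul, neg_neg, mul_neg,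
      Real.exp_neg, E]
    refine ⟨?_, ?_, ?_, ?_⟩ <;> field_simp <;> ring

/-- The spinors are quotients by 2t, but their initial values are polynomial in t. At t = 0 they
become the affine spinors of `h5`. -/
theorem weierstrass_CL {t : ℝ} (ht : 0 < t) : weierstrass (hCL t) (ηCL t) =
    cspin ![(t / 2) ^ 2, 1 / 2, (t / 2 + 1) / 2, 1 / 2, (t / 2 - 1) / 2, -(1 / 2), (t / 2 + 1) / 2,
      1 / 2, (1 - t / 2) / 2] := by
  have e1 : ∀ u, sol ((t / 2) ^ 2) (1 / 2) ((t / 2 - 1) / 2) u =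
      ((t - 1) * Real.exp (t / 2 * u) + Real.exp (-(t / 2 * u))) / (2 * t) := fun u => by
    rw [sol_exp_neg, exp_eq_sol]; simp only [sol]; field_simp; ring
  have e2 : ∀ u, sol ((t / 2) ^ 2) (1 / 2) ((1 - t / 2) / 2) u =
      ((t - 1) * Real.exp (-(t / 2 * u)) + Real.exp (t / 2 * u)) / (2 * t) := fun u => by
    rw [sol_exp_neg, exp_eq_sol]; simp only [sol]; field_simp; ring
  have e3 : ∀ u, sol ((t / 2) ^ 2) (1 / 2) ((t / 2 + 1) / 2) u =
      ((t + 1) * Real.exp (t / 2 * u) - Real.exp (-(t / 2 * u))) / (2 * t) := fun u => by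
    rw [sol_exp_neg, exp_eq_sol]; simp only [sol]; field_simp; ring
  have e4 : ∀ u, sol ((t / 2) ^ 2) (-(1 / 2)) ((t / 2 + 1) / 2) u =
      -((t + 1) * Real.exp (-(t / 2 * u)) - Real.exp (t / 2 * u)) / (2 * t) := fun u => by
    rw [sol_exp_neg, exp_eq_sol]; simp only [sol]; field_simp; ring
  have E : ∀ u, Real.exp (t * u) = Real.exp (t / 2 * u) ^ 2 := fun u => by
    rw [← Real.exp_nat_mul]; congr 1; push_cast; ring
  refine weierstrass_eq_cspin _ ?_ ?_ (by simp) (by simp) fun z h1 h2 => ?_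
  · simp only [wX, Matrix.cons_val]
    intro h; linarith
  · simp only [wY, Matrix.cons_val]
    intro h; linarith
  · simp only [Matrix.cons_val, e1, e2, e3, e4, Real.exp_neg] at h1 h2 ⊢
    obtain ⟨a, ha⟩ : ∃ a, a = Real.exp (t / 2 * pl z) := ⟨_, rfl⟩
    obtain ⟨b, hb⟩ : ∃ b, b = Real.exp (t / 2 * mi z) := ⟨_, rfl⟩
    have x1 : 0 < a := ha ▸ Real.exp_pos _
    have x2 : 0 < b := hb ▸ Real.exp_pos _
    rw [← ha] at h1 ⊢
    rw [← hb] at h2 ⊢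
    -- Nonvanishing of the spinors is nonvanishing of the denominator of `hCL`, since they differ by
    -- an exponential factor and 2t.
    have c1 : (t - 1) * a ^ 2 + 1 ≠ 0 := fun h => h1 (by field_simp; linear_combination h)
    have c3 : t - 1 + b ^ 2 ≠ 0 := fun h => h2 (by field_simp; linear_combination h)
    have c2 : (t - 1) * (b ^ 2)⁻¹ + 1 ≠ 0 := fun h => c3 (by field_simp at h; linear_combination h)
    obtain ⟨d1, d2⟩ := pdiv_components (z := j * ((t + 1) • pexp (t • (j * z)) - 1))
      (w := (t - 1) • pexp (t • (j * z)) + 1) (by simpa [E, ← ha])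
      (by simpa [E, Real.exp_neg, ← hb])
    simp only [hCL, ηCL, ht.ne', if_false, d1, d2, pl_add, mi_add, pl_sub, mi_sub, pl_smul, mi_smul,
      pl_pexp, mi_pexp, pl_neg, mi_neg, pl_pow, mi_pow, pl_one, mi_one,
      pl_j, mi_j, pl_mul, mi_mul, one_mul, neg_one_mul, neg_neg, mul_neg, Real.exp_neg, E, ← ha,
      ← hb]
    have c4 : 2 * t ≠ 0 := by positivity
    refine ⟨?_, ?_, ?_, ?_⟩
    · rw [div_mul_div_comm, div_eq_div_iff (mul_ne_zero c1 c4) c4]; field_simp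
    · rw [div_mul_div_comm, div_eq_div_iff (mul_ne_zero c2 c4) c4]; field_simp
    · field_simp; ring
    · field_simp; ring

end PlanarCurvature
end

/-! ### Coefficient vectors of the seven families; the family P -/

noncomputable section

namespace PlanarCurvature

open Branch

lemma q2_pos (k : ℝ) : 0 < q2 k := Real.rpow_pos_of_pos (by norm_num) _

lemma q2_one_pow : q2 1 ^ 4 = 2 := by
  rw [q2, ← Real.rpow_natCast, ← Real.rpow_mul (by norm_num)]; norm_num

lemma q2_three : q2 3 = q2 1 ^ 3 := by
  rw [q2, q2, ← Real.rpow_natCast, ← Real.rpow_mul (by norm_num)]; norm_num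

lemma q2_five : q2 5 = 2 * q2 1 := by
  rw [← q2_one_pow, ← pow_succ, q2, q2, ← Real.rpow_natCast, ← Real.rpow_mul (by norm_num)]
  norm_num

lemma sqrt_two_eq : √2 = q2 1 ^ 2 := by
  rw [Real.sqrt_eq_iff_mul_self_eq (by norm_num) (by have := q2_pos 1; positivity), ← q2_one_pow]
  ring

/-- The spinors of the surface `cspin c` after the rotation `rot`. -/
def rotc (c : Fin 9 → ℝ) : Fin 9 → ℝ :=
  ![c 0, (c 1 - c 3) / √2, (c 2 - c 4) / √2, (c 1 + c 3) / √2, (c 2 + c 4) / √2,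
    (c 5 - c 7) / √2, (c 6 - c 8) / √2, (c 5 + c 7) / √2, (c 6 + c 8) / √2]

/-- All spinors multiplied by `l`. -/
def scalec (l : ℝ) (c : Fin 9 → ℝ) : Fin 9 → ℝ :=
  ![c 0, l * c 1, l * c 2, l * c 3, l * c 4, l * c 5, l * c 6, l * c 7, l * c 8]

/-- Spinors turn by half the angle: the right angle in space is an eighth of a turn of (p, q) and of
(r, s), whence the factors 1/√2. -/
lemma rot_cspin (c : Fin 9 → ℝ) (z : ℝ × ℝ) : rot (cspin c z) = cspin (rotc c) z := by
  have h2 : √2 * √2 = 2 := Real.mul_self_sqrt (by norm_num)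
  have h2' : (0 : ℝ) < √2 := by positivity
  have hs : ∀ a b a' b' t, sol (c 0) ((a + a') / √2) ((b + b') / √2) t =
      (sol (c 0) a b t + sol (c 0) a' b' t) / √2 := fun a b a' b' t => by simp only [sol]; ring
  have hs' : ∀ a b a' b' t, sol (c 0) ((a - a') / √2) ((b - b') / √2) t =
      (sol (c 0) a b t - sol (c 0) a' b' t) / √2 := fun a b a' b' t => by simp only [sol]; ring
  have X : ∀ p q : ℝ, nullX ((p - q) / √2) ((p + q) / √2) = rot (nullX p q) := fun p q => by
    funext i
    fin_cases i <;> simp [nullX, rot, div_pow, div_mul_div_comm, h2] <;> ring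
  have Y : ∀ p q : ℝ, nullY ((p - q) / √2) ((p + q) / √2) = rot (nullY p q) := fun p q => by
    funext i
    fin_cases i <;> simp [nullY, rot, div_pow, div_mul_div_comm, h2] <;> ring
  funext i
  simp only [cspin, rotc, Matrix.cons_val, spin, sig, hs, hs', X, Y]
  fin_cases i <;> simp [rot, sig]
  ring

lemma cspin_scalec (l : ℝ) (c : Fin 9 → ℝ) (z : ℝ × ℝ) :
    cspin (scalec l c) z = l ^ 2 • cspin c z := by
  have hs : ∀ a b t, sol (c 0) (l * a) (l * b) t = l * sol (c 0) a b t := fun a b t => by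
    simp only [sol]; ring
  have X : ∀ p q : ℝ, nullX (l * p) (l * q) = l ^ 2 • nullX p q := fun p q => by
    funext i
    fin_cases i <;> simp [nullX] <;> ring
  have Y : ∀ p q : ℝ, nullY (l * p) (l * q) = l ^ 2 • nullY p q := fun p q => by
    funext i
    fin_cases i <;> simp [nullY] <;> ring
  funext i
  simp only [cspin, scalec, Matrix.cons_val, spin, sig, hs, X, Y, Pi.smul_apply]
  simp [mul_add]

/-- The amplitude of the spinors in the family `surfaceP`. -/
def ampP (t : ℝ) : ℝ :=
  √(1 / q2 1 * ((1 - (Real.cos t + Real.sin t) / √2) * |Real.cos t - Real.sin t| + 1 / √2))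

/-- The spinors of each family, before the rotation of the first one and the translations. -/
def coef0 : Branch → ℝ → Fin 9 → ℝ
  | BL2, t => ![(q2 1 / 2) ^ 2, √(1 / q2 5) * (1 + t), √(1 / q2 5) * (q2 1 / 2 * (1 - t)),
      √(1 / q2 5), -(√(1 / q2 5) * (q2 1 / 2)), √(1 / q2 5) * (1 - t),
      √(1 / q2 5) * (q2 1 / 2 * (1 + t)), √(1 / q2 5), -(√(1 / q2 5) * (q2 1 / 2))]
  | P, t => ![Real.cos (2 * t) / q2 3 ^ 2, 0, ampP t * ((Real.cos t + Real.sin t) / q2 3), ampP t, 0,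
      0, ampP t * ((Real.cos t + Real.sin t) / q2 3), ampP t, 0]
  | S2, t => (√(2 * (a1 t + a0 t)))⁻¹ • ![(a1 t / 2) ^ 2 * √(2 * (a1 t + a0 t)), 1, a1 t / 2 + a0 t,
      1, -(a1 t / 2), -1, a1 t / 2 + a0 t, 1, a1 t / 2]
  | CL, t => ![(t / 2) ^ 2, 1 / 2, (t / 2 + 1) / 2, 1 / 2, (t / 2 - 1) / 2, -(1 / 2),
      (t / 2 + 1) / 2, 1 / 2, (1 - t / 2) / 2]
  | A, t => ![0, Real.exp t / 2, Real.exp t / 2, Real.exp t / 2, -(Real.exp t / 2),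
      -(Real.exp (-t) / 2), Real.exp (-t) / 2, Real.exp (-t) / 2, Real.exp (-t) / 2]
  | S4, t => ![(1 / 2) ^ 2, √(1 / 2) * (1 + t), √(1 / 2) * ((1 - t) / 2), √(1 / 2),
      -(√(1 / 2) * (1 / 2)), -(√(1 / 2) * (1 - t)), √(1 / 2) * ((1 + t) / 2), √(1 / 2),
      √(1 / 2) * (1 / 2)]
  | M, t => ![(1 / 2) ^ 2, √(1 / 2) * (1 + t), √(1 / 2) * ((1 - t) / 2), √(1 / 2),
      -(√(1 / 2) * (1 / 2)), -(√(1 / 2) * (1 + t)), √(1 / 2) * ((1 - t) / 2), √(1 / 2),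
      √(1 / 2) * (1 / 2)]

/-- The spinors of each family. -/
def coef : Branch → ℝ → Fin 9 → ℝ
  | BL2, t => rotc (coef0 BL2 t)
  | P, t => coef0 P t
  | b, t => shiftc (coef0 b t) (-q2 1) (q2 1)

/-- The values at the origin. -/
def base : Branch → ℝ → Mink
  | BL2, _ => 0
  | P, _ => 0
  | b, t => cspin (coef0 b t) (0, -q2 1) + ![1 / √2, 0, -(2 * √2 / 3)]

lemma params_P {t : ℝ} (ht : t ∈ params P) : t = -(Real.pi / 4) ∨ t = 3 * Real.pi / 4 ∨
    0 < Real.cos t + Real.sin t := by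
  have e : Real.cos t + Real.sin t = √2 * Real.sin (t + Real.pi / 4) := by
    have h2 : √2 * √2 = 2 := Real.mul_self_sqrt (by norm_num)
    rw [Real.sin_add, Real.cos_pi_div_four, Real.sin_pi_div_four]
    linear_combination (-(Real.cos t + Real.sin t) / 2) * h2
  rcases eq_or_ne t (-(Real.pi / 4)) with h | h
  · exact Or.inl h
  rcases eq_or_ne t (3 * Real.pi / 4) with h' | h'
  · exact Or.inr (Or.inl h')
  refine Or.inr (Or.inr ?_)
  rw [e]
  have h1 := lt_of_le_of_ne ht.1 h.symm
  have h2 := lt_of_le_of_ne ht.2 h'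
  exact mul_pos (by positivity) (Real.sin_pos_of_pos_of_lt_pi (by linarith) (by linarith))

lemma sin_add_quarter (t : ℝ) :
    Real.sin (t + Real.pi / 4) = (Real.cos t + Real.sin t) / √2 := by
  have h2 : √2 * √2 = 2 := Real.mul_self_sqrt (by norm_num)
  rw [Real.sin_add, Real.cos_pi_div_four, Real.sin_pi_div_four]
  field_simp
  linear_combination (Real.cos t + Real.sin t) * h2

lemma cos_two_mul_eq (t : ℝ) : Real.cos (2 * t) =
    (Real.cos t + Real.sin t) * (Real.cos t - Real.sin t) := by
  rw [Real.cos_two_mul']; ring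

lemma cos_sub_sin_eq (t : ℝ) :
    Real.cos t - Real.sin t = √2 * Real.sin (Real.pi / 4 - t) := by
  have h2 : √2 * √2 = 2 := Real.mul_self_sqrt (by norm_num)
  rw [Real.sin_sub, Real.cos_pi_div_four, Real.sin_pi_div_four]
  linear_combination (-(Real.cos t - Real.sin t) / 2) * h2

lemma scaleP_pos {t : ℝ} (ht : 0 < Real.cos t + Real.sin t) : 0 < scaleP t := by
  have h1 : 0 < Real.sin (t + Real.pi / 4) := by rw [sin_add_quarter]; positivity
  have h2 := Real.sin_le_one (t + Real.pi / 4)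
  have : 0 ≤ (1 - Real.sin (t + Real.pi / 4)) * |Real.cos (2 * t)| :=
    mul_nonneg (by linarith) (abs_nonneg _)
  unfold scaleP
  linarith

/-- Both terms of `scaleP` contain the factor cos t + sin t, which cancels the denominator of `ηP`.
What is left under the root stays positive where that factor vanishes, and so `ampP` carries the
family continuously into its planar ends. -/
lemma ampP_eq {t : ℝ} (ht : 0 < Real.cos t + Real.sin t) :
    ampP t = √(scaleP t) * √(1 / (q2 1 * (Real.cos t + Real.sin t))) := by
  have := q2_pos 1
  rw [ampP, ← Real.sqrt_mul (scaleP_pos ht).le, scaleP, sin_add_quarter, cos_two_mul_eq, abs_mul,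
    abs_of_pos ht]
  congr 1
  field_simp

lemma surfaceP_eq {t : ℝ} (ht : t ∈ params P) : surface P t = cspin (coef0 P t) := by
  have hq1 := q2_pos 1
  have hq3 := q2_pos 3
  have hq13 : q2 1 * q2 3 = 2 := by rw [q2_three, ← q2_one_pow]; ring
  have hs2 := sqrt_two_eq
  have hend : t = -(Real.pi / 4) ∨ t = 3 * Real.pi / 4 → surface P t = cspin (coef0 P t) := by
    intro h
    have h1 : Real.cos t + Real.sin t = 0 ∧ |Real.cos t - Real.sin t| = √2 := by
      rcases h with rfl | rfl
      · rw [Real.cos_neg, Real.sin_neg, Real.cos_pi_div_four, Real.sin_pi_div_four]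
        exact ⟨by ring, by ring_nf; exact abs_of_pos (by positivity)⟩
      · rw [show 3 * Real.pi / 4 = Real.pi - Real.pi / 4 by ring, Real.cos_pi_sub, Real.sin_pi_sub,
          Real.cos_pi_div_four, Real.sin_pi_div_four]
        exact ⟨by ring, by ring_nf; rw [abs_neg]; exact abs_of_pos (by positivity)⟩
    -- At the ends `p` and `r` vanish and `q = s = ampP t` are constant. The square of this
    -- amplitude is the coefficient of the prescribed plane.
    have h2 : ampP t ^ 2 = 3 / q2 3 := by
      have : 0 ≤ 1 / q2 1 * ((1 - 0 / √2) * √2 + 1 / √2) := by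
        rw [zero_div, sub_zero]; positivity
      rw [ampP, h1.1, h1.2, Real.sq_sqrt this, hs2, q2_three]
      field_simp
      linear_combination q2_one_pow
    have h3 : coef0 P t = ![0, 0, 0, ampP t, 0, 0, 0, ampP t, 0] := by
      simp [coef0, cos_two_mul_eq, h1.1]
    have e' : ∀ u, cs 0 u = 1 := fun u => by simp [cs]
    funext z
    simp only [surface, surfaceP, if_pos h, h3]
    funext i
    fin_cases i <;> simp [cspin, spin, sig, nullX, nullY, sol, e', h2] <;> ring
  rcases params_P ht with h | h | h
  · exact hend (Or.inl h)
  · exact hend (Or.inr h)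
  have hne : ¬(t = -(Real.pi / 4) ∨ t = 3 * Real.pi / 4) := by
    rintro (rfl | rfl)
    · rw [Real.cos_neg, Real.sin_neg, Real.cos_pi_div_four, Real.sin_pi_div_four] at h
      linarith
    · rw [show 3 * Real.pi / 4 = Real.pi - Real.pi / 4 by ring, Real.cos_pi_sub, Real.sin_pi_sub,
          Real.cos_pi_div_four, Real.sin_pi_div_four] at h
      linarith
  have hm2 : √(1 / (q2 1 * (Real.cos t + Real.sin t))) ^ 2 =
      1 / (q2 1 * (Real.cos t + Real.sin t)) := Real.sq_sqrt (by positivity)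
  have hm : √(1 / (q2 1 * (Real.cos t + Real.sin t))) ≠ 0 := by positivity
  have hl2 : √(scaleP t) ^ 2 = scaleP t := Real.sq_sqrt (scaleP_pos h).le
  -- Velocities are quadratic in the spinors, so the homothety by `scaleP t` is absorbed as the
  -- factor `√(scaleP t)` on the spinors.
  have key : ∀ w : Fin 9 → ℝ, weierstrass (hP t) (ηP t) = cspin w →
      scalec √(scaleP t) w = coef0 P t → surface P t = cspin (coef0 P t) := by
    intro w h1 h2
    funext z
    rw [← h2, cspin_scalec, hl2, ← h1]
    simp only [surface, surfaceP, if_neg hne]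
  have hcs := cos_sub_sin_eq t
  have ht1 := ht.1
  have ht2 := ht.2
  rcases lt_trichotomy t (Real.pi / 4) with hlt | heq | hgt
  · have he : 0 < Real.cos t - Real.sin t := by
      rw [hcs]
      exact mul_pos (by positivity) (Real.sin_pos_of_pos_of_lt_pi (by linarith) (by linarith))
    have h2 : 0 < Real.cos (2 * t) := by rw [cos_two_mul_eq]; positivity
    have hk := Real.sqrt_pos.2 h2
    have hk2 := Real.sq_sqrt h2.le
    -- The spinors see the amplitude A of h and the frequency k only through κ and the product A k.
    -- That product is the same expression in the hyperbolic, linear and trigonometric ranges, so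
    -- one coefficient vector serves all three.
    have hAk : √(Real.cos (2 * t)) / (Real.cos t - Real.sin t) * (√(Real.cos (2 * t)) / q2 3) =
        (Real.cos t + Real.sin t) / q2 3 := by
      field_simp
      rw [hk2, cos_two_mul_eq]
      ring
    refine key _ (weierstrass_tanh (A := √(Real.cos (2 * t)) / (Real.cos t - Real.sin t))
      (k := √(Real.cos (2 * t)) / q2 3) (by positivity) (by positivity) hm
      (fun z => by simp [hP, hlt]) (fun z => by simp only [ηP, hlt, if_true, hm2])) ?_
    rw [hAk]
    simp only [scalec, coef0, ampP_eq h, Matrix.cons_val, div_pow, hk2]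
    simp [mul_assoc]
  · have hs : Real.cos t + Real.sin t = √2 := by
      rw [heq, Real.cos_pi_div_four, Real.sin_pi_div_four]; ring
    have h0 : Real.cos (2 * t) = 0 := by
      rw [cos_two_mul_eq, heq, Real.cos_pi_div_four, Real.sin_pi_div_four]; ring
    have hl : ¬ t < Real.pi / 4 := by linarith
    refine key _ (weierstrass_linear (A := 1 / q2 1) (by positivity) hm
      (fun z => by simp [hP, heq]) (fun z => by
        rw [hm2, hs, hs2, show q2 1 * q2 1 ^ 2 = q2 1 ^ 3 by ring]
        simp [ηP, heq, q2_three])) ?_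
    rw [show (1 / q2 1 : ℝ) = (Real.cos t + Real.sin t) / q2 3 by
      rw [hs, hs2, q2_three]; field_simp]
    simp only [scalec, coef0, ampP_eq h, Matrix.cons_val, h0]
    simp [mul_assoc]
  · have he : Real.cos t - Real.sin t < 0 := by
      rw [hcs, ← neg_sub t, Real.sin_neg]
      have := Real.sin_pos_of_pos_of_lt_pi (x := t - Real.pi / 4) (by linarith) (by linarith)
      have : 0 < √2 * Real.sin (t - Real.pi / 4) := by positivity
      linarith
    have h2 : 0 < -Real.cos (2 * t) := by rw [cos_two_mul_eq]; nlinarith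
    have hk := Real.sqrt_pos.2 h2
    have hk2 := Real.sq_sqrt h2.le
    have hAk : -(√(-Real.cos (2 * t)) / (Real.cos t - Real.sin t)) * (√(-Real.cos (2 * t)) / q2 3) =
        (Real.cos t + Real.sin t) / q2 3 := by
      have := he.ne
      field_simp
      rw [hk2, cos_two_mul_eq]
      ring
    refine key _ (weierstrass_tan (A := -(√(-Real.cos (2 * t)) / (Real.cos t - Real.sin t)))
      (k := √(-Real.cos (2 * t)) / q2 3) (neg_ne_zero.2 (div_ne_zero hk.ne' he.ne)) (by positivity)
      hm (fun z => by simp [hP, hgt.not_gt, hgt.ne'])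
      (fun z => by simp only [ηP, hgt.not_gt, hgt.ne', if_false, hm2])) ?_
    rw [hAk]
    simp only [scalec, coef0, ampP_eq h, Matrix.cons_val, div_pow, hk2]
    simp [mul_assoc, neg_div]

end PlanarCurvature
end

/-! ### All members as `base + cspin coef`; continuous dependence on the parameter -/

noncomputable section

namespace PlanarCurvature

open Branch

lemma params_S2 {t : ℝ} (ht : t ∈ params S2) : 0 ≤ Real.cos t ∧ 0 ≤ Real.cos t - Real.sin t ∧
    0 < a1 t + a0 t ∧ (t ≠ Real.pi / 4 → 0 < Real.cos t - Real.sin t) := by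
  have ht1 := ht.1
  have ht2 := ht.2
  have hpi := Real.pi_pos
  have h0 : 0 ≤ Real.cos t := Real.cos_nonneg_of_neg_pi_div_two_le_of_le ht1 (by linarith)
  have h1 : t ≠ Real.pi / 4 → 0 < Real.cos t - Real.sin t := fun h => by
    rw [cos_sub_sin_eq]
    have := lt_of_le_of_ne ht2 h
    exact mul_pos (by positivity) (Real.sin_pos_of_pos_of_lt_pi (by linarith) (by linarith))
  rcases eq_or_ne t (Real.pi / 4) with rfl | h
  · refine ⟨h0, by simp, ?_, h1⟩
    have : 0 < a0 (Real.pi / 4) := Real.sqrt_pos.2 (by rw [Real.cos_pi_div_four]; positivity)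
    have : 0 ≤ a1 (Real.pi / 4) := Real.sqrt_nonneg _
    linarith
  · refine ⟨h0, (h1 h).le, ?_, h1⟩
    have : 0 ≤ a0 t := Real.sqrt_nonneg _
    have : 0 < a1 t := Real.sqrt_pos.2 (h1 h)
    linarith

lemma a1_quarter : a1 (Real.pi / 4) = 0 := by simp [a1]

lemma a0_quarter : a0 (Real.pi / 4) = 1 / q2 1 := by
  have := q2_pos 1
  rw [a0, Real.cos_pi_div_four, Real.sqrt_eq_iff_mul_self_eq (by positivity) (by positivity),
    sqrt_two_eq]
  field_simp
  exact q2_one_pow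

lemma coef0_S2_quarter : coef0 S2 (Real.pi / 4) = ![0, (√(q2 3))⁻¹, (√(q2 3))⁻¹ / q2 1,
    (√(q2 3))⁻¹, 0, -(√(q2 3))⁻¹, (√(q2 3))⁻¹ / q2 1, (√(q2 3))⁻¹, 0] := by
  have := q2_pos 1
  have h : 2 * (0 + 1 / q2 1) = q2 3 := by
    rw [q2_three]; field_simp; linear_combination -q2_one_pow
  simp only [coef0, a0_quarter, a1_quarter, h]
  funext i
  fin_cases i <;> simp [div_eq_mul_inv]

lemma weierstrass_S2_eq {t : ℝ} (ht : t ∈ params S2) :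
    weierstrass (hS2 t) (ηS2 t) = cspin (coef0 S2 t) := by
  obtain ⟨h0, h1, h2, h3⟩ := params_S2 ht
  rcases eq_or_ne t (Real.pi / 4) with rfl | h
  · have hq := q2_pos 1
    have hq3 := q2_pos 3
    have hD2 := Real.sq_sqrt hq3.le
    have hD0 : √(q2 3) ≠ 0 := by positivity
    rw [coef0_S2_quarter]
    have e : ∀ u, sn 0 u = u := fun u => by simp [sn, cs]
    have e' : ∀ u, cs 0 u = 1 := fun u => by simp [cs]
    refine weierstrass_eq_cspin _ ?_ ?_ (by simp [hD0]) (by simp [hD0]) fun z h1 h2 => ?_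
    · simp [wX, hD0, hq.ne']
    · simp [wY, hD0, hq.ne']
    · simp [hS2, ηS2, sol, e, e', hD2]
      constructor <;> ring
  · have ha : 0 < a1 t := Real.sqrt_pos.2 (h3 h)
    exact weierstrass_S2 ha.ne' (by linarith) (fun z => by simp [hS2, h])
      (fun z => by simp [ηS2, h])

lemma weierstrass_CL_eq {t : ℝ} (ht : 0 ≤ t) :
    weierstrass (hCL t) (ηCL t) = cspin (coef0 CL t) := by
  rcases ht.eq_or_lt with rfl | h
  · have := weierstrass_h5 (φ := 0) (η := η5) (fun z => by
      apply para_ext <;> simp)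
    rw [show hCL 0 = h5 by funext z; simp [hCL], show ηCL 0 = η5 by funext z; simp [ηCL], this]
    congr 1
    funext i
    fin_cases i <;> simp [coef0]
    norm_num
  · exact weierstrass_CL h

/-- The bridge from integrals and case distinctions to nine real coefficients: `rot` becomes `rotc`,
`align` becomes a shift of initial values plus a base point. -/
theorem surface_eq {b : Branch} {t : ℝ} (ht : t ∈ params b) :
    surface b t = fun z => base b t + cspin (coef b t) z := by
  have hh : √(1 / 2) ^ 2 = (1 / 2 : ℝ) := Real.sq_sqrt (by norm_num)
  have hh' : √(1 / 2 : ℝ) ≠ 0 := by positivity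
  cases b with
  | BL2 =>
    have h5 := q2_pos 5
    have h := weierstrass_exp (k := q2 1) (m := √(1 / q2 5)) (t := t) (q2_pos 1).ne' (by positivity)
      (h := fun z => pexp (q2 1 • z) + t • j) (η := fun z => (1 / q2 5) • pexp (-(q2 1 • z)))
      (fun z => rfl) (fun z => by rw [Real.sq_sqrt (by positivity)])
    funext z
    simp only [surface, h, base, coef, zero_add]
    exact rot_cspin _ z
  | P =>
    rw [surfaceP_eq ht]
    funext z
    simp [base, coef]
  | S2 =>
    rw [surface, weierstrass_S2_eq ht, align_cspin]; rfl
  | CL =>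
    rw [surface, weierstrass_CL_eq ht, align_cspin]; rfl
  | A =>
    rw [surface, weierstrass_h5 (φ := t) (fun z => rfl), align_cspin]; rfl
  | S4 =>
    rw [surface, weierstrass_jexp (t := t) (t' := 0) hh' (fun z => by simp) (fun z => by rw [hh]),
      add_zero, sub_zero, align_cspin]
    rfl
  | M =>
    rw [surface, weierstrass_jexp (t := 0) (t' := t) hh' (fun z => by
      apply para_ext <;> simp) (fun z => by rw [hh]),
      zero_add, zero_sub, sub_neg_eq_add, ← sub_eq_add_neg, align_cspin]
    rfl

lemma continuousOn_vec9 {I : Set ℝ} {f0 f1 f2 f3 f4 f5 f6 f7 f8 : ℝ → ℝ} (h0 : ContinuousOn f0 I)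
    (h1 : ContinuousOn f1 I) (h2 : ContinuousOn f2 I) (h3 : ContinuousOn f3 I)
    (h4 : ContinuousOn f4 I) (h5 : ContinuousOn f5 I) (h6 : ContinuousOn f6 I)
    (h7 : ContinuousOn f7 I) (h8 : ContinuousOn f8 I) : ContinuousOn
      (fun t => (![f0 t, f1 t, f2 t, f3 t, f4 t, f5 t, f6 t, f7 t, f8 t] : Fin 9 → ℝ)) I := by
  refine continuousOn_pi.2 fun i => ?_
  fin_cases i <;> assumption

/-- The only nonconstant denominator is the root of 2 (a1 + a0) in S2, and a0, a1 do not vanish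
simultaneously on the parameter interval. -/
lemma continuousOn_coef0 (b : Branch) : ContinuousOn (coef0 b) (params b) := by
  have hs := Real.continuous_sqrt
  cases b with
  | BL2 => refine continuousOn_vec9 ?_ ?_ ?_ ?_ ?_ ?_ ?_ ?_ ?_ <;> fun_prop
  | P =>
    have hN : Continuous ampP := by unfold ampP; fun_prop
    refine continuousOn_vec9 ?_ ?_ ?_ ?_ ?_ ?_ ?_ ?_ ?_ <;> fun_prop
  | S2 =>
    have h0 : Continuous a0 := by unfold a0; fun_prop
    have h1 : Continuous a1 := by unfold a1; fun_prop
    have : ContinuousOn (fun t => (√(2 * (a1 t + a0 t)))⁻¹) (params S2) :=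
      ContinuousOn.inv₀ (by fun_prop) fun t ht => by
        have := (params_S2 ht).2.2.1
        positivity
    refine ContinuousOn.smul this ?_
    refine continuousOn_vec9 ?_ ?_ ?_ ?_ ?_ ?_ ?_ ?_ ?_ <;> fun_prop
  | CL => refine continuousOn_vec9 ?_ ?_ ?_ ?_ ?_ ?_ ?_ ?_ ?_ <;> fun_prop
  | A => refine continuousOn_vec9 ?_ ?_ ?_ ?_ ?_ ?_ ?_ ?_ ?_ <;> fun_prop
  | S4 => refine continuousOn_vec9 ?_ ?_ ?_ ?_ ?_ ?_ ?_ ?_ ?_ <;> fun_prop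
  | M => refine continuousOn_vec9 ?_ ?_ ?_ ?_ ?_ ?_ ?_ ?_ ?_ <;> fun_prop

lemma continuous_shiftc (a b : ℝ) : Continuous fun c => shiftc c a b := by
  refine continuous_pi fun i => ?_
  fin_cases i
  · exact continuous_apply 0
  all_goals exact continuous_sol (by fun_prop) (by fun_prop) (by fun_prop) (by fun_prop)

lemma continuous_rotc : Continuous rotc := by
  refine continuous_pi fun i => ?_
  fin_cases i <;> simp only [rotc] <;> fun_prop

lemma continuousOn_coef (b : Branch) : ContinuousOn (coef b) (params b) := by
  have h := continuousOn_coef0 b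
  cases b
  · exact continuous_rotc.comp_continuousOn h
  · exact h
  all_goals exact (continuous_shiftc _ _).comp_continuousOn h

lemma continuousOn_base (b : Branch) : ContinuousOn (base b) (params b) := by
  have h := continuousOn_coef0 b
  have h' : ContinuousOn (fun t => cspin (coef0 b t) (0, -q2 1) + ![1 / √2, 0, -(2 * √2 / 3)])
      (params b) :=
    (continuous_cspin.comp_continuousOn (h.prodMk continuousOn_const)).add continuousOn_const
  cases b
  · exact continuousOn_const
  · exact continuousOn_const
  all_goals exact h'

lemma continuousOn_surface (b : Branch) :
    ContinuousOn (fun x : ℝ × (ℝ × ℝ) => surface b x.1 x.2) (params b ×ˢ univ) := by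
  have h1 : ContinuousOn (fun x : ℝ × (ℝ × ℝ) => base b x.1 + cspin (coef b x.1) x.2)
      (params b ×ˢ univ) := by
    have hf : MapsTo (Prod.fst : ℝ × (ℝ × ℝ) → ℝ) (params b ×ˢ univ) (params b) := fun x hx => hx.1
    have hb : ContinuousOn (fun x : ℝ × (ℝ × ℝ) => base b x.1) (params b ×ˢ univ) :=
      (continuousOn_base b).comp continuousOn_fst hf
    have hc : ContinuousOn (fun x : ℝ × (ℝ × ℝ) => coef b x.1) (params b ×ˢ univ) :=
      (continuousOn_coef b).comp continuousOn_fst hf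
    have hd : ContinuousOn (fun x : ℝ × (ℝ × ℝ) => (coef b x.1, x.2)) (params b ×ˢ univ) :=
      hc.prodMk continuousOn_snd
    have he := continuous_cspin.comp_continuousOn hd
    refine ContinuousOn.add hb ?_
    exact he
  refine h1.congr fun x hx => ?_
  exact congrFun (surface_eq hx.1) x.2

/-- Currying a jointly continuous map gives a continuous map into the space of continuous functions
with the compact-open topology, where convergence is uniform convergence on compacta. -/
theorem isContinuousDeformation_of_continuousOn {I : Set ℝ} {Ψ : ℝ → ℝ × ℝ → Mink}
    (h : ContinuousOn (fun x : ℝ × (ℝ × ℝ) => Ψ x.1 x.2) (I ×ˢ univ)) :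
    IsContinuousDeformation I Ψ := by
  intro t ht K hK i
  let g : C(I × (ℝ × ℝ), ℝ) := ⟨fun x => Ψ x.1 x.2 i, by
    have h1 : Continuous fun x : I × (ℝ × ℝ) => Ψ x.1 x.2 :=
      h.comp_continuous (f := fun x : I × (ℝ × ℝ) => ((x.1 : ℝ), x.2)) (by fun_prop)
        fun x => ⟨x.1.2, mem_univ _⟩
    exact (continuous_apply i).comp h1⟩
  have h2 : Tendsto (fun s => g.curry s) (𝓝 (⟨t, ht⟩ : I)) (𝓝 (g.curry ⟨t, ht⟩)) :=
    g.curry.continuous.tendsto _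
  have h3 := ContinuousMap.tendsto_iff_forall_isCompact_tendstoUniformlyOn.1 h2 K hK
  rw [nhdsWithin_eq_map_subtype_coe ht]
  intro u hu
  exact Filter.eventually_map.2 (h3 u hu)

theorem isContinuousDeformation_surface (b : Branch) :
    IsContinuousDeformation (params b) (surface b) :=
  isContinuousDeformation_of_continuousOn (continuousOn_surface b)

/-! ### Joints -/

/-- Before the rotation the spinors are multiples of growing and decaying exponentials. The spinor
rotation forms their difference and sum, the hyperbolic sine and cosine of the family P. -/
theorem surface_BL2_zero : surface BL2 0 = surface P 0 := by
  have hx := q2_pos 1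
  have h0 : (0 : ℝ) ∈ params P := ⟨by linarith [Real.pi_pos], by linarith [Real.pi_pos]⟩
  rw [surface_eq (b := BL2) (by simp [params]), surface_eq h0]
  have hm : ampP 0 = √2 * √(1 / q2 5) := by
    rw [ampP, ← Real.sqrt_mul (by norm_num), q2_five]
    congr 1
    simp
    field_simp
  have hs : √2 * √2 = 2 := Real.mul_self_sqrt (by norm_num)
  have hs' : (0 : ℝ) < √2 := by positivity
  have h : coef BL2 0 = coef P 0 := by
    have e := q2_one_pow
    simp only [coef, coef0, rotc, hm, q2_three]
    generalize √(1 / q2 5) = m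
    funext i
    fin_cases i <;> simp <;> field_simp <;> ring_nf
    · linear_combination (q2 1 ^ 4 + 2) * e
    · linear_combination 2 * m * e - 2 * m * hs
    · linear_combination -m * hs
    · linear_combination 2 * m * e - 2 * m * hs
    · linear_combination -m * hs
  simp [h, base]

lemma integral_quadratic {f : ℝ → ℝ} (a b c x : ℝ) (h : ∀ t, f t = a + b * t + c * t ^ 2) :
    ∫ t in (0 : ℝ)..x, f t = a * x + b * x ^ 2 / 2 + c * x ^ 3 / 3 := by
  rw [show f = fun t => a + b * t + c * t ^ 2 from funext h, intervalIntegral.integral_add,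
    intervalIntegral.integral_add, intervalIntegral.integral_const_mul,
    intervalIntegral.integral_const_mul, integral_id, integral_pow]
  · simp; ring
  all_goals exact (by fun_prop : Continuous _).intervalIntegrable _ _

/-- The two values of h differ by the constant j, that is, by the translation of y by 2^{1/4} that
`align` undoes. The spatial constant in `align` is what makes the base point zero (`hb`), as
explicit cubic integrals show. -/
theorem surface_P_quarter : surface P (Real.pi / 4) = surface S2 (Real.pi / 4) := by
  have hx := q2_pos 1
  have hpi := Real.pi_pos
  have e := q2_one_pow
  have h1 : Real.pi / 4 ∈ params P := ⟨by linarith, by linarith⟩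
  have h2 : Real.pi / 4 ∈ params S2 := ⟨by linarith, le_rfl⟩
  rw [surface_eq h1, surface_eq h2]
  have es : ∀ u, sn 0 u = u := fun u => by simp [sn, cs]
  have ec : ∀ u, cs 0 u = 1 := fun u => by simp [cs]
  have hD2 := Real.sq_sqrt (q2_pos 3).le
  have hDp := Real.sqrt_pos.2 (q2_pos 3)
  have hc0 := coef0_S2_quarter
  set D := √(q2 3)
  have hN : ampP (Real.pi / 4) = D⁻¹ := by
    rw [ampP, Real.cos_pi_div_four, Real.sin_pi_div_four,
      Real.sqrt_eq_iff_mul_self_eq _ (by positivity)]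
    · rw [← mul_inv, ← pow_two, hD2, q2_three]
      simp [sqrt_two_eq]
      field_simp
    · simp; positivity
  have h : coef P (Real.pi / 4) = coef S2 (Real.pi / 4) := by
    have hcos : Real.cos (2 * (Real.pi / 4)) = 0 := by
      rw [show 2 * (Real.pi / 4) = Real.pi / 2 by ring, Real.cos_pi_div_two]
    have hsum : (Real.cos (Real.pi / 4) + Real.sin (Real.pi / 4)) / q2 3 = 1 / q2 1 := by
      rw [Real.cos_pi_div_four, Real.sin_pi_div_four, add_halves, sqrt_two_eq, q2_three]
      field_simp
    simp only [coef, hc0, shiftc]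
    simp only [coef0, hN, hcos, hsum]
    funext i
    fin_cases i <;> simp [sol, es, ec] <;> field_simp <;> simp
  have hb : base S2 (Real.pi / 4) = 0 := by
    simp only [base, hc0]
    funext i
    simp only [Pi.add_apply, cspin, spin, sig, Matrix.cons_val, sol, es, ec]
    have hE : D⁻¹ ^ 2 = 1 / q2 1 ^ 3 := by rw [inv_pow, hD2, q2_three, one_div]
    have hE' : (√2)⁻¹ = 1 / q2 1 ^ 2 := by rw [sqrt_two_eq, one_div]
    fin_cases i
    · simp only [nullX, nullY]
      rw [integral_quadratic (D⁻¹ ^ 2) (D⁻¹ ^ 2 / q2 1) 0 _ (fun t => by simp; ring),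
        integral_quadratic (-D⁻¹ ^ 2) (D⁻¹ ^ 2 / q2 1) 0 _ (fun t => by simp; ring), hE]
      simp [hE']
      field_simp
      ring
    · simp only [nullX, nullY]
      rw [integral_quadratic 0 (-D⁻¹ ^ 2 / q2 1) (-D⁻¹ ^ 2 / q2 1 ^ 2 / 2) _ (fun t => by simp; ring),
        integral_quadratic 0 (D⁻¹ ^ 2 / q2 1) (-D⁻¹ ^ 2 / q2 1 ^ 2 / 2) _ (fun t => by simp; ring), hE]
      simp
      ring
    · simp only [nullX, nullY]
      rw [integral_quadratic (-D⁻¹ ^ 2) (-D⁻¹ ^ 2 / q2 1) (-D⁻¹ ^ 2 / q2 1 ^ 2 / 2) _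
          (fun t => by simp; ring),
        integral_quadratic (D⁻¹ ^ 2) (-D⁻¹ ^ 2 / q2 1) (D⁻¹ ^ 2 / q2 1 ^ 2 / 2) _
          (fun t => by simp; ring), hE]
      simp [sqrt_two_eq]
      field_simp
      linear_combination -4 * e
  simp only [h, hb]
  simp [base]

theorem surface_S2_zero : surface S2 0 = surface CL 1 := by
  have h1 : hS2 0 = hCL 1 := by
    funext z
    have : (0 : ℝ) ≠ Real.pi / 4 := by positivity
    have e : hCL 1 z = pdiv (j * ((1 + 1 : ℝ) • pexp ((1 : ℝ) • (j * z)) - 1)) 1 := by simp [hCL]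
    obtain ⟨d1, d2⟩ := pdiv_components (z := j * ((1 + 1 : ℝ) • pexp ((1 : ℝ) • (j * z)) - 1))
      (w := 1) (by simp) (by simp)
    rw [e]
    apply para_ext
    · rw [d1]; simp [hS2, this, a0, a1]
    · rw [d2]; simp [hS2, this, a0, a1]
  have h2 : ηS2 0 = ηCL 1 := by
    funext z
    have : (0 : ℝ) ≠ Real.pi / 4 := by positivity
    apply para_ext <;> simp [ηS2, ηCL, this, a0, a1] <;> norm_num
  simp only [surface, h1, h2]

theorem surface_CL_zero : surface CL 0 = surface A 0 := by
  have h1 : hCL 0 = h5 := by funext z; simp [hCL]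
  have h2 : ηCL 0 = fun z => pexp ((2 * (0 : ℝ)) • j) * η5 z := by
    funext z
    apply para_ext <;> simp [ηCL]
  simp only [surface, h1, h2]

theorem surface_S2_left : surface S2 (-(Real.pi / 2)) = surface S4 0 := by
  have hpi := Real.pi_pos
  have : -(Real.pi / 2) ≠ Real.pi / 4 := by linarith
  have h1 : hS2 (-(Real.pi / 2)) = fun z => j * pexp (j * z) + ofReal 0 := by
    funext z
    apply para_ext <;> simp [hS2, this, a0, a1]
  have h2 : ηS2 (-(Real.pi / 2)) = fun z => (1 / 2 : ℝ) • pexp (-(j * z)) := by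
    funext z
    apply para_ext <;> simp [ηS2, this, a0, a1]
  simp only [surface, h1, h2]

theorem surface_S4_zero : surface S4 0 = surface M 0 := by
  have : (fun z => j * pexp (j * z) + ofReal 0) = fun z => j * pexp (j * z) + (0 : ℝ) • j := by
    funext z
    apply para_ext <;> simp
  simp only [surface, this]

/-! ### Connectedness -/

/-- The members of the deformation as continuous maps. -/
def memberMaps : Set C(ℝ × ℝ, Mink) := {f | ⇑f ∈ members}

/-- A family as a continuous map into the space of surfaces. -/
def familyMap (b : Branch) : C(params b, C(ℝ × ℝ, Mink)) :=
  ContinuousMap.curry ⟨fun x => surface b x.1 x.2,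
    (continuousOn_surface b).comp_continuous (f := fun x : params b × (ℝ × ℝ) => ((x.1 : ℝ), x.2))
      (by fun_prop) fun x => ⟨x.1.2, mem_univ _⟩⟩

lemma familyMap_mem (b : Branch) (t : params b) : familyMap b t ∈ memberMaps :=
  ⟨b, t, t.2, rfl⟩

lemma joinedIn_family (b : Branch) (s t : params b) :
    JoinedIn memberMaps (familyMap b s) (familyMap b t) := by
  have hc : Convex ℝ (params b) := by
    cases b
    · exact convex_Icc _ _
    · exact convex_Icc _ _
    · exact convex_Icc _ _
    · exact convex_Ici _
    · exact convex_univ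
    · exact convex_Ici _
    · exact convex_Ici _
  have : PathConnectedSpace (params b) :=
    isPathConnected_iff_pathConnectedSpace.1 (hc.isPathConnected ⟨s, s.2⟩)
  refine ((isPathConnected_range (familyMap b).continuous).joinedIn _ ⟨s, rfl⟩ _ ⟨t, rfl⟩).mono ?_
  rintro _ ⟨x, rfl⟩
  exact familyMap_mem b x

lemma familyMap_eq {b b' : Branch} (s : params b) (t : params b')
    (h : surface b s = surface b' t) : familyMap b s = familyMap b' t :=
  ContinuousMap.ext fun z => congrFun h z

lemma joinedIn_memberMaps {f g : C(ℝ × ℝ, Mink)} (hf : f ∈ memberMaps) (hg : g ∈ memberMaps) :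
    JoinedIn memberMaps f g := by
  have hpi := Real.pi_pos
  have aux : ∀ {b b' : Branch} {s t : ℝ} (hs : s ∈ params b) (ht : t ∈ params b'),
      surface b s = surface b' t → ∀ (x : params b) (y : params b'),
      JoinedIn memberMaps (familyMap b x) (familyMap b' y) := fun {b b' s t} hs ht h x y =>
    (joinedIn_family b x ⟨s, hs⟩).trans
      (familyMap_eq ⟨s, hs⟩ ⟨t, ht⟩ h ▸ joinedIn_family b' ⟨t, ht⟩ y)
  have m1 : (0 : ℝ) ∈ params S2 := ⟨by linarith, by linarith⟩
  have m2 : -(Real.pi / 2) ∈ params S2 := ⟨le_rfl, by linarith⟩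
  have m3 : (0 : ℝ) ∈ params CL := mem_Ici.2 le_rfl
  have m4 : (0 : ℝ) ∈ params S4 := mem_Ici.2 le_rfl
  have m5 : (0 : ℝ) ∈ params M := mem_Ici.2 le_rfl
  have m6 : Real.pi / 4 ∈ params S2 := ⟨by linarith, le_rfl⟩
  have m7 : Real.pi / 4 ∈ params P := ⟨by linarith, by linarith⟩
  have m8 : (0 : ℝ) ∈ params P := ⟨by linarith, by linarith⟩
  have m9 : (0 : ℝ) ∈ params BL2 := ⟨le_rfl, by norm_num⟩
  have m10 : (1 : ℝ) ∈ params CL := mem_Ici.2 (by norm_num)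
  have m11 : (0 : ℝ) ∈ params A := mem_univ _
  -- The joints form a tree on the seven families. The member of S2 with parameter 0 serves as the
  -- root.
  have key : ∀ (b : Branch) (x : params b),
      JoinedIn memberMaps (familyMap S2 ⟨0, m1⟩) (familyMap b x) := by
    intro b x
    cases b with
    | BL2 =>
      exact (aux m6 m7 surface_P_quarter.symm _ ⟨0, m8⟩).trans
        (aux m8 m9 surface_BL2_zero.symm _ _)
    | P => exact aux m6 m7 surface_P_quarter.symm _ _
    | S2 => exact joinedIn_family _ _ _
    | CL => exact aux m1 m10 surface_S2_zero _ _
    | A => exact (aux m1 m10 surface_S2_zero _ ⟨0, m3⟩).trans (aux m3 m11 surface_CL_zero _ _)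
    | S4 => exact aux m2 m4 surface_S2_left _ _
    | M => exact (aux m2 m4 surface_S2_left _ ⟨0, m4⟩).trans (aux m4 m5 surface_S4_zero _ _)
  have key' : ∀ f ∈ memberMaps, JoinedIn memberMaps (familyMap S2 ⟨0, m1⟩) f := by
    rintro f ⟨b, t, ht, hf⟩
    rw [show f = familyMap b ⟨t, ht⟩ from ContinuousMap.ext fun z => congrFun hf z]
    exact key b ⟨t, ht⟩
  exact (key' f hf).symm.trans (key' g hg)

theorem exists_deformation {G₀ G₁ : ℝ × ℝ → Mink} (h₀ : G₀ ∈ members) (h₁ : G₁ ∈ members) :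
    ∃ Γ : ℝ → ℝ × ℝ → Mink, Γ 0 = G₀ ∧ Γ 1 = G₁ ∧ (∀ t ∈ Set.Icc (0 : ℝ) 1, Γ t ∈ members) ∧
      IsContinuousDeformation (Set.Icc 0 1) Γ := by
  have hc : ∀ G ∈ members, ∃ f : C(ℝ × ℝ, Mink), f ∈ memberMaps ∧ ⇑f = G := by
    rintro G ⟨b, t, ht, rfl⟩
    exact ⟨familyMap b ⟨t, ht⟩, familyMap_mem b _, rfl⟩
  obtain ⟨f, hf, rfl⟩ := hc _ h₀
  obtain ⟨g, hg, rfl⟩ := hc _ h₁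
  obtain ⟨γ, hγ⟩ := joinedIn_memberMaps hf hg
  refine ⟨fun t => γ.extend t, by simp, by simp, fun t ht => ?_, ?_⟩
  · have := hγ ⟨t, ht⟩
    rwa [← γ.extend_apply ht] at this
  · apply isContinuousDeformation_of_continuousOn
    have h : Continuous fun x : ℝ × (ℝ × ℝ) => γ.extend x.1 x.2 :=
      ContinuousEval.continuous_eval.comp
        ((γ.continuous_extend.comp continuous_fst).prodMk continuous_snd)
    exact h.continuousOn

end PlanarCurvature
end

noncomputable section

namespace PlanarCurvature

/-! ### Surfaces split into two null curves -/

/-- The derivative of `nullX` at `(p, q)` in the direction `(p', q')`. -/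
def dnullX (p q p' q' : ℝ) : Mink := ![p' * q + p * q', q * q' - p * p', -(q * q' + p * p')]

/-- The derivative of `nullY` at `(r, s)` in the direction `(r', s')`. -/
def dnullY (r s r' s' : ℝ) : Mink := ![r' * s + r * s', s * s' - r * r', s * s' + r * r']

lemma hasDerivAt_nullX {p q : ℝ → ℝ} {p' q' t : ℝ} (hp : HasDerivAt p p' t)
    (hq : HasDerivAt q q' t) :
    HasDerivAt (fun t => nullX (p t) (q t)) (dnullX (p t) (q t) p' q') t := by
  rw [hasDerivAt_pi]
  intro i
  fin_cases i
  · exact hp.mul hq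
  · exact (((hq.pow 2).sub (hp.pow 2)).div_const 2).congr_deriv (by simp [dnullX]; ring)
  · exact (((hq.pow 2).add (hp.pow 2)).neg.div_const 2).congr_deriv (by simp [dnullX]; ring)

lemma hasDerivAt_nullY {p q : ℝ → ℝ} {p' q' t : ℝ} (hp : HasDerivAt p p' t)
    (hq : HasDerivAt q q' t) :
    HasDerivAt (fun t => nullY (p t) (q t)) (dnullY (p t) (q t) p' q') t := by
  rw [hasDerivAt_pi]
  intro i
  fin_cases i
  · exact hp.mul hq
  · exact (((hq.pow 2).sub (hp.pow 2)).div_const 2).congr_deriv (by simp [dnullY]; ring)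
  · exact (((hq.pow 2).add (hp.pow 2)).div_const 2).congr_deriv (by simp [dnullY]; ring)

/-- Near `a`, the surface `F` is the sum of a curve in the parameter `φ` with velocity `X` and a
curve in the parameter `ψ` with velocity `Y`. -/
structure NullChartAt (F : ℝ × ℝ → Mink) (a : ℝ × ℝ) (X Y : ℝ → Mink) (φ ψ : ℝ × ℝ → ℝ) : Prop where
  hasFDerivAt : ∀ᶠ z in 𝓝 a, HasFDerivAt F ((fderiv ℝ φ z).smulRight (X (φ z)) +
    (fderiv ℝ ψ z).smulRight (Y (ψ z))) z
  left : ContDiffAt ℝ 2 φ a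
  right : ContDiffAt ℝ 2 ψ a

namespace NullChartAt

variable {F : ℝ × ℝ → Mink} {a : ℝ × ℝ} {X Y : ℝ → Mink} {φ ψ : ℝ × ℝ → ℝ}

lemma d1_eq (h : NullChartAt F a X Y φ ψ) (v : ℝ × ℝ) :
    d1 F a v = fderiv ℝ φ a v • X (φ a) + fderiv ℝ ψ a v • Y (ψ a) := by
  rw [d1, h.hasFDerivAt.self_of_nhds.fderiv]; rfl

lemma d2_eq (h : NullChartAt F a X Y φ ψ) {X' Y' : Mink} (hX : HasDerivAt X X' (φ a))
    (hY : HasDerivAt Y Y' (ψ a)) (v w : ℝ × ℝ) :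
    d2 F a v w = (fderiv ℝ φ a v * fderiv ℝ φ a w) • X' + (fderiv ℝ ψ a v * fderiv ℝ ψ a w) • Y' +
      fderiv ℝ (fun z => fderiv ℝ φ z w) a v • X (φ a) +
      fderiv ℝ (fun z => fderiv ℝ ψ z w) a v • Y (ψ a) := by
  have h1 : (fun z => d1 F z w) =ᶠ[𝓝 a]
      fun z => fderiv ℝ φ z w • X (φ z) + fderiv ℝ ψ z w • Y (ψ z) := by
    filter_upwards [h.hasFDerivAt] with z hz
    rw [d1, hz.fderiv]; rfl
  have hd : ∀ {χ : ℝ × ℝ → ℝ}, ContDiffAt ℝ 2 χ a →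
      DifferentiableAt ℝ (fun z => fderiv ℝ χ z w) a := fun {χ} hχ =>
    ((hχ.fderiv_right (m := 1) le_rfl).differentiableAt one_ne_zero).clm_apply
      (differentiableAt_const w)
  have hφ := (h.left.differentiableAt two_ne_zero).hasFDerivAt
  have hψ := (h.right.differentiableAt two_ne_zero).hasFDerivAt
  have h2 := ((hd h.left).hasFDerivAt.smul (hX.hasFDerivAt.comp a hφ)).add
    ((hd h.right).hasFDerivAt.smul (hY.hasFDerivAt.comp a hψ))
  rw [d2, h1.fderiv_eq]
  erw [h2.fderiv]
  ext i
  simp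
  ring

/-- The Jacobian determinant of the null coordinates. -/
def jac (φ ψ : ℝ × ℝ → ℝ) (a : ℝ × ℝ) : ℝ :=
  fderiv ℝ φ a (1, 0) * fderiv ℝ ψ a (0, 1) - fderiv ℝ φ a (0, 1) * fderiv ℝ ψ a (1, 0)

lemma apply_eq (L : ℝ × ℝ →L[ℝ] ℝ) (v : ℝ × ℝ) : L v = v.1 * L (1, 0) + v.2 * L (0, 1) := by
  rw [← smul_eq_mul, ← smul_eq_mul, ← map_smul, ← map_smul, ← map_add]
  simp

lemma exists_eq (hj : jac φ ψ a ≠ 0) (α β : ℝ) :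
    ∃ w : ℝ × ℝ, fderiv ℝ φ a w = α ∧ fderiv ℝ ψ a w = β := by
  refine ⟨((α * fderiv ℝ ψ a (0, 1) - β * fderiv ℝ φ a (0, 1)) / jac φ ψ a,
    (β * fderiv ℝ φ a (1, 0) - α * fderiv ℝ ψ a (1, 0)) / jac φ ψ a), ?_, ?_⟩ <;>
  · rw [apply_eq]
    field_simp
    rw [jac]; ring

lemma eq_zero (hj : jac φ ψ a ≠ 0) {v : ℝ × ℝ} (h1 : fderiv ℝ φ a v = 0) (h2 : fderiv ℝ ψ a v = 0) :
    v = 0 := by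
  rw [apply_eq] at h1 h2
  have e1 : v.1 * jac φ ψ a = 0 := by
    rw [jac]; linear_combination fderiv ℝ ψ a (0, 1) * h1 - fderiv ℝ φ a (0, 1) * h2
  have e2 : v.2 * jac φ ψ a = 0 := by
    rw [jac]; linear_combination fderiv ℝ φ a (1, 0) * h2 - fderiv ℝ ψ a (1, 0) * h1
  ext
  · exact (mul_eq_zero.1 e1).resolve_right hj
  · exact (mul_eq_zero.1 e2).resolve_right hj

variable {p q r s p' q' r' s' : ℝ}

/-- Both velocities are light-like, so only their mixed product survives, and it is half the square
of the spinor pairing. The metric degenerates exactly where q s + p r = 0. -/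
lemma firstForm_eq (h : NullChartAt F a X Y φ ψ) (hX : X (φ a) = nullX p q)
    (hY : Y (ψ a) = nullY r s) (v w : ℝ × ℝ) : firstForm F a v w = (q * s + p * r) ^ 2 / 2 *
      (fderiv ℝ φ a v * fderiv ℝ ψ a w + fderiv ℝ ψ a v * fderiv ℝ φ a w) := by
  rw [firstForm, h.d1_eq, h.d1_eq, hX, hY]
  simp [mink, nullX, nullY]
  ring

lemma gramDet_eq (h : NullChartAt F a X Y φ ψ) (hX : X (φ a) = nullX p q)
    (hY : Y (ψ a) = nullY r s) : gramDet F a = -((q * s + p * r) ^ 2 / 2 * jac φ ψ a) ^ 2 := by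
  simp only [gramDet, h.firstForm_eq hX hY, jac]
  ring

lemma timelikeAt_iff (h : NullChartAt F a X Y φ ψ) (hX : X (φ a) = nullX p q)
    (hY : Y (ψ a) = nullY r s) (hj : jac φ ψ a ≠ 0) : TimelikeAt F a ↔ q * s + p * r ≠ 0 := by
  rw [TimelikeAt, h.gramDet_eq hX hY]
  constructor
  · intro hlt h0
    rw [h0] at hlt
    simp at hlt
  · intro h0
    have : 0 < ((q * s + p * r) ^ 2 / 2 * jac φ ψ a) ^ 2 := by positivity
    linarith

/-- The second derivatives of φ and ψ come with the tangent vectors X and Y, which the normal kills.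
There is no mixed term: this is minimality. -/
lemma secondForm_eq (h : NullChartAt F a X Y φ ψ) {X' Y' : Mink} (hX : HasDerivAt X X' (φ a))
    (hY : HasDerivAt Y Y' (ψ a)) (hj : jac φ ψ a ≠ 0) {n : Mink} (hn : IsUnitNormal F a n)
    (v w : ℝ × ℝ) : secondForm F a n v w = fderiv ℝ φ a v * fderiv ℝ φ a w * mink X' n +
      fderiv ℝ ψ a v * fderiv ℝ ψ a w * mink Y' n := by
  obtain ⟨w1, e1, e1'⟩ := exists_eq hj 1 0
  obtain ⟨w2, e2, e2'⟩ := exists_eq hj 0 1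
  have h1 := hn.2 w1
  have h2 := hn.2 w2
  rw [h.d1_eq, e1, e1'] at h1
  rw [h.d1_eq, e2, e2'] at h2
  rw [secondForm, h.d2_eq hX hY]
  simp [mink] at h1 h2 ⊢
  linear_combination fderiv ℝ (fun z => fderiv ℝ φ z w) a v * h1 +
    fderiv ℝ (fun z => fderiv ℝ ψ z w) a v * h2

/-- The two unit normal vectors, up to sign. -/
def normal (p q r s : ℝ) : Mink :=
  (q * s + p * r)⁻¹ • ![q * s - p * r, -(p * s + q * r), q * r - p * s]

lemma isUnitNormal_normal (h : NullChartAt F a X Y φ ψ) (hX : X (φ a) = nullX p q)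
    (hY : Y (ψ a) = nullY r s) (hρ : q * s + p * r ≠ 0) : IsUnitNormal F a (normal p q r s) := by
  refine ⟨?_, fun v => ?_⟩
  · simp [mink, normal]
    field_simp
    ring
  · rw [h.d1_eq, hX, hY]
    simp [mink, normal, nullX, nullY]
    ring

lemma mink_normal (h : NullChartAt F a X Y φ ψ) (hX : X (φ a) = nullX p q)
    (hY : Y (ψ a) = nullY r s) (hρ : q * s + p * r ≠ 0) (hj : jac φ ψ a ≠ 0) {n : Mink}
    (hn : IsUnitNormal F a n) : ∃ ε : ℝ, ε ≠ 0 ∧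
      mink (dnullX p q p' q') n = ε * (q * p' - p * q') ∧
      mink (dnullY r s r' s') n = ε * (s * r' - r * s') := by
  obtain ⟨w1, e1, e1'⟩ := exists_eq hj 1 0
  obtain ⟨w2, e2, e2'⟩ := exists_eq hj 0 1
  have h1 := hn.2 w1
  have h2 := hn.2 w2
  have h0 := hn.1
  rw [h.d1_eq, e1, e1', hX, hY] at h1
  rw [h.d1_eq, e2, e2', hX, hY] at h2
  simp only [mink, nullX, nullY, dnullX, dnullY, one_smul, zero_smul, add_zero, zero_add,
    Matrix.cons_val] at h0 h1 h2 ⊢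
  -- ε is the scalar product of `n` with `normal p q r s`. Working with it spares deciding which of
  -- the two normals `n` is; only ε ≠ 0 is needed.
  refine ⟨(n 0 * (q * s - p * r) - n 1 * (p * s + q * r) - n 2 * (q * r - p * s)) /
    (q * s + p * r), ?_, ?_, ?_⟩
  · intro hε
    rw [div_eq_zero_iff, or_iff_left hρ] at hε
    refine hρ (pow_eq_zero_iff two_ne_zero |>.1 ?_)
    linear_combination (-(q * s + p * r) ^ 2) * h0 +
      (n 0 * (q * s - p * r) - n 1 * (p * s + q * r) - n 2 * (q * r - p * s)) * hε +
      4 * (r * s * n 0 + (s ^ 2 - r ^ 2) / 2 * n 1 - (s ^ 2 + r ^ 2) / 2 * n 2) * h1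
  · rw [div_mul_eq_mul_div, eq_div_iff hρ]
    linear_combination 2 * (q' * s + p' * r) * h1
  · rw [div_mul_eq_mul_div, eq_div_iff hρ]
    linear_combination 2 * (q * s' + p * r') * h2

/-- The first form is a multiple of dφ dψ, so the vectors orthogonal to one with null components (α,
β) are the multiples of (α, -β). Being principal means that the second form, ε times W_X dφ² + W_Y
dψ², vanishes on this pair: W_X α² = W_Y β². -/
lemma isPrincipal_iff (h : NullChartAt F a X Y φ ψ) (hX : X (φ a) = nullX p q)
    (hY : Y (ψ a) = nullY r s) (hX' : HasDerivAt X (dnullX p q p' q') (φ a))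
    (hY' : HasDerivAt Y (dnullY r s r' s') (ψ a)) (hρ : q * s + p * r ≠ 0) (hj : jac φ ψ a ≠ 0)
    (v : ℝ × ℝ) : IsPrincipal F a v ↔ v ≠ 0 ∧
      (q * p' - p * q') * fderiv ℝ φ a v ^ 2 = (s * r' - r * s') * fderiv ℝ ψ a v ^ 2 := by
  refine and_congr_right fun hv => ⟨fun H => ?_, fun H n hn => ?_⟩
  · obtain ⟨k, hk⟩ := H _ (h.isUnitNormal_normal hX hY hρ)
    have hn := h.isUnitNormal_normal hX hY hρ
    obtain ⟨ε, hε, e1, e2⟩ := h.mink_normal (p' := p') (q' := q') (r' := r') (s' := s') hX hY hρ hj hn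
    obtain ⟨w, w1, w2⟩ := exists_eq hj (fderiv ℝ φ a v) (-fderiv ℝ ψ a v)
    have := hk w
    rw [h.secondForm_eq hX' hY' hj hn, h.firstForm_eq hX hY, w1, w2, e1, e2] at this
    refine mul_left_cancel₀ hε ?_
    linear_combination this
  · obtain ⟨ε, hε, e1, e2⟩ := h.mink_normal (p' := p') (q' := q') (r' := r') (s' := s') hX hY hρ hj hn
    simp only [h.secondForm_eq hX' hY' hj hn, h.firstForm_eq hX hY, e1, e2]
    generalize q * p' - p * q' = wx at *
    generalize s * r' - r * s' = wy at *
    generalize hρ' : q * s + p * r = ρ at *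
    by_cases hφ : fderiv ℝ φ a v = 0
    · have hψ : fderiv ℝ ψ a v ≠ 0 := fun h0 => hv (eq_zero hj hφ h0)
      have hw : wy = 0 := by
        rw [hφ] at H
        exact (mul_eq_zero.1 (show wy * fderiv ℝ ψ a v ^ 2 = 0 by rw [← H]; ring)).resolve_right
          (pow_ne_zero 2 hψ)
      exact ⟨0, fun w => by rw [hφ, hw]; ring⟩
    · by_cases hψ : fderiv ℝ ψ a v = 0
      · have hw : wx = 0 := by
          rw [hψ] at H
          simpa [hφ] using H
        exact ⟨0, fun w => by rw [hψ, hw]; ring⟩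
      · refine ⟨2 * ε * wy * fderiv ℝ ψ a v / (ρ ^ 2 * fderiv ℝ φ a v), fun w => ?_⟩
        field_simp
        linear_combination fderiv ℝ φ a w * H

lemma meanCurvature_eq_zero (h : NullChartAt F a X Y φ ψ) (hX : X (φ a) = nullX p q)
    (hY : Y (ψ a) = nullY r s) (hX' : HasDerivAt X (dnullX p q p' q') (φ a))
    (hY' : HasDerivAt Y (dnullY r s r' s') (ψ a)) (hj : jac φ ψ a ≠ 0) {n : Mink}
    (hn : IsUnitNormal F a n) : meanCurvature F a n = 0 := by
  rw [meanCurvature, div_eq_zero_iff]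
  left
  simp only [h.secondForm_eq hX' hY' hj hn, h.firstForm_eq hX hY]
  ring

end NullChartAt

end PlanarCurvature
end

noncomputable section

namespace PlanarCurvature

/-! ### Smoothness of the spinors -/

lemma contDiff_cs (κ : ℝ) {n : WithTop ℕ∞} : ContDiff ℝ n (cs κ) := by
  unfold cs
  exact (Real.contDiff_cosh.comp (by fun_prop)).mul (Real.contDiff_cos.comp (by fun_prop))

lemma contDiff_sn (κ : ℝ) {n : WithTop ℕ∞} : ContDiff ℝ n (sn κ) := by
  rcases lt_trichotomy κ 0 with h | rfl | h
  · have h0 : √(-κ) ≠ 0 := (Real.sqrt_pos.2 (neg_pos.2 h)).ne'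
    rw [show sn κ = fun u => (√(-κ))⁻¹ * Real.sin (√(-κ) * u) by
      funext u; rw [← sqrt_mul_sn_of_nonpos h.le, inv_mul_cancel_left₀ h0]]
    exact contDiff_const.mul (Real.contDiff_sin.comp (by fun_prop))
  · rw [show sn 0 = fun u => u by funext u; simp [sn, cs]]
    fun_prop
  · have h0 : √κ ≠ 0 := (Real.sqrt_pos.2 h).ne'
    rw [show sn κ = fun u => (√κ)⁻¹ * Real.sinh (√κ * u) by
      funext u; rw [← sqrt_mul_sn_of_nonneg h.le, inv_mul_cancel_left₀ h0]]
    exact contDiff_const.mul (Real.contDiff_sinh.comp (by fun_prop))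

lemma contDiff_sol (κ a b : ℝ) {n : WithTop ℕ∞} : ContDiff ℝ n (sol κ a b) := by
  unfold sol
  exact (contDiff_const.mul (contDiff_cs κ)).add (contDiff_const.mul (contDiff_sn κ))

lemma contDiff_nullX {p q : ℝ → ℝ} {n : WithTop ℕ∞} (hp : ContDiff ℝ n p) (hq : ContDiff ℝ n q) :
    ContDiff ℝ n fun t => nullX (p t) (q t) := by
  refine contDiff_pi.2 fun i => ?_
  fin_cases i <;> simp [nullX] <;> fun_prop

lemma contDiff_nullY {p q : ℝ → ℝ} {n : WithTop ℕ∞} (hp : ContDiff ℝ n p) (hq : ContDiff ℝ n q) :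
    ContDiff ℝ n fun t => nullY (p t) (q t) := by
  refine contDiff_pi.2 fun i => ?_
  fin_cases i <;> simp [nullY] <;> fun_prop

/-- The null curve with velocity `X`, starting at the origin. -/
def curve (X : ℝ → Mink) (u : ℝ) : Mink := fun i => ∫ t in (0 : ℝ)..u, X t i

lemma hasDerivAt_curve {X : ℝ → Mink} (hX : Continuous X) (u : ℝ) :
    HasDerivAt (curve X) (X u) u := by
  rw [hasDerivAt_pi]
  intro i
  have hc : Continuous fun t => X t i := (continuous_apply i).comp hX
  exact intervalIntegral.integral_hasDerivAt_right (hc.intervalIntegrable _ _)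
    (hc.stronglyMeasurableAtFilter _ _) hc.continuousAt

lemma contDiff_curve {X : ℝ → Mink} (hX : ContDiff ℝ 3 X) : ContDiff ℝ 4 (curve X) := by
  rw [show (4 : WithTop ℕ∞) = 3 + 1 by norm_num, contDiff_succ_iff_deriv]
  refine ⟨fun u => (hasDerivAt_curve hX.continuous u).differentiableAt, by simp, ?_⟩
  rwa [show deriv (curve X) = X from funext fun u => (hasDerivAt_curve hX.continuous u).deriv]

/-! ### Planar curvature lines -/

/-- The rows are the coefficients of cs², cs sn and sn² in the velocity along a curvature line, once
the u-spinors are rewritten as functions of v. The first factor of the determinant is the condition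
that the direction is principal, and this is why such a line is planar. -/
lemma det_pencil (μ p p' q q' r r' s s' : ℝ) : Matrix.det (Matrix.of
    ![μ • nullX p q + nullY r s, μ • dnullX p q p' q' + dnullY r s r' s',
      μ • nullX p' q' + nullY r' s']) = 1 / 2 * (μ * (q * p' - p * q') - (s * r' - r * s')) *
        ((μ * (q * p' - p * q') + (s * r' - r * s')) ^ 2 -
          μ * (q' * s + p' * r - q * s' - p * r') ^ 2) := by
  rw [Matrix.det_fin_three]
  simp [nullX, nullY, dnullX, dnullY]
  ring

/-- For constant spinors this yields the normal of a plane. In general it measures how far a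
difference of potentials moves the acceleration out of the osculating plane. -/
lemma det_pencil_null (p p' q q' r r' s s' : ℝ) : Matrix.det (Matrix.of
    ![nullX p q + nullY r s, dnullX p q p' q' + dnullY r s r' s', nullX p q]) =
      (q * s + p * r) ^ 2 * ((q * p' - p * q') + (s * r' - r * s')) / 2 := by
  rw [Matrix.det_fin_three]
  simp [nullX, nullY, dnullX, dnullY]
  ring

lemma exists_normal_of_det {Z₀ Z₁ Z₂ : Mink} (h : Matrix.det (Matrix.of ![Z₀, Z₁, Z₂]) = 0) :
    ∃ m : Mink, m ≠ 0 ∧ m ⬝ᵥ Z₀ = 0 ∧ m ⬝ᵥ Z₁ = 0 ∧ m ⬝ᵥ Z₂ = 0 := by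
  obtain ⟨m, hm, hm'⟩ := Matrix.exists_mulVec_eq_zero_iff.2 h
  refine ⟨m, hm, ?_, ?_, ?_⟩
  · rw [dotProduct_comm]; exact congrFun hm' 0
  · rw [dotProduct_comm]; exact congrFun hm' 1
  · rw [dotProduct_comm]; exact congrFun hm' 2

/-- The velocity `μ X + Y` along a curvature line is a polynomial in `cs` and `sn` with linearly
dependent coefficients. -/
lemma exists_normal_of_wronskian {μ p p' q q' r r' s s' : ℝ}
    (h : μ * (q * p' - p * q') = s * r' - r * s') (κ : ℝ) : ∃ m : Mink, m ≠ 0 ∧ ∀ v,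
      m ⬝ᵥ (μ • nullX (sol κ p p' v) (sol κ q q' v) + nullY (sol κ r r' v) (sol κ s s' v)) = 0 := by
  obtain ⟨m, hm, h0, h1, h2⟩ := exists_normal_of_det (det_pencil μ p p' q q' r r' s s' |>.trans
    (by rw [h, sub_self, mul_zero, zero_mul]))
  refine ⟨m, hm, fun v => ?_⟩
  simp [dotProduct, Fin.sum_univ_three, nullX, nullY, dnullX, dnullY, sol] at h0 h1 h2 ⊢
  linear_combination cs κ v ^ 2 * h0 + cs κ v * sn κ v * h1 + sn κ v ^ 2 * h2

/-- On a line u = μ v + const the u-spinors satisfy f'' = κ μ² f in v. They share the constant κ of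
the v-spinors only under this alternative, which explains the one in `IsModel`. -/
lemma sol_mul {κ μ : ℝ} (h : κ = 0 ∨ μ ^ 2 = 1) (a b v : ℝ) :
    sol κ a b (μ * v) = sol κ a (μ * b) v := by
  have hμ : κ * μ ^ 2 = κ := by rcases h with h | h <;> simp [h]
  have h1 : ∀ t, HasDerivAt (fun t => sol κ a b (μ * t)) (μ * sol κ b (κ * a) (μ * t)) t := fun t =>
    ((hasDerivAt_sol κ a b (μ * t)).comp t ((hasDerivAt_id t).const_mul μ)).congr_deriv (by ring)
  have h2 : ∀ t, HasDerivAt (fun t => μ * sol κ b (κ * a) (μ * t)) (κ * sol κ a b (μ * t)) t :=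
    fun t => (((hasDerivAt_sol' κ a b (μ * t)).comp t
      ((hasDerivAt_id t).const_mul μ)).const_mul μ).congr_deriv (by linear_combination sol κ a b (μ * t) * hμ)
  simpa using eq_sol_of_hasDerivAt (u₀ := 0) (u := v) isOpen_univ isPreconnected_univ
    (fun t _ => h1 t) (fun t _ => h2 t) (mem_univ _) (mem_univ _)

/-! ### The model surfaces -/

/-- The null velocities of `cspin c`. -/
def velX (c : Fin 9 → ℝ) (u : ℝ) : Mink := nullX (sol (c 0) (c 1) (c 2) u) (sol (c 0) (c 3) (c 4) u)

def velY (c : Fin 9 → ℝ) (v : ℝ) : Mink := nullY (sol (c 0) (c 5) (c 6) v) (sol (c 0) (c 7) (c 8) v)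

lemma cspin_eq_curve (c : Fin 9 → ℝ) (z : ℝ × ℝ) :
    cspin c z = curve (velX c) (z.1 + z.2) + curve (velY c) (z.1 - z.2) := rfl

lemma contDiff_velX (c : Fin 9 → ℝ) {n : WithTop ℕ∞} : ContDiff ℝ n (velX c) :=
  contDiff_nullX (contDiff_sol _ _ _) (contDiff_sol _ _ _)

lemma contDiff_velY (c : Fin 9 → ℝ) {n : WithTop ℕ∞} : ContDiff ℝ n (velY c) :=
  contDiff_nullY (contDiff_sol _ _ _) (contDiff_sol _ _ _)

lemma hasDerivAt_velX (c : Fin 9 → ℝ) (u : ℝ) : HasDerivAt (velX c)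
    (dnullX (sol (c 0) (c 1) (c 2) u) (sol (c 0) (c 3) (c 4) u)
      (sol (c 0) (c 2) (c 0 * c 1) u) (sol (c 0) (c 4) (c 0 * c 3) u)) u :=
  hasDerivAt_nullX (hasDerivAt_sol _ _ _ _) (hasDerivAt_sol _ _ _ _)

lemma hasDerivAt_velY (c : Fin 9 → ℝ) (u : ℝ) : HasDerivAt (velY c)
    (dnullY (sol (c 0) (c 5) (c 6) u) (sol (c 0) (c 7) (c 8) u)
      (sol (c 0) (c 6) (c 0 * c 5) u) (sol (c 0) (c 8) (c 0 * c 7) u)) u :=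
  hasDerivAt_nullY (hasDerivAt_sol _ _ _ _) (hasDerivAt_sol _ _ _ _)

lemma velX_wronskian (c : Fin 9 → ℝ) (u : ℝ) :
    sol (c 0) (c 3) (c 4) u * sol (c 0) (c 2) (c 0 * c 1) u -
      sol (c 0) (c 1) (c 2) u * sol (c 0) (c 4) (c 0 * c 3) u = wX c := by
  rw [wX]; linear_combination sol_wronskian (c 0) (c 3) (c 4) (c 1) (c 2) u

lemma velY_wronskian (c : Fin 9 → ℝ) (u : ℝ) :
    sol (c 0) (c 7) (c 8) u * sol (c 0) (c 6) (c 0 * c 5) u -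
      sol (c 0) (c 5) (c 6) u * sol (c 0) (c 8) (c 0 * c 7) u = wY c := by
  rw [wY]; linear_combination sol_wronskian (c 0) (c 7) (c 8) (c 5) (c 6) u

/-- The null coordinate `x + y`. -/
def nullU : ℝ × ℝ →L[ℝ] ℝ := .fst ℝ ℝ ℝ + .snd ℝ ℝ ℝ

/-- The null coordinate `x - y`. -/
def nullV : ℝ × ℝ →L[ℝ] ℝ := .fst ℝ ℝ ℝ - .snd ℝ ℝ ℝ

@[simp] lemma nullU_apply (z : ℝ × ℝ) : nullU z = z.1 + z.2 := rfl

@[simp] lemma nullV_apply (z : ℝ × ℝ) : nullV z = z.1 - z.2 := rfl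

lemma hasFDerivAt_cspin (b : Mink) (c : Fin 9 → ℝ) (z : ℝ × ℝ) :
    HasFDerivAt (fun z => b + cspin c z) (nullU.smulRight (velX c (nullU z)) +
      nullV.smulRight (velY c (nullV z))) z := by
  have h1 := (hasDerivAt_curve (contDiff_velX c (n := 0)).continuous (nullU z)).hasFDerivAt.comp z
    nullU.hasFDerivAt
  have h2 := (hasDerivAt_curve (contDiff_velY c (n := 0)).continuous (nullV z)).hasFDerivAt.comp z
    nullV.hasFDerivAt
  refine ((h1.add h2).const_add b).congr_fderiv ?_
  ext v <;> simp

lemma nullChartAt_cspin (b : Mink) (c : Fin 9 → ℝ) (z : ℝ × ℝ) :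
    NullChartAt (fun z => b + cspin c z) z (velX c) (velY c) nullU nullV where
  hasFDerivAt := Eventually.of_forall fun z => by
    simpa only [ContinuousLinearMap.fderiv] using hasFDerivAt_cspin b c z
  left := nullU.contDiff.contDiffAt
  right := nullV.contDiff.contDiffAt

lemma jac_null (z : ℝ × ℝ) : NullChartAt.jac nullU nullV z = -2 := by
  simp [NullChartAt.jac]; norm_num

lemma contDiff_cspin (b : Mink) (c : Fin 9 → ℝ) : ContDiff ℝ 4 fun z => b + cspin c z :=
  contDiff_const.add (((contDiff_curve (contDiff_velX c)).comp nullU.contDiff).add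
    ((contDiff_curve (contDiff_velY c)).comp nullV.contDiff))

/-- The coefficients of the surfaces with planar curvature lines: either the shape operator has two
real eigenvalues of opposite sign everywhere, or the surface is a plane. -/
def IsModel (c : Fin 9 → ℝ) : Prop :=
  (0 < wX c * wY c ∧ (c 0 = 0 ∨ wX c = wY c)) ∨
    (c 0 = 0 ∧ c 2 = 0 ∧ c 4 = 0 ∧ c 6 = 0 ∧ c 8 = 0 ∧ c 3 * c 7 + c 1 * c 5 ≠ 0)

end PlanarCurvature
end

noncomputable section

namespace PlanarCurvature

/-! ### The model surfaces have planar curvature lines -/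

/-- The density of the metric of `cspin c`. -/
def dens (c : Fin 9 → ℝ) (z : ℝ × ℝ) : ℝ :=
  sol (c 0) (c 3) (c 4) (z.1 + z.2) * sol (c 0) (c 7) (c 8) (z.1 - z.2) +
    sol (c 0) (c 1) (c 2) (z.1 + z.2) * sol (c 0) (c 5) (c 6) (z.1 - z.2)

lemma timelikeAt_cspin (b : Mink) (c : Fin 9 → ℝ) (z : ℝ × ℝ) :
    TimelikeAt (fun z => b + cspin c z) z ↔ dens c z ≠ 0 :=
  (nullChartAt_cspin b c z).timelikeAt_iff rfl rfl (by rw [jac_null]; norm_num)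

lemma sol_eq_const {κ a b : ℝ} (h0 : κ = 0) (hb : b = 0) (u : ℝ) : sol κ a b u = a := by
  simp [sol, h0, hb, cs]

/-- If the pairing vanished near a point, then for fixed v both (q, p) and its u-derivative would
annihilate (s, r). The nonzero first Wronskian forces s = r = 0 at v, against the nonzero second
one. For planes the pairing is a nonzero constant. -/
lemma not_eventually_dens_eq_zero {c : Fin 9 → ℝ} (hc : IsModel c) (z : ℝ × ℝ) :
    ¬ ∀ᶠ w in 𝓝 z, dens c w = 0 := by
  intro h
  rcases hc with ⟨hw, -⟩ | ⟨h0, h2, h4, h6, h8, hne⟩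
  · have ht : Tendsto (fun t : ℝ => (z.1 + t / 2, z.2 + t / 2)) (𝓝 0) (𝓝 z) := by
      have : ContinuousAt (fun t : ℝ => (z.1 + t / 2, z.2 + t / 2)) 0 := by fun_prop
      simpa [ContinuousAt] using this
    set u := z.1 + z.2
    set v := z.1 - z.2
    have h1 : ∀ᶠ t : ℝ in 𝓝 0, sol (c 0) (c 3) (c 4) (u + t) * sol (c 0) (c 7) (c 8) v +
        sol (c 0) (c 1) (c 2) (u + t) * sol (c 0) (c 5) (c 6) v = 0 := by
      filter_upwards [ht.eventually h] with t ht
      rw [← ht, dens]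
      simp only [u, v]
      ring_nf
    have h1' : (fun t => sol (c 0) (c 3) (c 4) (u + t) * sol (c 0) (c 7) (c 8) v +
        sol (c 0) (c 1) (c 2) (u + t) * sol (c 0) (c 5) (c 6) v) =ᶠ[𝓝 0] fun _ => (0 : ℝ) := h1
    have e0 := h1.self_of_nhds
    have hd := ((((hasDerivAt_sol (c 0) (c 3) (c 4) (u + 0)).comp_const_add u 0).mul_const
      (sol (c 0) (c 7) (c 8) v)).add
      (((hasDerivAt_sol (c 0) (c 1) (c 2) (u + 0)).comp_const_add u 0).mul_const
      (sol (c 0) (c 5) (c 6) v)))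
    have e1 := (hd.congr_of_eventuallyEq h1'.symm).unique (hasDerivAt_const _ _)
    have hX := velX_wronskian c (u + 0)
    have hY := velY_wronskian c v
    have hwX : wX c ≠ 0 := fun h => by simp [h] at hw
    have hwY : wY c ≠ 0 := fun h => by simp [h] at hw
    have hs : sol (c 0) (c 7) (c 8) v = 0 := (mul_eq_zero.1 (show wX c * _ = 0 by
      rw [← hX]
      linear_combination sol (c 0) (c 2) (c 0 * c 1) (u + 0) * e0 -
        sol (c 0) (c 1) (c 2) (u + 0) * e1)).resolve_left hwX
    have hr : sol (c 0) (c 5) (c 6) v = 0 := (mul_eq_zero.1 (show wX c * _ = 0 by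
      rw [← hX]
      linear_combination -sol (c 0) (c 4) (c 0 * c 3) (u + 0) * e0 +
        sol (c 0) (c 3) (c 4) (u + 0) * e1)).resolve_left hwX
    apply hwY
    rw [← hY, hs, hr]; ring
  · have := h.self_of_nhds
    simp only [dens, sol_eq_const h0 h2, sol_eq_const h0 h4, sol_eq_const h0 h6,
      sol_eq_const h0 h8] at this
    exact hne this

lemma exists_principal_cspin (b : Mink) {c : Fin 9 → ℝ} (hc : IsModel c) {z : ℝ × ℝ}
    (hz : dens c z ≠ 0) : ∃ v w : ℝ × ℝ, LinearIndependent ℝ ![v, w] ∧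
      IsPrincipal (fun z => b + cspin c z) z v ∧ IsPrincipal (fun z => b + cspin c z) z w := by
  have hch := nullChartAt_cspin b c z
  have hj : NullChartAt.jac nullU nullV z ≠ 0 := by rw [jac_null]; norm_num
  have key := hch.isPrincipal_iff rfl rfl (hasDerivAt_velX c _) (hasDerivAt_velY c _) hz hj
  simp only [velX_wronskian, velY_wronskian] at key
  -- The principal directions have null components (±l, 1) with l² = wY / wX. In a plane all
  -- directions are principal and l = 1 will do.
  have hl : ∃ l : ℝ, l ≠ 0 ∧ wX c * l ^ 2 = wY c := by
    rcases hc with ⟨hw, -⟩ | ⟨h0, h2, h4, h6, h8, hne⟩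
    · have hq : 0 < wY c / wX c := by rcases mul_pos_iff.1 hw with h | h
                                      · exact div_pos h.2 h.1
                                      · exact div_pos_of_neg_of_neg h.2 h.1
      refine ⟨√(wY c / wX c), (Real.sqrt_pos.2 hq).ne', ?_⟩
      rw [Real.sq_sqrt hq.le, mul_div_cancel₀]
      intro h; simp [h] at hw
    · exact ⟨1, one_ne_zero, by simp [wX, wY, h2, h4, h6, h8]⟩
  obtain ⟨l, hl0, hl⟩ := hl
  obtain ⟨v, v1, v2⟩ := NullChartAt.exists_eq hj l 1
  obtain ⟨w, w1, w2⟩ := NullChartAt.exists_eq hj (-l) 1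
  refine ⟨v, w, ?_, (key v).2 ⟨?_, ?_⟩, (key w).2 ⟨?_, ?_⟩⟩
  · rw [LinearIndependent.pair_iff]
    intro s t hst
    have e1 := congrArg (fderiv ℝ nullU z) hst
    have e2 := congrArg (fderiv ℝ nullV z) hst
    simp only [map_add, map_smul, v1, v2, w1, w2, map_zero, smul_eq_mul] at e1 e2
    have e3 : l * (s - t) = 0 := by linear_combination e1
    have e4 := (mul_eq_zero.1 e3).resolve_left hl0
    constructor <;> linarith
  · rintro rfl; simp at v2
  · rw [v1, v2, hl]; ring
  · rintro rfl; simp at w2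
  · rw [w1, w2, ← hl]; ring

lemma eq_add_of_deriv {f g : ℝ → ℝ} {μ a b : ℝ} (hf : ∀ t ∈ Ioo a b, DifferentiableAt ℝ f t)
    (hg : ∀ t ∈ Ioo a b, DifferentiableAt ℝ g t) (h : ∀ t ∈ Ioo a b, deriv f t = μ * deriv g t)
    {t₀ t : ℝ} (ht₀ : t₀ ∈ Ioo a b) (ht : t ∈ Ioo a b) : f t = f t₀ + μ * (g t - g t₀) := by
  have := isOpen_Ioo.is_const_of_deriv_eq_zero (f := fun t => f t - μ * g t) isPreconnected_Ioo
    (fun t ht => ((hf t ht).sub ((hg t ht).const_mul μ)).differentiableWithinAt)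
    (fun t ht => by
      have := ((hf t ht).hasDerivAt.sub ((hg t ht).hasDerivAt.const_mul μ)).deriv
      exact this.trans (by rw [h t ht, sub_self]; rfl)) ht ht₀
  linarith

/-- A curvature line has u' = μ v' with one constant μ, so it is a straight segment u = μ v + const,
however it is parametrized. Its velocity is v' times μ X + Y, which `exists_normal_of_wronskian`
places in a fixed plane. -/
lemma planar_cspin (b : Mink) {c : Fin 9 → ℝ} (hc : IsModel c) {x y : ℝ} {γ : ℝ → ℝ × ℝ}
    (hxy : x < y) (hγ : ContDiffOn ℝ 1 γ (Ioo x y)) (hd : ∀ t ∈ Ioo x y, dens c (γ t) ≠ 0)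
    (hP : ∀ t ∈ Ioo x y, IsPrincipal (fun z => b + cspin c z) (γ t) (deriv γ t)) :
    ∃ (m : Mink) (k : ℝ), m ≠ 0 ∧ ∀ t ∈ Ioo x y, ∑ i, m i * (b + cspin c (γ t)) i = k := by
  have hdiff : ∀ t ∈ Ioo x y, DifferentiableAt ℝ γ t := fun t ht =>
    (hγ.contDiffAt (isOpen_Ioo.mem_nhds ht)).differentiableAt one_ne_zero
  have hU : ∀ t ∈ Ioo x y, HasDerivAt (fun t => nullU (γ t)) (nullU (deriv γ t)) t := fun t ht =>
    nullU.hasFDerivAt.comp_hasDerivAt t (hdiff t ht).hasDerivAt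
  have hV : ∀ t ∈ Ioo x y, HasDerivAt (fun t => nullV (γ t)) (nullV (deriv γ t)) t := fun t ht =>
    nullV.hasFDerivAt.comp_hasDerivAt t (hdiff t ht).hasDerivAt
  obtain ⟨t₀, ht₀⟩ : (Ioo x y).Nonempty := nonempty_Ioo.2 hxy
  have hcX := hasDerivAt_curve (contDiff_velX c (n := 0)).continuous
  have hcY := hasDerivAt_curve (contDiff_velY c (n := 0)).continuous
  suffices H : ∃ m : Mink, m ≠ 0 ∧ ∀ t ∈ Ioo x y, m ⬝ᵥ (nullU (deriv γ t) • velX c (nullU (γ t)) +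
      nullV (deriv γ t) • velY c (nullV (γ t))) = 0 by
    obtain ⟨m, hm, hm'⟩ := H
    refine ⟨m, m ⬝ᵥ (b + cspin c (γ t₀)), hm, fun t ht => ?_⟩
    have hF : ∀ t ∈ Ioo x y, HasDerivAt (fun t => m ⬝ᵥ (b + cspin c (γ t))) 0 t := fun t ht => by
      have h1 := (hasFDerivAt_cspin b c (γ t)).comp_hasDerivAt t (hdiff t ht).hasDerivAt
      have h2 : HasDerivAt (fun t => m ⬝ᵥ (b + cspin c (γ t))) (m ⬝ᵥ _) t :=
        (LinearMap.toContinuousLinearMap (dotProductBilin ℝ ℝ m)).hasFDerivAt.comp_hasDerivAt t h1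
      exact h2.congr_deriv (hm' t ht)
    exact isOpen_Ioo.is_const_of_deriv_eq_zero isPreconnected_Ioo
      (fun t ht => (hF t ht).differentiableAt.differentiableWithinAt)
      (fun t ht => (hF t ht).deriv) ht ht₀
  rcases hc with ⟨hw, hκ⟩ | ⟨h0, h2, h4, h6, h8, hne⟩
  · have hwX : wX c ≠ 0 := fun h => by simp [h] at hw
    have hq : 0 < wY c / wX c := by rcases mul_pos_iff.1 hw with h | h
                                    · exact div_pos h.2 h.1
                                    · exact div_pos_of_neg_of_neg h.2 h.1
    have key : ∀ t ∈ Ioo x y, nullU (deriv γ t) ^ 2 = wY c / wX c * nullV (deriv γ t) ^ 2 ∧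
        nullV (deriv γ t) ≠ 0 := fun t ht => by
      have h1 := ((nullChartAt_cspin b c (γ t)).isPrincipal_iff rfl rfl (hasDerivAt_velX c _)
        (hasDerivAt_velY c _) (hd t ht) (by rw [jac_null]; norm_num) (deriv γ t)).1 (hP t ht)
      rw [velX_wronskian, velY_wronskian, ContinuousLinearMap.fderiv,
        ContinuousLinearMap.fderiv] at h1
      have h2 : nullU (deriv γ t) ^ 2 = wY c / wX c * nullV (deriv γ t) ^ 2 := by
        field_simp; linear_combination h1.2
      refine ⟨h2, fun h3 => h1.1 ?_⟩
      rw [h3] at h2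
      simp only [nullU_apply, nullV_apply] at h2 h3
      have h4 := pow_eq_zero_iff two_ne_zero |>.1 (h2.trans (by simp))
      ext <;> simp <;> linarith
    -- The principal condition fixes u' / v' up to sign. Since v' has no zero and the interval is
    -- connected, continuity of γ' fixes the sign once for the whole line.
    obtain ⟨μ, hμ, hμ'⟩ : ∃ μ : ℝ, μ ^ 2 = wY c / wX c ∧
        ∀ t ∈ Ioo x y, nullU (deriv γ t) = μ * nullV (deriv γ t) := by
      have hcont : ContinuousOn (deriv γ) (Ioo x y) := hγ.continuousOn_deriv_of_isOpen isOpen_Ioo le_rfl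
      rcases isPreconnected_Ioo.eq_or_eq_neg_of_sq_eq (f := fun t => nullU (deriv γ t))
        (g := fun t => √(wY c / wX c) * nullV (deriv γ t))
        (nullU.continuous.comp_continuousOn hcont)
        ((nullV.continuous.comp_continuousOn hcont).const_smul (√(wY c / wX c)))
        (fun t ht => by
          have := (key t ht).1
          simp only [Pi.pow_apply, mul_pow, Real.sq_sqrt hq.le, this])
        (fun {t} ht => mul_ne_zero (Real.sqrt_pos.2 hq).ne' (key t ht).2) with h | h
      · exact ⟨√(wY c / wX c), Real.sq_sqrt hq.le, fun t ht => h ht⟩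
      · exact ⟨-√(wY c / wX c), by rw [neg_sq, Real.sq_sqrt hq.le],
          fun t ht => (h ht).trans (neg_mul _ _).symm⟩
    have hμκ : c 0 = 0 ∨ μ ^ 2 = 1 := hκ.imp_right fun h => by rw [hμ, h, div_self (h ▸ hwX)]
    set u₀ := nullU (γ t₀)
    set v₀ := nullV (γ t₀)
    have hu : ∀ t ∈ Ioo x y, nullU (γ t) = μ * (nullV (γ t) - v₀) + u₀ := fun t ht => by
      rw [add_comm]
      exact eq_add_of_deriv (fun t ht => (hU t ht).differentiableAt)
        (fun t ht => (hV t ht).differentiableAt)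
        (fun t ht => by rw [(hU t ht).deriv, (hV t ht).deriv, hμ' t ht]) ht₀ ht
    -- The spinors are restarted at the base point of the line. The derivatives of the u-spinors
    -- carry the chain-rule factor μ, so the hypothesis becomes μ² wX = wY.
    obtain ⟨m, hm, hm'⟩ := exists_normal_of_wronskian (μ := μ)
      (p := sol (c 0) (c 1) (c 2) u₀) (p' := μ * sol (c 0) (c 2) (c 0 * c 1) u₀)
      (q := sol (c 0) (c 3) (c 4) u₀) (q' := μ * sol (c 0) (c 4) (c 0 * c 3) u₀)
      (r := sol (c 0) (c 5) (c 6) v₀) (r' := sol (c 0) (c 6) (c 0 * c 5) v₀)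
      (s := sol (c 0) (c 7) (c 8) v₀) (s' := sol (c 0) (c 8) (c 0 * c 7) v₀)
      (by
        rw [velY_wronskian]
        have := velX_wronskian c u₀
        have h2 : μ ^ 2 * wX c = wY c := by rw [hμ]; field_simp
        linear_combination μ ^ 2 * this + h2) (c 0)
    refine ⟨m, hm, fun t ht => ?_⟩
    have e : nullV (γ t) = (nullV (γ t) - v₀) + v₀ := by ring
    have := hm' (nullV (γ t) - v₀)
    rw [← sol_mul hμκ, ← sol_mul hμκ, ← sol_add, ← sol_add, ← sol_add, ← sol_add, ← hu t ht,
      ← e] at this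
    rw [hμ' t ht, mul_comm, mul_smul, ← smul_add, dotProduct_smul]
    exact (congrArg _ this).trans (smul_zero _)
  -- For a plane the velocities are constant. A vector annihilating X + Y and X annihilates both,
  -- hence every tangent vector.
  · obtain ⟨m, hm, e0, -, e1⟩ := exists_normal_of_det ((det_pencil_null (c 1) 0 (c 3) 0 (c 5) 0
      (c 7) 0).trans (by ring))
    refine ⟨m, hm, fun t ht => ?_⟩
    simp only [velX, velY, sol_eq_const h0 h2, sol_eq_const h0 h4, sol_eq_const h0 h6,
      sol_eq_const h0 h8, dotProduct_add, dotProduct_smul] at e0 ⊢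
    rw [e1, zero_add] at e0
    rw [e1, e0]; simp

lemma nullX_eq_zero_iff {p q : ℝ} : nullX p q = 0 ↔ p = 0 ∧ q = 0 := by
  constructor
  · intro h
    have h1 := congrFun h 1
    have h2 := congrFun h 2
    simp [nullX] at h1 h2
    constructor <;> nlinarith
  · rintro ⟨rfl, rfl⟩
    ext i; fin_cases i <;> simp [nullX]

lemma nullY_eq_zero_iff {r s : ℝ} : nullY r s = 0 ↔ r = 0 ∧ s = 0 := by
  constructor
  · intro h
    have h1 := congrFun h 1
    have h2 := congrFun h 2
    simp [nullY] at h1 h2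
    constructor <;> nlinarith
  · rintro ⟨rfl, rfl⟩
    ext i; fin_cases i <;> simp [nullY]

lemma velX_ne_zero {c : Fin 9 → ℝ} (hc : IsModel c) (u : ℝ) : velX c u ≠ 0 := by
  rw [velX, Ne, nullX_eq_zero_iff]
  rintro ⟨h1, h2⟩
  have h := velX_wronskian c u
  rcases hc with ⟨hw, -⟩ | ⟨h0, e2, e4, -, -, hne⟩
  · rw [h1, h2] at h
    simp [← h] at hw
  · rw [sol_eq_const h0 e2] at h1
    rw [sol_eq_const h0 e4] at h2
    simp [h1, h2] at hne

lemma velY_ne_zero {c : Fin 9 → ℝ} (hc : IsModel c) (u : ℝ) : velY c u ≠ 0 := by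
  rw [velY, Ne, nullY_eq_zero_iff]
  rintro ⟨h1, h2⟩
  have h := velY_wronskian c u
  rcases hc with ⟨hw, -⟩ | ⟨h0, -, -, e6, e8, hne⟩
  · rw [h1, h2] at h
    simp [← h] at hw
  · rw [sol_eq_const h0 e6] at h1
    rw [sol_eq_const h0 e8] at h2
    simp [h1, h2] at hne

theorem isGeneralizedPCL_cspin (b : Mink) {c : Fin 9 → ℝ} (hc : IsModel c) :
    IsGeneralizedPCL (fun z => b + cspin c z) univ := by
  have hj : ∀ z, NullChartAt.jac nullU nullV z ≠ 0 := fun z => by rw [jac_null]; norm_num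
  have hset : (univ ∩ {p | TimelikeAt (fun z => b + cspin c z) p}) = {z | dens c z ≠ 0} := by
    ext z; simp [timelikeAt_cspin]
  have hdens : Continuous (dens c) := by
    unfold dens
    exact (((continuous_sol_const _ _ _).comp (by fun_prop)).mul
      ((continuous_sol_const _ _ _).comp (by fun_prop))).add
      (((continuous_sol_const _ _ _).comp (by fun_prop)).mul
      ((continuous_sol_const _ _ _).comp (by fun_prop)))
  refine ⟨⟨isOpen_univ, (contDiff_cspin b c).contDiffOn, fun z _ => ?_, fun z _ => ⟨?_, ?_⟩,
    fun z _ => ⟨?_, ?_⟩, ?_⟩, ⟨?_, ?_, ?_, ?_⟩, ?_, ?_⟩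
  · simp only [(nullChartAt_cspin b c z).d2_eq (hasDerivAt_velX c _) (hasDerivAt_velY c _),
      ContinuousLinearMap.fderiv]
    simp
  · simp only [(nullChartAt_cspin b c z).firstForm_eq rfl rfl]; simp; ring
  · simp only [(nullChartAt_cspin b c z).firstForm_eq rfl rfl]; simp
  · rw [(nullChartAt_cspin b c z).d1_eq]
    simpa using velX_ne_zero hc _
  · rw [(nullChartAt_cspin b c z).d1_eq]
    simpa using velY_ne_zero hc _
  · rw [hset]
    intro z _
    rw [mem_closure_iff_frequently]
    exact fun h => not_eventually_dens_eq_zero hc z (h.mono fun w hw => not_not.1 hw)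
  · rw [hset]; exact isOpen_ne_fun hdens continuous_const
  · exact (contDiff_cspin b c).contDiffOn
  · exact fun p hp => hp.2
  · exact fun z hz n hn => (nullChartAt_cspin b c z).meanCurvature_eq_zero rfl rfl
      (hasDerivAt_velX c _) (hasDerivAt_velY c _) (hj z) hn
  · rw [hset]; exact fun z hz => exists_principal_cspin b hc hz
  · rw [hset]; exact fun x y γ hxy hγ hm hP => planar_cspin b hc hxy hγ (fun t ht => hm ht) hP

end PlanarCurvature
end

noncomputable section

namespace PlanarCurvature

open Branch

/-! ### The members have planar curvature lines -/

lemma ampP_pos (t : ℝ) : 0 < ampP t := by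
  have h := Real.sin_le_one (t + Real.pi / 4)
  rw [sin_add_quarter] at h
  have := q2_pos 1
  have h2 : 0 ≤ (1 - (Real.cos t + Real.sin t) / √2) * |Real.cos t - Real.sin t| :=
    mul_nonneg (by linarith) (abs_nonneg _)
  have h3 : 0 < 1 / √2 := by positivity
  exact Real.sqrt_pos.2 (mul_pos (by positivity) (by linarith))

lemma wX_rotc (c : Fin 9 → ℝ) : wX (rotc c) = wX c := by
  have h2 : √2 * √2 = 2 := Real.mul_self_sqrt (by norm_num)
  simp only [wX, rotc, Matrix.cons_val]
  field_simp
  rw [pow_two, h2]; ring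

lemma wY_rotc (c : Fin 9 → ℝ) : wY (rotc c) = wY c := by
  have h2 : √2 * √2 = 2 := Real.mul_self_sqrt (by norm_num)
  simp only [wY, rotc, Matrix.cons_val]
  field_simp
  rw [pow_two, h2]; ring

/-- Only the family A has unequal Wronskians, and there κ = 0. P is left out because its Wronskians
vanish at the planar ends. -/
lemma wronskian_coef0 {b : Branch} {t : ℝ} (hb : b ≠ P) (ht : t ∈ params b) :
    0 < wX (coef0 b t) * wY (coef0 b t) ∧ (coef0 b t 0 = 0 ∨ wX (coef0 b t) = wY (coef0 b t)) := by
  have hh : √(1 / 2 : ℝ) * √(1 / 2) = 1 / 2 := Real.mul_self_sqrt (by norm_num)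
  have main : ∀ {w w' k x : ℝ}, w = x → w' = x → x ≠ 0 → 0 < w * w' ∧ (k = 0 ∨ w = w') := by
    rintro w w' k x rfl rfl hx
    exact ⟨mul_self_pos.2 hx, Or.inr rfl⟩
  cases b with
  | BL2 =>
    have h5 := q2_pos 5
    have h1 := q2_pos 1
    have hs : √(1 / q2 5) * √(1 / q2 5) = 1 / q2 5 := Real.mul_self_sqrt (by positivity)
    refine main (x := q2 1 * (1 / q2 5)) ?_ ?_ (by positivity)
    · simp only [wX, coef0, Matrix.cons_val]; linear_combination q2 1 * hs
    · simp only [wY, coef0, Matrix.cons_val]; linear_combination q2 1 * hs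
  | P => exact absurd rfl hb
  | S2 =>
    have hp := (params_S2 ht).2.2.1
    have h2 : (√(2 * (a1 t + a0 t)))⁻¹ * (√(2 * (a1 t + a0 t)))⁻¹ = 1 / (2 * (a1 t + a0 t)) := by
      rw [← mul_inv, Real.mul_self_sqrt (by positivity), one_div]
    have h3 : 1 / (2 * (a1 t + a0 t)) * (a1 t + a0 t) = 1 / 2 := by field_simp
    refine main (x := 1 / 2) ?_ ?_ (by norm_num)
    · simp only [wX, coef0, Pi.smul_apply, smul_eq_mul, Matrix.cons_val]
      linear_combination (a1 t + a0 t) * h2 + h3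
    · simp only [wY, coef0, Pi.smul_apply, smul_eq_mul, Matrix.cons_val]
      linear_combination (a1 t + a0 t) * h2 + h3
  | CL =>
    refine main (x := 1 / 2) ?_ ?_ (by norm_num) <;>
    · simp only [wX, wY, coef0, Matrix.cons_val]; ring
  | A =>
    refine ⟨?_, Or.inl rfl⟩
    simp only [wX, wY, coef0, Matrix.cons_val]
    have := Real.exp_pos t
    have := Real.exp_pos (-t)
    ring_nf
    positivity
  | S4 =>
    refine main (x := 1 / 2) ?_ ?_ (by norm_num)
    · simp only [wX, coef0, Matrix.cons_val]; linear_combination hh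
    · simp only [wY, coef0, Matrix.cons_val]; linear_combination hh
  | M =>
    refine main (x := 1 / 2) ?_ ?_ (by norm_num)
    · simp only [wX, coef0, Matrix.cons_val]; linear_combination hh
    · simp only [wY, coef0, Matrix.cons_val]; linear_combination hh

lemma IsModel.rotc {c : Fin 9 → ℝ} (h : 0 < wX c * wY c ∧ (c 0 = 0 ∨ wX c = wY c)) :
    IsModel (rotc c) :=
  Or.inl (by rw [wX_rotc, wY_rotc]; exact h)

lemma IsModel.shiftc {c : Fin 9 → ℝ} (h : 0 < wX c * wY c ∧ (c 0 = 0 ∨ wX c = wY c)) (a b : ℝ) :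
    IsModel (shiftc c a b) :=
  Or.inl (by rw [wX_shiftc, wY_shiftc]; exact h)

lemma isModel_coef0_P (t : ℝ) : IsModel (coef0 P t) := by
  have hN := ampP_pos t
  have hq := q2_pos 3
  by_cases h : Real.cos t + Real.sin t = 0
  · refine Or.inr ?_
    simp only [coef0, Matrix.cons_val, cos_two_mul_eq, h]
    simp [hN.ne']
  · have hX : wX (coef0 P t) = ampP t * (ampP t * ((Real.cos t + Real.sin t) / q2 3)) := by
      simp [wX, coef0]
    have hY : wY (coef0 P t) = ampP t * (ampP t * ((Real.cos t + Real.sin t) / q2 3)) := by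
      simp [wY, coef0]
    refine Or.inl ?_
    rw [hX, hY]
    exact ⟨mul_self_pos.2 (mul_ne_zero hN.ne' (mul_ne_zero hN.ne' (div_ne_zero h hq.ne'))),
      Or.inr rfl⟩

lemma isModel_coef {b : Branch} {t : ℝ} (ht : t ∈ params b) : IsModel (coef b t) := by
  cases b with
  | BL2 => exact .rotc (wronskian_coef0 (by simp) ht)
  | P => exact isModel_coef0_P t
  | _ => exact .shiftc (wronskian_coef0 (by simp) ht) _ _

theorem isGeneralizedPCL_of_mem_members {G : ℝ × ℝ → Mink} (hG : G ∈ members) :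
    IsGeneralizedPCL G univ := by
  obtain ⟨b, t, ht, rfl⟩ := hG
  rw [surface_eq ht]
  exact isGeneralizedPCL_cspin _ (isModel_coef ht)

end PlanarCurvature
end

/-! ### The converse: local structure of an arbitrary surface -/

noncomputable section

namespace PlanarCurvature

/-! ### Local inverses and null coordinates -/

theorem exists_localInverse {E : Type*} [NormedAddCommGroup E] [NormedSpace ℝ E]
    [FiniteDimensional ℝ E] {f : E → E} {a : E} {n : WithTop ℕ∞} (hn : n ≠ 0)
    (hf : ContDiffAt ℝ n f a) (hinj : ∀ v, fderiv ℝ f a v = 0 → v = 0) :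
    ∃ g : E → E, ContDiffAt ℝ n g (f a) ∧ g (f a) = a ∧ (∀ᶠ w in 𝓝 (f a), f (g w) = w) ∧
      ∀ᶠ z in 𝓝 a, g (f z) = z := by
  have := FiniteDimensional.complete ℝ E
  let e : E ≃L[ℝ] E := (LinearEquiv.ofInjectiveEndo (fderiv ℝ f a : E →ₗ[ℝ] E)
    ((injective_iff_map_eq_zero _).2 hinj)).toContinuousLinearEquiv
  have he : HasFDerivAt f (e : E →L[ℝ] E) a := by
    have : (e : E →L[ℝ] E) = fderiv ℝ f a := by ext v; rfl
    rw [this]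
    exact (hf.differentiableAt hn).hasFDerivAt
  exact ⟨hf.localInverse he hn, hf.to_localInverse he hn, hf.localInverse_apply_image he hn,
    (hf.hasStrictFDerivAt' he hn).eventually_right_inverse,
    (hf.hasStrictFDerivAt' he hn).eventually_left_inverse⟩

theorem exists_localInverse_pair {φ ψ : ℝ × ℝ → ℝ} {a : ℝ × ℝ} {n : WithTop ℕ∞} (hn : n ≠ 0)
    (hφ : ContDiffAt ℝ n φ a) (hψ : ContDiffAt ℝ n ψ a) (hj : NullChartAt.jac φ ψ a ≠ 0) :
    ∃ Ψ : ℝ × ℝ → ℝ × ℝ, ContDiffAt ℝ n Ψ (φ a, ψ a) ∧ Ψ (φ a, ψ a) = a ∧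
      (∀ᶠ w in 𝓝 (φ a, ψ a), φ (Ψ w) = w.1 ∧ ψ (Ψ w) = w.2) ∧
      ∀ᶠ z in 𝓝 a, Ψ (φ z, ψ z) = z := by
  obtain ⟨Ψ, h1, h2, h3, h4⟩ := exists_localInverse hn (hφ.prodMk hψ) (fun v hv => by
    have h := ((hφ.differentiableAt hn).hasFDerivAt.prodMk (hψ.differentiableAt hn).hasFDerivAt).fderiv
    rw [h] at hv
    exact NullChartAt.eq_zero hj (congrArg Prod.fst hv) (congrArg Prod.snd hv))
  exact ⟨Ψ, h1, h2, h3.mono fun w hw => ⟨congrArg Prod.fst hw, congrArg Prod.snd hw⟩, h4⟩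

/-- A submersion maps the neighbourhood filter onto the neighbourhood filter. This passes between
local statements on the surface and on a null coordinate axis. -/
lemma eventually_comp_iff {φ : ℝ × ℝ → ℝ} {a : ℝ × ℝ} {n : WithTop ℕ∞} (hn : n ≠ 0)
    (hφ : ContDiffAt ℝ n φ a) (h : fderiv ℝ φ a ≠ 0) {P : ℝ → Prop} :
    (∀ᶠ z in 𝓝 a, P (φ z)) ↔ ∀ᶠ u in 𝓝 (φ a), P u := by
  have hs := hφ.hasStrictFDerivAt hn
  rw [← hs.map_nhds_eq_of_surj, eventually_map]
  rw [LinearMap.range_eq_top]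
  refine LinearMap.surjective (f := (fderiv ℝ φ a : ℝ × ℝ →ₗ[ℝ] ℝ)) fun h0 => h ?_
  ext1 <;> ext <;> simpa using LinearMap.congr_fun h0 _

lemma exists_square {P : ℝ × ℝ → Prop} {w : ℝ × ℝ} (h : ∀ᶠ z in 𝓝 w, P z) : ∃ ε > 0,
    ∀ u ∈ Ioo (w.1 - ε) (w.1 + ε), ∀ v ∈ Ioo (w.2 - ε) (w.2 + ε), P (u, v) := by
  obtain ⟨ε, hε, H⟩ := Metric.eventually_nhds_iff_ball.1 h
  refine ⟨ε, hε, fun u hu v hv => H _ ?_⟩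
  rw [← ball_prod_same, Real.ball_eq_Ioo, Real.ball_eq_Ioo]
  exact ⟨hu, hv⟩

/-- In the coordinates (φ, ψ) the hypothesis says that the ψ-derivative of `A` vanishes, so on a
small square `A` depends on φ alone. -/
theorem exists_factor {E : Type} [NormedAddCommGroup E] [NormedSpace ℝ E] {φ ψ : ℝ × ℝ → ℝ}
    {a : ℝ × ℝ} {n : ℕ} (hn : n ≠ 0) (hφ : ContDiffAt ℝ n φ a) (hψ : ContDiffAt ℝ n ψ a)
    (hj : NullChartAt.jac φ ψ a ≠ 0) {A : ℝ × ℝ → E} (hA : ContDiffAt ℝ n A a)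
    (h : ∀ᶠ z in 𝓝 a, ∀ v, fderiv ℝ φ z v = 0 → fderiv ℝ A z v = 0) :
    ∃ B : ℝ → E, ContDiffAt ℝ n B (φ a) ∧ ∀ᶠ z in 𝓝 a, A z = B (φ z) := by
  have hn' : (n : WithTop ℕ∞) ≠ 0 := by exact_mod_cast hn
  have hn1 : (1 : WithTop ℕ∞) ≤ n := by exact_mod_cast Nat.one_le_iff_ne_zero.2 hn
  obtain ⟨Ψ, h1, h2, h3, h4⟩ := exists_localInverse_pair hn' hφ hψ hj
  have hΨ : Tendsto Ψ (𝓝 (φ a, ψ a)) (𝓝 a) := by simpa [h2] using h1.continuousAt.tendsto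
  have hd : ∀ {G : Type} [NormedAddCommGroup G] [NormedSpace ℝ G] {f : ℝ × ℝ → G},
      ContDiffAt ℝ n f a → ∀ᶠ z in 𝓝 a, DifferentiableAt ℝ f z := fun hf =>
    ((hf.of_le hn1).eventually (by simp)).mono fun z hz => hz.differentiableAt one_ne_zero
  have key : ∀ᶠ w in 𝓝 (φ a, ψ a), HasDerivAt (fun t => A (Ψ (w.1, t))) 0 w.2 := by
    filter_upwards [hΨ.eventually (hd hA), hΨ.eventually (hd hφ), hΨ.eventually h,
      ((h1.of_le hn1).eventually (by simp)), h3.eventually_nhds] with w e1 e2 e3 e4 e5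
    have hw : HasDerivAt (fun t => (w.1, t)) ((0 : ℝ), (1 : ℝ)) w.2 :=
      (hasDerivAt_const _ _).prodMk (hasDerivAt_id _)
    have hΨw := (e4.differentiableAt one_ne_zero).hasFDerivAt
    have hc := hΨw.comp_hasDerivAt_of_eq w.2 hw rfl
    have hcφ := e2.hasFDerivAt.comp w hΨw
    have hfst : HasFDerivAt (φ ∘ Ψ) (ContinuousLinearMap.fst ℝ ℝ ℝ) w :=
      hasFDerivAt_fst.congr_of_eventuallyEq (e5.mono fun y hy => hy.1)
    have h0 : fderiv ℝ φ (Ψ w) (fderiv ℝ Ψ w (0, 1)) = 0 := by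
      have := DFunLike.congr_fun (hcφ.unique hfst) ((0 : ℝ), (1 : ℝ))
      simpa using this
    have := e1.hasFDerivAt.comp_hasDerivAt_of_eq w.2 hc rfl
    rw [e3 _ h0] at this
    exact this
  obtain ⟨ε, hε, hsq⟩ := exists_square key
  refine ⟨fun u => A (Ψ (u, ψ a)), ?_, ?_⟩
  · have hA' : ContDiffAt ℝ n A (Ψ (φ a, ψ a)) := by rwa [h2]
    exact hA'.comp (φ a) (h1.comp (φ a) (contDiffAt_id.prodMk contDiffAt_const))
  · have hI : ∀ {f : ℝ × ℝ → ℝ}, ContDiffAt ℝ n f a → ∀ᶠ z in 𝓝 a, f z ∈ Ioo (f a - ε) (f a + ε) :=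
      fun hf => hf.continuousAt.eventually (Ioo_mem_nhds (by linarith) (by linarith))
    filter_upwards [h4, hI hφ, hI hψ] with z e1 e2 e3
    have := isOpen_Ioo.is_const_of_deriv_eq_zero (f := fun t => A (Ψ (φ z, t))) isPreconnected_Ioo
      (fun t ht => (hsq _ e2 t ht).differentiableAt.differentiableWithinAt)
      (fun t ht => (hsq _ e2 t ht).deriv) e3 (show ψ a ∈ _ from ⟨by linarith, by linarith⟩)
    simpa [e1] using this

/-! ### Splitting into two closed null forms -/

/-- The differential of `F` is the sum of two closed forms with values in the light cone. -/
structure IsNullSplit (F : ℝ × ℝ → Mink) (α β : ℝ × ℝ → ℝ × ℝ →L[ℝ] Mink) (U : Set (ℝ × ℝ)) :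
    Prop where
  isOpen : IsOpen U
  left : ContDiffOn ℝ 3 α U
  right : ContDiffOn ℝ 3 β U
  hasFDerivAt : ∀ z ∈ U, HasFDerivAt F (α z + β z) z
  closed_left : ∀ z ∈ U, ∀ v w, fderiv ℝ α z v w = fderiv ℝ α z w v
  closed_right : ∀ z ∈ U, ∀ v w, fderiv ℝ β z v w = fderiv ℝ β z w v
  null_left : ∀ z ∈ U, ∀ v, mink (α z v) (α z v) = 0
  null_right : ∀ z ∈ U, ∀ v, mink (β z v) (β z v) = 0
  injective : ∀ z ∈ U, ∀ v, α z v = 0 → β z v = 0 → v = 0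

lemma exists_primitive {α : ℝ × ℝ → ℝ × ℝ →L[ℝ] Mink} {U : Set (ℝ × ℝ)} (hU : IsOpen U)
    (h : ContDiffOn ℝ 3 α U) (hc : ∀ z ∈ U, ∀ v w, fderiv ℝ α z v w = fderiv ℝ α z w v)
    {a : ℝ × ℝ} (ha : a ∈ U) : ∃ A : ℝ × ℝ → Mink, ContDiffAt ℝ 4 A a ∧
      ∀ᶠ z in 𝓝 a, HasFDerivAt A (α z) z := by
  obtain ⟨ε, hε, hB⟩ := Metric.isOpen_iff.1 hU a ha
  obtain ⟨A, hA⟩ := (convex_ball a ε).exists_forall_hasFDerivAt_of_fderiv_symmetric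
    Metric.isOpen_ball ((h.mono hB).differentiableOn (by norm_num)) (fun z hz => hc z (hB hz))
  have hA' : ∀ᶠ z in 𝓝 a, HasFDerivAt A (α z) z := by
    filter_upwards [Metric.ball_mem_nhds a hε] with z hz using hA z hz
  refine ⟨A, ?_, hA'⟩
  rw [show (4 : WithTop ℕ∞) = (3 : ℕ) + 1 by norm_num, contDiffAt_succ_iff_hasFDerivAt]
  exact ⟨α, ⟨_, Metric.ball_mem_nhds a hε, hA⟩, h.contDiffAt (hU.mem_nhds ha)⟩

lemma eq_zero_of_mink_eq_zero {x : Mink} (h : mink x x = 0) (h2 : x 2 = 0) : x = 0 := by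
  simp only [mink, h2] at h
  have h0 : x 0 ^ 2 = 0 := by nlinarith [sq_nonneg (x 0), sq_nonneg (x 1)]
  have h1 : x 1 ^ 2 = 0 := by nlinarith [sq_nonneg (x 0), sq_nonneg (x 1)]
  ext i
  fin_cases i
  · exact pow_eq_zero_iff two_ne_zero |>.1 h0
  · exact pow_eq_zero_iff two_ne_zero |>.1 h1
  · exact h2

end PlanarCurvature
end

/-! ### Null coordinates and spinors from the two null forms -/

noncomputable section

namespace PlanarCurvature

lemma jac_ne_zero {φ ψ : ℝ × ℝ → ℝ} {a : ℝ × ℝ}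
    (h : ∀ v, fderiv ℝ φ a v = 0 → fderiv ℝ ψ a v = 0 → v = 0) : NullChartAt.jac φ ψ a ≠ 0 := by
  intro hj
  rw [NullChartAt.jac] at hj
  have h1 := h (-fderiv ℝ φ a (0, 1), fderiv ℝ φ a (1, 0))
    (by rw [NullChartAt.apply_eq]; ring)
    (by rw [NullChartAt.apply_eq]; linear_combination hj)
  have h2 := h (-fderiv ℝ ψ a (0, 1), fderiv ℝ ψ a (1, 0))
    (by rw [NullChartAt.apply_eq]; linear_combination -hj)
    (by rw [NullChartAt.apply_eq]; ring)
  simp only [Prod.mk_eq_zero] at h1 h2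
  have := h (1, 0) h1.2 h2.2
  simp at this

lemma fderiv_ne_zero_of_jac {φ ψ : ℝ × ℝ → ℝ} {a : ℝ × ℝ} (h : NullChartAt.jac φ ψ a ≠ 0) :
    fderiv ℝ φ a ≠ 0 := fun h0 => h (by simp [NullChartAt.jac, h0])

lemma jac_swap (φ ψ : ℝ × ℝ → ℝ) (a : ℝ × ℝ) :
    NullChartAt.jac ψ φ a = -NullChartAt.jac φ ψ a := by
  simp only [NullChartAt.jac]; ring

lemma eventually_differentiableAt {E G : Type} [NormedAddCommGroup E] [NormedSpace ℝ E]
    [NormedAddCommGroup G] [NormedSpace ℝ G] {f : E → G} {a : E} {n : ℕ} (hn : n ≠ 0)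
    (hf : ContDiffAt ℝ n f a) : ∀ᶠ z in 𝓝 a, DifferentiableAt ℝ f z := by
  have hn1 : (1 : WithTop ℕ∞) ≤ n := by exact_mod_cast Nat.one_le_iff_ne_zero.2 hn
  exact ((hf.of_le hn1).eventually (by simp)).mono fun z hz => hz.differentiableAt one_ne_zero

lemma _root_.ContDiffAt.deriv {E : Type*} [NormedAddCommGroup E] [NormedSpace ℝ E] {f : ℝ → E}
    {u : ℝ} {m n : WithTop ℕ∞} (hf : ContDiffAt ℝ n f u) (h : m + 1 ≤ n) :
    ContDiffAt ℝ m (deriv f) u := by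
  have := (hf.fderiv_right h).clm_apply (contDiffAt_const (c := (1 : ℝ)))
  simpa using this

/-- A light-like vector without time component is zero, so α dies wherever dφ does. The primitive
`A` is therefore a curve in φ, and its velocity has constant time component τ. -/
lemma exists_velocity {α : ℝ × ℝ → ℝ × ℝ →L[ℝ] Mink} {A : ℝ × ℝ → Mink} {φ ψ : ℝ × ℝ → ℝ}
    {a : ℝ × ℝ} {τ : ℝ} (hφ : ContDiffAt ℝ 4 φ a) (hψ : ContDiffAt ℝ 4 ψ a)
    (hj : NullChartAt.jac φ ψ a ≠ 0) (hA : ContDiffAt ℝ 4 A a)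
    (hd : ∀ᶠ z in 𝓝 a, HasFDerivAt A (α z) z) (hn : ∀ᶠ z in 𝓝 a, ∀ v, mink (α z v) (α z v) = 0)
    (h2 : ∀ᶠ z in 𝓝 a, ∀ v, α z v 2 = τ * fderiv ℝ φ z v) :
    ∃ X : ℝ → Mink, ContDiffAt ℝ 3 X (φ a) ∧
      (∀ᶠ z in 𝓝 a, α z = (fderiv ℝ φ z).smulRight (X (φ z))) ∧
      ∀ᶠ u in 𝓝 (φ a), mink (X u) (X u) = 0 ∧ X u 2 = τ := by
  obtain ⟨B, hB, hAB⟩ := exists_factor (n := 4) (by norm_num) hφ hψ hj hA (by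
    filter_upwards [hd, hn, h2] with z e1 e2 e3 v hv
    rw [e1.fderiv]
    exact eq_zero_of_mink_eq_zero (e2 v) (by rw [e3, hv, mul_zero]))
  have h0 := fderiv_ne_zero_of_jac hj
  have hBd := (eventually_comp_iff (by norm_num) hφ h0).2
    (eventually_differentiableAt (n := 4) (by norm_num) hB)
  have hα : ∀ᶠ z in 𝓝 a, α z = (fderiv ℝ φ z).smulRight (deriv B (φ z)) := by
    filter_upwards [hd, hAB.eventually_nhds, hBd,
      eventually_differentiableAt (n := 4) (by norm_num) hφ] with z e1 e2 e3 e4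
    have := (e3.hasDerivAt.hasFDerivAt.comp z e4.hasFDerivAt).congr_of_eventuallyEq e2
    rw [e1.unique this]
    refine ContinuousLinearMap.ext fun v => ?_
    simp
  have hφ' : ∀ᶠ z in 𝓝 a, fderiv ℝ φ z ≠ 0 :=
    (hφ.continuousAt_fderiv (by norm_num)).eventually_ne h0
  refine ⟨deriv B, hB.deriv (m := 3) (by norm_num), hα, ?_⟩
  rw [← eventually_comp_iff (by norm_num) hφ h0]
  filter_upwards [hα, hn, h2, hφ'] with z e1 e2 e3 e4
  obtain ⟨v, hv⟩ : ∃ v, fderiv ℝ φ z v ≠ 0 := by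
    by_contra! H
    exact e4 (ContinuousLinearMap.ext H)
  have e2 := e2 v
  have e3 := e3 v
  rw [e1] at e2 e3
  simp only [ContinuousLinearMap.smulRight_apply, Pi.smul_apply, smul_eq_mul, mink] at e2 e3
  refine ⟨mul_left_cancel₀ (pow_ne_zero 2 hv) ?_, mul_left_cancel₀ hv (by rw [e3]; ring)⟩
  rw [mink]; linear_combination e2

/-- The time components of primitives of α and β serve as null coordinates. They are independent
because light-like vectors with zero time component vanish and α, β have no common kernel. The sign
in φ makes X past directed and Y future directed, as for `nullX` and `nullY`. -/
theorem IsNullSplit.exists_nullCoordinates {F : ℝ × ℝ → Mink} {α β : ℝ × ℝ → ℝ × ℝ →L[ℝ] Mink}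
    {U : Set (ℝ × ℝ)} (h : IsNullSplit F α β U) {a : ℝ × ℝ} (ha : a ∈ U) :
    ∃ (φ ψ : ℝ × ℝ → ℝ) (X Y : ℝ → Mink), ContDiffAt ℝ 4 φ a ∧ ContDiffAt ℝ 4 ψ a ∧
      NullChartAt.jac φ ψ a ≠ 0 ∧ ContDiffAt ℝ 3 X (φ a) ∧ ContDiffAt ℝ 3 Y (ψ a) ∧
      (∀ᶠ z in 𝓝 a, α z = (fderiv ℝ φ z).smulRight (X (φ z))) ∧
      (∀ᶠ z in 𝓝 a, β z = (fderiv ℝ ψ z).smulRight (Y (ψ z))) ∧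
      (∀ᶠ u in 𝓝 (φ a), mink (X u) (X u) = 0 ∧ X u 2 = -1) ∧
      ∀ᶠ v in 𝓝 (ψ a), mink (Y v) (Y v) = 0 ∧ Y v 2 = 1 := by
  obtain ⟨A, hA, hA'⟩ := exists_primitive h.isOpen h.left h.closed_left ha
  obtain ⟨B, hB, hB'⟩ := exists_primitive h.isOpen h.right h.closed_right ha
  have hφ : ContDiffAt ℝ 4 (fun z => -A z 2) a := (contDiffAt_pi.1 hA 2).neg
  have hψ : ContDiffAt ℝ 4 (fun z => B z 2) a := contDiffAt_pi.1 hB 2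
  have hU : ∀ᶠ z in 𝓝 a, z ∈ U := h.isOpen.mem_nhds ha
  have hdφ : ∀ {z}, HasFDerivAt A (α z) z → ∀ v, fderiv ℝ (fun z => -A z 2) z v = -α z v 2 :=
    fun {z} hz v => by
      rw [show (fun z => -A z 2) = -fun z => A z 2 from rfl, (hasFDerivAt_pi'.1 hz 2).neg.fderiv]; rfl
  have hdψ : ∀ {z}, HasFDerivAt B (β z) z → ∀ v, fderiv ℝ (fun z => B z 2) z v = β z v 2 :=
    fun {z} hz v => by rw [(hasFDerivAt_pi'.1 hz 2).fderiv]; rfl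
  have hj : NullChartAt.jac (fun z => -A z 2) (fun z => B z 2) a ≠ 0 := jac_ne_zero fun v h1 h2 => by
    rw [hdφ hA'.self_of_nhds, neg_eq_zero] at h1
    rw [hdψ hB'.self_of_nhds] at h2
    exact h.injective a ha v (eq_zero_of_mink_eq_zero (h.null_left a ha v) h1)
      (eq_zero_of_mink_eq_zero (h.null_right a ha v) h2)
  obtain ⟨X, hX, hX1, hX2⟩ := exists_velocity (τ := -1) hφ hψ hj hA hA'
    (hU.mono fun z hz => h.null_left z hz) (hA'.mono fun z hz v => by rw [hdφ hz]; ring)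
  obtain ⟨Y, hY, hY1, hY2⟩ := exists_velocity (τ := 1) hψ hφ (by rwa [jac_swap, neg_ne_zero]) hB hB'
    (hU.mono fun z hz => h.null_right z hz) (hB'.mono fun z hz v => by rw [hdψ hz]; ring)
  exact ⟨_, _, X, Y, hφ, hψ, hj, hX, hY, hX1, hY1, hX2, hY2⟩

/-- The spatial part lies on the unit circle, and a spinor is given by the half-angle formulas q² =
1 + X₁, p² = 1 - X₁. The root is taken of whichever of the two is nonzero at `u`, and the other
spinor is obtained from p q = X₀. -/
lemma exists_spinors {X : ℝ → Mink} {u : ℝ} (hX : ContDiffAt ℝ 3 X u)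
    (h : ∀ᶠ t in 𝓝 u, mink (X t) (X t) = 0 ∧ X t 2 = -1) :
    ∃ p q : ℝ → ℝ, ContDiffAt ℝ 3 p u ∧ ContDiffAt ℝ 3 q u ∧ ∀ᶠ t in 𝓝 u, X t = nullX (p t) (q t) := by
  have h0 : ContDiffAt ℝ 3 (fun t => X t 0) u := contDiffAt_pi.1 hX 0
  have h1 : ContDiffAt ℝ 3 (fun t => X t 1) u := contDiffAt_pi.1 hX 1
  rcases lt_or_ge 0 (1 + X u 1) with hp | hp
  · have hev : ∀ᶠ t in 𝓝 u, 0 < 1 + X t 1 :=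
      (continuousAt_const.add h1.continuousAt).eventually (lt_mem_nhds hp)
    have hq : ContDiffAt ℝ 3 (fun t => √(1 + X t 1)) u := (contDiffAt_const.add h1).sqrt hp.ne'
    refine ⟨fun t => X t 0 / √(1 + X t 1), fun t => √(1 + X t 1),
      h0.div hq (Real.sqrt_pos.2 hp).ne', hq, ?_⟩
    filter_upwards [hev, h] with t e1 e2
    have e3 := Real.sq_sqrt e1.le
    have e4 := (Real.sqrt_pos.2 e1).ne'
    have e2' := e2.2
    simp only [mink, e2.2] at e2
    have e5 : (X t 0 / √(1 + X t 1)) ^ 2 = 1 - X t 1 := by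
      rw [div_pow, e3, div_eq_iff e1.ne']; linear_combination e2.1
    ext i
    fin_cases i
    · simp [nullX, e4]
    · simp [nullX, e3, e5]
    · simp [nullX, e3, e5]; linarith [e2']
  · have hp : 0 < 1 - X u 1 := by linarith
    have hev : ∀ᶠ t in 𝓝 u, 0 < 1 - X t 1 :=
      (continuousAt_const.sub h1.continuousAt).eventually (lt_mem_nhds hp)
    have hq : ContDiffAt ℝ 3 (fun t => √(1 - X t 1)) u := (contDiffAt_const.sub h1).sqrt hp.ne'
    refine ⟨fun t => √(1 - X t 1), fun t => X t 0 / √(1 - X t 1), hq,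
      h0.div hq (Real.sqrt_pos.2 hp).ne', ?_⟩
    filter_upwards [hev, h] with t e1 e2
    have e3 := Real.sq_sqrt e1.le
    have e4 := (Real.sqrt_pos.2 e1).ne'
    have e2' := e2.2
    simp only [mink, e2.2] at e2
    have e5 : (X t 0 / √(1 - X t 1)) ^ 2 = 1 + X t 1 := by
      rw [div_pow, e3, div_eq_iff e1.ne']; linear_combination e2.1
    ext i
    fin_cases i
    · simp [nullX, e4, mul_div_cancel₀]
    · simp [nullX, e3, e5]
    · simp [nullX, e3, e5]; linarith [e2']

/-- Reversal of time. -/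
def timeRev (x : Mink) : Mink := ![x 0, x 1, -x 2]

@[simp] lemma timeRev_nullX (p q : ℝ) : timeRev (nullX p q) = nullY p q := by
  ext i; fin_cases i <;> simp [timeRev, nullX, nullY]
  ring

@[simp] lemma timeRev_timeRev (x : Mink) : timeRev (timeRev x) = x := by
  ext i; fin_cases i <;> simp [timeRev]

@[simp] lemma mink_timeRev (x y : Mink) : mink (timeRev x) (timeRev y) = mink x y := by
  simp [mink, timeRev]

/-- Near `a`, the two null forms are given by spinors. -/
structure SpinorGerm (α β : ℝ × ℝ → ℝ × ℝ →L[ℝ] Mink) (a : ℝ × ℝ) (n : ℕ) (φ ψ : ℝ × ℝ → ℝ)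
    (p q r s : ℝ → ℝ) : Prop where
  left : ContDiffAt ℝ 3 φ a
  right : ContDiffAt ℝ 3 ψ a
  jac : NullChartAt.jac φ ψ a ≠ 0
  hp : ContDiffAt ℝ n p (φ a)
  hq : ContDiffAt ℝ n q (φ a)
  hr : ContDiffAt ℝ n r (ψ a)
  hs : ContDiffAt ℝ n s (ψ a)
  eq_left : ∀ᶠ z in 𝓝 a, α z = (fderiv ℝ φ z).smulRight (nullX (p (φ z)) (q (φ z)))
  eq_right : ∀ᶠ z in 𝓝 a, β z = (fderiv ℝ ψ z).smulRight (nullY (r (ψ z)) (s (ψ z)))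

theorem IsNullSplit.exists_spinorGerm {F : ℝ × ℝ → Mink} {α β : ℝ × ℝ → ℝ × ℝ →L[ℝ] Mink}
    {U : Set (ℝ × ℝ)} (h : IsNullSplit F α β U) {a : ℝ × ℝ} (ha : a ∈ U) :
    ∃ φ ψ p q r s, SpinorGerm α β a 3 φ ψ p q r s ∧
      (∀ᶠ u in 𝓝 (φ a), p u ^ 2 + q u ^ 2 = 2) ∧ ∀ᶠ v in 𝓝 (ψ a), r v ^ 2 + s v ^ 2 = 2 := by
  obtain ⟨φ, ψ, X, Y, hφ, hψ, hj, hX, hY, hα, hβ, hX', hY'⟩ := h.exists_nullCoordinates ha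
  obtain ⟨p, q, hp, hq, hpq⟩ := exists_spinors hX hX'
  have hY0 : ContDiffAt ℝ 3 (fun v => timeRev (Y v)) (ψ a) := contDiffAt_pi.2 fun i => by
    have := contDiffAt_pi.1 hY
    fin_cases i
    · exact this 0
    · exact this 1
    · exact (this 2).neg
  obtain ⟨r, s, hr, hs, hrs⟩ := exists_spinors hY0 (hY'.mono fun v hv => by
    rw [mink_timeRev]; exact ⟨hv.1, by simp [timeRev, hv.2]⟩)
  have hrs : ∀ᶠ v in 𝓝 (ψ a), Y v = nullY (r v) (s v) := hrs.mono fun v hv => by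
    rw [← timeRev_nullX, ← hv, timeRev_timeRev]
  refine ⟨φ, ψ, p, q, r, s, ⟨hφ.of_le (by norm_num), hψ.of_le (by norm_num), hj, hp, hq, hr, hs,
    ?_, ?_⟩, ?_, ?_⟩
  · filter_upwards [hα, (eventually_comp_iff (by norm_num) hφ (fderiv_ne_zero_of_jac hj)).2 hpq]
      with z e1 e2
    rw [e1, e2]
  · filter_upwards [hβ, (eventually_comp_iff (by norm_num) hψ (fderiv_ne_zero_of_jac
      (by rwa [jac_swap, neg_ne_zero]))).2 hrs] with z e1 e2
    rw [e1, e2]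
  · filter_upwards [hX', hpq] with u e1 e2
    have := e1.2
    rw [e2] at this
    simp [nullX] at this
    linarith
  · filter_upwards [hY', hrs] with u e1 e2
    have := e1.2
    rw [e2] at this
    simp [nullY] at this
    linarith

end PlanarCurvature
end

noncomputable section

namespace PlanarCurvature

/-! ### Spinors of a surface with planar curvature lines -/

/-- The Wronskian `q p' - p q'`. -/
def wron (p q : ℝ → ℝ) (u : ℝ) : ℝ := q u * deriv p u - p u * deriv q u

lemma _root_.ContDiffAt.eventually_nat {E G : Type*} [NormedAddCommGroup E] [NormedSpace ℝ E]
    [NormedAddCommGroup G] [NormedSpace ℝ G] {f : E → G} {a : E} {n : ℕ}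
    (hf : ContDiffAt ℝ n f a) : ∀ᶠ z in 𝓝 a, ContDiffAt ℝ n f z :=
  hf.eventually (by simp)

lemma contDiffAt_wron {p q : ℝ → ℝ} {u : ℝ} {n : ℕ} (hp : ContDiffAt ℝ (n + 1 : ℕ) p u)
    (hq : ContDiffAt ℝ (n + 1 : ℕ) q u) : ContDiffAt ℝ n (wron p q) u := by
  have h : ((n : ℕ) : WithTop ℕ∞) + 1 ≤ (n + 1 : ℕ) := by push_cast; rfl
  have h' : ((n : ℕ) : WithTop ℕ∞) ≤ (n + 1 : ℕ) := by exact_mod_cast Nat.le_succ n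
  exact ((hq.of_le h').mul (hp.deriv h)).sub ((hp.of_le h').mul (hq.deriv h))

namespace NullChartAt

variable {F : ℝ × ℝ → Mink} {a : ℝ × ℝ} {p q r s : ℝ → ℝ} {φ ψ : ℝ × ℝ → ℝ}

lemma isPrincipal_iff_wron (h : NullChartAt F a (fun u => nullX (p u) (q u))
    (fun v => nullY (r v) (s v)) φ ψ) (hp : DifferentiableAt ℝ p (φ a))
    (hq : DifferentiableAt ℝ q (φ a)) (hr : DifferentiableAt ℝ r (ψ a))
    (hs : DifferentiableAt ℝ s (ψ a)) (hj : jac φ ψ a ≠ 0)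
    (hρ : q (φ a) * s (ψ a) + p (φ a) * r (ψ a) ≠ 0) (v : ℝ × ℝ) :
    IsPrincipal F a v ↔ v ≠ 0 ∧
      wron p q (φ a) * fderiv ℝ φ a v ^ 2 = wron r s (ψ a) * fderiv ℝ ψ a v ^ 2 :=
  h.isPrincipal_iff rfl rfl (hasDerivAt_nullX hp.hasDerivAt hq.hasDerivAt)
    (hasDerivAt_nullY hr.hasDerivAt hs.hasDerivAt) hρ hj v

end NullChartAt

/-- The quadratic form x L² - y M² has two independent isotropic vectors. It has just one isotropic
line if exactly one of x, y vanishes, and none if x y < 0. -/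
lemma pos_or_zero_of_linearIndependent {L M : ℝ × ℝ →L[ℝ] ℝ} (hLM : ∀ v, L v = 0 → M v = 0 → v = 0)
    {x y : ℝ} {v w : ℝ × ℝ} (h : LinearIndependent ℝ ![v, w]) (hv : x * L v ^ 2 = y * M v ^ 2)
    (hw : x * L w ^ 2 = y * M w ^ 2) : (x = 0 ∧ y = 0) ∨ 0 < x * y := by
  rw [LinearIndependent.pair_iff] at h
  have hdep : ∀ K : ℝ × ℝ →L[ℝ] ℝ, (∀ v, K v = 0 → v = 0) → False := fun K hK => by
    have h1 := h _ _ (hK (K w • v + (-K v) • w) (by simp; ring))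
    have hv0 : v = 0 := hK v (by linarith [h1.2])
    have := h 1 0 (by simp [hv0])
    simp at this
  have hne : v ≠ 0 := fun h0 => by simpa [h0] using h 1 0
  rcases eq_or_ne x 0 with hx | hx
  · refine Or.inl ⟨hx, by_contra fun hy => ?_⟩
    have h1 : M v = 0 := by simpa [hx, hy] using hv.symm
    have h2 : M w = 0 := by simpa [hx, hy] using hw.symm
    have h3 := h _ _ (hLM (L w • v + (-L v) • w) (by simp; ring) (by simp [h1, h2]))
    exact hne (hLM v (by linarith [h3.2]) h1)
  rcases eq_or_ne y 0 with hy | hy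
  · exfalso
    have h1 : L v = 0 := by simpa [hx, hy] using hv
    have h2 : L w = 0 := by simpa [hx, hy] using hw
    have h3 := h _ _ (hLM (M w • v + (-M v) • w) (by simp [h1, h2]) (by simp; ring))
    exact hne (hLM v h1 (by linarith [h3.2]))
  refine Or.inr (by_contra fun hxy => hne ?_)
  have hxy' : x * y < 0 := lt_of_le_of_ne (not_lt.1 hxy) (mul_ne_zero hx hy)
  have e1 : x ^ 2 * L v ^ 2 + (-(x * y)) * M v ^ 2 = 0 := by linear_combination x * hv
  have t1 : 0 ≤ x ^ 2 * L v ^ 2 := by positivity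
  have t2 : 0 ≤ (-(x * y)) * M v ^ 2 := mul_nonneg (by linarith) (sq_nonneg _)
  have e2 : x ^ 2 * L v ^ 2 = 0 := by linarith
  have e3 : (-(x * y)) * M v ^ 2 = 0 := by linarith
  exact hLM v (by simpa [hx] using e2) (by simpa [hx, hy] using e3)

/-- The relation and its derivative are two linear equations for (r, s) whose determinant is, up to
sign, the Wronskian. -/
lemma zero_of_eventually {p q : ℝ → ℝ} {u r s : ℝ} (hp : DifferentiableAt ℝ p u)
    (hq : DifferentiableAt ℝ q u) (hW : wron p q u ≠ 0)
    (h : ∀ᶠ t in 𝓝 u, q t * s + p t * r = 0) : r = 0 ∧ s = 0 := by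
  have e0 := h.self_of_nhds
  have e1 : deriv q u * s + deriv p u * r = 0 :=
    (((hq.hasDerivAt.mul_const s).add (hp.hasDerivAt.mul_const r)).congr_of_eventuallyEq
      (f₁ := fun _ => (0 : ℝ)) (h.mono fun t ht => ht.symm)).unique (hasDerivAt_const _ _)
  constructor
  · refine (mul_eq_zero.1 (show wron p q u * r = 0 from ?_)).resolve_left hW
    rw [wron]; linear_combination q u * e1 - deriv q u * e0
  · refine (mul_eq_zero.1 (show wron p q u * s = 0 from ?_)).resolve_left hW
    rw [wron]; linear_combination deriv p u * e0 - p u * e1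

/-- The alternative is known only off the singular set. If one Wronskian were nonzero at u and the
other zero at v, the pairing would have to vanish near u for this v, and `zero_of_eventually` would
give a zero spinor. Hence both vanish identically or neither has a zero, and then the signs are
constant on the intervals. -/
lemma wronskian_dichotomy {p q r s : ℝ → ℝ} {I J : Set ℝ} (hI : IsOpen I) (hJ : IsOpen J)
    (hp : ∀ u ∈ I, ContDiffAt ℝ 2 p u) (hq : ∀ u ∈ I, ContDiffAt ℝ 2 q u)
    (hr : ∀ v ∈ J, ContDiffAt ℝ 2 r v) (hs : ∀ v ∈ J, ContDiffAt ℝ 2 s v)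
    (hpq : ∀ u ∈ I, ¬(p u = 0 ∧ q u = 0)) (hrs : ∀ v ∈ J, ¬(r v = 0 ∧ s v = 0))
    (h : ∀ u ∈ I, ∀ v ∈ J, q u * s v + p u * r v ≠ 0 →
      (wron p q u = 0 ∧ wron r s v = 0) ∨ 0 < wron p q u * wron r s v)
    {u₀ v₀ : ℝ} (hu₀ : u₀ ∈ I) (hv₀ : v₀ ∈ J) (hI' : IsPreconnected I) (hJ' : IsPreconnected J)
    (hne : ∃ u ∈ I, ∃ v ∈ J, q u * s v + p u * r v ≠ 0) :
    (∀ u ∈ I, ∀ v ∈ J, wron p q u = 0 ∧ wron r s v = 0) ∨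
      ∀ u ∈ I, ∀ v ∈ J, 0 < wron p q u * wron r s v := by
  have cX : ContinuousOn (wron p q) I := fun u hu =>
    (contDiffAt_wron (n := 1) (hp u hu) (hq u hu)).continuousAt.continuousWithinAt
  have cY : ContinuousOn (wron r s) J := fun u hu =>
    (contDiffAt_wron (n := 1) (hr u hu) (hs u hu)).continuousAt.continuousWithinAt
  have key1 : ∀ u ∈ I, wron p q u ≠ 0 → ∀ v ∈ J, wron r s v ≠ 0 := fun u hu hW v hv h0 => by
    refine hrs v hv (zero_of_eventually ((hp u hu).differentiableAt two_ne_zero)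
      ((hq u hu).differentiableAt two_ne_zero) hW ?_)
    filter_upwards [hI.mem_nhds hu, (cX.continuousAt (hI.mem_nhds hu)).eventually_ne hW] with t e1 e2
    by_contra e3
    rcases h t e1 v hv e3 with h1 | h1
    · exact e2 h1.1
    · simp [h0] at h1
  have key2 : ∀ v ∈ J, wron r s v ≠ 0 → ∀ u ∈ I, wron p q u ≠ 0 := fun v hv hW u hu h0 => by
    refine hpq u hu (zero_of_eventually ((hr v hv).differentiableAt two_ne_zero)
      ((hs v hv).differentiableAt two_ne_zero) hW ?_)
    filter_upwards [hJ.mem_nhds hv, (cY.continuousAt (hJ.mem_nhds hv)).eventually_ne hW] with t e1 e2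
    by_contra e3
    rcases h u hu t e1 (by rwa [mul_comm (q u), mul_comm (p u)]) with h1 | h1
    · exact e2 h1.2
    · simp [h0] at h1
  by_cases hz : ∀ u ∈ I, ∀ v ∈ J, wron p q u = 0 ∧ wron r s v = 0
  · exact Or.inl hz
  right
  have hall : (∀ u ∈ I, wron p q u ≠ 0) ∧ ∀ v ∈ J, wron r s v ≠ 0 := by
    push Not at hz
    obtain ⟨u, hu, v, hv, huv⟩ := hz
    by_cases h1 : wron p q u = 0
    · exact ⟨key2 v hv (huv h1), key1 u₀ hu₀ (key2 v hv (huv h1) u₀ hu₀)⟩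
    · exact ⟨key2 v₀ hv₀ (key1 u hu h1 v₀ hv₀), key1 u hu h1⟩
  obtain ⟨u₁, hu₁, v₁, hv₁, h₁⟩ := hne
  have hsign : ∀ {f : ℝ → ℝ} {K : Set ℝ}, IsPreconnected K → ContinuousOn f K → (∀ t ∈ K, f t ≠ 0) →
      ∀ x ∈ K, ∀ y ∈ K, 0 < f x * f y := fun {f K} hK hf h0 x hx y hy => by
    by_contra hlt
    have h2 : f x * f y < 0 := lt_of_le_of_ne (not_lt.1 hlt) (mul_ne_zero (h0 x hx) (h0 y hy))
    have : (0 : ℝ) ∈ f '' K := by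
      rcases mul_neg_iff.1 h2 with h3 | h3
      · exact hK.intermediate_value hy hx hf ⟨h3.2.le, h3.1.le⟩
      · exact hK.intermediate_value hx hy hf ⟨h3.1.le, h3.2.le⟩
    obtain ⟨t, ht, ht'⟩ := this
    exact h0 t ht ht'
  have h2 : 0 < wron p q u₁ * wron r s v₁ := (h u₁ hu₁ v₁ hv₁ h₁).resolve_left
    fun h3 => hall.1 u₁ hu₁ h3.1
  intro u hu v hv
  have h3 := hsign hI' cX hall.1 u hu u₁ hu₁
  have h4 := hsign hJ' cY hall.2 v hv v₁ hv₁
  by_contra hlt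
  have h5 := mul_pos h3 h4
  have h6 : wron p q u * wron p q u₁ * (wron r s v * wron r s v₁) =
    (wron p q u * wron r s v) * (wron p q u₁ * wron r s v₁) := by ring
  rw [h6] at h5
  exact hlt (pos_of_mul_pos_left h5 h2.le)

end PlanarCurvature
end

/-! ### Coordinate squares: many local properties on one product of intervals -/

noncomputable section

namespace PlanarCurvature

/-- The image of `I ×ˢ J` under `Ψ` is covered by the null coordinates `φ`, `ψ`, in which the
surface `F` has the spinors `p, q, r, s`. -/
structure IsSquare (F : ℝ × ℝ → Mink) (U : Set (ℝ × ℝ)) (φ ψ : ℝ × ℝ → ℝ) (p q r s : ℝ → ℝ)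
    (Ψ : ℝ × ℝ → ℝ × ℝ) (I J : Set ℝ) : Prop where
  mem : ∀ u ∈ I, ∀ v ∈ J, Ψ (u, v) ∈ U
  left : ∀ u ∈ I, ∀ v ∈ J, φ (Ψ (u, v)) = u
  right : ∀ u ∈ I, ∀ v ∈ J, ψ (Ψ (u, v)) = v
  chart : ∀ u ∈ I, ∀ v ∈ J, NullChartAt F (Ψ (u, v)) (fun u => nullX (p u) (q u))
    (fun v => nullY (r v) (s v)) φ ψ
  jac : ∀ u ∈ I, ∀ v ∈ J, NullChartAt.jac φ ψ (Ψ (u, v)) ≠ 0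
  smooth : ∀ u ∈ I, ∀ v ∈ J, ContDiffAt ℝ 1 Ψ (u, v)
  freq : ∀ u ∈ I, ∀ v ∈ J, ∃ᶠ w : ℝ × ℝ in 𝓝 (u, v), q w.1 * s w.2 + p w.1 * r w.2 ≠ 0
  hp : ∀ u ∈ I, ContDiffAt ℝ 2 p u
  hq : ∀ u ∈ I, ContDiffAt ℝ 2 q u
  hr : ∀ v ∈ J, ContDiffAt ℝ 2 r v
  hs : ∀ v ∈ J, ContDiffAt ℝ 2 s v

variable {F : ℝ × ℝ → Mink} {U : Set (ℝ × ℝ)} {φ ψ : ℝ × ℝ → ℝ} {p q r s : ℝ → ℝ}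
  {Ψ : ℝ × ℝ → ℝ × ℝ} {I J : Set ℝ} {α β : ℝ × ℝ → ℝ × ℝ →L[ℝ] Mink} {a : ℝ × ℝ} {n : ℕ}

lemma SpinorGerm.eventually_chart (g : SpinorGerm α β a n φ ψ p q r s) (h : IsNullSplit F α β U)
    (ha : a ∈ U) : ∀ᶠ z in 𝓝 a, z ∈ U ∧ NullChartAt F z (fun u => nullX (p u) (q u))
      (fun v => nullY (r v) (s v)) φ ψ ∧ NullChartAt.jac φ ψ z ≠ 0 := by
  have hU : ∀ᶠ z in 𝓝 a, z ∈ U := h.isOpen.mem_nhds ha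
  have cφ := g.left.continuousAt_fderiv (by norm_num)
  have cψ := g.right.continuousAt_fderiv (by norm_num)
  have hj : ContinuousAt (NullChartAt.jac φ ψ) a :=
    ((cφ.clm_apply continuousAt_const).mul (cψ.clm_apply continuousAt_const)).sub
      ((cφ.clm_apply continuousAt_const).mul (cψ.clm_apply continuousAt_const))
  filter_upwards [hU, hU.eventually_nhds, g.eq_left.eventually_nhds, g.eq_right.eventually_nhds,
    (g.left.of_le (m := (2 : ℕ)) (by norm_num)).eventually_nat,
    (g.right.of_le (m := (2 : ℕ)) (by norm_num)).eventually_nat, hj.eventually_ne g.jac]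
    with z e1 e2 e3 e4 e5 e6 e7
  refine ⟨e1, ⟨?_, e5, e6⟩, e7⟩
  filter_upwards [e2, e3, e4] with w w1 w2 w3
  rw [← w2, ← w3]
  exact h.hasFDerivAt w w1

/-- Density of the regular points is transported to the null coordinates, so that identities proved
where the pairing is nonzero extend by continuity. -/
lemma SpinorGerm.eventually_frequently (g : SpinorGerm α β a n φ ψ p q r s)
    (h : IsNullSplit F α β U) (ha : a ∈ U) (hT : U ⊆ closure (U ∩ {z | TimelikeAt F z})) :
    ∀ᶠ z in 𝓝 a, ∃ᶠ w in 𝓝 (φ z, ψ z), q w.1 * s w.2 + p w.1 * r w.2 ≠ 0 := by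
  filter_upwards [(g.eventually_chart h ha).eventually_nhds] with z hz
  have h1 := hz.self_of_nhds
  have hc : Tendsto (fun z => (φ z, ψ z)) (𝓝 z) (𝓝 (φ z, ψ z)) :=
    h1.2.1.left.continuousAt.prodMk h1.2.1.right.continuousAt
  refine hc.frequently (((mem_closure_iff_frequently.1 (hT h1.1)).and_eventually hz).mono ?_)
  exact fun w hw => (hw.2.2.1.timelikeAt_iff rfl rfl hw.2.2.2).1 hw.1.2

theorem SpinorGerm.exists_isSquare (g : SpinorGerm α β a n φ ψ p q r s) (hn : 2 ≤ n)
    (h : IsNullSplit F α β U) (ha : a ∈ U) (hT : U ⊆ closure (U ∩ {z | TimelikeAt F z}))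
    {P Q : ℝ → Prop} (hP : ∀ᶠ u in 𝓝 (φ a), P u) (hQ : ∀ᶠ v in 𝓝 (ψ a), Q v) :
    ∃ (Ψ : ℝ × ℝ → ℝ × ℝ) (I J : Set ℝ), IsOpen I ∧ IsPreconnected I ∧ φ a ∈ I ∧
      IsOpen J ∧ IsPreconnected J ∧ ψ a ∈ J ∧ IsSquare F U φ ψ p q r s Ψ I J ∧
      (∀ u ∈ I, P u) ∧ ∀ v ∈ J, Q v := by
  have hn' : ((2 : ℕ) : WithTop ℕ∞) ≤ n := by exact_mod_cast hn
  obtain ⟨Ψ, h1, h2, h3, h4⟩ := exists_localInverse_pair (by norm_num) g.left g.right g.jac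
  have hΨ : Tendsto Ψ (𝓝 (φ a, ψ a)) (𝓝 a) := by simpa [h2] using h1.continuousAt.tendsto
  have hf : ∀ {P : ℝ → Prop}, (∀ᶠ u in 𝓝 (φ a), P u) → ∀ᶠ w in 𝓝 (φ a, ψ a), P w.1 := fun hP =>
    continuousAt_fst.eventually hP
  have hs : ∀ {P : ℝ → Prop}, (∀ᶠ u in 𝓝 (ψ a), P u) → ∀ᶠ w in 𝓝 (φ a, ψ a), P w.2 := fun hP =>
    continuousAt_snd.eventually hP
  have key := (hΨ.eventually (g.eventually_chart h ha)).and <|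
    (hΨ.eventually (g.eventually_frequently h ha hT)).and <|
    h3.and <| ((h1.of_le (m := (1 : ℕ)) (by norm_num)).eventually_nat).and <|
    (hf (g.hp.of_le hn').eventually_nat).and <| (hf (g.hq.of_le hn').eventually_nat).and <|
    (hs (g.hr.of_le hn').eventually_nat).and <| (hs (g.hs.of_le hn').eventually_nat).and <|
    (hf hP).and (hs hQ)
  obtain ⟨ε, hε, H⟩ := exists_square key
  have m1 : φ a ∈ Ioo (φ a - ε) (φ a + ε) := ⟨by linarith, by linarith⟩
  have m2 : ψ a ∈ Ioo (ψ a - ε) (ψ a + ε) := ⟨by linarith, by linarith⟩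
  refine ⟨Ψ, _, _, isOpen_Ioo, isPreconnected_Ioo, m1, isOpen_Ioo, isPreconnected_Ioo, m2,
    ⟨fun u hu v hv => (H u hu v hv).1.1, fun u hu v hv => (H u hu v hv).2.2.1.1,
      fun u hu v hv => (H u hu v hv).2.2.1.2, fun u hu v hv => (H u hu v hv).1.2.1,
      fun u hu v hv => (H u hu v hv).1.2.2, fun u hu v hv => (H u hu v hv).2.2.2.1,
      fun u hu v hv => ?_, fun u hu => (H u hu _ m2).2.2.2.2.1, fun u hu => (H u hu _ m2).2.2.2.2.2.1,
      fun v hv => (H _ m1 v hv).2.2.2.2.2.2.1, fun v hv => (H _ m1 v hv).2.2.2.2.2.2.2.1⟩,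
    fun u hu => (H u hu _ m2).2.2.2.2.2.2.2.2.1, fun v hv => (H _ m1 v hv).2.2.2.2.2.2.2.2.2⟩
  have := H u hu v hv
  simpa only [this.2.2.1.1, this.2.2.1.2] using this.2.1

namespace IsSquare

lemma timelike (S : IsSquare F U φ ψ p q r s Ψ I J) {u v : ℝ} (hu : u ∈ I) (hv : v ∈ J)
    (hρ : q u * s v + p u * r v ≠ 0) : Ψ (u, v) ∈ U ∩ {z | TimelikeAt F z} := by
  refine ⟨S.mem u hu v hv, ((S.chart u hu v hv).timelikeAt_iff rfl rfl (S.jac u hu v hv)).2 ?_⟩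
  rwa [S.left u hu v hv, S.right u hu v hv]

lemma isPrincipal_iff (S : IsSquare F U φ ψ p q r s Ψ I J) {u v : ℝ} (hu : u ∈ I) (hv : v ∈ J)
    (hρ : q u * s v + p u * r v ≠ 0) (w : ℝ × ℝ) : IsPrincipal F (Ψ (u, v)) w ↔ w ≠ 0 ∧
      wron p q u * fderiv ℝ φ (Ψ (u, v)) w ^ 2 = wron r s v * fderiv ℝ ψ (Ψ (u, v)) w ^ 2 := by
  have e1 := S.left u hu v hv
  have e2 := S.right u hu v hv
  have := (S.chart u hu v hv).isPrincipal_iff_wron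
    (by rw [e1]; exact (S.hp u hu).differentiableAt two_ne_zero) (by rw [e1]; exact (S.hq u hu).differentiableAt two_ne_zero)
    (by rw [e2]; exact (S.hr v hv).differentiableAt two_ne_zero) (by rw [e2]; exact (S.hs v hv).differentiableAt two_ne_zero)
    (S.jac u hu v hv) (by rwa [e1, e2]) w
  rwa [e1, e2] at this

lemma wron_pos_or_zero (S : IsSquare F U φ ψ p q r s Ψ I J)
    (hP : HasPlanarCurvatureLines F (U ∩ {z | TimelikeAt F z})) {u v : ℝ} (hu : u ∈ I) (hv : v ∈ J)
    (hρ : q u * s v + p u * r v ≠ 0) :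
    (wron p q u = 0 ∧ wron r s v = 0) ∨ 0 < wron p q u * wron r s v := by
  obtain ⟨x, y, hxy, hx, hy⟩ := hP.exists_principal _ (S.timelike hu hv hρ)
  exact pos_or_zero_of_linearIndependent
    (fun v h1 h2 => NullChartAt.eq_zero (S.jac u hu _ hv) h1 h2) hxy
    ((S.isPrincipal_iff hu hv hρ x).1 hx).2 ((S.isPrincipal_iff hu hv hρ y).1 hy).2

end IsSquare

end PlanarCurvature
end

noncomputable section

namespace PlanarCurvature

/-! ### Planarity forces the spinors to be exponential -/

/-- With equal Wronskians the first summand is zero, and the determinant is k times the squared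
pairing times the Wronskian. The factor k will be the difference of the two potentials. -/
lemma det_pencil_add (k p p' q q' r r' s s' : ℝ) : Matrix.det (Matrix.of
    ![nullX p q + nullY r s, dnullX p q p' q' + dnullY r s r' s',
      nullX p' q' + nullY r' s' + k • nullX p q]) =
      1 / 2 * ((q * p' - p * q') - (s * r' - r * s')) *
        (((q * p' - p * q') + (s * r' - r * s')) ^ 2 - (q' * s + p' * r - q * s' - p * r') ^ 2) +
      k * ((q * s + p * r) ^ 2 * ((q * p' - p * q') + (s * r' - r * s')) / 2) := by
  rw [Matrix.det_fin_three]
  simp [nullX, nullY, dnullX, dnullY]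
  ring

/-- The common quotient `p'' / p = q'' / q` of two spinors with constant Wronskian. -/
def spinorPotential (p q : ℝ → ℝ) (u : ℝ) : ℝ :=
  (p u * deriv (deriv p) u + q u * deriv (deriv q) u) / (p u ^ 2 + q u ^ 2)

/-- Differentiating the constant Wronskian gives q p'' = p q'', so (p'', q'') is a multiple of the
nonzero vector (p, q). The factor is written with p² + q² because either spinor alone may vanish. -/
lemma hasDerivAt_deriv_of_wron {p q : ℝ → ℝ} {I : Set ℝ} (hI : IsOpen I)
    (hp : ∀ u ∈ I, ContDiffAt ℝ 2 p u) (hq : ∀ u ∈ I, ContDiffAt ℝ 2 q u) {σ : ℝ} (hσ : σ ≠ 0)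
    (hW : ∀ u ∈ I, wron p q u = σ) : ContinuousOn (spinorPotential p q) I ∧
      ∀ u ∈ I, HasDerivAt (deriv p) (spinorPotential p q u * p u) u ∧
        HasDerivAt (deriv q) (spinorPotential p q u * q u) u := by
  have hne : ∀ u ∈ I, p u ^ 2 + q u ^ 2 ≠ 0 := fun u hu h0 => hσ (by
    have h1 : p u = 0 := by nlinarith [sq_nonneg (p u), sq_nonneg (q u)]
    have h2 : q u = 0 := by nlinarith [sq_nonneg (p u), sq_nonneg (q u)]
    rw [← hW u hu, wron, h1, h2]; ring)
  have h1 : ∀ {f : ℝ → ℝ} {u}, ContDiffAt ℝ 2 f u → ContDiffAt ℝ 1 (deriv f) u := fun hf =>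
    hf.deriv (by norm_num)
  have h0 : ∀ {f : ℝ → ℝ} {u}, ContDiffAt ℝ 2 f u → ContinuousAt (deriv (deriv f)) u := fun hf =>
    ((h1 hf).deriv (m := 0) (by norm_num)).continuousAt
  refine ⟨fun u hu => ContinuousAt.continuousWithinAt ?_, fun u hu => ?_⟩
  · exact (((hp u hu).continuousAt.mul (h0 (hp u hu))).add
      ((hq u hu).continuousAt.mul (h0 (hq u hu)))).div
      (((hp u hu).continuousAt.pow 2).add ((hq u hu).continuousAt.pow 2)) (hne u hu)
  · have dp := ((hp u hu).differentiableAt two_ne_zero).hasDerivAt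
    have dq := ((hq u hu).differentiableAt two_ne_zero).hasDerivAt
    have dp' := ((h1 (hp u hu)).differentiableAt one_ne_zero).hasDerivAt
    have dq' := ((h1 (hq u hu)).differentiableAt one_ne_zero).hasDerivAt
    have e : q u * deriv (deriv p) u - p u * deriv (deriv q) u = 0 := by
      have h2 := (dq.mul dp').sub (dp.mul dq')
      have h3 : wron p q =ᶠ[𝓝 u] fun _ => σ := by
        filter_upwards [hI.mem_nhds hu] with t ht using hW t ht
      have h4 := h2.unique ((hasDerivAt_const u σ).congr_of_eventuallyEq h3)
      linear_combination h4
    refine ⟨dp'.congr_deriv ?_, dq'.congr_deriv ?_⟩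
    · rw [spinorPotential, div_mul_eq_mul_div, eq_div_iff (hne u hu)]
      linear_combination q u * e
    · rw [spinorPotential, div_mul_eq_mul_div, eq_div_iff (hne u hu)]
      linear_combination (-p u) * e

lemma hasDerivAt_dnullX {p q p' q' : ℝ → ℝ} {k t : ℝ} (hp : HasDerivAt p (p' t) t)
    (hq : HasDerivAt q (q' t) t) (hp' : HasDerivAt p' (k * p t) t)
    (hq' : HasDerivAt q' (k * q t) t) :
    HasDerivAt (fun t => dnullX (p t) (q t) (p' t) (q' t))
      ((2 : ℝ) • (nullX (p' t) (q' t) + k • nullX (p t) (q t))) t := by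
  rw [hasDerivAt_pi]
  intro i
  fin_cases i
  · exact ((hp'.mul hq).add (hp.mul hq')).congr_deriv (by simp [nullX]; ring)
  · exact ((hq.mul hq').sub (hp.mul hp')).congr_deriv (by simp [nullX]; ring)
  · exact ((hq.mul hq').add (hp.mul hp')).neg.congr_deriv (by simp [nullX]; ring)

lemma hasDerivAt_dnullY {p q p' q' : ℝ → ℝ} {k t : ℝ} (hp : HasDerivAt p (p' t) t)
    (hq : HasDerivAt q (q' t) t) (hp' : HasDerivAt p' (k * p t) t)
    (hq' : HasDerivAt q' (k * q t) t) :
    HasDerivAt (fun t => dnullY (p t) (q t) (p' t) (q' t))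
      ((2 : ℝ) • (nullY (p' t) (q' t) + k • nullY (p t) (q t))) t := by
  rw [hasDerivAt_pi]
  intro i
  fin_cases i
  · exact ((hp'.mul hq).add (hp.mul hq')).congr_deriv (by simp [nullY]; ring)
  · exact ((hq.mul hq').sub (hp.mul hp')).congr_deriv (by simp [nullY]; ring)
  · exact ((hq.mul hq').add (hp.mul hp')).congr_deriv (by simp [nullY]; ring)

lemma hasDerivAt_dotProduct {m : Mink} {Z : ℝ → Mink} {Z' : Mink} {t : ℝ} (h : HasDerivAt Z Z' t) :
    HasDerivAt (fun t => m ⬝ᵥ Z t) (m ⬝ᵥ Z') t :=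
  (LinearMap.toContinuousLinearMap (dotProductBilin ℝ ℝ m)).hasFDerivAt.comp_hasDerivAt t h

variable {F : ℝ × ℝ → Mink} {U : Set (ℝ × ℝ)} {φ ψ : ℝ × ℝ → ℝ} {p q r s : ℝ → ℝ}
  {Ψ : ℝ × ℝ → ℝ × ℝ} {I J : Set ℝ}

/-- Along a curvature line through a regular point, the velocity stays in a plane. -/
lemma IsSquare.exists_normal (S : IsSquare F U φ ψ p q r s Ψ I J) (hI : IsOpen I) (hJ : IsOpen J)
    (hP : HasPlanarCurvatureLines F (U ∩ {z | TimelikeAt F z})) {σ : ℝ}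
    (hX : ∀ u ∈ I, wron p q u = σ) (hY : ∀ v ∈ J, wron r s v = σ) {u v : ℝ} (hu : u ∈ I)
    (hv : v ∈ J) (hρ : q u * s v + p u * r v ≠ 0) : ∃ m : Mink, m ≠ 0 ∧ ∀ᶠ t in 𝓝 (0 : ℝ),
      m ⬝ᵥ (nullX (p (u + t)) (q (u + t)) + nullY (r (v + t)) (s (v + t))) = 0 := by
  have cu : Tendsto (fun t => u + t) (𝓝 0) (𝓝 u) := by
    have : ContinuousAt (fun t : ℝ => u + t) 0 := by fun_prop
    simpa [ContinuousAt] using this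
  have cv : Tendsto (fun t => v + t) (𝓝 0) (𝓝 v) := by
    have : ContinuousAt (fun t : ℝ => v + t) 0 := by fun_prop
    simpa [ContinuousAt] using this
  have hρ' : ∀ᶠ t in 𝓝 (0 : ℝ), q (u + t) * s (v + t) + p (u + t) * r (v + t) ≠ 0 := by
    have h1 := ((S.hq u hu).continuousAt.tendsto.comp cu).mul
      ((S.hs v hv).continuousAt.tendsto.comp cv)
    have h2 := ((S.hp u hu).continuousAt.tendsto.comp cu).mul
      ((S.hr v hv).continuousAt.tendsto.comp cv)
    exact (h1.add h2).eventually_ne hρ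
  have hall := (cu.eventually (hI.mem_nhds hu)).and ((cv.eventually (hJ.mem_nhds hv)).and hρ')
  obtain ⟨δ, hδ, H⟩ := Metric.eventually_nhds_iff_ball.1 hall
  rw [Real.ball_eq_Ioo, zero_sub, zero_add] at H
  -- For equal Wronskians the direction with null components (1, 1) is principal, so this diagonal
  -- is a curvature line, and planarity applies to it.
  let γ : ℝ → ℝ × ℝ := fun t => Ψ (u + t, v + t)
  have hγ : ∀ t ∈ Ioo (-δ) δ, ContDiffAt ℝ 1 γ t := fun t ht =>
    ContDiffAt.comp t (S.smooth _ (H t ht).1 _ (H t ht).2.1)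
      ((contDiffAt_const.add contDiffAt_id).prodMk (contDiffAt_const.add contDiffAt_id))
  have hγ' : ∀ t ∈ Ioo (-δ) δ, HasDerivAt γ (deriv γ t) t := fun t ht =>
    ((hγ t ht).differentiableAt one_ne_zero).hasDerivAt
  have hφ : ∀ t ∈ Ioo (-δ) δ, fderiv ℝ φ (γ t) (deriv γ t) = 1 := fun t ht => by
    have hc := S.chart _ (H t ht).1 _ (H t ht).2.1
    have h1 := (hc.left.differentiableAt two_ne_zero).hasFDerivAt.comp_hasDerivAt t (hγ' t ht)
    refine h1.unique (((hasDerivAt_id t).const_add u).congr_of_eventuallyEq ?_)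
    filter_upwards [Ioo_mem_nhds ht.1 ht.2] with t' ht'
    exact S.left _ (H t' ht').1 _ (H t' ht').2.1
  have hψ : ∀ t ∈ Ioo (-δ) δ, fderiv ℝ ψ (γ t) (deriv γ t) = 1 := fun t ht => by
    have hc := S.chart _ (H t ht).1 _ (H t ht).2.1
    have h1 := (hc.right.differentiableAt two_ne_zero).hasFDerivAt.comp_hasDerivAt t (hγ' t ht)
    refine h1.unique (((hasDerivAt_id t).const_add v).congr_of_eventuallyEq ?_)
    filter_upwards [Ioo_mem_nhds ht.1 ht.2] with t' ht'
    exact S.right _ (H t' ht').1 _ (H t' ht').2.1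
  obtain ⟨m, k, hm, hmk⟩ := hP.planar (-δ) δ γ (by linarith)
    (fun t ht => (hγ t ht).contDiffWithinAt)
    (fun t ht => S.timelike (H t ht).1 (H t ht).2.1 (H t ht).2.2)
    (fun t ht => by
      refine (S.isPrincipal_iff (H t ht).1 (H t ht).2.1 (H t ht).2.2 _).2 ⟨fun h0 => ?_, ?_⟩
      · have := hφ t ht
        rw [h0, map_zero] at this
        exact zero_ne_one this
      · rw [hX _ (H t ht).1, hY _ (H t ht).2.1]
        rw [show Ψ (u + t, v + t) = γ t from rfl, hφ t ht, hψ t ht])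
  refine ⟨m, hm, ?_⟩
  filter_upwards [Ioo_mem_nhds (neg_lt_zero.2 hδ) hδ] with t ht
  have hc := S.chart _ (H t ht).1 _ (H t ht).2.1
  have h1 := hasDerivAt_dotProduct (m := m)
    (hc.hasFDerivAt.self_of_nhds.comp_hasDerivAt t (hγ' t ht))
  have h2 := h1.unique ((hasDerivAt_const t k).congr_of_eventuallyEq (by
    filter_upwards [Ioo_mem_nhds ht.1 ht.2] with t' ht' using hmk t' ht'))
  have e1 := hφ t ht
  have e2 := hψ t ht
  simp only [γ] at e1 e2
  simpa [e1, e2, S.left _ (H t ht).1 _ (H t ht).2.1, S.right _ (H t ht).1 _ (H t ht).2.1, γ] using h2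

/-- The normal of the plane annihilates Z = X + Y along the diagonal, hence also Z' and Z''. With
p'' = f p, q'' = f q, r'' = g r, s'' = g s, half of Z'' minus g Z is the third row of
`det_pencil_add` with k = f - g. The determinant must vanish, so f = g. -/
lemma IsSquare.potential_eq (S : IsSquare F U φ ψ p q r s Ψ I J) (hI : IsOpen I) (hJ : IsOpen J)
    (hP : HasPlanarCurvatureLines F (U ∩ {z | TimelikeAt F z})) {σ : ℝ} (hσ : σ ≠ 0)
    (hX : ∀ u ∈ I, wron p q u = σ) (hY : ∀ v ∈ J, wron r s v = σ) {u v : ℝ} (hu : u ∈ I)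
    (hv : v ∈ J) (hρ : q u * s v + p u * r v ≠ 0) :
    spinorPotential p q u = spinorPotential r s v := by
  obtain ⟨m, hm, h0⟩ := S.exists_normal hI hJ hP hX hY hu hv hρ
  have hpq := (hasDerivAt_deriv_of_wron hI S.hp S.hq hσ hX).2
  have hrs := (hasDerivAt_deriv_of_wron hJ S.hr S.hs hσ hY).2
  have cu : Tendsto (fun t => u + t) (𝓝 0) (𝓝 u) := by
    have : ContinuousAt (fun t : ℝ => u + t) 0 := by fun_prop
    simpa [ContinuousAt] using this
  have cv : Tendsto (fun t => v + t) (𝓝 0) (𝓝 v) := by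
    have : ContinuousAt (fun t : ℝ => v + t) 0 := by fun_prop
    simpa [ContinuousAt] using this
  have hd : ∀ {f : ℝ → ℝ} {x : ℝ}, ContDiffAt ℝ 2 f x → HasDerivAt f (deriv f x) x := fun hf =>
    (hf.differentiableAt two_ne_zero).hasDerivAt
  have h1 : ∀ᶠ t in 𝓝 (0 : ℝ), m ⬝ᵥ (dnullX (p (u + t)) (q (u + t)) (deriv p (u + t))
      (deriv q (u + t)) + dnullY (r (v + t)) (s (v + t)) (deriv r (v + t)) (deriv s (v + t))) = 0 := by
    filter_upwards [h0.eventually_nhds, cu.eventually (hI.mem_nhds hu),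
      cv.eventually (hJ.mem_nhds hv)] with t e1 e2 e3
    have hd1 := hasDerivAt_dotProduct (m := m)
      ((hasDerivAt_nullX ((hd (S.hp _ e2)).comp_const_add u t)
        ((hd (S.hq _ e2)).comp_const_add u t)).add
      (hasDerivAt_nullY ((hd (S.hr _ e3)).comp_const_add v t)
        ((hd (S.hs _ e3)).comp_const_add v t)))
    exact hd1.unique ((hasDerivAt_const t (0 : ℝ)).congr_of_eventuallyEq e1)
  have hu' : u + 0 ∈ I := by rwa [add_zero]
  have hv' : v + 0 ∈ J := by rwa [add_zero]
  have h2 : m ⬝ᵥ _ = 0 := (hasDerivAt_dotProduct (m := m)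
      ((hasDerivAt_dnullX (p' := fun t => deriv p (u + t)) (q' := fun t => deriv q (u + t))
        ((hd (S.hp _ hu')).comp_const_add u 0) ((hd (S.hq _ hu')).comp_const_add u 0)
        ((hpq _ hu').1.comp_const_add u 0) ((hpq _ hu').2.comp_const_add u 0)).add
      (hasDerivAt_dnullY (p' := fun t => deriv r (v + t)) (q' := fun t => deriv s (v + t))
        ((hd (S.hr _ hv')).comp_const_add v 0) ((hd (S.hs _ hv')).comp_const_add v 0)
        ((hrs _ hv').1.comp_const_add v 0) ((hrs _ hv').2.comp_const_add v 0)))).unique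
      ((hasDerivAt_const _ (0 : ℝ)).congr_of_eventuallyEq h1)
  have h0 := h0.self_of_nhds
  have h1 := h1.self_of_nhds
  simp only [add_zero] at h0 h1 h2
  set f := spinorPotential p q u
  set g := spinorPotential r s v
  have hdet := det_pencil_add (f - g) (p u) (deriv p u) (q u) (deriv q u) (r v) (deriv r v) (s v)
    (deriv s v)
  rw [Matrix.exists_mulVec_eq_zero_iff.1 ⟨m, hm, ?_⟩] at hdet
  · have e1 := hX u hu
    have e2 := hY v hv
    rw [wron] at e1 e2
    rw [e1, e2, sub_self] at hdet
    have : (f - g) * ((q u * s v + p u * r v) ^ 2 * σ) = 0 := by linear_combination -hdet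
    exact sub_eq_zero.1 ((mul_eq_zero.1 this).resolve_right (mul_ne_zero (pow_ne_zero 2 hρ) hσ))
  · ext i
    fin_cases i
    · exact (dotProduct_comm _ _).trans h0
    · exact (dotProduct_comm _ _).trans h1
    · refine (dotProduct_comm _ _).trans ?_
      show m ⬝ᵥ (nullX (deriv p u) (deriv q u) + nullY (deriv r v) (deriv s v) +
        (f - g) • nullX (p u) (q u)) = 0
      simp only [dotProduct_add, dotProduct_smul, smul_eq_mul] at h0 h2 ⊢
      linear_combination 1 / 2 * h2 - g * h0

/-- The potentials agree at regular points, which are dense, and by continuity everywhere on the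
square. A function of u that equals a function of v is constant. -/
theorem IsSquare.exists_potential (S : IsSquare F U φ ψ p q r s Ψ I J) (hI : IsOpen I)
    (hJ : IsOpen J) (hP : HasPlanarCurvatureLines F (U ∩ {z | TimelikeAt F z})) {σ : ℝ}
    (hσ : σ ≠ 0) (hX : ∀ u ∈ I, wron p q u = σ) (hY : ∀ v ∈ J, wron r s v = σ)
    {u₀ v₀ : ℝ} (hu₀ : u₀ ∈ I) (hv₀ : v₀ ∈ J) : ∃ κ : ℝ,
      (∀ u ∈ I, HasDerivAt (deriv p) (κ * p u) u ∧ HasDerivAt (deriv q) (κ * q u) u) ∧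
      ∀ v ∈ J, HasDerivAt (deriv r) (κ * r v) v ∧ HasDerivAt (deriv s) (κ * s v) v := by
  have hpq := hasDerivAt_deriv_of_wron hI S.hp S.hq hσ hX
  have hrs := hasDerivAt_deriv_of_wron hJ S.hr S.hs hσ hY
  have key : ∀ u ∈ I, ∀ v ∈ J, spinorPotential p q u = spinorPotential r s v := fun u hu v hv => by
    by_contra hne
    have c1 : ContinuousAt (fun w : ℝ × ℝ => spinorPotential p q w.1) (u, v) :=
      ContinuousAt.comp (f := Prod.fst) (hpq.1.continuousAt (hI.mem_nhds hu)) continuousAt_fst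
    have c2 : ContinuousAt (fun w : ℝ × ℝ => spinorPotential r s w.2) (u, v) :=
      ContinuousAt.comp (f := Prod.snd) (hrs.1.continuousAt (hJ.mem_nhds hv)) continuousAt_snd
    have h1 : ∀ᶠ w : ℝ × ℝ in 𝓝 (u, v), spinorPotential p q w.1 - spinorPotential r s w.2 ≠ 0 :=
      (c1.sub c2).eventually_ne (sub_ne_zero.2 hne)
    have h2 : ∀ᶠ w : ℝ × ℝ in 𝓝 (u, v), w.1 ∈ I ∧ w.2 ∈ J := (hI.prod hJ).mem_nhds ⟨hu, hv⟩
    obtain ⟨w, hw, hw1, hw2⟩ := ((S.freq u hu v hv).and_eventually (h1.and h2)).exists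
    exact hw1 (sub_eq_zero.2 (S.potential_eq hI hJ hP hσ hX hY hw2.1 hw2.2 hw))
  refine ⟨spinorPotential p q u₀, fun u hu => ?_, fun v hv => ?_⟩
  · rw [key u₀ hu₀ v₀ hv₀, ← key u hu v₀ hv₀]
    exact hpq.2 u hu
  · rw [key u₀ hu₀ v hv]
    exact hrs.2 v hv

end PlanarCurvature
end

noncomputable section

namespace PlanarCurvature

/-! ### The local normal form -/

/-- Dividing the spinors by k and taking a new parameter with h' = k² preserves the form nullX (p,
q) du and divides the Wronskian by k⁴. The choice k = |W|^{1/4} leaves only the sign σ, at the price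
of one derivative of the spinors. -/
lemma exists_reparam {p q : ℝ → ℝ} {u σ : ℝ} (hp : ContDiffAt ℝ 3 p u) (hq : ContDiffAt ℝ 3 q u)
    (hσ : σ ^ 2 = 1) (hW : 0 < σ * wron p q u) : ∃ h P Q : ℝ → ℝ, ContDiffAt ℝ 3 h u ∧
      deriv h u ≠ 0 ∧ ContDiffAt ℝ 2 P (h u) ∧ ContDiffAt ℝ 2 Q (h u) ∧
      (∀ᶠ t in 𝓝 u, ∃ k : ℝ, p t = k * P (h t) ∧ q t = k * Q (h t) ∧ k ^ 2 = deriv h t) ∧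
      ∀ᶠ x in 𝓝 (h u), wron P Q x = σ := by
  have cW : ContDiffAt ℝ 2 (fun t => σ * wron p q t) u :=
    contDiffAt_const.mul (contDiffAt_wron (n := 2) hp hq)
  have hWev : ∀ᶠ t in 𝓝 u, 0 < σ * wron p q t := cW.continuousAt.eventually (lt_mem_nhds hW)
  set k : ℝ → ℝ := fun t => √√(σ * wron p q t) with hk
  have ck : ContDiffAt ℝ 2 k u := (cW.sqrt hW.ne').sqrt (Real.sqrt_pos.2 hW).ne'
  have kpos : ∀ᶠ t in 𝓝 u, 0 < k t := hWev.mono fun t ht => Real.sqrt_pos.2 (Real.sqrt_pos.2 ht)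
  have k4 : ∀ᶠ t in 𝓝 u, wron p q t = σ * k t ^ 4 := hWev.mono fun t ht => by
    have : k t ^ 4 = σ * wron p q t := by
      rw [show k t ^ 4 = (k t ^ 2) ^ 2 by ring, hk]
      simp only
      rw [Real.sq_sqrt (Real.sqrt_nonneg _), Real.sq_sqrt ht.le]
    rw [this]; linear_combination (-wron p q t) * hσ
  obtain ⟨δ, hδ, hd⟩ := Metric.eventually_nhds_iff_ball.1
    (eventually_differentiableAt (n := 2) two_ne_zero (ck.pow 2))
  obtain ⟨h, hh⟩ := (convex_ball u δ).exists_forall_hasDerivWithinAt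
    (fun t ht => (hd t ht).differentiableWithinAt)
  have hh' : ∀ᶠ t in 𝓝 u, HasDerivAt h (k t ^ 2) t := by
    filter_upwards [Metric.isOpen_ball.mem_nhds (Metric.mem_ball_self hδ)] with t ht
    exact (hh t ht).hasDerivAt (Metric.isOpen_ball.mem_nhds ht)
  have ch : ContDiffAt ℝ 3 h u := by
    rw [show (3 : WithTop ℕ∞) = (2 : ℕ) + 1 by norm_num, contDiffAt_succ_iff_hasFDerivAt]
    refine ⟨fun t => (k t ^ 2) • (1 : ℝ →L[ℝ] ℝ), ⟨_, hh', fun t ht => ?_⟩,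
      (ck.pow 2).smul contDiffAt_const⟩
    refine HasDerivAt.hasFDerivAt ht |>.congr_fderiv ?_
    ext; simp
  have hdu : deriv h u = k u ^ 2 := hh'.self_of_nhds.deriv
  have ku := kpos.self_of_nhds
  obtain ⟨g, cg, g0, hg1, hg2⟩ := exists_localInverse (by norm_num) ch (fun v hv => by
    rw [hh'.self_of_nhds.hasFDerivAt.fderiv] at hv
    simpa [ku.ne'] using hv)
  have tg : Tendsto g (𝓝 (h u)) (𝓝 u) := by simpa [g0] using cg.continuousAt.tendsto
  have cP : ∀ {f : ℝ → ℝ}, ContDiffAt ℝ 3 f u → ContDiffAt ℝ 2 (fun x => f (g x) / k (g x)) (h u) :=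
    fun {f} hf => by
      have : ContDiffAt ℝ 2 (fun t => f t / k t) (g (h u)) := by
        rw [g0]; exact (hf.of_le (by norm_num)).div ck ku.ne'
      exact this.comp (h u) (cg.of_le (by norm_num))
  refine ⟨h, fun x => p (g x) / k (g x), fun x => q (g x) / k (g x), ch, by rw [hdu]; positivity,
    cP hp, cP hq, ?_, ?_⟩
  · filter_upwards [hg2, kpos, hh'] with t e1 e2 e3
    exact ⟨k t, by rw [e1]; field_simp, by rw [e1]; field_simp, e3.deriv.symm⟩
  · filter_upwards [tg.eventually kpos, tg.eventually k4, tg.eventually hh', hg1.eventually_nhds,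
      eventually_differentiableAt (n := 3) (by norm_num) cg,
      tg.eventually (eventually_differentiableAt (n := 3) (by norm_num) hp),
      tg.eventually (eventually_differentiableAt (n := 3) (by norm_num) hq),
      tg.eventually (eventually_differentiableAt (n := 2) (by norm_num) ck)]
      with x e1 e2 e3 e4 e5 e6 e7 e8
    have hg' : k (g x) ^ 2 * deriv g x = 1 :=
      (e3.comp x e5.hasDerivAt).unique ((hasDerivAt_id x).congr_of_eventuallyEq e4)
    have dP : ∀ {f : ℝ → ℝ}, DifferentiableAt ℝ f (g x) → deriv (fun x => f (g x) / k (g x)) x =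
        (deriv f (g x) * k (g x) - f (g x) * deriv k (g x)) / k (g x) ^ 2 * deriv g x := fun hf =>
      ((hf.hasDerivAt.div e8.hasDerivAt e1.ne').comp x e5.hasDerivAt).deriv
    rw [wron, dP e6, dP e7]
    rw [wron] at e2
    have e9 : deriv g x = 1 / k (g x) ^ 2 := by field_simp; linear_combination hg'
    rw [e9]
    field_simp
    linear_combination k (g x) * e2

lemma nullX_smul (k p q : ℝ) : nullX (k * p) (k * q) = k ^ 2 • nullX p q := by
  ext i; fin_cases i <;> simp [nullX] <;> ring

lemma nullY_smul (k p q : ℝ) : nullY (k * p) (k * q) = k ^ 2 • nullY p q := by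
  ext i; fin_cases i <;> simp [nullY] <;> ring

/-- Normalized coefficients: the Hopf differentials are `1` or the surface is a plane with null
coordinates that measure time. -/
def IsCore (c : Fin 9 → ℝ) : Prop :=
  (wX c = wY c ∧ wX c ^ 2 = 1) ∨ (c 0 = 0 ∧ c 2 = 0 ∧ c 4 = 0 ∧ c 6 = 0 ∧ c 8 = 0 ∧
    c 3 * c 7 + c 1 * c 5 ≠ 0 ∧ c 1 ^ 2 + c 3 ^ 2 = 2 ∧ c 5 ^ 2 + c 7 ^ 2 = 2)

/-- Near `a`, the null forms are those of `cspin c` in suitable null coordinates. -/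
def HasForm (α β : ℝ × ℝ → ℝ × ℝ →L[ℝ] Mink) (c : Fin 9 → ℝ) (a : ℝ × ℝ) (φ ψ : ℝ × ℝ → ℝ) : Prop :=
  ContDiffAt ℝ 3 φ a ∧ ContDiffAt ℝ 3 ψ a ∧ NullChartAt.jac φ ψ a ≠ 0 ∧
    (∀ᶠ z in 𝓝 a, α z = (fderiv ℝ φ z).smulRight (velX c (φ z))) ∧
    ∀ᶠ z in 𝓝 a, β z = (fderiv ℝ ψ z).smulRight (velY c (ψ z))

variable {F : ℝ × ℝ → Mink} {U : Set (ℝ × ℝ)} {φ ψ : ℝ × ℝ → ℝ} {p q r s : ℝ → ℝ}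
  {Ψ : ℝ × ℝ → ℝ × ℝ} {I J : Set ℝ} {α β : ℝ × ℝ → ℝ × ℝ →L[ℝ] Mink} {a : ℝ × ℝ} {n : ℕ}

lemma fderiv_comp_real {h : ℝ → ℝ} {φ : ℝ × ℝ → ℝ} {z : ℝ × ℝ} (hh : DifferentiableAt ℝ h (φ z))
    (hφ : DifferentiableAt ℝ φ z) : fderiv ℝ (fun z => h (φ z)) z = deriv h (φ z) • fderiv ℝ φ z :=
  (hh.hasDerivAt.comp_hasFDerivAt z hφ.hasFDerivAt).fderiv

lemma SpinorGerm.reparam (g : SpinorGerm α β a 3 φ ψ p q r s) {σ : ℝ} (hσ : σ ^ 2 = 1)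
    (hX : 0 < σ * wron p q (φ a)) (hY : 0 < σ * wron r s (ψ a)) :
    ∃ φ' ψ' p' q' r' s', SpinorGerm α β a 2 φ' ψ' p' q' r' s' ∧
      (∀ᶠ u in 𝓝 (φ' a), wron p' q' u = σ) ∧ ∀ᶠ v in 𝓝 (ψ' a), wron r' s' v = σ := by
  obtain ⟨h, P, Q, ch, dh, cP, cQ, hPQ, hw⟩ := exists_reparam g.hp g.hq hσ hX
  obtain ⟨k, R, S, ck, dk, cR, cS, hRS, hw'⟩ := exists_reparam g.hr g.hs hσ hY
  have dφ := eventually_differentiableAt (n := 3) (by norm_num) g.left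
  have dψ := eventually_differentiableAt (n := 3) (by norm_num) g.right
  have dh' := g.left.continuousAt.eventually (eventually_differentiableAt (n := 3) (by norm_num) ch)
  have dk' := g.right.continuousAt.eventually (eventually_differentiableAt (n := 3) (by norm_num) ck)
  refine ⟨fun z => h (φ z), fun z => k (ψ z), P, Q, R, S, ⟨ch.comp a g.left, ck.comp a g.right, ?_,
    cP, cQ, cR, cS, ?_, ?_⟩, hw, hw'⟩
  · have := mul_ne_zero (mul_ne_zero dh dk) g.jac
    rw [NullChartAt.jac] at this ⊢
    rw [fderiv_comp_real dh'.self_of_nhds dφ.self_of_nhds,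
      fderiv_comp_real dk'.self_of_nhds dψ.self_of_nhds]
    convert this using 1
    simp only [smul_apply, smul_eq_mul]
    ring
  · filter_upwards [g.eq_left, dφ, dh', g.left.continuousAt.eventually hPQ] with z e1 e2 e3 e4
    obtain ⟨x, x1, x2, x3⟩ := e4
    rw [e1, fderiv_comp_real e3 e2, x1, x2, nullX_smul, x3]
    refine ContinuousLinearMap.ext fun v => ?_
    simp [smul_smul, mul_comm]
  · filter_upwards [g.eq_right, dψ, dk', g.right.continuousAt.eventually hRS] with z e1 e2 e3 e4
    obtain ⟨x, x1, x2, x3⟩ := e4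
    rw [e1, fderiv_comp_real e3 e2, x1, x2, nullY_smul, x3]
    refine ContinuousLinearMap.ext fun v => ?_
    simp [smul_smul, mul_comm]

lemma SpinorGerm.hasForm_of_wron (g : SpinorGerm α β a 2 φ ψ p q r s) (h : IsNullSplit F α β U)
    (ha : a ∈ U) (hT : U ⊆ closure (U ∩ {z | TimelikeAt F z}))
    (hP : HasPlanarCurvatureLines F (U ∩ {z | TimelikeAt F z})) {σ : ℝ} (hσ : σ ^ 2 = 1)
    (hX : ∀ᶠ u in 𝓝 (φ a), wron p q u = σ) (hY : ∀ᶠ v in 𝓝 (ψ a), wron r s v = σ) :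
    ∃ c, IsCore c ∧ ∃ φ' ψ', HasForm α β c a φ' ψ' := by
  have hσ0 : σ ≠ 0 := by rintro rfl; norm_num at hσ
  obtain ⟨Ψ, I, J, hI, hI', hIa, hJ, hJ', hJa, S, hX, hY⟩ := g.exists_isSquare le_rfl h ha hT hX hY
  obtain ⟨κ, hpq, hrs⟩ := S.exists_potential hI hJ hP hσ0 hX hY hIa hJa
  have hd : ∀ {f : ℝ → ℝ} {x : ℝ}, ContDiffAt ℝ 2 f x → HasDerivAt f (deriv f x) x := fun hf =>
    (hf.differentiableAt two_ne_zero).hasDerivAt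
  let c : Fin 9 → ℝ := ![κ, p (φ a), deriv p (φ a), q (φ a), deriv q (φ a), r (ψ a),
    deriv r (ψ a), s (ψ a), deriv s (ψ a)]
  have h1 : wX c = σ := hX _ hIa
  have h2 : wY c = σ := hY _ hJa
  refine ⟨c, Or.inl ⟨h1.trans h2.symm, by rw [h1, hσ]⟩, fun z => φ z - φ a, fun z => ψ z - ψ a,
    g.left.sub contDiffAt_const, g.right.sub contDiffAt_const, ?_, ?_, ?_⟩
  · simpa only [NullChartAt.jac, fderiv_sub_const] using g.jac
  · filter_upwards [g.eq_left, g.left.continuousAt.eventually (hI.mem_nhds hIa)] with z e1 e2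
    rw [e1, fderiv_sub_const]
    congr 2
    · exact eq_sol_of_hasDerivAt hI hI' (fun u hu => hd (S.hp u hu)) (fun u hu => (hpq u hu).1) hIa e2
    · exact eq_sol_of_hasDerivAt hI hI' (fun u hu => hd (S.hq u hu)) (fun u hu => (hpq u hu).2) hIa e2
  · filter_upwards [g.eq_right, g.right.continuousAt.eventually (hJ.mem_nhds hJa)] with z e1 e2
    rw [e1, fderiv_sub_const]
    congr 2
    · exact eq_sol_of_hasDerivAt hJ hJ' (fun u hu => hd (S.hr u hu)) (fun u hu => (hrs u hu).1) hJa e2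
    · exact eq_sol_of_hasDerivAt hJ hJ' (fun u hu => hd (S.hs u hu)) (fun u hu => (hrs u hu).2) hJa e2

/-- The derivative of (p, q) is orthogonal to (p, q) by constant length and parallel to it by the
vanishing Wronskian. -/
lemma eq_const_of_wron {I : Set ℝ} (hI : IsOpen I) (hI' : IsPreconnected I) {p q : ℝ → ℝ}
    (hp : ∀ u ∈ I, ContDiffAt ℝ 2 p u) (hq : ∀ u ∈ I, ContDiffAt ℝ 2 q u)
    (h : ∀ u ∈ I, wron p q u = 0) (h2 : ∀ u ∈ I, p u ^ 2 + q u ^ 2 = 2) {u v : ℝ} (hu : u ∈ I)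
    (hv : v ∈ I) : p u = p v ∧ q u = q v := by
  have key : ∀ t ∈ I, deriv p t = 0 ∧ deriv q t = 0 := fun t ht => by
    have dp := ((hp t ht).differentiableAt two_ne_zero).hasDerivAt
    have dq := ((hq t ht).differentiableAt two_ne_zero).hasDerivAt
    have e1 := ((dp.pow 2).add (dq.pow 2)).unique ((hasDerivAt_const t (2 : ℝ)).congr_of_eventuallyEq
      (by filter_upwards [hI.mem_nhds ht] with x hx using h2 x hx))
    have e2 := h t ht
    have e3 := h2 t ht
    rw [wron] at e2
    constructor
    · have : 2 * deriv p t = 0 := by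
        rw [← e3]; linear_combination p t / 2 * e1 + q t * e2
      linarith
    · have : 2 * deriv q t = 0 := by
        rw [← e3]; linear_combination q t / 2 * e1 - p t * e2
      linarith
  exact ⟨hI.is_const_of_deriv_eq_zero hI' (fun t ht => ((hp t ht).differentiableAt
      two_ne_zero).differentiableWithinAt) (fun t ht => (key t ht).1) hu hv,
    hI.is_const_of_deriv_eq_zero hI' (fun t ht => ((hq t ht).differentiableAt
      two_ne_zero).differentiableWithinAt) (fun t ht => (key t ht).2) hu hv⟩

/-- Where the Wronskians vanish, spinors of constant length are constant and the surface is a plane.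
Otherwise their common sign is σ, and reparametrization leads to a constant potential. -/
theorem IsNullSplit.exists_hasForm (h : IsNullSplit F α β U) (ha : a ∈ U)
    (hT : U ⊆ closure (U ∩ {z | TimelikeAt F z}))
    (hP : HasPlanarCurvatureLines F (U ∩ {z | TimelikeAt F z})) :
    ∃ c, IsCore c ∧ ∃ φ ψ, HasForm α β c a φ ψ := by
  obtain ⟨φ, ψ, p, q, r, s, g, hpq, hrs⟩ := h.exists_spinorGerm ha
  obtain ⟨Ψ, I, J, hI, hI', hIa, hJ, hJ', hJa, S, hpq, hrs⟩ :=
    g.exists_isSquare (by norm_num) h ha hT hpq hrs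
  have hne : ∃ u ∈ I, ∃ v ∈ J, q u * s v + p u * r v ≠ 0 := by
    have h2 : ∀ᶠ w : ℝ × ℝ in 𝓝 (φ a, ψ a), w.1 ∈ I ∧ w.2 ∈ J :=
      (hI.prod hJ).mem_nhds ⟨hIa, hJa⟩
    obtain ⟨w, w1, w2⟩ := ((S.freq _ hIa _ hJa).and_eventually h2).exists
    exact ⟨_, w2.1, _, w2.2, w1⟩
  rcases wronskian_dichotomy hI hJ S.hp S.hq S.hr S.hs
    (fun u hu h0 => by simpa [h0.1, h0.2] using hpq u hu)
    (fun v hv h0 => by simpa [h0.1, h0.2] using hrs v hv)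
    (fun u hu v hv => S.wron_pos_or_zero hP hu hv) hIa hJa hI' hJ' hne with H | H
  · have eX := fun u hu => eq_const_of_wron hI hI' S.hp S.hq (fun u hu => (H u hu _ hJa).1) hpq
      (u := u) hu hIa
    have eY := fun v hv => eq_const_of_wron hJ hJ' S.hr S.hs (fun v hv => (H _ hIa v hv).2) hrs
      (u := v) hv hJa
    obtain ⟨u, hu, v, hv, hρ⟩ := hne
    rw [(eX u hu).1, (eX u hu).2, (eY v hv).1, (eY v hv).2] at hρ
    refine ⟨![0, p (φ a), 0, q (φ a), 0, r (ψ a), 0, s (ψ a), 0],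
      Or.inr ⟨rfl, rfl, rfl, rfl, rfl, hρ, hpq _ hIa, hrs _ hJa⟩, φ, ψ, g.left, g.right, g.jac, ?_, ?_⟩
    · filter_upwards [g.eq_left, g.left.continuousAt.eventually (hI.mem_nhds hIa)] with z e1 e2
      rw [e1, (eX _ e2).1, (eX _ e2).2, velX]
      congr 2 <;> exact (sol_eq_const rfl rfl _).symm
    · filter_upwards [g.eq_right, g.right.continuousAt.eventually (hJ.mem_nhds hJa)] with z e1 e2
      rw [e1, (eY _ e2).1, (eY _ e2).2, velY]
      congr 2 <;> exact (sol_eq_const rfl rfl _).symm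
  · have h0 := H _ hIa _ hJa
    obtain ⟨σ, hσ, h1, h2⟩ : ∃ σ : ℝ, σ ^ 2 = 1 ∧ 0 < σ * wron p q (φ a) ∧
        0 < σ * wron r s (ψ a) := by
      rcases mul_pos_iff.1 h0 with h1 | h1
      · exact ⟨1, by norm_num, by linarith, by linarith⟩
      · exact ⟨-1, by norm_num, by linarith, by linarith⟩
    obtain ⟨φ', ψ', p', q', r', s', g', hX, hY⟩ := g.reparam hσ h1 h2
    exact g'.hasForm_of_wron h ha hT hP hσ hX hY

end PlanarCurvature
end

noncomputable section

namespace PlanarCurvature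

/-! ### Gluing the local normal forms -/

/-- The velocity of a null curve, normalized by its curvature or, if that vanishes, by time. -/
structure IsNormalVelocity (X : ℝ → Mink) (τ σ : ℝ) : Prop where
  analytic : AnalyticOnNhd ℝ X univ
  null : ∀ u, mink (X u) (X u) = 0
  time : ∀ u, 0 < τ * X u 2
  curvature : ∀ u, mink (deriv X u) (deriv X u) = σ
  normalized : σ = 1 ∨ (σ = 0 ∧ ∀ u, X u 2 = τ)

lemma hasDerivAt_mink {X Y : ℝ → Mink} {X' Y' : Mink} {u : ℝ} (hX : HasDerivAt X X' u)
    (hY : HasDerivAt Y Y' u) :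
    HasDerivAt (fun u => mink (X u) (Y u)) (mink X' (Y u) + mink (X u) Y') u := by
  rw [hasDerivAt_pi] at hX hY
  exact ((((hX 0).mul (hY 0)).add ((hX 1).mul (hY 1))).sub ((hX 2).mul (hY 2))).congr_deriv (by
    simp only [mink]; ring)

lemma IsNormalVelocity.hasDerivAt {X : ℝ → Mink} {τ σ : ℝ} (h : IsNormalVelocity X τ σ) (u : ℝ) :
    HasDerivAt X (deriv X u) u := (h.analytic u (mem_univ u)).differentiableAt.hasDerivAt

lemma IsNormalVelocity.mink_deriv {X : ℝ → Mink} {τ σ : ℝ} (h : IsNormalVelocity X τ σ) (u : ℝ) :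
    mink (X u) (deriv X u) = 0 := by
  have h1 := (hasDerivAt_mink (h.hasDerivAt u) (h.hasDerivAt u)).unique
    ((hasDerivAt_const u (0 : ℝ)).congr_of_eventuallyEq (Eventually.of_forall h.null))
  simp only [mink] at h1 ⊢
  linarith

/-- Two presentations of one null form differ by a positive function l: X = l Y and dφ' = l dφ.
Since Y is light-like and orthogonal to Y', one derivative multiplies the curvature by l⁴. Either
normalization therefore forces l = 1, and a curve of one type cannot match one of the other. -/
lemma fderiv_eq_of_velocity {X Y : ℝ → Mink} {τ σ σ' : ℝ} (hX : IsNormalVelocity X τ σ)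
    (hY : IsNormalVelocity Y τ σ') {φ φ' : ℝ × ℝ → ℝ} {b : ℝ × ℝ} (hφ : ContDiffAt ℝ 3 φ b)
    (hφ' : ContDiffAt ℝ 3 φ' b) (h0 : fderiv ℝ φ b ≠ 0)
    (h : ∀ᶠ z in 𝓝 b, (fderiv ℝ φ z).smulRight (X (φ z)) = (fderiv ℝ φ' z).smulRight (Y (φ' z))) :
    fderiv ℝ φ' b = fderiv ℝ φ b := by
  have hX2 : ∀ u, X u 2 ≠ 0 := fun u h0 => by simpa [h0] using hX.time u
  have hY2 : ∀ u, Y u 2 ≠ 0 := fun u h0 => by simpa [h0] using hY.time u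
  set l : ℝ × ℝ → ℝ := fun z => X (φ z) 2 / Y (φ' z) 2 with hl
  have hd : ∀ {z}, (fderiv ℝ φ z).smulRight (X (φ z)) = (fderiv ℝ φ' z).smulRight (Y (φ' z)) →
      ∀ v, fderiv ℝ φ' z v = l z * fderiv ℝ φ z v := fun {z} hz v => by
    have := congrFun (DFunLike.congr_fun hz v) 2
    simp only [ContinuousLinearMap.smulRight_apply, Pi.smul_apply, smul_eq_mul] at this
    rw [hl, div_mul_eq_mul_div, eq_div_iff (hY2 _), ← this, mul_comm]
  have hXY : ∀ᶠ z in 𝓝 b, X (φ z) = l z • Y (φ' z) := by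
    filter_upwards [h, (hφ.continuousAt_fderiv (by norm_num)).eventually_ne h0] with z hz hz0
    obtain ⟨v, hv⟩ : ∃ v, fderiv ℝ φ z v ≠ 0 := by
      by_contra! H
      exact hz0 (ContinuousLinearMap.ext H)
    have := DFunLike.congr_fun hz v
    simp only [ContinuousLinearMap.smulRight_apply, hd hz v, mul_comm (l z), mul_smul] at this
    exact smul_right_injective _ hv this
  obtain ⟨e, he⟩ : ∃ e, fderiv ℝ φ b e = 1 := by
    obtain ⟨v, hv⟩ : ∃ v, fderiv ℝ φ b v ≠ 0 := by
      by_contra! H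
      exact h0 (ContinuousLinearMap.ext H)
    exact ⟨(fderiv ℝ φ b v)⁻¹ • v, by simp [hv]⟩
  have he' := hd h.self_of_nhds e
  rw [he, mul_one] at he'
  have dγ : HasDerivAt (fun t : ℝ => b + t • e) e 0 := by
    simpa using ((hasDerivAt_id (0 : ℝ)).smul_const e).const_add b
  have cγ : Tendsto (fun t : ℝ => b + t • e) (𝓝 0) (𝓝 b) := by simpa using dγ.continuousAt.tendsto
  have eb : b = b + (0 : ℝ) • e := by simp
  have dφ : HasDerivAt (fun t : ℝ => φ (b + t • e)) 1 0 := by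
    have := (hφ.differentiableAt (by norm_num)).hasFDerivAt.comp_hasDerivAt_of_eq 0 dγ eb
    rwa [he] at this
  have dφ' : HasDerivAt (fun t : ℝ => φ' (b + t • e)) (l b) 0 := by
    have := (hφ'.differentiableAt (by norm_num)).hasFDerivAt.comp_hasDerivAt_of_eq 0 dγ eb
    rwa [he'] at this
  have dX : HasDerivAt (fun t : ℝ => X (φ (b + t • e))) (deriv X (φ b)) 0 :=
    ((hX.hasDerivAt (φ b)).scomp_of_eq 0 dφ (by simp)).congr_deriv (one_smul _ _)
  have dY : HasDerivAt (fun t : ℝ => Y (φ' (b + t • e))) (l b • deriv Y (φ' b)) 0 :=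
    (hY.hasDerivAt (φ' b)).scomp_of_eq 0 dφ' (by simp)
  have dl := (hasDerivAt_pi.1 dX 2).div (hasDerivAt_pi.1 dY 2) (hY2 _)
  have dXY := dX.unique ((dl.smul dY).congr_of_eventuallyEq (cγ.eventually hXY))
  simp only [zero_smul, add_zero] at dXY
  generalize (deriv X (φ b) 2 * Y (φ' b) 2 - X (φ b) 2 * (l b • deriv Y (φ' b)) 2) /
    Y (φ' b) 2 ^ 2 = m at dXY
  have hσ : σ = l b ^ 4 * σ' := by
    have e1 := hY.null (φ' b)
    have e2 := hY.mink_deriv (φ' b)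
    have e3 : X (φ b) 2 / Y (φ' b) 2 = l b := rfl
    rw [← hX.curvature (φ b), ← hY.curvature (φ' b), dXY]
    simp only [mink, Pi.add_apply, Pi.smul_apply, Pi.div_apply, smul_eq_mul, zero_smul, add_zero, e3]
      at e1 e2 ⊢
    linear_combination m ^ 2 * e1 + 2 * m * l b ^ 2 * e2
  have hl1 : l b = 1 := by
    -- The common time orientation excludes the root l = -1 of l⁴ = 1.
    have hpos : 0 < l b := by
      have h1 := hX.time (φ b)
      have h2 := hY.time (φ' b)
      have hτ : τ ≠ 0 := by rintro rfl; simp at h1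
      have : l b = (τ * X (φ b) 2) / (τ * Y (φ' b) 2) := by
        rw [mul_div_mul_left _ _ hτ]
      rw [this]; positivity
    rcases hX.normalized with h1 | ⟨h1, h1'⟩ <;> rcases hY.normalized with h2 | ⟨h2, h2'⟩
    · rw [h1, h2, mul_one] at hσ
      exact (pow_eq_one_iff_of_nonneg hpos.le (by norm_num)).1 hσ.symm
    · rw [h1, h2, mul_zero] at hσ; norm_num at hσ
    · rw [h1, h2, mul_one] at hσ
      exact absurd hσ.symm (pow_ne_zero 4 hpos.ne')
    · simp only [hl, h1', h2']
      exact div_self fun h0 => hY2 (φ' b) (by rw [h2', h0])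
  ext1 <;> ext <;> simp [hd h.self_of_nhds, hl1]

end PlanarCurvature
end

noncomputable section

namespace PlanarCurvature

lemma eventually_eq_const_of_fderiv {E : Type} [NormedAddCommGroup E] [NormedSpace ℝ E]
    {f : ℝ × ℝ → E} {a : ℝ × ℝ} (h : ∀ᶠ z in 𝓝 a, HasFDerivAt f (0 : ℝ × ℝ →L[ℝ] E) z) :
    ∀ᶠ z in 𝓝 a, f z = f a := by
  obtain ⟨ε, hε, H⟩ := Metric.eventually_nhds_iff_ball.1 h
  filter_upwards [Metric.ball_mem_nhds a hε] with z hz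
  exact Metric.isOpen_ball.is_const_of_fderiv_eq_zero (convex_ball a ε).isPreconnected
    (fun w hw => (H w hw).differentiableAt.differentiableWithinAt) (fun w hw => (H w hw).fderiv) hz
    (Metric.mem_ball_self hε)

/-- Equal differentials mean that φ' - φ is locally constant. The velocities then agree up to this
shift on an open interval, and on all of ℝ by analyticity. -/
lemma velocity_unique {X Y : ℝ → Mink} {τ σ σ' : ℝ} (hX : IsNormalVelocity X τ σ)
    (hY : IsNormalVelocity Y τ σ') {φ φ' : ℝ × ℝ → ℝ} {b : ℝ × ℝ} (hφ : ContDiffAt ℝ 3 φ b)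
    (hφ' : ContDiffAt ℝ 3 φ' b) (h0 : fderiv ℝ φ b ≠ 0)
    (h : ∀ᶠ z in 𝓝 b, (fderiv ℝ φ z).smulRight (X (φ z)) = (fderiv ℝ φ' z).smulRight (Y (φ' z))) :
    ∃ k, φ' b = φ b + k ∧ ∀ u, X u = Y (u + k) := by
  have hφ3 : ∀ᶠ z in 𝓝 b, ContDiffAt ℝ 3 φ z :=
    ContDiffAt.eventually_nat (n := 3) hφ
  have hφ3' : ∀ᶠ z in 𝓝 b, ContDiffAt ℝ 3 φ' z :=
    ContDiffAt.eventually_nat (n := 3) hφ'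
  have hev0 := (hφ.continuousAt_fderiv (by norm_num)).eventually_ne h0
  have hd : ∀ᶠ z in 𝓝 b, fderiv ℝ φ' z = fderiv ℝ φ z := by
    filter_upwards [hφ3, hφ3', h.eventually_nhds, hev0] with z e1 e2 e3 e4
    exact fderiv_eq_of_velocity hX hY e1 e2 e4 e3
  refine ⟨φ' b - φ b, by ring, ?_⟩
  have hc : ∀ᶠ z in 𝓝 b, φ' z - φ z = φ' b - φ b := by
    refine eventually_eq_const_of_fderiv (f := fun z => φ' z - φ z) ?_
    filter_upwards [hφ3, hφ3', hd] with z e1 e2 e3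
    have := (e2.differentiableAt (by norm_num)).hasFDerivAt.sub
      (e1.differentiableAt (by norm_num)).hasFDerivAt
    rwa [e3, sub_self] at this
  have hev : ∀ᶠ z in 𝓝 b, X (φ z) = Y (φ z + (φ' b - φ b)) := by
    filter_upwards [h, hd, hc, hev0] with z e1 e2 e3 e4
    obtain ⟨v, hv⟩ : ∃ v, fderiv ℝ φ z v ≠ 0 := by
      by_contra! H
      exact e4 (ContinuousLinearMap.ext H)
    have := DFunLike.congr_fun e1 v
    simp only [ContinuousLinearMap.smulRight_apply, e2] at this
    rw [← e3, add_sub_cancel]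
    exact smul_right_injective _ hv this
  have hev' := (eventually_comp_iff (by norm_num) hφ h0
    (P := fun u => X u = Y (u + (φ' b - φ b)))).1 hev
  have hYk : AnalyticOnNhd ℝ (fun u => Y (u + (φ' b - φ b))) univ := fun u _ =>
    (hY.analytic _ (mem_univ _)).comp_of_eq (analyticAt_id.add analyticAt_const) rfl
  exact fun u => congrFun (hX.analytic.eq_of_eventuallyEq hYk hev') u

lemma sum_eq_zero_of_eq_zero_sq {p q : ℝ} (h : p ^ 2 + q ^ 2 = 0) : p = 0 ∧ q = 0 :=
  ⟨by nlinarith [sq_nonneg p, sq_nonneg q], by nlinarith [sq_nonneg p, sq_nonneg q]⟩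

lemma IsCore.isNormalVelocity {c : Fin 9 → ℝ} (hc : IsCore c) :
    ∃ σ, IsNormalVelocity (velX c) (-1) σ ∧ IsNormalVelocity (velY c) 1 σ := by
  have hmodel : IsModel c := by
    rcases hc with ⟨h1, h2⟩ | ⟨h0, h2, h4, h6, h8, hne, -, -⟩
    · exact Or.inl ⟨by rw [← h1, ← sq, h2]; norm_num, Or.inr h1⟩
    · exact Or.inr ⟨h0, h2, h4, h6, h8, hne⟩
  have hW : wX c ^ 2 = wY c ^ 2 := by
    rcases hc with ⟨h1, h2⟩ | ⟨h0, h2, h4, h6, h8, hne, -, -⟩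
    · rw [h1]
    · simp [wX, wY, h2, h4, h6, h8]
  have hnorm : wX c ^ 2 = 1 ∨ (wX c ^ 2 = 0 ∧ (∀ u, velX c u 2 = -1) ∧ ∀ u, velY c u 2 = 1) := by
    rcases hc with ⟨h1, h2⟩ | ⟨h0, h2, h4, h6, h8, hne, e1, e2⟩
    · exact Or.inl h2
    · refine Or.inr ⟨by simp [wX, h2, h4], fun u => ?_, fun u => ?_⟩
      · simp only [velX, sol_eq_const h0 h2, sol_eq_const h0 h4, nullX, Matrix.cons_val]
        linarith
      · simp only [velY, sol_eq_const h0 h6, sol_eq_const h0 h8, nullY, Matrix.cons_val]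
        linarith
  refine ⟨wX c ^ 2, ⟨contDiff_omega_iff_analyticOnNhd.1 (contDiff_velX c), fun u => ?_, fun u => ?_,
    fun u => ?_, hnorm.imp_right fun h => ⟨h.1, h.2.1⟩⟩,
    ⟨contDiff_omega_iff_analyticOnNhd.1 (contDiff_velY c), fun u => ?_, fun u => ?_, fun u => ?_,
    hnorm.imp_right fun h => ⟨h.1, h.2.2⟩⟩⟩
  · simp [velX, nullX, mink]; ring
  · have h := velX_ne_zero hmodel u
    rw [velX, Ne, nullX_eq_zero_iff] at h
    simp only [velX, nullX, Matrix.cons_val]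
    generalize sol (c 0) (c 1) (c 2) u = p at h ⊢
    generalize sol (c 0) (c 3) (c 4) u = q at h ⊢
    by_contra hlt
    exact h (sum_eq_zero_of_eq_zero_sq (by nlinarith [sq_nonneg p, sq_nonneg q]))
  · rw [(hasDerivAt_velX c u).deriv, ← velX_wronskian c u]
    simp [dnullX, mink]; ring
  · simp [velY, nullY, mink]; ring
  · have h := velY_ne_zero hmodel u
    rw [velY, Ne, nullY_eq_zero_iff] at h
    simp only [velY, nullY, Matrix.cons_val]
    generalize sol (c 0) (c 5) (c 6) u = p at h ⊢
    generalize sol (c 0) (c 7) (c 8) u = q at h ⊢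
    by_contra hlt
    exact h (sum_eq_zero_of_eq_zero_sq (by nlinarith [sq_nonneg p, sq_nonneg q]))
  · rw [(hasDerivAt_velY c u).deriv, hW, ← velY_wronskian c u]
    simp [dnullY, mink]; ring

lemma curve_add_of_eq {X Y : ℝ → Mink} (hX : Continuous X) (hY : Continuous Y) {k : ℝ}
    (h : ∀ u, X u = Y (u + k)) (u : ℝ) : curve Y (u + k) = curve X u + curve Y k := by
  have hd : ∀ t, HasDerivAt (fun t => curve Y (t + k) - curve X t) 0 t := fun t => by
    have := ((hasDerivAt_curve hY (t + k)).comp_add_const t k).sub (hasDerivAt_curve hX t)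
    rwa [h t, sub_self] at this
  have := is_const_of_deriv_eq_zero (fun t => (hd t).differentiableAt) (fun t => (hd t).deriv) u 0
  have h0 : curve X 0 = 0 := by ext i; simp [curve]
  rw [zero_add, h0, sub_zero] at this
  rw [← this]; abel

variable {F : ℝ × ℝ → Mink} {U : Set (ℝ × ℝ)} {φ ψ : ℝ × ℝ → ℝ}
  {α β : ℝ × ℝ → ℝ × ℝ →L[ℝ] Mink} {a : ℝ × ℝ} {c : Fin 9 → ℝ}

lemma HasForm.eventually_hasForm (h : HasForm α β c a φ ψ) :
    ∀ᶠ z in 𝓝 a, HasForm α β c z φ ψ := by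
  obtain ⟨h1, h2, h3, h4, h5⟩ := h
  have cφ := h1.continuousAt_fderiv (by norm_num)
  have cψ := h2.continuousAt_fderiv (by norm_num)
  have hj : ContinuousAt (NullChartAt.jac φ ψ) a :=
    ((cφ.clm_apply continuousAt_const).mul (cψ.clm_apply continuousAt_const)).sub
      ((cφ.clm_apply continuousAt_const).mul (cψ.clm_apply continuousAt_const))
  filter_upwards [ContDiffAt.eventually_nat (n := 3) h1, ContDiffAt.eventually_nat (n := 3) h2,
    hj.eventually_ne h3, h4.eventually_nhds, h5.eventually_nhds] with z e1 e2 e3 e4 e5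
  exact ⟨e1, e2, e3, e4, e5⟩

lemma HasForm.exists_eq_add (h : HasForm α β c a φ ψ) (hs : IsNullSplit F α β U) (ha : a ∈ U) :
    ∃ k : Mink, ∀ᶠ z in 𝓝 a, F z = k + curve (velX c) (φ z) + curve (velY c) (ψ z) := by
  have hc := eventually_eq_const_of_fderiv (a := a)
    (f := fun z => F z - (curve (velX c) (φ z) + curve (velY c) (ψ z))) (by
    filter_upwards [h.eventually_hasForm, hs.isOpen.mem_nhds ha] with z hz hzU
    obtain ⟨h1, h2, -, h4, h5⟩ := hz
    have e1 := (hasDerivAt_curve (contDiff_velX c (n := 0)).continuous (φ z)).hasFDerivAt.comp z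
      (h1.differentiableAt (by norm_num)).hasFDerivAt
    have e2 := (hasDerivAt_curve (contDiff_velY c (n := 0)).continuous (ψ z)).hasFDerivAt.comp z
      (h2.differentiableAt (by norm_num)).hasFDerivAt
    refine ((hs.hasFDerivAt z hzU).sub (e1.add e2)).congr_fderiv ?_
    rw [h4.self_of_nhds, h5.self_of_nhds]
    refine ContinuousLinearMap.ext fun v => ?_
    simp)
  refine ⟨F a - (curve (velX c) (φ a) + curve (velY c) (ψ a)), hc.mono fun z hz => ?_⟩
  rw [add_assoc, ← hz]; abel

lemma HasForm.translate (h : HasForm α β c a φ ψ) {c' : Fin 9 → ℝ} {k l : ℝ}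
    (hX : ∀ u, velX c' u = velX c (u + k)) (hY : ∀ u, velY c' u = velY c (u + l)) :
    HasForm α β c' a (fun z => φ z - k) fun z => ψ z - l := by
  obtain ⟨h1, h2, h3, h4, h5⟩ := h
  refine ⟨h1.sub contDiffAt_const, h2.sub contDiffAt_const, ?_, ?_, ?_⟩
  · simpa only [NullChartAt.jac, fderiv_sub_const] using h3
  · filter_upwards [h4] with z hz
    rw [hz, fderiv_sub_const, hX, sub_add_cancel]
  · filter_upwards [h5] with z hz
    rw [hz, fderiv_sub_const, hY, sub_add_cancel]

/-- The points near which `F` has the form given by fixed `c` and `b` form an open set. At a limit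
point in `U` the local normal form overlaps the fixed one, and uniqueness of velocities turns it
into the fixed one by translating the null coordinates; the set is thus closed in `U`. -/
theorem IsNullSplit.exists_global (hs : IsNullSplit F α β U) (hU : IsConnected U)
    (hloc : ∀ a ∈ U, ∃ c, IsCore c ∧ ∃ φ ψ, HasForm α β c a φ ψ) :
    ∃ (c : Fin 9 → ℝ) (b : Mink), IsCore c ∧ ∀ a ∈ U, ∃ φ ψ, HasForm α β c a φ ψ ∧
      ∀ᶠ z in 𝓝 a, F z = b + curve (velX c) (φ z) + curve (velY c) (ψ z) := by
  obtain ⟨a₀, ha₀⟩ := hU.nonempty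
  obtain ⟨c, hc, φ₀, ψ₀, h₀⟩ := hloc a₀ ha₀
  obtain ⟨b, hb⟩ := h₀.exists_eq_add hs ha₀
  refine ⟨c, b, hc, ?_⟩
  let S : Set (ℝ × ℝ) := {a | ∃ φ ψ, HasForm α β c a φ ψ ∧
      ∀ᶠ z in 𝓝 a, F z = b + curve (velX c) (φ z) + curve (velY c) (ψ z)}
  have hSo : IsOpen S := isOpen_iff_mem_nhds.2 fun a ⟨φ, ψ, h1, h2⟩ => by
    filter_upwards [h1.eventually_hasForm, h2.eventually_nhds] with z e1 e2 using ⟨φ, ψ, e1, e2⟩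
  refine hU.isPreconnected.subset_of_closure_inter_subset hSo ⟨a₀, ha₀, φ₀, ψ₀, h₀, hb⟩ ?_
  rintro a ⟨haS, haU⟩
  obtain ⟨c', hc', φ', ψ', h'⟩ := hloc a haU
  obtain ⟨b', hb'⟩ := h'.exists_eq_add hs haU
  obtain ⟨z, ⟨φ, ψ, h1, h2⟩, h3, h4⟩ :=
    ((mem_closure_iff_frequently.1 haS).and_eventually (h'.eventually_hasForm.and hb')).exists
  obtain ⟨σ, hX, hY⟩ := hc.isNormalVelocity
  obtain ⟨σ', hX', hY'⟩ := hc'.isNormalVelocity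
  obtain ⟨k, hk, hkX⟩ := velocity_unique hX hX' h1.1 h3.1 (fderiv_ne_zero_of_jac h1.2.2.1) (by
    filter_upwards [h1.2.2.2.1, h3.2.2.2.1] with w e1 e2
    rw [← e1, ← e2])
  obtain ⟨l, hl, hlY⟩ := velocity_unique hY hY' h1.2.1 h3.2.1
    (fderiv_ne_zero_of_jac (φ := ψ) (ψ := φ) (by rw [jac_swap, neg_ne_zero]; exact h1.2.2.1)) (by
    filter_upwards [h1.2.2.2.2, h3.2.2.2.2] with w e1 e2
    rw [← e1, ← e2])
  have cX := curve_add_of_eq (contDiff_velX c (n := 0)).continuous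
    (contDiff_velX c' (n := 0)).continuous hkX
  have cY := curve_add_of_eq (contDiff_velY c (n := 0)).continuous
    (contDiff_velY c' (n := 0)).continuous hlY
  refine ⟨_, _, h'.translate hkX hlY, ?_⟩
  -- The constants are compared at the common point z. Both descriptions of F hold there.
  have hbb : b' + curve (velX c') k + curve (velY c') l = b := by
    have e := h2.self_of_nhds
    rw [h4, hk, hl, cX, cY] at e
    have : b' + curve (velX c') k + curve (velY c') l + (curve (velX c) (φ z) + curve (velY c) (ψ z))
        = b + (curve (velX c) (φ z) + curve (velY c) (ψ z)) := by
      rw [← add_assoc b, ← e]; abel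
    exact add_right_cancel this
  filter_upwards [hb'] with w hw
  have e1 := cX (φ' w - k)
  have e2 := cY (ψ' w - l)
  rw [sub_add_cancel] at e1 e2
  rw [hw, e1, e2, ← hbb]; abel

end PlanarCurvature
end

noncomputable section

namespace PlanarCurvature

/-! ### Existence of the splitting -/

variable {F : ℝ × ℝ → Mink} {U : Set (ℝ × ℝ)} {z : ℝ × ℝ}

lemma d2_eq_fderiv (hF : ContDiffAt ℝ 4 F z) (v w : ℝ × ℝ) :
    d2 F z v w = fderiv ℝ (fderiv ℝ F) z v w := by
  have h : DifferentiableAt ℝ (fderiv ℝ F) z :=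
    (hF.fderiv_right (m := 3) (by norm_num)).differentiableAt (by norm_num)
  have h2 : HasFDerivAt (fun q => d1 F q w) ((ContinuousLinearMap.apply ℝ Mink w).comp
      (fderiv ℝ (fderiv ℝ F) z)) z :=
    (ContinuousLinearMap.apply ℝ Mink w).hasFDerivAt.comp z h.hasFDerivAt
  rw [d2, h2.fderiv]; rfl

lemma d2_symm (hF : ContDiffAt ℝ 4 F z) (v w : ℝ × ℝ) : d2 F z v w = d2 F z w v := by
  rw [d2_eq_fderiv hF, d2_eq_fderiv hF]
  exact hF.isSymmSndFDerivAt (by simp; norm_num) v w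

lemma contDiffAt_d1 (hF : ContDiffAt ℝ 4 F z) (w : ℝ × ℝ) : ContDiffAt ℝ 3 (fun z => d1 F z w) z :=
  (hF.fderiv_right (m := 3) (by norm_num)).clm_apply contDiffAt_const

/-- The form `A dx + B dy`. -/
def coordForm (A B : ℝ × ℝ → Mink) (z : ℝ × ℝ) : ℝ × ℝ →L[ℝ] Mink :=
  (ContinuousLinearMap.fst ℝ ℝ ℝ).smulRight (A z) + (ContinuousLinearMap.snd ℝ ℝ ℝ).smulRight (B z)

lemma coordForm_apply (A B : ℝ × ℝ → Mink) (z v : ℝ × ℝ) :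
    coordForm A B z v = v.1 • A z + v.2 • B z := rfl

lemma contDiffAt_coordForm {A B : ℝ × ℝ → Mink} (hA : ContDiffAt ℝ 3 A z)
    (hB : ContDiffAt ℝ 3 B z) : ContDiffAt ℝ 3 (coordForm A B) z :=
  (contDiffAt_const.smulRight hA).add (contDiffAt_const.smulRight hB)

lemma coordForm_closed {A B : ℝ × ℝ → Mink} (hA : ContDiffAt ℝ 3 A z) (hB : ContDiffAt ℝ 3 B z)
    (h : fderiv ℝ A z (0, 1) = fderiv ℝ B z (1, 0)) (v w : ℝ × ℝ) :
    fderiv ℝ (coordForm A B) z v w = fderiv ℝ (coordForm A B) z w v := by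
  have key : ∀ v w : ℝ × ℝ, fderiv ℝ (coordForm A B) z v w =
      w.1 • fderiv ℝ A z v + w.2 • fderiv ℝ B z v := fun v w => by
    have h1 := ((contDiffAt_coordForm hA hB).differentiableAt (by norm_num)).hasFDerivAt
    have h2 : HasFDerivAt (fun z => coordForm A B z w) ((ContinuousLinearMap.apply ℝ Mink w).comp
      (fderiv ℝ (coordForm A B) z)) z :=
      (ContinuousLinearMap.apply ℝ Mink w).hasFDerivAt.comp z h1
    have h3 : HasFDerivAt (fun z => coordForm A B z w) (w.1 • fderiv ℝ A z + w.2 • fderiv ℝ B z) z :=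
      ((hA.differentiableAt (by norm_num)).hasFDerivAt.const_smul w.1).add
      ((hB.differentiableAt (by norm_num)).hasFDerivAt.const_smul w.2)
    exact DFunLike.congr_fun (h2.unique h3) v
  have e : ∀ (A : ℝ × ℝ → Mink) (v : ℝ × ℝ),
      fderiv ℝ A z v = v.1 • fderiv ℝ A z (1, 0) + v.2 • fderiv ℝ A z (0, 1) := fun A v => by
    rw [← map_smul, ← map_smul, ← map_add]; simp
  rw [key, key, e A v, e B v, e A w, e B w, h]
  module

/-- Only the first form needs a closedness hypothesis, because the complement dF - (A dx + B dy)
inherits it from the symmetry of second derivatives. -/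
lemma isNullSplit_of_coord (hU : IsOpen U) (hF : ContDiffOn ℝ 4 F U) {A B : ℝ × ℝ → Mink}
    (hA : ∀ z ∈ U, ContDiffAt ℝ 3 A z) (hB : ∀ z ∈ U, ContDiffAt ℝ 3 B z)
    (hc : ∀ z ∈ U, fderiv ℝ A z (0, 1) = fderiv ℝ B z (1, 0))
    (hn : ∀ z ∈ U, mink (A z) (A z) = 0 ∧ mink (A z) (B z) = 0 ∧ mink (B z) (B z) = 0)
    (hn' : ∀ z ∈ U, mink (d1 F z (1, 0) - A z) (d1 F z (1, 0) - A z) = 0 ∧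
      mink (d1 F z (1, 0) - A z) (d1 F z (0, 1) - B z) = 0 ∧
      mink (d1 F z (0, 1) - B z) (d1 F z (0, 1) - B z) = 0)
    (hi : ∀ z ∈ U, ∀ v : ℝ × ℝ, v.1 • A z + v.2 • B z = 0 → d1 F z v = 0 → v = 0) :
    ∃ α β, IsNullSplit F α β U := by
  have hF' : ∀ z ∈ U, ContDiffAt ℝ 4 F z := fun z hz => hF.contDiffAt (hU.mem_nhds hz)
  have e : ∀ z v, d1 F z v = v.1 • d1 F z (1, 0) + v.2 • d1 F z (0, 1) := fun z v => by
    simp only [d1]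
    rw [← map_smul, ← map_smul, ← map_add]; simp
  have hA' : ∀ z ∈ U, ContDiffAt ℝ 3 (fun z => d1 F z (1, 0) - A z) z := fun z hz =>
    (contDiffAt_d1 (hF' z hz) _).sub (hA z hz)
  have hB' : ∀ z ∈ U, ContDiffAt ℝ 3 (fun z => d1 F z (0, 1) - B z) z := fun z hz =>
    (contDiffAt_d1 (hF' z hz) _).sub (hB z hz)
  have hnull : ∀ x y : Mink, mink x x = 0 ∧ mink x y = 0 ∧ mink y y = 0 → ∀ s t : ℝ,
      mink (s • x + t • y) (s • x + t • y) = 0 := fun x y ⟨h1, h2, h3⟩ s t => by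
    simp only [mink, Pi.add_apply, Pi.smul_apply, smul_eq_mul] at *
    linear_combination s ^ 2 * h1 + 2 * s * t * h2 + t ^ 2 * h3
  have hsum : ∀ z, coordForm A B z + coordForm (fun z => d1 F z (1, 0) - A z)
      (fun z => d1 F z (0, 1) - B z) z = fderiv ℝ F z := fun z => by
    refine ContinuousLinearMap.ext fun v => ?_
    rw [add_apply, coordForm_apply, coordForm_apply]
    refine Eq.trans ?_ (e z v).symm
    module
  refine ⟨coordForm A B, coordForm (fun z => d1 F z (1, 0) - A z) (fun z => d1 F z (0, 1) - B z),
    hU, fun z hz => (contDiffAt_coordForm (hA z hz) (hB z hz)).contDiffWithinAt,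
    fun z hz => (contDiffAt_coordForm (hA' z hz) (hB' z hz)).contDiffWithinAt, fun z hz => ?_,
    fun z hz => coordForm_closed (hA z hz) (hB z hz) (hc z hz),
    fun z hz => coordForm_closed (hA' z hz) (hB' z hz) ?_,
    fun z hz v => hnull _ _ (hn z hz) _ _, fun z hz v => hnull _ _ (hn' z hz) _ _,
    fun z hz v h1 h2 => hi z hz v h1 ?_⟩
  · rw [hsum]
    exact ((hF' z hz).differentiableAt (by norm_num)).hasFDerivAt
  · have hd : ∀ w, DifferentiableAt ℝ (fun z => d1 F z w) z := fun w =>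
      (contDiffAt_d1 (hF' z hz) w).differentiableAt (by norm_num)
    have e1 := ((hd (1, 0)).hasFDerivAt.sub
      ((hA z hz).differentiableAt (by norm_num)).hasFDerivAt).fderiv
    have e2 := ((hd (0, 1)).hasFDerivAt.sub
      ((hB z hz).differentiableAt (by norm_num)).hasFDerivAt).fderiv
    have e3 : fderiv ℝ (fun z => d1 F z (1, 0)) z (0, 1) = fderiv ℝ (fun z => d1 F z (0, 1)) z (1, 0) :=
      d2_symm (hF' z hz) (0, 1) (1, 0)
    have e4 := hc z hz
    refine (DFunLike.congr_fun e1 (0, 1)).trans (Eq.trans ?_ (DFunLike.congr_fun e2 (1, 0)).symm)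
    simp only [sub_apply, e3, e4]
  · rw [d1, ← hsum, add_apply, h2, add_zero]; exact h1

/-- In conformal coordinates the splitting is the one into dx + dy and dx - dy, with coefficients
half of F_x ± F_y. The wave equation is closedness, the conformal relations give light-like values,
and regularity keeps the kernels disjoint even at singular points. -/
theorem IsGeneralizedTimelikeMinimal.exists_isNullSplit (h : IsGeneralizedTimelikeMinimal F U) :
    ∃ α β, IsNullSplit F α β U := by
  have hF' : ∀ z ∈ U, ContDiffAt ℝ 4 F z := fun z hz => h.contDiffOn.contDiffAt (h.isOpen.mem_nhds hz)
  have hA : ∀ z ∈ U, ContDiffAt ℝ 3 (fun z => (1 / 2 : ℝ) • d1 F z (1, 1)) z := fun z hz =>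
    (contDiffAt_d1 (hF' z hz) _).const_smul _
  have e : ∀ z v, d1 F z v = v.1 • d1 F z (1, 0) + v.2 • d1 F z (0, 1) := fun z v => by
    simp only [d1]
    rw [← map_smul, ← map_smul, ← map_add]; simp
  refine isNullSplit_of_coord h.isOpen h.contDiffOn hA hA (fun z hz => ?_) (fun z hz => ?_)
    (fun z hz => ?_) fun z hz v h1 h2 => ?_
  · have hw := h.wave z hz
    have hs := d2_symm (hF' z hz) (1, 0) (0, 1)
    have hd := (contDiffAt_d1 (hF' z hz) (1, 1)).differentiableAt (by norm_num)
    have key : ∀ v, fderiv ℝ (fun z => (1 / 2 : ℝ) • d1 F z (1, 1)) z v =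
        (1 / 2 : ℝ) • (d2 F z v (1, 0) + d2 F z v (0, 1)) := fun v => by
      rw [show (fun z => (1 / 2 : ℝ) • d1 F z (1, 1)) = (1 / 2 : ℝ) • fun z => d1 F z (1, 1) from rfl,
        (hd.hasFDerivAt.const_smul (1 / 2 : ℝ)).fderiv, d2_eq_fderiv (hF' z hz),
        d2_eq_fderiv (hF' z hz), ← map_add]
      simp only [smul_apply]
      congr 1
      rw [show ((1, 0) + (0, 1) : ℝ × ℝ) = (1, 1) by simp, ← d2_eq_fderiv (hF' z hz)]
      rfl
    rw [key, key, hw, hs, add_comm]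
  · have h1 := h.conformal z hz
    have : mink ((1 / 2 : ℝ) • d1 F z (1, 1)) ((1 / 2 : ℝ) • d1 F z (1, 1)) = 0 := by
      rw [e z (1, 1)]
      simp only [firstForm, mink, Pi.add_apply, Pi.smul_apply, smul_eq_mul] at h1 ⊢
      linear_combination 1 / 4 * h1.1 + 1 / 2 * h1.2
    exact ⟨this, this, this⟩
  · have h1 := h.conformal z hz
    rw [e z (1, 1)]
    simp only [firstForm, mink, Pi.add_apply, Pi.sub_apply, Pi.smul_apply, smul_eq_mul] at h1 ⊢
    refine ⟨?_, ?_, ?_⟩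
    · linear_combination 1 / 4 * h1.1 - 1 / 2 * h1.2
    · linear_combination -1 / 4 * h1.1 + 1 / 2 * h1.2
    · linear_combination 1 / 4 * h1.1 - 1 / 2 * h1.2
  · have hr := h.regular z hz
    rw [← add_smul, smul_smul, smul_eq_zero, or_iff_left hr.1] at h1
    have h3 : v = ((v.1 - v.2) / 2) • ((1, -1) : ℝ × ℝ) := by ext <;> simp <;> linarith
    have h4 : d1 F z v = ((v.1 - v.2) / 2) • d1 F z (1, -1) := by
      conv_lhs => rw [h3]
      simp only [d1, map_smul]
    rw [h4, smul_eq_zero, or_iff_left hr.2] at h2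
    rw [h3, h2, zero_smul]

end PlanarCurvature
end

noncomputable section

namespace PlanarCurvature

/-! ### The splitting of a timelike minimal surface -/

/-- The Lorentzian vector product. -/
def mcross (a b : Mink) : Mink :=
  ![a 1 * b 2 - a 2 * b 1, a 2 * b 0 - a 0 * b 2, -(a 0 * b 1 - a 1 * b 0)]

lemma mink_cross_left (a b : Mink) : mink a (mcross a b) = 0 := by
  simp [mink, mcross]; ring

lemma mink_cross_right (a b : Mink) : mink b (mcross a b) = 0 := by
  simp [mink, mcross]; ring

lemma mink_cross_self (a b : Mink) :
    mink (mcross a b) (mcross a b) = -(mink a a * mink b b - mink a b ^ 2) := by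
  simp [mink, mcross]; ring

lemma eq_zero_of_mink {a b x : Mink} (hg : mink a a * mink b b - mink a b ^ 2 ≠ 0)
    (ha : mink x a = 0) (hb : mink x b = 0) (hn : mink x (mcross a b) = 0) : x = 0 := by
  have key : ∀ i, (mink a a * mink b b - mink a b ^ 2) * x i = 0 := by
    intro i
    have : (mink a a * mink b b - mink a b ^ 2) * x i =
        (mink x a * mink b b - mink x b * mink a b) * a i +
        (mink x b * mink a a - mink x a * mink a b) * b i -
        mink x (mcross a b) * mcross a b i := by
      fin_cases i <;> simp [mink, mcross] <;> ring
    rw [this, ha, hb, hn]; ring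
  ext i
  exact (mul_eq_zero.1 (key i)).resolve_left hg

lemma mink_add_left (a b c : Mink) : mink (a + b) c = mink a c + mink b c := by
  simp [mink]; ring

lemma mink_sub_left (a b c : Mink) : mink (a - b) c = mink a c - mink b c := by
  simp [mink]; ring

lemma mink_smul_left (a c : Mink) (r : ℝ) : mink (r • a) c = r * mink a c := by
  simp [mink]; ring

lemma mink_comm (a b : Mink) : mink a b = mink b a := by
  simp [mink]; ring

variable {F : ℝ × ℝ → Mink} {U : Set (ℝ × ℝ)} {z : ℝ × ℝ}

/-- The area density of a timelike surface. -/
def area (F : ℝ × ℝ → Mink) (z : ℝ × ℝ) : ℝ := √(-gramDet F z)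

/-- The first component of the Hodge dual of the differential. -/
def starX (F : ℝ × ℝ → Mink) (z : ℝ × ℝ) : Mink := (area F z)⁻¹ •
  (firstForm F z (1, 0) (1, 0) • d1 F z (0, 1) - firstForm F z (1, 0) (0, 1) • d1 F z (1, 0))

/-- The second component of the Hodge dual of the differential. -/
def starY (F : ℝ × ℝ → Mink) (z : ℝ × ℝ) : Mink := (area F z)⁻¹ •
  (firstForm F z (1, 0) (0, 1) • d1 F z (0, 1) - firstForm F z (0, 1) (0, 1) • d1 F z (1, 0))

lemma area_sq (h : TimelikeAt F z) : area F z ^ 2 = -gramDet F z :=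
  Real.sq_sqrt (by rw [TimelikeAt] at h; linarith)

lemma area_pos (h : TimelikeAt F z) : 0 < area F z :=
  Real.sqrt_pos.2 (by rw [TimelikeAt] at h; linarith)

lemma contDiffAt_mink {A B : ℝ × ℝ → Mink} (hA : ContDiffAt ℝ 3 A z) (hB : ContDiffAt ℝ 3 B z) :
    ContDiffAt ℝ 3 (fun z => mink (A z) (B z)) z := by
  have hA := contDiffAt_pi.1 hA
  have hB := contDiffAt_pi.1 hB
  exact (((hA 0).mul (hB 0)).add ((hA 1).mul (hB 1))).sub ((hA 2).mul (hB 2))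

lemma contDiffAt_firstForm (hF : ContDiffAt ℝ 4 F z) (v w : ℝ × ℝ) :
    ContDiffAt ℝ 3 (fun z => firstForm F z v w) z :=
  contDiffAt_mink (contDiffAt_d1 hF v) (contDiffAt_d1 hF w)

lemma contDiffAt_area (hF : ContDiffAt ℝ 4 F z) (h : TimelikeAt F z) : ContDiffAt ℝ 3 (area F) z := by
  refine ContDiffAt.sqrt (ContDiffAt.neg (ContDiffAt.sub (ContDiffAt.mul ?_ ?_) ?_))
    (by rw [TimelikeAt] at h; linarith)
  · exact contDiffAt_firstForm hF _ _
  · exact contDiffAt_firstForm hF _ _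
  · exact (contDiffAt_firstForm hF _ _).pow 2

lemma contDiffAt_starX (hF : ContDiffAt ℝ 4 F z) (h : TimelikeAt F z) :
    ContDiffAt ℝ 3 (starX F) z :=
  ((contDiffAt_area hF h).inv (area_pos h).ne').smul
    (((contDiffAt_firstForm hF _ _).smul (contDiffAt_d1 hF _)).sub
      ((contDiffAt_firstForm hF _ _).smul (contDiffAt_d1 hF _)))

lemma contDiffAt_starY (hF : ContDiffAt ℝ 4 F z) (h : TimelikeAt F z) :
    ContDiffAt ℝ 3 (starY F) z :=
  ((contDiffAt_area hF h).inv (area_pos h).ne').smul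
    (((contDiffAt_firstForm hF _ _).smul (contDiffAt_d1 hF _)).sub
      ((contDiffAt_firstForm hF _ _).smul (contDiffAt_d1 hF _)))

lemma hasFDerivAt_mink {A B : ℝ × ℝ → Mink} (hA : DifferentiableAt ℝ A z)
    (hB : DifferentiableAt ℝ B z) (v : ℝ × ℝ) : fderiv ℝ (fun z => mink (A z) (B z)) z v =
      mink (fderiv ℝ A z v) (B z) + mink (A z) (fderiv ℝ B z v) := by
  have hd : DifferentiableAt ℝ (fun z => mink (A z) (B z)) z := by
    rw [differentiableAt_pi] at hA hB
    exact (((hA 0).mul (hB 0)).add ((hA 1).mul (hB 1))).sub ((hA 2).mul (hB 2))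
  have h1 : HasDerivAt _ _ (0 : ℝ) := hd.hasFDerivAt.hasLineDerivAt v
  have h2 := hasDerivAt_mink (u := (0 : ℝ)) (hA.hasFDerivAt.hasLineDerivAt v)
    (hB.hasFDerivAt.hasLineDerivAt v)
  simp only [zero_smul, add_zero] at h2
  exact h1.unique h2

lemma fderiv_smul_apply {f : ℝ × ℝ → ℝ} {A : ℝ × ℝ → Mink} (hf : DifferentiableAt ℝ f z)
    (hA : DifferentiableAt ℝ A z) (v : ℝ × ℝ) : fderiv ℝ (fun z => f z • A z) z v =
      f z • fderiv ℝ A z v + fderiv ℝ f z v • A z := by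
  rw [show (fun z => f z • A z) = f • A from rfl, (hf.hasFDerivAt.smul hA.hasFDerivAt).fderiv]
  simp

/-- The Hodge dual of the differential of a timelike minimal surface is closed. -/
lemma IsTimelikeMinimal.star_closed (h : IsTimelikeMinimal F U) (hz : z ∈ U) :
    fderiv ℝ (starX F) z (0, 1) = fderiv ℝ (starY F) z (1, 0) := by
  have hF : ∀ᶠ z in 𝓝 z, ContDiffAt ℝ 4 F z := by
    filter_upwards [h.isOpen.mem_nhds hz] with w hw using h.contDiffOn.contDiffAt (h.isOpen.mem_nhds hw)
  have ht : ∀ᶠ z in 𝓝 z, TimelikeAt F z := by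
    filter_upwards [h.isOpen.mem_nhds hz] with w hw using h.timelike w hw
  have hF0 := hF.self_of_nhds
  have ht0 := ht.self_of_nhds
  have hD := (area_pos ht0).ne'
  have da := (contDiffAt_d1 hF0 (1, 0)).differentiableAt (by norm_num)
  have db := (contDiffAt_d1 hF0 (0, 1)).differentiableAt (by norm_num)
  have dR := (contDiffAt_starX hF0 ht0).differentiableAt (by norm_num)
  have dP := (contDiffAt_starY hF0 ht0).differentiableAt (by norm_num)
  have dD := (contDiffAt_area hF0 ht0).differentiableAt (by norm_num)
  have dFF : ∀ v w, DifferentiableAt ℝ (fun z => firstForm F z v w) z := fun v w =>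
    (contDiffAt_firstForm hF0 v w).differentiableAt (by norm_num)
  have hs := d2_symm hF0 (0, 1) (1, 0)
  -- the dual forms in terms of the differential
  have eR : ∀ z, TimelikeAt F z → area F z • starX F z = firstForm F z (1, 0) (1, 0) • d1 F z (0, 1) -
      firstForm F z (1, 0) (0, 1) • d1 F z (1, 0) := fun z hz => by
    rw [starX, smul_smul, mul_inv_cancel₀ (area_pos hz).ne', one_smul]
  have eP : ∀ z, TimelikeAt F z → area F z • starY F z = firstForm F z (1, 0) (0, 1) • d1 F z (0, 1) -
      firstForm F z (0, 1) (0, 1) • d1 F z (1, 0) := fun z hz => by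
    rw [starY, smul_smul, mul_inv_cancel₀ (area_pos hz).ne', one_smul]
  have eRy : area F z • fderiv ℝ (starX F) z (0, 1) + fderiv ℝ (area F) z (0, 1) • starX F z =
      (firstForm F z (1, 0) (1, 0) • d2 F z (0, 1) (0, 1) +
        fderiv ℝ (fun z => firstForm F z (1, 0) (1, 0)) z (0, 1) • d1 F z (0, 1)) -
      (firstForm F z (1, 0) (0, 1) • d2 F z (0, 1) (1, 0) +
        fderiv ℝ (fun z => firstForm F z (1, 0) (0, 1)) z (0, 1) • d1 F z (1, 0)) := by
    have e1 := fderiv_smul_apply dD dR (0, 1)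
    have he : (fun z => area F z • starX F z) =ᶠ[𝓝 z] _ := ht.mono fun z hz => eR z hz
    rw [he.fderiv_eq] at e1
    rw [← e1]
    refine (DFunLike.congr_fun (((dFF (1, 0) (1, 0)).smul db).hasFDerivAt.sub
      ((dFF (1, 0) (0, 1)).smul da).hasFDerivAt).fderiv (0, 1)).trans ?_
    rw [sub_apply]
    exact congrArg₂ _ (fderiv_smul_apply (dFF (1, 0) (1, 0)) db (0, 1))
      (fderiv_smul_apply (dFF (1, 0) (0, 1)) da (0, 1))
  have ePx : area F z • fderiv ℝ (starY F) z (1, 0) + fderiv ℝ (area F) z (1, 0) • starY F z =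
      (firstForm F z (1, 0) (0, 1) • d2 F z (1, 0) (0, 1) +
        fderiv ℝ (fun z => firstForm F z (1, 0) (0, 1)) z (1, 0) • d1 F z (0, 1)) -
      (firstForm F z (0, 1) (0, 1) • d2 F z (1, 0) (1, 0) +
        fderiv ℝ (fun z => firstForm F z (0, 1) (0, 1)) z (1, 0) • d1 F z (1, 0)) := by
    have e1 := fderiv_smul_apply dD dP (1, 0)
    have he : (fun z => area F z • starY F z) =ᶠ[𝓝 z] _ := ht.mono fun z hz => eP z hz
    rw [he.fderiv_eq] at e1
    rw [← e1]
    refine (DFunLike.congr_fun (((dFF (1, 0) (0, 1)).smul db).hasFDerivAt.sub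
      ((dFF (0, 1) (0, 1)).smul da).hasFDerivAt).fderiv (1, 0)).trans ?_
    rw [sub_apply]
    exact congrArg₂ _ (fderiv_smul_apply (dFF (1, 0) (0, 1)) db (1, 0))
      (fderiv_smul_apply (dFF (0, 1) (0, 1)) da (1, 0))
  -- derivatives of the first fundamental form
  have eE : fderiv ℝ (fun z => firstForm F z (1, 0) (1, 0)) z (0, 1) =
      2 * mink (d2 F z (1, 0) (0, 1)) (d1 F z (1, 0)) := by
    refine (hasFDerivAt_mink da da (0, 1)).trans ?_
    rw [← d2_symm hF0 (0, 1) (1, 0), d2]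
    simp only [mink]; ring
  have eFy : fderiv ℝ (fun z => firstForm F z (1, 0) (0, 1)) z (0, 1) =
      mink (d2 F z (1, 0) (0, 1)) (d1 F z (0, 1)) + mink (d2 F z (0, 1) (0, 1)) (d1 F z (1, 0)) := by
    rw [mink_comm (d2 F z (0, 1) (0, 1))]
    refine (hasFDerivAt_mink da db (0, 1)).trans ?_
    rw [← d2_symm hF0 (0, 1) (1, 0)]; rfl
  have eFx : fderiv ℝ (fun z => firstForm F z (1, 0) (0, 1)) z (1, 0) =
      mink (d2 F z (1, 0) (1, 0)) (d1 F z (0, 1)) + mink (d2 F z (1, 0) (0, 1)) (d1 F z (1, 0)) := by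
    rw [mink_comm (d2 F z (1, 0) (0, 1))]
    exact hasFDerivAt_mink da db (1, 0)
  have eG : fderiv ℝ (fun z => firstForm F z (0, 1) (0, 1)) z (1, 0) =
      2 * mink (d2 F z (1, 0) (0, 1)) (d1 F z (0, 1)) := by
    refine (hasFDerivAt_mink db db (1, 0)).trans ?_
    rw [d2]
    simp only [mink]; ring
  have eEx : fderiv ℝ (fun z => firstForm F z (1, 0) (1, 0)) z (1, 0) =
      2 * mink (d2 F z (1, 0) (1, 0)) (d1 F z (1, 0)) := by
    refine (hasFDerivAt_mink da da (1, 0)).trans ?_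
    rw [d2]
    simp only [mink]; ring
  have eGy : fderiv ℝ (fun z => firstForm F z (0, 1) (0, 1)) z (0, 1) =
      2 * mink (d2 F z (0, 1) (0, 1)) (d1 F z (0, 1)) := by
    refine (hasFDerivAt_mink db db (0, 1)).trans ?_
    rw [d2]
    simp only [mink]; ring
  have eD : ∀ v, 2 * (area F z * fderiv ℝ (area F) z v) =
      2 * (firstForm F z (1, 0) (0, 1) * fderiv ℝ (fun z => firstForm F z (1, 0) (0, 1)) z v) -
      (firstForm F z (1, 0) (1, 0) * fderiv ℝ (fun z => firstForm F z (0, 1) (0, 1)) z v +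
        fderiv ℝ (fun z => firstForm F z (1, 0) (1, 0)) z v * firstForm F z (0, 1) (0, 1)) := fun v => by
    have he : (fun z => area F z * area F z) =ᶠ[𝓝 z] fun z => firstForm F z (1, 0) (0, 1) *
        firstForm F z (1, 0) (0, 1) - firstForm F z (1, 0) (1, 0) * firstForm F z (0, 1) (0, 1) :=
      ht.mono fun z hz => by
        have := area_sq hz
        rw [gramDet] at this
        linear_combination this
    have h1 := (dD.hasFDerivAt.mul dD.hasFDerivAt).congr_of_eventuallyEq he.symm
    have h2 := ((dFF (1, 0) (0, 1)).hasFDerivAt.mul (dFF (1, 0) (0, 1)).hasFDerivAt).sub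
      ((dFF (1, 0) (1, 0)).hasFDerivAt.mul (dFF (0, 1) (0, 1)).hasFDerivAt)
    have h3 := DFunLike.congr_fun (h1.unique h2) v
    simp only [sub_apply, add_apply, smul_apply, smul_eq_mul] at h3
    linear_combination h3
  have tx := eD (1, 0)
  have ty := eD (0, 1)
  have hg := area_sq ht0
  have hR := eR z ht0
  have hP := eP z ht0
  rw [eFx, eG, eEx] at tx
  rw [eFy, eE, eGy] at ty
  rw [eE, eFy] at eRy
  rw [eFx, eG] at ePx
  rw [hs] at eRy
  set D := area F z
  set a := d1 F z (1, 0) with ha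
  set b := d1 F z (0, 1) with hb
  rw [gramDet] at hg
  have hE : firstForm F z (1, 0) (1, 0) = mink a a := rfl
  have hM : firstForm F z (1, 0) (0, 1) = mink a b := rfl
  have hG : firstForm F z (0, 1) (0, 1) = mink b b := rfl
  simp only [hE, hM, hG] at hg tx ty eRy ePx hR hP
  have hg' : mink a a * mink b b - mink a b ^ 2 ≠ 0 := by
    rw [← neg_ne_zero, ← hg]; exact pow_ne_zero 2 hD
  -- The difference is tested against the two tangent vectors and their vector product. The
  -- tangential components vanish by the derivative of the area density, with no condition on the
  -- surface; the normal component is the mean curvature.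
  refine (sub_eq_zero.1 (eq_zero_of_mink hg' ?_ ?_ ?_)).symm
  all_goals refine (mul_eq_zero.1 (?_ : D * _ = 0)).resolve_left hD
  · have ra : mink (starX F z) a = 0 := (mul_eq_zero.1 (?_ : D * _ = 0)).resolve_left hD
    have pa : mink (starY F z) a = D := mul_left_cancel₀ hD ?_
    · have r1 := congrArg (mink · a) eRy
      have p1 := congrArg (mink · a) ePx
      simp only [mink_add_left, mink_smul_left, mink_sub_left, mink_smul_left, mink_add_left, mink_comm b a, ra, pa] at r1 p1
      rw [mink_sub_left]
      linear_combination p1 - r1 - tx / 2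
    · have p2 := congrArg (mink · a) hP
      simp only [mink_sub_left, mink_smul_left, mink_comm b a] at p2
      linear_combination p2 - hg
    · have r2 := congrArg (mink · a) hR
      simp only [mink_sub_left, mink_smul_left, mink_comm b a] at r2
      linear_combination r2
  · have ra : mink (starX F z) b = -D := mul_left_cancel₀ hD ?_
    have pa : mink (starY F z) b = 0 := (mul_eq_zero.1 (?_ : D * _ = 0)).resolve_left hD
    · have r1 := congrArg (mink · b) eRy
      have p1 := congrArg (mink · b) ePx
      simp only [mink_add_left, mink_smul_left, mink_sub_left, mink_smul_left, mink_add_left, ra, pa] at r1 p1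
      rw [mink_sub_left]
      linear_combination p1 - r1 - ty / 2
    · have p2 := congrArg (mink · b) hP
      simp only [mink_sub_left, mink_smul_left] at p2
      linear_combination p2
    · have r2 := congrArg (mink · b) hR
      simp only [mink_sub_left, mink_smul_left] at r2
      linear_combination r2 + hg
  · have ra : mink (starX F z) (mcross a b) = 0 := (mul_eq_zero.1 (?_ : D * _ = 0)).resolve_left hD
    have pa : mink (starY F z) (mcross a b) = 0 := (mul_eq_zero.1 (?_ : D * _ = 0)).resolve_left hD
    · have r1 := congrArg (mink · (mcross a b)) eRy
      have p1 := congrArg (mink · (mcross a b)) ePx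
      simp only [mink_add_left, mink_smul_left, mink_sub_left, mink_smul_left, mink_add_left, mink_cross_left,
        mink_cross_right, ra, pa] at r1 p1
      rw [mink_sub_left]
      -- The square of the vector product is minus the Gram determinant, D², so dividing by the area
      -- density gives a unit normal.
      have hm := h.minimal z hz (D⁻¹ • mcross a b) ⟨?_, fun v => ?_⟩
      · rw [meanCurvature, div_eq_zero_iff, or_iff_left (by
          rw [gramDet]; exact mul_ne_zero two_ne_zero hg')] at hm
        simp only [secondForm, mink_comm _ (D⁻¹ • _), mink_smul_left, hE, hM, hG] at hm
        simp only [mink_comm (mcross a b)] at hm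
        have hm' : D * D⁻¹ = 1 := mul_inv_cancel₀ hD
        linear_combination p1 - r1 - D * hm + (mink (d2 F z (1, 0) (1, 0)) (mcross a b) * mink b b
          - 2 * mink (d2 F z (1, 0) (0, 1)) (mcross a b) * mink a b +
          mink (d2 F z (0, 1) (0, 1)) (mcross a b) * mink a a) * hm'
      · rw [mink_smul_left, mink_comm, mink_smul_left, mink_cross_self, ← hg]
        field_simp
      · have : d1 F z v = v.1 • a + v.2 • b := by
          simp only [ha, hb, d1]
          rw [← map_smul, ← map_smul, ← map_add]; simp
        rw [this, mink_comm, mink_smul_left, mink_comm, mink_add_left, mink_smul_left, mink_smul_left,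
          mink_cross_left, mink_cross_right]
        ring
    · have p2 := congrArg (mink · (mcross a b)) hP
      simp only [mink_sub_left, mink_smul_left, mink_cross_left, mink_cross_right] at p2
      linear_combination p2
    · have r2 := congrArg (mink · (mcross a b)) hR
      simp only [mink_sub_left, mink_smul_left, mink_cross_left, mink_cross_right] at r2
      linear_combination r2

/-- On a Lorentzian surface ⋆⋆ = 1, and the forms (dF ± ⋆dF) / 2 take values in the two light-like
directions of the tangent plane. They are closed by `IsTimelikeMinimal.star_closed`. -/
theorem IsTimelikeMinimal.exists_isNullSplit (h : IsTimelikeMinimal F U) :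
    ∃ α β, IsNullSplit F α β U := by
  have hF : ∀ z ∈ U, ContDiffAt ℝ 4 F z := fun z hz =>
    h.contDiffOn.contDiffAt (h.isOpen.mem_nhds hz)
  have ha : ∀ z ∈ U, ContDiffAt ℝ 3 (fun z => (1 / 2 : ℝ) • (d1 F z (1, 0) + starX F z)) z :=
    fun z hz => ((contDiffAt_d1 (hF z hz) _).add (contDiffAt_starX (hF z hz) (h.timelike z hz))).const_smul _
  have hb : ∀ z ∈ U, ContDiffAt ℝ 3 (fun z => (1 / 2 : ℝ) • (d1 F z (0, 1) + starY F z)) z :=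
    fun z hz => ((contDiffAt_d1 (hF z hz) _).add (contDiffAt_starY (hF z hz) (h.timelike z hz))).const_smul _
  have key : ∀ z ∈ U, ∀ e ∈ ({1, -1} : Set ℝ),
      mink (d1 F z (1, 0) + e • starX F z) (d1 F z (1, 0) + e • starX F z) = 0 ∧
      mink (d1 F z (1, 0) + e • starX F z) (d1 F z (0, 1) + e • starY F z) = 0 ∧
      mink (d1 F z (0, 1) + e • starY F z) (d1 F z (0, 1) + e • starY F z) = 0 := by
    intro z hz e he
    have he : e ^ 2 = 1 := by
      rcases he with rfl | he
      · norm_num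
      · rw [mem_singleton_iff.1 he]; norm_num
    have hg := area_sq (h.timelike z hz)
    have hD := (area_pos (h.timelike z hz)).ne'
    have hi : area F z * (area F z)⁻¹ = 1 := mul_inv_cancel₀ hD
    have hi2 : (area F z)⁻¹ ^ 2 * -gramDet F z = 1 := by rw [← hg]; field_simp
    rw [gramDet] at hg hi2
    have hE : firstForm F z (1, 0) (1, 0) = mink (d1 F z (1, 0)) (d1 F z (1, 0)) := rfl
    have hM : firstForm F z (1, 0) (0, 1) = mink (d1 F z (1, 0)) (d1 F z (0, 1)) := rfl
    have hG : firstForm F z (0, 1) (0, 1) = mink (d1 F z (0, 1)) (d1 F z (0, 1)) := rfl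
    simp only [starX, starY, hE, hM, hG] at hg hi2 ⊢
    generalize (area F z)⁻¹ = i at *
    generalize d1 F z (1, 0) = a at *
    generalize d1 F z (0, 1) = b at *
    have right_add : ∀ a b c : Mink, mink a (b + c) = mink a b + mink a c := fun a b c => by
      simp [mink]; ring
    have right_sub : ∀ a b c : Mink, mink a (b - c) = mink a b - mink a c := fun a b c => by
      simp [mink]; ring
    have right_smul : ∀ (a b : Mink) (r : ℝ), mink a (r • b) = r * mink a b := fun a b c => by
      simp [mink]; ring
    refine ⟨?_, ?_, ?_⟩ <;>
      simp only [mink_add_left, mink_sub_left, mink_smul_left, right_add, right_sub, right_smul,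
        mink_comm b a]
    · linear_combination (-(mink a a)) * hi2 + (i ^ 2 * mink a a * (mink a a * mink b b - mink a b ^ 2)) * he
    · linear_combination (-(mink a b)) * hi2 + (i ^ 2 * mink a b * (mink a a * mink b b - mink a b ^ 2)) * he
    · linear_combination (-(mink b b)) * hi2 + (i ^ 2 * mink b b * (mink a a * mink b b - mink a b ^ 2)) * he
  have half : ∀ a b : Mink, mink a b = 0 → mink ((1 / 2 : ℝ) • a) ((1 / 2 : ℝ) • b) = 0 :=
    fun a b h => by
      simp only [mink, Pi.smul_apply, smul_eq_mul] at h ⊢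
      linear_combination h / 4
  refine isNullSplit_of_coord h.isOpen h.contDiffOn ha hb (fun z hz => ?_) (fun z hz => ?_)
    (fun z hz => ?_) fun z hz v _ h2 => ?_
  · have d1' := (contDiffAt_d1 (hF z hz) (1, 0)).differentiableAt (by norm_num)
    have d2' := (contDiffAt_d1 (hF z hz) (0, 1)).differentiableAt (by norm_num)
    have d3' := (contDiffAt_starX (hF z hz) (h.timelike z hz)).differentiableAt (by norm_num)
    have d4' := (contDiffAt_starY (hF z hz) (h.timelike z hz)).differentiableAt (by norm_num)
    refine (DFunLike.congr_fun ((d1'.hasFDerivAt.add d3'.hasFDerivAt).const_smul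
      (1 / 2 : ℝ)).fderiv (0, 1)).trans (Eq.trans ?_ (DFunLike.congr_fun
        ((d2'.hasFDerivAt.add d4'.hasFDerivAt).const_smul (1 / 2 : ℝ)).fderiv (1, 0)).symm)
    simp only [smul_apply, add_apply, h.star_closed hz]
    congr 2
    exact d2_symm (hF z hz) (0, 1) (1, 0)
  · have k := key z hz 1 (by simp)
    simp only [one_smul] at k
    exact ⟨half _ _ k.1, half _ _ k.2.1, half _ _ k.2.2⟩
  · have k := key z hz (-1) (by simp)
    have e : ∀ a b : Mink, a - (1 / 2 : ℝ) • (a + b) = (1 / 2 : ℝ) • (a + (-1 : ℝ) • b) :=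
      fun a b => by module
    simp only [e]
    exact ⟨half _ _ k.1, half _ _ k.2.1, half _ _ k.2.2⟩
  · have e : d1 F z v = v.1 • d1 F z (1, 0) + v.2 • d1 F z (0, 1) := by
      simp only [d1]
      rw [← map_smul, ← map_smul, ← map_add]; simp
    have hg := h.timelike z hz
    rw [TimelikeAt, gramDet] at hg
    have e1 : mink (d1 F z v) (d1 F z (1, 0)) = 0 := by rw [h2]; simp [mink]
    have e2 : mink (d1 F z v) (d1 F z (0, 1)) = 0 := by rw [h2]; simp [mink]
    rw [e, mink_add_left, mink_smul_left, mink_smul_left] at e1 e2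
    rw [mink_comm (d1 F z (0, 1)) (d1 F z (1, 0))] at e1
    simp only [firstForm] at hg
    have k1 : (mink (d1 F z (1, 0)) (d1 F z (1, 0)) * mink (d1 F z (0, 1)) (d1 F z (0, 1)) -
        mink (d1 F z (1, 0)) (d1 F z (0, 1)) ^ 2) * v.1 = 0 := by
      linear_combination mink (d1 F z (0, 1)) (d1 F z (0, 1)) * e1 -
        mink (d1 F z (1, 0)) (d1 F z (0, 1)) * e2
    have k2 : (mink (d1 F z (1, 0)) (d1 F z (1, 0)) * mink (d1 F z (0, 1)) (d1 F z (0, 1)) -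
        mink (d1 F z (1, 0)) (d1 F z (0, 1)) ^ 2) * v.2 = 0 := by
      linear_combination mink (d1 F z (1, 0)) (d1 F z (1, 0)) * e2 -
        mink (d1 F z (1, 0)) (d1 F z (0, 1)) * e1
    exact Prod.ext ((mul_eq_zero.1 k1).resolve_left hg.ne) ((mul_eq_zero.1 k2).resolve_left hg.ne)

end PlanarCurvature
end

noncomputable section

namespace PlanarCurvature

/-! ### Pieces of model surfaces -/

variable {F G H : ℝ × ℝ → Mink} {U : Set (ℝ × ℝ)} {α β : ℝ × ℝ → ℝ × ℝ →L[ℝ] Mink}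

lemma isSimilarity_translation (b : Mink) : IsSimilarity fun p => b + p :=
  ⟨1, .id, b, one_pos, fun _ _ => rfl, fun p => by simp [add_comm]⟩

lemma bijective_of_jac {φ ψ : ℝ × ℝ → ℝ} {z : ℝ × ℝ} (hφ : DifferentiableAt ℝ φ z)
    (hψ : DifferentiableAt ℝ ψ z) (hj : NullChartAt.jac φ ψ z ≠ 0) :
    Function.Bijective (fderiv ℝ (fun z => ((φ z + ψ z) / 2, (φ z - ψ z) / 2)) z) := by
  have hd : HasFDerivAt (fun z => ((φ z + ψ z) / 2, (φ z - ψ z) / 2))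
      (((2 : ℝ)⁻¹ • (fderiv ℝ φ z + fderiv ℝ ψ z)).prod ((2 : ℝ)⁻¹ • (fderiv ℝ φ z - fderiv ℝ ψ z))) z := by
      simp only [div_eq_inv_mul]
      exact ((hφ.hasFDerivAt.add hψ.hasFDerivAt).const_smul (2 : ℝ)⁻¹).prodMk
        ((hφ.hasFDerivAt.sub hψ.hasFDerivAt).const_smul (2 : ℝ)⁻¹)
  rw [hd.fderiv]
  have hi : Function.Injective (((2 : ℝ)⁻¹ • (fderiv ℝ φ z + fderiv ℝ ψ z)).prod
      ((2 : ℝ)⁻¹ • (fderiv ℝ φ z - fderiv ℝ ψ z))) := (injective_iff_map_eq_zero _).2 fun v hv => by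
    have h1 := congrArg Prod.fst hv
    have h2 := congrArg Prod.snd hv
    simp at h1 h2
    exact NullChartAt.eq_zero hj (by linarith) (by linarith)
  exact ⟨hi, LinearMap.injective_iff_surjective.1 hi⟩

/-- A surface that splits into null curves and has planar curvature lines is a piece of a model. -/
theorem IsNullSplit.exists_isPieceOf (h : IsNullSplit F α β U) (hU : IsConnected U)
    (hT : U ⊆ closure (U ∩ {z | TimelikeAt F z}))
    (hP : HasPlanarCurvatureLines F (U ∩ {z | TimelikeAt F z})) :
    ∃ c, IsCore c ∧ IsPieceOf F U (cspin c) := by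
  obtain ⟨c, b, hc, hb⟩ := h.exists_global hU fun a ha => h.exists_hasForm ha hT hP
  refine ⟨c, hc, _, isSimilarity_translation b, fun a ha => ?_⟩
  obtain ⟨φ, ψ, hf, he⟩ := hb a ha
  have e1 : ∀ᶠ z in 𝓝 a, ContDiffAt ℝ 1 φ z ∧ ContDiffAt ℝ 1 ψ z ∧ NullChartAt.jac φ ψ z ≠ 0 := by
    filter_upwards [hf.eventually_hasForm] with z hz using
      ⟨hz.1.of_le (by norm_num), hz.2.1.of_le (by norm_num), hz.2.2.1⟩
  obtain ⟨V, hV, hVo, haV⟩ := eventually_nhds_iff.1 ((e1.and he).and (h.isOpen.mem_nhds ha))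
  -- This is the passage from the null coordinates (φ, ψ) back to (x, y), the arguments of `cspin`.
  refine ⟨V, fun z => ((φ z + ψ z) / 2, (φ z - ψ z) / 2), hVo, haV, fun z hz => (hV z hz).2,
    fun z hz => ?_, fun z hz => ?_, fun z hz => ?_⟩
  · obtain ⟨⟨⟨h1, h2, -⟩, -⟩, -⟩ := hV z hz
    exact (((h1.add h2).div_const 2).prodMk ((h1.sub h2).div_const 2)).contDiffWithinAt
  · obtain ⟨⟨⟨h1, h2, h3⟩, -⟩, -⟩ := hV z hz
    exact bijective_of_jac (h1.differentiableAt one_ne_zero) (h2.differentiableAt one_ne_zero) h3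
  · rw [(hV z hz).1.2, cspin_eq_curve, add_assoc]
    congr <;> ring

theorem IsTimelikeMinimalPCL.exists_isPieceOf (h : IsTimelikeMinimalPCL F U) (hU : IsConnected U) :
    ∃ c, IsCore c ∧ IsPieceOf F U (cspin c) := by
  obtain ⟨α, β, hs⟩ := h.1.exists_isNullSplit
  have e : U ∩ {z | TimelikeAt F z} = U := inter_eq_left.2 h.1.timelike
  exact hs.exists_isPieceOf hU (by rw [e]; exact subset_closure) (by rw [e]; exact h.2)

theorem IsGeneralizedPCL.exists_isPieceOf (h : IsGeneralizedPCL F U) (hU : IsConnected U) :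
    ∃ c, IsCore c ∧ IsPieceOf F U (cspin c) := by
  obtain ⟨α, β, hs⟩ := h.1.exists_isNullSplit
  exact hs.exists_isPieceOf hU h.1.dense h.2.2

/-! ### Similar surfaces -/

lemma IsSimilarity.comp {T S : Mink → Mink} (hT : IsSimilarity T) (hS : IsSimilarity S) :
    IsSimilarity (T ∘ S) := by
  obtain ⟨r, A, b, hr, hA, h⟩ := hT
  obtain ⟨r', A', b', hr', hA', h'⟩ := hS
  refine ⟨r * r', A ∘ₗ A', r • A b' + b, mul_pos hr hr', fun v w => (hA _ _).trans (hA' v w), fun p => ?_⟩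
  simp only [Function.comp_apply, h, h', map_add, map_smul, smul_add, smul_smul,
    LinearMap.comp_apply, add_assoc]

lemma eq_zero_of_forall_mink {v : Mink} (h : ∀ w, mink v w = 0) : v = 0 := by
  have h0 := h ![1, 0, 0]
  have h1 := h ![0, 1, 0]
  have h2 := h ![0, 0, 1]
  simp [mink] at h0 h1 h2
  ext i
  fin_cases i <;> assumption

lemma IsSimilarity.exists_inverse {T : Mink → Mink} (hT : IsSimilarity T) :
    ∃ S, IsSimilarity S ∧ ∀ p, S (T p) = p := by
  obtain ⟨r, A, b, hr, hA, h⟩ := hT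
  have hi : Function.Injective A := (injective_iff_map_eq_zero _).2 fun v hv =>
    eq_zero_of_forall_mink fun w => by rw [← hA, hv]; simp [mink]
  let E := LinearEquiv.ofInjectiveEndo A hi
  have hE : ∀ v, A (E.symm v) = v := fun v => E.apply_symm_apply v
  refine ⟨fun p => r⁻¹ • E.symm p - r⁻¹ • E.symm b, ⟨r⁻¹, E.symm, -(r⁻¹ • E.symm b), inv_pos.2 hr,
    fun v w => ?_, fun p => sub_eq_add_neg _ _⟩, fun p => ?_⟩
  · change mink (E.symm v) (E.symm w) = _
    rw [← hA, hE, hE]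
  · change r⁻¹ • E.symm (T p) - r⁻¹ • E.symm b = p
    have : E.symm (A p) = p := E.symm_apply_apply p
    rw [h, map_add, map_smul, this, smul_add, add_sub_cancel_right, smul_smul, inv_mul_cancel₀ hr.ne',
      one_smul]

/-- `F` is `G` up to a similarity of space and an affine transformation of the plane. -/
def AffineSimilar (F G : ℝ × ℝ → Mink) : Prop := ∃ T, IsSimilarity T ∧
  ∃ (L : (ℝ × ℝ) ≃L[ℝ] ℝ × ℝ) (w : ℝ × ℝ), ∀ z, F z = T (G (L z + w))

/-- `F` is `G` up to a similarity of space and a homothety and translation of the plane. -/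
def HomSimilar (F G : ℝ × ℝ → Mink) : Prop := ∃ T, IsSimilarity T ∧
  ∃ (s : ℝ) (w : ℝ × ℝ), s ≠ 0 ∧ ∀ z, F z = T (G (s • z + w))

lemma HomSimilar.affineSimilar (h : HomSimilar F G) : AffineSimilar F G := by
  obtain ⟨T, hT, s, w, hs, h⟩ := h
  exact ⟨T, hT, ContinuousLinearEquiv.smulLeft (Units.mk0 s hs), w, h⟩

lemma HomSimilar.trans (h : HomSimilar F G) (h' : HomSimilar G H) : HomSimilar F H := by
  obtain ⟨T, hT, s, w, hs, h⟩ := h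
  obtain ⟨T', hT', s', w', hs', h'⟩ := h'
  refine ⟨_, hT.comp hT', s' * s, s' • w + w', mul_ne_zero hs' hs, fun z => ?_⟩
  rw [h, h', Function.comp_apply, smul_add, smul_smul, add_assoc]

lemma HomSimilar.symm (h : HomSimilar F G) : HomSimilar G F := by
  obtain ⟨T, hT, s, w, hs, h⟩ := h
  obtain ⟨S, hS, hST⟩ := hT.exists_inverse
  refine ⟨S, hS, s⁻¹, -(s⁻¹ • w), inv_ne_zero hs, fun z => ?_⟩
  rw [h, hST, smul_add, smul_neg, smul_smul, smul_smul, mul_inv_cancel₀ hs, one_smul, one_smul,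
    neg_add_cancel_right]

lemma AffineSimilar.trans (h : AffineSimilar F G) (h' : AffineSimilar G H) : AffineSimilar F H := by
  obtain ⟨T, hT, L, w, h⟩ := h
  obtain ⟨T', hT', L', w', h'⟩ := h'
  refine ⟨_, hT.comp hT', L.trans L', L' w + w', fun z => ?_⟩
  rw [h, h', Function.comp_apply, map_add, add_assoc]; rfl

lemma IsPieceOf.of_affineSimilar (h : IsPieceOf F U G) (h' : AffineSimilar G H) : IsPieceOf F U H := by
  obtain ⟨T, hT, h⟩ := h
  obtain ⟨S, hS, L, w, h'⟩ := h'
  refine ⟨_, hT.comp hS, fun p hp => ?_⟩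
  obtain ⟨V, Φ, hV, hpV, hVU, hΦ, hb, he⟩ := h p hp
  refine ⟨V, fun z => L (Φ z) + w, hV, hpV, hVU, (L.contDiff.comp_contDiffOn hΦ).add contDiffOn_const,
    fun q hq => ?_, fun q hq => ?_⟩
  · have hd := (hΦ.contDiffAt (hV.mem_nhds hq)).differentiableAt one_ne_zero
    have : HasFDerivAt (fun z => L (Φ z) + w) ((L : ℝ × ℝ →L[ℝ] ℝ × ℝ).comp (fderiv ℝ Φ q)) q :=
      (L.hasFDerivAt.comp q hd.hasFDerivAt).add_const w
    rw [this.fderiv]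
    exact L.bijective.comp (hb q hq)
  · rw [he q hq, h']; rfl

end PlanarCurvature
end

/-! ### Classification of the models up to similarity -/

noncomputable section

namespace PlanarCurvature

/-! ### The Gram matrix of the spinors -/

/-- The linear conformal map with `nullX p q ↦ nullX (d p + c q) (a q + b p)` and
`nullY r s ↦ nullY (a r - b s) (d s - c r)`. -/
def conformalMap (a b c d : ℝ) : Mink →ₗ[ℝ] Mink where
  toFun v := ![(a * d + b * c) * v 0 + b * d * (-v 1 - v 2) + a * c * (v 1 - v 2),
    ((a ^ 2 - c ^ 2) * (v 1 - v 2) + 2 * (a * b - c * d) * v 0 + (b ^ 2 - d ^ 2) * (-v 1 - v 2)) / 2,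
    -((a ^ 2 + c ^ 2) * (v 1 - v 2) + 2 * (a * b + c * d) * v 0 + (b ^ 2 + d ^ 2) * (-v 1 - v 2)) / 2]
  map_add' v w := by ext i; fin_cases i <;> simp <;> ring
  map_smul' r v := by ext i; fin_cases i <;> simp <;> ring

lemma conformalMap_nullX (a b c d p q : ℝ) :
    conformalMap a b c d (nullX p q) = nullX (d * p + c * q) (a * q + b * p) := by
  ext i; fin_cases i <;> simp [conformalMap, nullX] <;> ring

lemma conformalMap_nullY (a b c d r s : ℝ) :
    conformalMap a b c d (nullY r s) = nullY (a * r - b * s) (d * s - c * r) := by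
  ext i; fin_cases i <;> simp [conformalMap, nullY] <;> ring

lemma mink_conformalMap (a b c d : ℝ) (v w : Mink) :
    mink (conformalMap a b c d v) (conformalMap a b c d w) = (a * d - b * c) ^ 2 * mink v w := by
  simp [conformalMap, mink]; ring

lemma isSimilarity_conformalMap {a b c d : ℝ} (h : a * d - b * c ≠ 0) :
    IsSimilarity (conformalMap a b c d) := by
  have h' := abs_pos.2 h
  refine ⟨|a * d - b * c|, |a * d - b * c|⁻¹ • conformalMap a b c d, 0, h', fun v w => ?_, fun p => ?_⟩
  · have := mink_conformalMap a b c d v w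
    simp only [mink, LinearMap.smul_apply, Pi.smul_apply, smul_eq_mul] at this ⊢
    have e : |a * d - b * c|⁻¹ ^ 2 * (a * d - b * c) ^ 2 = 1 := by
      rw [inv_pow, sq_abs, inv_mul_cancel₀ (pow_ne_zero 2 h)]
    linear_combination |a * d - b * c|⁻¹ ^ 2 * this + (v 0 * w 0 + v 1 * w 1 - v 2 * w 2) * e
  · rw [LinearMap.smul_apply, smul_smul, mul_inv_cancel₀ h'.ne', one_smul, add_zero]

lemma curve_map (A : Mink →ₗ[ℝ] Mink) {X : ℝ → Mink} (hX : Continuous X) (u : ℝ) :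
    curve (fun t => A (X t)) u = A (curve X u) := by
  ext i
  have e : ∀ v, A v i = ∑ k, A (fun l => if k = l then 1 else 0) i * v k := fun v => by
    rw [LinearMap.pi_apply_eq_sum_univ A v, Finset.sum_apply]
    exact Finset.sum_congr rfl fun k _ => by simp [mul_comm]
  rw [e, curve]
  simp only [e (X _)]
  rw [intervalIntegral.integral_finsetSum fun k _ => (show Continuous fun t =>
    A (fun l => if k = l then 1 else 0) i * X t k by fun_prop).intervalIntegrable _ _]
  simp only [intervalIntegral.integral_const_mul]
  rfl

lemma homSimilar_of_conformalMap {e e' : Fin 9 → ℝ} {a b c d : ℝ} (h : a * d - b * c ≠ 0)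
    (hX : ∀ u, velX e u = conformalMap a b c d (velX e' u))
    (hY : ∀ v, velY e v = conformalMap a b c d (velY e' v)) : HomSimilar (cspin e) (cspin e') := by
  refine ⟨_, isSimilarity_conformalMap h, 1, 0, one_ne_zero, fun z => ?_⟩
  rw [one_smul, add_zero, cspin_eq_curve, cspin_eq_curve, map_add,
    ← curve_map _ (contDiff_velX e' (n := 0)).continuous,
    ← curve_map _ (contDiff_velY e' (n := 0)).continuous, ← funext hX, ← funext hY]

/-- The pairings of the spinors. -/
def gram (c : Fin 9 → ℝ) : Fin 4 → ℝ :=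
  ![c 3 * c 7 + c 1 * c 5, c 3 * c 8 + c 1 * c 6, c 4 * c 7 + c 2 * c 5, c 4 * c 8 + c 2 * c 6]

/-- As the first Wronskian is nonzero, the initial data of the u-spinors form a basis, and exactly
one linear map takes those of `e'` to those of `e`. The pairings then determine the v-spinors as
images under the contragredient map, up to a factor. The condition on Wronskians says that the
determinant is ±g, so that this factor is a sign. -/
theorem homSimilar_of_gram {e e' : Fin 9 → ℝ} {g : ℝ} (h0 : e 0 = e' 0) (hg : g ≠ 0)
    (hw : wX e ≠ 0) (hG : gram e = g • gram e') (hW : wX e ^ 2 = g ^ 2 * wX e' ^ 2) :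
    HomSimilar (cspin e) (cspin e') := by
  have hw' : wX e' ≠ 0 := fun h => hw (by rw [h] at hW; simpa using hW)
  have g0 := congrFun hG 0
  have g1 := congrFun hG 1
  have g2 := congrFun hG 2
  have g3 := congrFun hG 3
  simp [gram] at g0 g1 g2 g3
  set w := wX e' with hw0
  -- the linear map that takes the first pair of spinors of `e'` to that of `e`
  obtain ⟨a, b, ha, hb⟩ : ∃ a b, e 3 = a * e' 3 + b * e' 1 ∧ e 4 = a * e' 4 + b * e' 2 :=
    ⟨(e 3 * e' 2 - e 4 * e' 1) / w, (e 4 * e' 3 - e 3 * e' 4) / w, by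
      field_simp; rw [hw0, wX]; ring, by field_simp; rw [hw0, wX]; ring⟩
  obtain ⟨c, d, hc, hd⟩ : ∃ c d, e 1 = d * e' 1 + c * e' 3 ∧ e 2 = d * e' 2 + c * e' 4 :=
    ⟨(e 1 * e' 2 - e 2 * e' 1) / w, (e 2 * e' 3 - e 1 * e' 4) / w, by
      field_simp; rw [hw0, wX]; ring, by field_simp; rw [hw0, wX]; ring⟩
  have hΔ : wX e = (a * d - b * c) * w := by rw [hw0, wX, wX, ha, hb, hc, hd]; ring
  have hΔ0 : a * d - b * c ≠ 0 := fun h => hw (by rw [hΔ, h, zero_mul])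
  have hΔg : (a * d - b * c) ^ 2 = g ^ 2 :=
    mul_right_cancel₀ (pow_ne_zero 2 hw') (by rw [← hW, hΔ]; ring)
  have s0 : a * e 7 + c * e 5 = g * e' 7 := mul_left_cancel₀ hw' (by
    rw [hw0, wX]
    rw [ha, hc] at g0; rw [hb, hd] at g2
    linear_combination e' 2 * g0 - e' 1 * g2)
  have r0 : b * e 7 + d * e 5 = g * e' 5 := mul_left_cancel₀ hw' (by
    rw [hw0, wX]
    rw [ha, hc] at g0; rw [hb, hd] at g2
    linear_combination e' 3 * g2 - e' 4 * g0)
  have s1 : a * e 8 + c * e 6 = g * e' 8 := mul_left_cancel₀ hw' (by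
    rw [hw0, wX]
    rw [ha, hc] at g1; rw [hb, hd] at g3
    linear_combination e' 2 * g1 - e' 1 * g3)
  have r1 : b * e 8 + d * e 6 = g * e' 6 := mul_left_cancel₀ hw' (by
    rw [hw0, wX]
    rw [ha, hc] at g1; rw [hb, hd] at g3
    linear_combination e' 3 * g3 - e' 4 * g1)
  refine homSimilar_of_conformalMap hΔ0 (fun u => ?_) fun v => ?_
  · rw [velX, velX, conformalMap_nullX, hc, hd, ha, hb, h0]
    congr 1 <;> simp only [sol] <;> ring
  · rw [velY, velY, conformalMap_nullY, h0]
    have k1 : (a * d - b * c) * sol (e' 0) (e 5) (e 6) v =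
        g * (a * sol (e' 0) (e' 5) (e' 6) v - b * sol (e' 0) (e' 7) (e' 8) v) := by
      simp only [sol]
      linear_combination cs (e' 0) v * (a * r0 - b * s0) + sn (e' 0) v * (a * r1 - b * s1)
    have k2 : (a * d - b * c) * sol (e' 0) (e 7) (e 8) v =
        g * (d * sol (e' 0) (e' 7) (e' 8) v - c * sol (e' 0) (e' 5) (e' 6) v) := by
      simp only [sol]
      linear_combination cs (e' 0) v * (d * s0 - c * r0) + sn (e' 0) v * (d * s1 - c * r1)
    -- The velocity is quadratic in the spinors, so only the squares of the determinant and of g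
    -- matter.
    have k3 := nullY_smul (a * d - b * c) (sol (e' 0) (e 5) (e 6) v) (sol (e' 0) (e 7) (e 8) v)
    rw [k1, k2, nullY_smul, hΔg] at k3
    exact (smul_right_injective _ (pow_ne_zero 2 hg) k3).symm

lemma homSimilar_shiftc (c : Fin 9 → ℝ) (a b : ℝ) : HomSimilar (cspin c) (cspin (shiftc c a b)) := by
  refine HomSimilar.symm ⟨_, isSimilarity_translation (-cspin c ((a + b) / 2, (a - b) / 2)), 1,
    ((a + b) / 2, (a - b) / 2), one_ne_zero, fun z => ?_⟩
  rw [one_smul, cspin_add, show ((a + b) / 2 + (a - b) / 2 : ℝ) = a by ring,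
    show ((a + b) / 2 - (a - b) / 2 : ℝ) = b by ring]
  abel

/-- The spinors after the homothety `z ↦ l z` of the plane. -/
def stretchc (l : ℝ) (c : Fin 9 → ℝ) : Fin 9 → ℝ :=
  ![l ^ 2 * c 0, c 1, l * c 2, c 3, l * c 4, c 5, l * c 6, c 7, l * c 8]

lemma sol_stretch (l κ a b u : ℝ) : sol (l ^ 2 * κ) a (l * b) u = sol κ a b (l * u) := by
  have h1 : ∀ t, HasDerivAt (fun t => sol κ a b (l * t)) (l * sol κ b (κ * a) (l * t)) t := fun t =>
    ((hasDerivAt_sol κ a b (l * t)).comp t ((hasDerivAt_id t).const_mul l)).congr_deriv (by ring)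
  have h2 : ∀ t, HasDerivAt (fun t => l * sol κ b (κ * a) (l * t))
      (l ^ 2 * κ * sol κ a b (l * t)) t := fun t =>
    (((hasDerivAt_sol' κ a b (l * t)).comp t ((hasDerivAt_id t).const_mul l)).const_mul l).congr_deriv
      (by ring)
  have := eq_sol_of_hasDerivAt isOpen_univ isPreconnected_univ (κ := l ^ 2 * κ)
    (fun t _ => h1 t) (fun t _ => h2 t) (mem_univ 0) (mem_univ u)
  simpa using this.symm

lemma curve_stretch {l : ℝ} (hl : l ≠ 0) (X : ℝ → Mink) (u : ℝ) :
    curve (fun t => X (l * t)) u = l⁻¹ • curve X (l * u) := by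
  ext i
  simp only [curve, Pi.smul_apply]
  rw [intervalIntegral.integral_comp_mul_left (fun t => X t i) hl, mul_zero]

lemma isSimilarity_smul {k : ℝ} (hk : k ≠ 0) : IsSimilarity fun p => k • p := by
  have h' := abs_pos.2 hk
  refine ⟨|k|, (|k|⁻¹ * k) • .id, 0, h', fun v w => ?_, fun p => ?_⟩
  · have e : |k|⁻¹ ^ 2 * k ^ 2 = 1 := by rw [inv_pow, sq_abs, inv_mul_cancel₀ (pow_ne_zero 2 hk)]
    simp only [mink, LinearMap.smul_apply, Pi.smul_apply, smul_eq_mul, LinearMap.id_apply]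
    linear_combination (v 0 * w 0 + v 1 * w 1 - v 2 * w 2) * e
  · rw [LinearMap.smul_apply, smul_smul, mul_inv_cancel_left₀ h'.ne', add_zero, LinearMap.id_apply]

lemma homSimilar_stretchc {l : ℝ} (hl : l ≠ 0) (c : Fin 9 → ℝ) :
    HomSimilar (cspin (stretchc l c)) (cspin c) := by
  refine ⟨_, isSimilarity_smul (inv_ne_zero hl), l, 0, hl, fun z => ?_⟩
  have hX : velX (stretchc l c) = fun t => velX c (l * t) := funext fun t => by
    simp [velX, stretchc, sol_stretch]
  have hY : velY (stretchc l c) = fun t => velY c (l * t) := funext fun t => by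
    simp [velY, stretchc, sol_stretch]
  rw [cspin_eq_curve, hX, hY, curve_stretch hl, curve_stretch hl, cspin_eq_curve, ← smul_add]
  simp [mul_add, mul_sub]

/-- The spinors after the reflection `y ↦ -y` and a time reversal. -/
def swapc (c : Fin 9 → ℝ) : Fin 9 → ℝ := ![c 0, c 5, c 6, c 7, c 8, c 1, c 2, c 3, c 4]

lemma affineSimilar_swapc (c : Fin 9 → ℝ) : AffineSimilar (cspin (swapc c)) (cspin c) := by
  let L : (ℝ × ℝ) ≃L[ℝ] ℝ × ℝ := (ContinuousLinearEquiv.refl ℝ ℝ).prodCongr (ContinuousLinearEquiv.neg ℝ)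
  let R : Mink →ₗ[ℝ] Mink :=
    { toFun := timeRev
      map_add' := fun v w => by ext i; fin_cases i <;> simp [timeRev]; ring
      map_smul' := fun r v => by ext i; fin_cases i <;> simp [timeRev] }
  refine ⟨R, ⟨1, R, 0, one_pos, mink_timeRev, fun p => by simp⟩, L, 0, fun z => ?_⟩
  have hX : velX (swapc c) = fun t => R (velY c t) := funext fun t => by
    ext i; fin_cases i <;> simp [velX, velY, swapc, R, timeRev, nullX, nullY]; ring
  have hY : velY (swapc c) = fun t => R (velX c t) := funext fun t => by
    ext i; fin_cases i <;> simp [velX, velY, swapc, R, timeRev, nullX, nullY]; ring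
  have e : ∀ z : ℝ × ℝ, L z = (z.1, -z.2) := fun z => rfl
  have k1 := curve_map R (contDiff_velX c (n := 0)).continuous (z.1 - z.2)
  have k2 := curve_map R (contDiff_velY c (n := 0)).continuous (z.1 + z.2)
  rw [add_zero, cspin_eq_curve, cspin_eq_curve, hX, hY, e, map_add, sub_neg_eq_add, ← sub_eq_add_neg,
    add_comm]
  exact congrArg₂ _ k1 k2

/-- Spinors with prescribed pairings. -/
def gramc (κ a b c d : ℝ) : Fin 9 → ℝ := ![κ, 0, 1, 1, 0, c, d, a, b]

lemma gram_gramc (κ a b c d : ℝ) : gram (gramc κ a b c d) = ![a, b, c, d] := by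
  simp [gram, gramc]

lemma wX_gramc (κ a b c d : ℝ) : wX (gramc κ a b c d) = 1 := by simp [wX, gramc]

/-- A surface is determined up to similarity by its Gram matrix. -/
theorem homSimilar_gramc {e : Fin 9 → ℝ} {κ l g a b c d : ℝ} (h0 : e 0 = l ^ 2 * κ) (hl : l ≠ 0)
    (hg : g ≠ 0) (hG : gram e = ![g * a, g * (l * b), g * (l * c), g * (l ^ 2 * d)])
    (hW : wX e ^ 2 = g ^ 2 * l ^ 2) : HomSimilar (cspin e) (cspin (gramc κ a b c d)) := by
  refine HomSimilar.trans (homSimilar_of_gram (e' := stretchc l (gramc κ a b c d)) (g := g) ?_ hg ?_ ?_ ?_)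
    (homSimilar_stretchc hl _)
  · simpa [stretchc, gramc] using h0
  · intro h
    rw [h] at hW
    simp [hg, hl] at hW
  · rw [hG]
    ext i
    fin_cases i <;> simp [gram, stretchc, gramc]
    exact Or.inl (by ring)
  · rw [hW]; simp [wX, stretchc, gramc]

end PlanarCurvature
end

noncomputable section

namespace PlanarCurvature

open Branch

/-! ### The Gram matrices of the members and of the named surfaces -/

lemma homSimilar_add (b : Mink) (F : ℝ × ℝ → Mink) : HomSimilar (fun z => b + F z) F :=
  ⟨_, isSimilarity_translation b, 1, 0, one_ne_zero, fun z => by simp⟩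

lemma isSimilarity_rot : IsSimilarity rot := by
  let R : Mink →ₗ[ℝ] Mink :=
    { toFun := rot
      map_add' := fun v w => by ext i; fin_cases i <;> simp [rot]; ring
      map_smul' := fun r v => by ext i; fin_cases i <;> simp [rot] }
  exact ⟨1, R, 0, one_pos, fun v w => by simp [R, mink, rot]; ring, fun p => by simp [R]⟩

lemma homSimilar_rotc (c : Fin 9 → ℝ) : HomSimilar (cspin (rotc c)) (cspin c) :=
  ⟨rot, isSimilarity_rot, 1, 0, one_ne_zero, fun z => by simp [rot_cspin]⟩

lemma homSimilar_scalec {l : ℝ} (hl : l ≠ 0) (c : Fin 9 → ℝ) :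
    HomSimilar (cspin (scalec l c)) (cspin c) :=
  ⟨_, isSimilarity_smul (pow_ne_zero 2 hl), 1, 0, one_ne_zero, fun z => by simp [cspin_scalec]⟩

lemma homSimilar_surface {b : Branch} {t : ℝ} (ht : t ∈ params b) :
    HomSimilar (surface b t) (cspin (coef0 b t)) := by
  rw [surface_eq ht]
  refine (homSimilar_add _ _).trans ?_
  cases b with
  | BL2 => exact homSimilar_rotc _
  | P => exact ⟨id, ⟨1, .id, 0, one_pos, fun _ _ => rfl, fun p => by simp⟩, 1, 0, one_ne_zero,
      fun z => by simp [coef]⟩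
  | _ => exact (homSimilar_shiftc _ _ _).symm

/-- Spinors with `κ = 1` whose pairings are `a e^{u + v} + b e^{u - v} + c e^{-u + v} + d e^{-u - v}`
up to a factor. -/
def hypc (a b c d : ℝ) : Fin 9 → ℝ :=
  gramc 1 ((a + b + c + d) / 2) ((a - b + c - d) / 2) ((a + b - c - d) / 2) ((a - b - c + d) / 2)

@[simp] lemma gramc_zero (κ a b c d : ℝ) : gramc κ a b c d 0 = κ := rfl

@[simp] lemma hypc_zero (a b c d : ℝ) : hypc a b c d 0 = 1 := rfl

@[simp] lemma wX_hypc (a b c d : ℝ) : wX (hypc a b c d) = 1 := wX_gramc _ _ _ _ _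

lemma gram_hypc (a b c d : ℝ) : gram (hypc a b c d) =
    ![(a + b + c + d) / 2, (a - b + c - d) / 2, (a + b - c - d) / 2, (a - b - c + d) / 2] :=
  gram_gramc _ _ _ _ _

lemma homSimilar_exp {k m : ℝ} (hk : k ≠ 0) (hm : m ≠ 0) (t : ℝ) :
    HomSimilar (cspin ![(k / 2) ^ 2, m * (1 + t), m * (k / 2 * (1 - t)), m, -(m * (k / 2)),
      m * (1 - t), m * (k / 2 * (1 + t)), m, -(m * (k / 2))])
      (cspin (hypc 1 (-t) t (1 - t ^ 2))) := by
  refine homSimilar_gramc (l := k / 2) (g := 2 * m ^ 2) ?_ (by positivity) (by positivity) ?_ ?_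
  · simp
  · ext i; fin_cases i <;> simp [gram] <;> ring
  · simp [wX]; ring

lemma homSimilar_jexp {m : ℝ} (hm : m ≠ 0) (t t' : ℝ) :
    HomSimilar (cspin ![(1 / 2) ^ 2, m * (1 + (t + t')), m * ((1 - (t + t')) / 2), m,
      -(m * (1 / 2)), -(m * (1 - (t - t'))), m * ((1 + (t - t')) / 2), m, m * (1 / 2)])
      (cspin (hypc (t - t') (-1) (1 + t ^ 2 - t' ^ 2) (-(t + t')))) := by
  refine homSimilar_gramc (l := 1 / 2) (g := 2 * m ^ 2) ?_ (by positivity) (by positivity) ?_ ?_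
  · simp
  · ext i; fin_cases i <;> simp [gram] <;> ring
  · simp [wX]; ring

lemma homSimilar_trig {A k m : ℝ} (hA : A ≠ 0) (hk : k ≠ 0) (hm : m ≠ 0) :
    HomSimilar (cspin ![-k ^ 2, 0, m * (A * k), m, 0, 0, m * (A * k), m, 0])
      (cspin (gramc (-1) A⁻¹ 0 0 A)) := by
  refine homSimilar_gramc (l := k) (g := A * m ^ 2) ?_ hk (by positivity) ?_ ?_
  · simp
  · ext i; fin_cases i <;> simp [gram] <;> field_simp
  · simp [wX]; ring

lemma homSimilar_linear {A m : ℝ} (hA : A ≠ 0) (hm : m ≠ 0) :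
    HomSimilar (cspin ![0, 0, m * A, m, 0, 0, m * A, m, 0]) (cspin (gramc 0 1 0 0 1)) := by
  refine homSimilar_gramc (l := A) (g := m ^ 2) ?_ hA (by positivity) ?_ ?_
  · simp
  · ext i; fin_cases i <;> simp [gram] <;> ring
  · simp [wX]; ring

lemma homSimilar_BL2 {t : ℝ} (ht : t ∈ params BL2) :
    HomSimilar (surface BL2 t) (cspin (hypc 1 (-t) t (1 - t ^ 2))) :=
  (homSimilar_surface ht).trans (homSimilar_exp (q2_pos 1).ne'
    (Real.sqrt_pos.2 (one_div_pos.2 (q2_pos 5))).ne' t)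

lemma homSimilar_S4 {t : ℝ} (ht : 0 ≤ t) :
    HomSimilar (surface S4 t) (cspin (hypc t (-1) (1 + t ^ 2) (-t))) := by
  have h := homSimilar_jexp (m := √(1 / 2)) (by positivity) t 0
  have := (homSimilar_surface (b := S4) ht).trans (by simpa [coef0] using h)
  exact this

lemma homSimilar_M {t : ℝ} (ht : 0 ≤ t) :
    HomSimilar (surface M t) (cspin (hypc (-t) (-1) (1 - t ^ 2) (-t))) := by
  have h := homSimilar_jexp (m := √(1 / 2)) (by positivity) 0 t
  have := (homSimilar_surface (b := M) ht).trans (by simpa [coef0, ← sub_eq_add_neg] using h)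
  exact this

/-- The translations of the plane act on the pairings diagonally. -/
lemma homSimilar_hypc_mul {l m : ℝ} (hl : 0 < l) (hm : 0 < m) (a b c d : ℝ) :
    HomSimilar (cspin (hypc a b c d)) (cspin (hypc (l * a) (m * b) (m⁻¹ * c) (l⁻¹ * d))) := by
  have hA := Real.exp_pos ((Real.log l + Real.log m) / 2)
  have hB := Real.exp_pos ((Real.log l - Real.log m) / 2)
  have hC : ∀ u, cs 1 u = (Real.exp u + (Real.exp u)⁻¹) / 2 := fun u => by
    rw [cs_of_nonneg zero_le_one, Real.sqrt_one, one_mul, Real.cosh_eq, Real.exp_neg]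
  have hS : ∀ u, sn 1 u = (Real.exp u - (Real.exp u)⁻¹) / 2 := fun u => by
    have := sqrt_mul_sn_of_nonneg zero_le_one u
    rwa [Real.sqrt_one, one_mul, one_mul, Real.sinh_eq, Real.exp_neg] at this
  have e1 : Real.exp ((Real.log l + Real.log m) / 2) * Real.exp ((Real.log l - Real.log m) / 2) = l := by
    rw [← Real.exp_add, ← Real.exp_log hl]; simp; ring
  have e2 : Real.exp ((Real.log l + Real.log m) / 2) = m * Real.exp ((Real.log l - Real.log m) / 2) := by
    rw [← Real.exp_log hm, ← Real.exp_add]; simp; ring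
  -- These shifts of u and v have sum log l and difference log m, so e^{u + v} is multiplied by l
  -- and e^{u - v} by m.
  refine (homSimilar_shiftc _ ((Real.log l + Real.log m) / 2) ((Real.log l - Real.log m) / 2)).trans
    (homSimilar_of_gram (g := 1) (by simp [shiftc]) one_ne_zero ?_ ?_ ?_)
  · simp [wX_shiftc]
  · rw [gram_hypc, one_smul]
    simp only [gram, shiftc, hypc, gramc, Matrix.cons_val, sol, hC, hS]
    generalize Real.exp ((Real.log l + Real.log m) / 2) = x at *
    generalize Real.exp ((Real.log l - Real.log m) / 2) = y at *
    obtain rfl : m = x / y := by rw [e2]; field_simp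
    subst e1
    ext i; fin_cases i <;> simp <;> field_simp <;> ring
  · simp [wX_shiftc]

lemma homSimilar_gramc_neg (κ a b c d : ℝ) :
    HomSimilar (cspin (gramc κ a b c d)) (cspin (gramc κ (-a) (-b) (-c) (-d))) :=
  homSimilar_of_gram (g := -1) (by simp) (by norm_num) (by simp [wX_gramc])
    (by simp [gram_gramc]) (by simp [wX_gramc])

lemma homSimilar_hypc_neg (a b c d : ℝ) :
    HomSimilar (cspin (hypc a b c d)) (cspin (hypc (-a) (-b) (-c) (-d))) :=
  homSimilar_of_gram (g := -1) (by simp) (by norm_num) (by simp)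
    (by rw [gram_hypc, gram_hypc]; ext i; fin_cases i <;> simp <;> ring) (by simp)

/-- The half turn z ↦ -z exchanges e^{u + v} with e^{-u - v} and e^{u - v} with e^{-u + v}. -/
lemma homSimilar_hypc_flip (a b c d : ℝ) :
    HomSimilar (cspin (hypc a b c d)) (cspin (hypc d c b a)) := by
  refine homSimilar_gramc (l := -1) (g := 1) (by simp) (by norm_num) one_ne_zero ?_ (by simp)
  rw [gram_hypc]
  ext i; fin_cases i <;> simp <;> ring

/-- The reflection y ↦ -y exchanges the null coordinates and transposes the Gram matrix. The first
Wronskian becomes the determinant a d - b c, which therefore has to be ±1. -/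
lemma affineSimilar_gramc_swap {κ a b c d : ℝ} (h : (a * d - b * c) ^ 2 = 1) :
    AffineSimilar (cspin (gramc κ a b c d)) (cspin (gramc κ a c b d)) := by
  have h1 := affineSimilar_swapc (swapc (gramc κ a b c d))
  have e : swapc (swapc (gramc κ a b c d)) = gramc κ a b c d := by
    ext i; fin_cases i <;> rfl
  rw [e] at h1
  have hw : wX (swapc (gramc κ a b c d)) = a * d - c * b := by simp [wX, swapc, gramc]
  refine h1.trans (homSimilar_of_gram (g := 1) (by simp [swapc]) one_ne_zero ?_ ?_ ?_).affineSimilar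
  · rw [hw]; intro h0
    rw [mul_comm b c, h0] at h
    norm_num at h
  · simp [gram, swapc, gramc]
  · rw [hw, wX_gramc]; linear_combination h

lemma affineSimilar_hypc_swap {a b c d : ℝ} (h : a * d - b * c = 1) :
    AffineSimilar (cspin (hypc a b c d)) (cspin (hypc a c b d)) := by
  have := affineSimilar_gramc_swap (κ := 1) (a := (a + b + c + d) / 2) (b := (a - b + c - d) / 2)
    (c := (a + b - c - d) / 2) (d := (a - b - c + d) / 2) (by
      rw [show (a + b + c + d) / 2 * ((a - b - c + d) / 2) - (a - b + c - d) / 2 * ((a + b - c - d) / 2) =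
        a * d - b * c by ring, h, one_pow])
  rwa [hypc, hypc, show a + c + b + d = a + b + c + d by ring, show a - c + b - d = a + b - c - d by ring,
    show a + c - b - d = a - b + c - d by ring, show a - c - b + d = a - b - c + d by ring]

lemma homSimilar_S2 {t : ℝ} (ht : t ∈ params S2) (h : t ≠ Real.pi / 4) :
    HomSimilar (surface S2 t) (cspin (hypc (a0 t / a1 t) (-1) (1 - (a0 t / a1 t) ^ 2) (a0 t / a1 t))) := by
  obtain ⟨h0, h1, h2, h3⟩ := params_S2 ht
  have h4 : 0 < a1 t := Real.sqrt_pos.2 (h3 h)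
  have h5 : 0 ≤ a0 t := Real.sqrt_nonneg _
  have e : coef0 S2 t = scalec (√(2 * (a1 t + a0 t)))⁻¹ ![(a1 t / 2) ^ 2, 1, a1 t / 2 + a0 t,
      1, -(a1 t / 2), -1, a1 t / 2 + a0 t, 1, a1 t / 2] := by
    have : √(2 * (a1 t + a0 t)) ≠ 0 := by positivity
    ext i; fin_cases i <;> simp [coef0, scalec]
    field_simp
  refine (homSimilar_surface ht).trans ?_
  rw [e]
  have h6 : HomSimilar (cspin (hypc (a0 t / a1 t) (-(1 + a0 t / a1 t)) (1 - a0 t / a1 t) (a0 t / a1 t)))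
      (cspin (hypc (a0 t / a1 t) (-1) (1 - (a0 t / a1 t) ^ 2) (a0 t / a1 t))) := by
    have := homSimilar_hypc_mul one_pos (m := (1 + a0 t / a1 t)⁻¹) (by positivity) (a0 t / a1 t)
      (-(1 + a0 t / a1 t)) (1 - a0 t / a1 t) (a0 t / a1 t)
    rwa [one_mul, inv_one, one_mul, inv_inv, mul_neg, inv_mul_cancel₀ (by positivity),
      show (1 + a0 t / a1 t) * (1 - a0 t / a1 t) = 1 - (a0 t / a1 t) ^ 2 by ring] at this
  refine (homSimilar_scalec (by positivity) _).trans (HomSimilar.trans (homSimilar_gramc (κ := 1)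
    (l := a1 t / 2) (g := 2 * (a1 t + a0 t) / a1 t) ?_ ?_ ?_ ?_ ?_) h6)
  · simp
  · positivity
  · positivity
  · ext i; fin_cases i <;> simp [gram]
    · exact Or.inr (by ring)
    all_goals field_simp; ring
  · simp [wX]; field_simp; ring

end PlanarCurvature
end

noncomputable section

namespace PlanarCurvature

open Branch

/-! ### The named surfaces -/

lemma exists_S2 {c : ℝ} (hc : 0 < c) : ∃ t ∈ params S2,
    HomSimilar (surface S2 t) (cspin (hypc c (-1) (1 - c ^ 2) c)) := by
  -- The equation a0 / a1 = c reads cos t = c² (cos t - sin t).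
  set t := Real.arctan (1 - 1 / c ^ 2) with ht
  have hlt : t < Real.pi / 4 := by
    rw [ht, ← Real.arctan_one]
    exact Real.arctan_strictMono (sub_lt_self _ (by positivity))
  have hm : t ∈ params S2 := ⟨(Real.neg_pi_div_two_lt_arctan _).le, hlt.le⟩
  have hcos : 0 < Real.cos t := Real.cos_arctan_pos _
  have htan : Real.sin t = (1 - 1 / c ^ 2) * Real.cos t := by
    rw [← Real.tan_mul_cos hcos.ne', ht, Real.tan_arctan]
  have e : a0 t / a1 t = c := by
    rw [a0, a1, ← Real.sqrt_div hcos.le, htan,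
      show Real.cos t / (Real.cos t - (1 - 1 / c ^ 2) * Real.cos t) = c ^ 2 by field_simp; ring,
      Real.sqrt_sq hc.le]
  refine ⟨t, hm, ?_⟩
  have := homSimilar_S2 hm hlt.ne
  rwa [e] at this

lemma exists_P {A : ℝ} (hA : 0 < A) : ∃ t ∈ params P,
    HomSimilar (surface P t) (cspin (gramc (-1) A⁻¹ 0 0 A)) := by
  -- At t = π/4 + θ the amplitude of h satisfies A² = (cos t + sin t) / (sin t - cos t) = cot θ.
  set θ := Real.arctan (1 / A ^ 2) with hθ
  have h0 : 0 < θ := Real.arctan_pos.2 (by positivity)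
  have h1 : θ < Real.pi / 2 := Real.arctan_lt_pi_div_two _
  have hcos : 0 < Real.cos θ := Real.cos_arctan_pos _
  have htan : Real.sin θ = 1 / A ^ 2 * Real.cos θ := by
    rw [← Real.tan_mul_cos hcos.ne', hθ, Real.tan_arctan]
  have hm : Real.pi / 4 + θ ∈ params P := by constructor <;> linarith [Real.pi_pos]
  have hq := q2_pos 3
  have e1 : Real.cos (2 * (Real.pi / 4 + θ)) = -(√2 * Real.cos θ / A) ^ 2 := by
    rw [show 2 * (Real.pi / 4 + θ) = 2 * θ + Real.pi / 2 by ring, Real.cos_add_pi_div_two,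
      Real.sin_two_mul, htan, div_pow, mul_pow, Real.sq_sqrt zero_le_two]
    field_simp
  have e2 : Real.cos (Real.pi / 4 + θ) + Real.sin (Real.pi / 4 + θ) = √2 * Real.cos θ := by
    rw [Real.cos_add, Real.sin_add, Real.cos_pi_div_four, Real.sin_pi_div_four]; ring
  refine ⟨_, hm, (homSimilar_surface hm).trans ?_⟩
  have := homSimilar_trig (A := A) (k := √2 * Real.cos θ / A / q2 3) (m := ampP (Real.pi / 4 + θ))
    hA.ne' (by positivity) (ampP_pos _).ne'
  convert this using 2
  rw [coef0, e1, e2, show A * (√2 * Real.cos θ / A / q2 3) = √2 * Real.cos θ / q2 3 by field_simp,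
    div_pow _ (q2 3), neg_div]

lemma homSimilar_P_quarter :
    HomSimilar (surface P (Real.pi / 4)) (cspin (gramc 0 1 0 0 1)) := by
  have hm : Real.pi / 4 ∈ params P := by constructor <;> linarith [Real.pi_pos]
  have hq := q2_pos 3
  have := homSimilar_linear (A := (Real.cos (Real.pi / 4) + Real.sin (Real.pi / 4)) / q2 3)
    (m := ampP (Real.pi / 4)) (by rw [Real.cos_pi_div_four, Real.sin_pi_div_four]; positivity)
    (ampP_pos _).ne'
  refine (homSimilar_surface hm).trans ?_
  convert this using 2
  rw [coef0, show 2 * (Real.pi / 4) = Real.pi / 2 by ring, Real.cos_pi_div_two, zero_div]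

lemma homSimilar_plane (h : Para → Para) (η : Para → Para) (hh : ∀ z, h z = 0) (hη : ∀ z, η z = 1) :
    HomSimilar (weierstrass h η) (surface P (-(Real.pi / 4))) := by
  have hq := q2_pos 3
  refine ⟨_, isSimilarity_smul (k := q2 3 / 3) (by positivity), 1, 0, one_ne_zero, fun z => ?_⟩
  rw [one_smul, add_zero]
  ext i
  fin_cases i <;> simp [weierstrass, weierstrassForm, hh, hη, surface, surfaceP, j] <;> field_simp

theorem exists_homSimilar_of_isNamed {h η : Para → Para} (hn : IsNamed h η) :
    ∃ G ∈ members, HomSimilar (weierstrass h η) G := by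
  have half : (√(1 / 2 : ℝ)) ^ 2 = 1 / 2 := Real.sq_sqrt (by norm_num)
  have half0 : √(1 / 2 : ℝ) ≠ 0 := by positivity
  -- These data have the Gram matrix of S2 with a0 / a1 = c. The cases c < 1, c = 1 and c > 1 need
  -- no distinction.
  have hS2 : ∀ c : ℝ, 0 < c → ∃ G ∈ members, HomSimilar (weierstrass
      (fun z => j * pexp (j * z) - c • j) fun z => (1 / 2 : ℝ) • pexp (-(j * z))) G := fun c hc => by
    obtain ⟨t, ht, h⟩ := exists_S2 hc
    refine ⟨_, ⟨S2, t, ht, rfl⟩, ?_⟩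
    rw [weierstrass_jexp (t := 0) (t' := -c) half0 (fun z => by apply para_ext <;> simp; ring)
      (fun z => by rw [half])]
    have := homSimilar_jexp half0 0 (-c)
    simp only [zero_sub, neg_neg, zero_add, ne_eq, OfNat.ofNat_ne_zero, not_false_eq_true, zero_pow,
      neg_sq, add_zero] at this ⊢
    exact this.trans h.symm
  have hS4 : ∀ c : ℝ, 0 ≤ c → ∃ G ∈ members, HomSimilar (weierstrass
      (fun z => j * pexp (j * z) + ofReal c) fun z => (1 / 2 : ℝ) • pexp (-(j * z))) G := fun c hc => by
    refine ⟨_, ⟨S4, c, hc, rfl⟩, ?_⟩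
    rw [weierstrass_jexp (t := c) (t' := 0) half0 (fun z => by simp) (fun z => by rw [half])]
    have := homSimilar_jexp half0 c 0
    simp only [sub_zero, add_zero, ne_eq, OfNat.ofNat_ne_zero, not_false_eq_true, zero_pow] at this ⊢
    exact this.trans (homSimilar_S4 hc).symm
  have hBL2 : ∀ c : ℝ, c ∈ params BL2 → ∃ G ∈ members, HomSimilar (weierstrass
      (fun z => pexp z + c • j) fun z => (1 / 2 : ℝ) • pexp (-z)) G := fun c hc => by
    refine ⟨_, ⟨BL2, c, hc, rfl⟩, ?_⟩
    rw [weierstrass_exp (k := 1) (t := c) one_ne_zero half0 (fun z => by rw [one_smul])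
      (fun z => by rw [half, one_smul])]
    exact (homSimilar_exp one_ne_zero half0 c).trans (homSimilar_BL2 hc).symm
  have hP : ∀ c : ℝ, 0 < c → ∃ G ∈ members, HomSimilar (weierstrass
      (fun z => c • ptan z) fun z => (1 / (2 * c)) • pcos z ^ 2) G := fun c hc => by
    obtain ⟨t, ht, h⟩ := exists_P hc
    have hm : √(1 / (2 * c)) ≠ 0 := by positivity
    refine ⟨_, ⟨P, t, ht, rfl⟩, ?_⟩
    rw [weierstrass_tan (k := 1) hc.ne' one_ne_zero hm (fun z => by rw [one_smul])
      (fun z => by rw [Real.sq_sqrt (by positivity), one_smul])]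
    exact (homSimilar_trig hc.ne' one_ne_zero hm).trans h.symm
  have hA : ∀ φ : ℝ, ∃ G ∈ members, HomSimilar (weierstrass h5 fun z => pexp (φ • j) * η5 z) G := by
    intro φ
    refine ⟨_, ⟨A, φ / 2, mem_univ _, rfl⟩, ?_⟩
    rw [weierstrass_h5 (φ := φ / 2) (fun z => by rw [mul_div_cancel₀ _ two_ne_zero])]
    exact (homSimilar_surface (b := A) (mem_univ _)).symm
  cases hn with
  | plane => exact ⟨_, ⟨P, _, by constructor <;> linarith [Real.pi_pos], rfl⟩,
      homSimilar_plane _ _ (fun _ => rfl) fun _ => rfl⟩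
  | CT => simpa using hP 1 one_pos
  | BTper c hc => exact hP c (by linarith)
  | E =>
    refine ⟨_, ⟨P, Real.pi / 4, by constructor <;> linarith [Real.pi_pos], rfl⟩, ?_⟩
    have hm : √(1 / (2 * √2)) ≠ 0 := by positivity
    rw [weierstrass_linear (A := √2) (by positivity) hm (fun z => rfl)
      (fun z => by rw [Real.sq_sqrt (by positivity)])]
    exact (homSimilar_linear (by positivity) hm).trans homSimilar_P_quarter.symm
  | BT1 c hc => exact hS2 c (by linarith)
  | CS1 => simpa using hBL2 0 (by constructor <;> norm_num)
  | BL1 => simpa using hS2 1 one_pos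
  | BS c hc hc' => exact hS2 c hc
  | CS2 =>
    have h0 : ofReal 0 = 0 := rfl
    simpa [h0] using hS4 0 le_rfl
  | BL2 => simpa using hBL2 1 (by constructor <;> norm_num)
  | BT2 c hc => exact hS4 c hc.le
  | CL =>
    have h0 : pexp 0 = 1 := by apply para_ext <;> simp
    simpa [h0] using hA 0
  | assocCL φ => exact hA φ

end PlanarCurvature
end

noncomputable section

namespace PlanarCurvature

open Branch

/-! ### Every model surface is similar to a member -/

/-- `F` is a member up to a similarity of space and an affine transformation of the plane. -/
def IsMemberLike (F : ℝ × ℝ → Mink) : Prop := ∃ G ∈ members, AffineSimilar F G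

variable {F G : ℝ × ℝ → Mink} {a b c d κ : ℝ} {e : Fin 9 → ℝ}

lemma IsMemberLike.of_affineSimilar (h : IsMemberLike G) (h' : AffineSimilar F G) : IsMemberLike F :=
  let ⟨H, hH, h⟩ := h
  ⟨H, hH, h'.trans h⟩

lemma IsMemberLike.of_homSimilar (h : IsMemberLike G) (h' : HomSimilar F G) : IsMemberLike F :=
  h.of_affineSimilar h'.affineSimilar

lemma isMemberLike_of_surface {B : Branch} {t : ℝ} (ht : t ∈ params B)
    (h : HomSimilar (surface B t) F) : IsMemberLike F :=
  ⟨_, ⟨B, t, ht, rfl⟩, h.symm.affineSimilar⟩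

/-- Translations normalize b to -1, and the determinant gives c = 1 - a d, so only the product a d
and the signs of a and d count. Two positive signs give S2, opposite signs S4, two negative signs M.
If just one of a, d is zero, the surface is the end t = 1 of BL2; if both are, it is S4 at 0. -/
lemma isMemberLike_hypc_of_neg (h : a * d - b * c = 1) (hb : b < 0) :
    IsMemberLike (cspin (hypc a b c d)) := by
  have scale : ∀ {a b c d l : ℝ}, a * d - b * c = 1 → b < 0 → 0 < l →
      HomSimilar (cspin (hypc a b c d)) (cspin (hypc (l * a) (-1) (1 - a * d) (l⁻¹ * d))) := by
    intro a b c d l h hb hl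
    have := homSimilar_hypc_mul hl (m := -b⁻¹) (by rw [neg_pos]; exact inv_neg''.2 hb) a b c d
    rwa [neg_mul, inv_mul_cancel₀ hb.ne, inv_neg, inv_inv,
      show -b * c = 1 - a * d by linear_combination h] at this
  have flip : ∀ {a b c d : ℝ}, a * d - b * c = 1 →
      AffineSimilar (cspin (hypc a b c d)) (cspin (hypc d b c a)) := fun {a b c d} h =>
    (homSimilar_hypc_flip a b c d).affineSimilar.trans
      (affineSimilar_hypc_swap (by linear_combination h))
  have pos_zero : ∀ {a b c d : ℝ}, a * d - b * c = 1 → b < 0 → 0 < a → d = 0 →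
      IsMemberLike (cspin (hypc a b c d)) := by
    intro a b c d h hb ha hd
    have h1 := scale h hb (inv_pos.2 ha)
    have ht : (1 : ℝ) ∈ params BL2 := by constructor <;> norm_num
    refine (isMemberLike_of_surface ht (homSimilar_BL2 ht)).of_homSimilar ?_
    simpa [hd, ha.ne'] using h1
  have pos_neg : ∀ {a b c d : ℝ}, a * d - b * c = 1 → b < 0 → 0 < a → d < 0 →
      IsMemberLike (cspin (hypc a b c d)) := by
    intro a b c d h hb ha hd
    have hp : 0 < -(a * d) := neg_pos.2 (mul_neg_of_pos_of_neg ha hd)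
    have hs := Real.sqrt_pos.2 hp
    have hss := Real.sq_sqrt hp.le
    set t := √(-(a * d))
    -- This scaling makes the outer coefficients equal in absolute value.
    have h1 := scale h hb (l := t / a) (by positivity)
    refine (isMemberLike_of_surface hs.le (homSimilar_S4 hs.le)).of_homSimilar ?_
    rwa [div_mul_cancel₀ _ ha.ne', show (t / a)⁻¹ * d = -t by field_simp; linear_combination hss,
      show 1 - a * d = 1 + t ^ 2 by rw [hss]; ring] at h1
  have zero_neg : ∀ {a b c d : ℝ}, a * d - b * c = 1 → b < 0 → a = 0 → d < 0 →
      IsMemberLike (cspin (hypc a b c d)) := by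
    intro a b c d h hb ha hd
    subst ha
    have hc : -c < 0 := by
      by_contra hc
      nlinarith
    exact (pos_zero (by linear_combination h) hc (neg_pos.2 hd) neg_zero).of_homSimilar
      ((homSimilar_hypc_flip _ _ _ _).trans (homSimilar_hypc_neg _ _ _ _))
  rcases lt_trichotomy a 0 with ha | ha | ha <;> rcases lt_trichotomy d 0 with hd | hd | hd
  · have hp : 0 < a * d := mul_pos_of_neg_of_neg ha hd
    have hs := Real.sqrt_pos.2 hp
    have hss := Real.sq_sqrt hp.le
    set t := √(a * d)
    have h1 := scale h hb (l := t / -a) (div_pos hs (neg_pos.2 ha))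
    refine (isMemberLike_of_surface hs.le (homSimilar_M hs.le)).of_homSimilar ?_
    rwa [show t / -a * a = -t by rw [div_neg, neg_mul, div_mul_cancel₀ _ ha.ne],
      show (t / -a)⁻¹ * d = -t by rw [inv_div]; field_simp; linear_combination hss, ← hss] at h1
  · exact (zero_neg (by linear_combination h) hb hd ha).of_affineSimilar (flip h)
  · exact (pos_neg (by linear_combination h) hb hd ha).of_affineSimilar (flip h)
  · exact zero_neg h hb ha hd
  · have h1 := scale h hb one_pos
    refine (isMemberLike_of_surface (le_refl (0 : ℝ)) (homSimilar_S4 le_rfl)).of_homSimilar ?_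
    simpa [ha, hd] using h1
  · exact (pos_zero (by linear_combination h) hb hd ha).of_affineSimilar (flip h)
  · exact pos_neg h hb ha hd
  · exact pos_zero h hb ha hd
  · have hp : 0 < a * d := mul_pos ha hd
    have hs := Real.sqrt_pos.2 hp
    have hss := Real.sq_sqrt hp.le
    obtain ⟨τ, hτ, hτ'⟩ := exists_S2 hs
    have h1 := scale h hb (l := √(a * d) / a) (by positivity)
    refine (isMemberLike_of_surface hτ hτ').of_homSimilar ?_
    rwa [div_mul_cancel₀ _ ha.ne',
      show (√(a * d) / a)⁻¹ * d = √(a * d) by rw [inv_div]; field_simp; linear_combination -hss,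
      show 1 - a * d = 1 - √(a * d) ^ 2 by rw [hss]] at h1

/-- The overall sign reduces b > 0 to b < 0, and a reflection reduces b = 0 ≠ c to b ≠ 0. If b = c =
0, a translation leads to the catenoid at the start of BL2. -/
lemma isMemberLike_hypc (h : a * d - b * c = 1) : IsMemberLike (cspin (hypc a b c d)) := by
  have ne : ∀ {a b c d : ℝ}, a * d - b * c = 1 → b ≠ 0 → IsMemberLike (cspin (hypc a b c d)) := by
    intro a b c d h hb
    rcases lt_or_gt_of_ne hb with hb | hb
    · exact isMemberLike_hypc_of_neg h hb
    · exact (isMemberLike_hypc_of_neg (by linear_combination h) (neg_neg_of_pos hb)).of_homSimilar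
        (homSimilar_hypc_neg a b c d)
  by_cases hb : b = 0
  · by_cases hc : c = 0
    · subst hb hc
      have pos : ∀ {a d : ℝ}, a * d = 1 → 0 < a → IsMemberLike (cspin (hypc a 0 0 d)) := by
        intro a d h ha
        have h1 := homSimilar_hypc_mul (inv_pos.2 ha) one_pos a 0 0 d
        have ht : (0 : ℝ) ∈ params BL2 := by constructor <;> norm_num
        refine (isMemberLike_of_surface ht (homSimilar_BL2 ht)).of_homSimilar ?_
        simpa [h, ha.ne'] using h1
      rcases lt_trichotomy a 0 with ha | ha | ha
      · refine IsMemberLike.of_homSimilar ?_ (homSimilar_hypc_neg a 0 0 d)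
        rw [neg_zero]
        exact pos (by linear_combination h) (neg_pos.2 ha)
      · simp [ha] at h
      · exact pos (by linear_combination h) ha
    · exact (ne (by linear_combination h) hc).of_affineSimilar (affineSimilar_hypc_swap h)
  · exact ne h hb

lemma isMemberLike_of_pos (hκ : 0 < κ) (h : a * d - b * c = 1) :
    IsMemberLike (cspin (gramc κ a b c d)) := by
  have hs := Real.sqrt_pos.2 hκ
  have hss := Real.sq_sqrt hκ.le
  set l := √κ
  -- A homothety brings κ to 1, and the witnesses are the coefficients of the same pairing in the
  -- exponentials e^{±u ± v}. This change of basis is its own inverse.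
  refine (isMemberLike_hypc (a := (l * a + b + c + d / l) / 2) (b := (l * a - b + c - d / l) / 2)
    (c := (l * a + b - c - d / l) / 2) (d := (l * a - b - c + d / l) / 2) ?_).of_homSimilar
    (homSimilar_gramc (l := l) (g := l⁻¹) ?_ hs.ne' (by positivity) ?_ ?_)
  · field_simp
    linear_combination 4 * l ^ 2 * h
  · simp [hss]
  · rw [gram_gramc]; ext i; fin_cases i <;> simp <;> field_simp <;> ring
  · rw [wX_gramc]; field_simp

lemma exists_phase (x y : ℝ) : ∃ σ, x * Real.sin σ + y * Real.cos σ = 0 := by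
  by_cases h : x = 0
  · exact ⟨Real.pi / 2, by simp [h]⟩
  · refine ⟨Real.arctan (-y / x), ?_⟩
    rw [← Real.tan_mul_cos (Real.cos_arctan_pos _).ne', Real.tan_arctan]
    field_simp; ring

/-- With κ = -1 translations of u and v multiply the Gram matrix by rotations from the left and from
the right, so a singular value decomposition makes it diagonal. Diagonal matrices of determinant 1
are, up to sign, those of the trigonometric half of P. -/
lemma isMemberLike_of_neg (hκ : κ < 0) (h : a * d - b * c = 1) :
    IsMemberLike (cspin (gramc κ a b c d)) := by
  have diag : ∀ {x y : ℝ}, x * y = 1 → IsMemberLike (cspin (gramc (-1) x 0 0 y)) := by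
    have pos : ∀ {x y : ℝ}, x * y = 1 → 0 < y → IsMemberLike (cspin (gramc (-1) x 0 0 y)) := by
      intro x y h hy
      obtain ⟨t, ht, h'⟩ := exists_P hy
      rw [eq_inv_of_mul_eq_one_left h]
      exact isMemberLike_of_surface ht h'
    intro x y h
    rcases lt_trichotomy y 0 with hy | hy | hy
    · refine IsMemberLike.of_homSimilar ?_ (homSimilar_gramc_neg _ _ _ _ _)
      rw [neg_zero]
      exact pos (by linear_combination h) (neg_pos.2 hy)
    · simp [hy] at h
    · exact pos h hy
  have hs := Real.sqrt_pos.2 (neg_pos.2 hκ)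
  have hss := Real.sq_sqrt (neg_pos.2 hκ).le
  set l := √(-κ)
  have h1 : HomSimilar (cspin (gramc κ a b c d)) (cspin (gramc (-1) (l * a) b c (d / l))) := by
    refine homSimilar_gramc (l := l) (g := l⁻¹) ?_ hs.ne' (by positivity) ?_ ?_
    · simp [hss]
    · rw [gram_gramc]; ext i; fin_cases i <;> simp <;> field_simp
    · rw [wX_gramc]; field_simp
  have h' : l * a * (d / l) - b * c = 1 := by field_simp; linear_combination h
  generalize l * a = a at *
  generalize d / l = d at *
  refine IsMemberLike.of_homSimilar ?_ h1
  -- The sum of the off-diagonal entries depends on α + β alone and their difference on α - β alone,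
  -- so two independent phases annihilate both.
  obtain ⟨σ, hσ⟩ := exists_phase (d - a) (b + c)
  obtain ⟨δ, hδ⟩ := exists_phase (a + d) (b - c)
  obtain ⟨α, β, hα, hβ⟩ : ∃ α β, σ = α + β ∧ δ = α - β := ⟨(σ + δ) / 2, (σ - δ) / 2, by ring, by ring⟩
  rw [hα, Real.sin_add, Real.cos_add] at hσ
  rw [hβ, Real.sin_sub, Real.cos_sub] at hδ
  have hC : ∀ u, cs (-1) u = Real.cos u := fun u => by
    rw [cs_of_nonpos (by norm_num), neg_neg, Real.sqrt_one, one_mul]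
  have hS : ∀ u, sn (-1) u = Real.sin u := fun u => by
    have := sqrt_mul_sn_of_nonpos (κ := -1) (by norm_num) u
    rwa [neg_neg, Real.sqrt_one, one_mul, one_mul] at this
  have c1 := Real.sin_sq_add_cos_sq α
  have c2 := Real.sin_sq_add_cos_sq β
  refine IsMemberLike.of_homSimilar (diag (x := a * Real.cos α * Real.cos β + b * Real.cos α * Real.sin β +
    c * Real.sin α * Real.cos β + d * Real.sin α * Real.sin β) (y := a * Real.sin α * Real.sin β -
    b * Real.sin α * Real.cos β - c * Real.cos α * Real.sin β + d * Real.cos α * Real.cos β) ?_)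
    ((homSimilar_shiftc _ α β).trans (homSimilar_of_gram (g := 1) (by simp [shiftc]) one_ne_zero
      (by simp [wX_shiftc, wX_gramc]) ?_ (by simp [wX_shiftc, wX_gramc])))
  · generalize Real.sin α = sa at *
    generalize Real.sin β = sb at *
    generalize Real.cos α = ca at *
    generalize Real.cos β = cb at *
    have g1 : -a * ca * sb + b * ca * cb - c * sa * sb + d * sa * cb = 0 := by
      linear_combination (hσ + hδ) / 2
    linear_combination (-a * sa * cb - b * sa * sb + c * ca * cb + d * ca * sb) * g1 + h' +
      (a * d - b * c) * ((cb ^ 2 + sb ^ 2) * c1 + c2)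
  · rw [gram_gramc, one_smul]
    simp only [gram, shiftc, gramc, Matrix.cons_val, sol, hC, hS]
    ext i; fin_cases i <;> simp
    · ring
    · linear_combination (hσ + hδ) / 2
    · linear_combination (hσ - hδ) / 2
    · ring

/-- The spinors after the stretching `v ↦ m ^ 2 v` of the second null coordinate. -/
def stretchYc (m : ℝ) (c : Fin 9 → ℝ) : Fin 9 → ℝ :=
  ![c 0, c 1, c 2, c 3, c 4, m * c 5, m ^ 3 * c 6, m * c 7, m ^ 3 * c 8]

/-- For κ = 0 one null coordinate can be stretched on its own, since affine functions remain affine.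
The factor m on the spinors compensates the stretching by m², so the curve is the same one traversed
at another speed. -/
lemma affineSimilar_stretchYc {m : ℝ} (hm : m ≠ 0) (he : e 0 = 0) :
    AffineSimilar (cspin (stretchYc m e)) (cspin e) := by
  let L : (ℝ × ℝ) ≃ₗ[ℝ] ℝ × ℝ :=
    { toFun := fun z => ((z.1 + z.2 + m ^ 2 * (z.1 - z.2)) / 2, (z.1 + z.2 - m ^ 2 * (z.1 - z.2)) / 2)
      map_add' := fun z w => by ext <;> simp <;> ring
      map_smul' := fun r z => by ext <;> simp <;> ring
      invFun := fun z => ((z.1 + z.2 + (m ^ 2)⁻¹ * (z.1 - z.2)) / 2,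
        (z.1 + z.2 - (m ^ 2)⁻¹ * (z.1 - z.2)) / 2)
      left_inv := fun z => by ext <;> simp <;> field_simp <;> ring
      right_inv := fun z => by ext <;> simp <;> field_simp <;> ring }
  refine ⟨id, ⟨1, .id, 0, one_pos, fun _ _ => rfl, fun p => by simp⟩, L.toContinuousLinearEquiv, 0,
    fun z => ?_⟩
  have hX : velX (stretchYc m e) = velX e := rfl
  have hY : velY (stretchYc m e) = fun t => m ^ 2 • velY e (m ^ 2 * t) := funext fun t => by
    have hs : ∀ x y, sol (e 0) (m * x) (m ^ 3 * y) t = m * sol (e 0) x y (m ^ 2 * t) := fun x y => by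
      rw [he, ← sol_stretch, mul_zero]
      simp only [sol]; ring
    simp only [velY, stretchYc, Matrix.cons_val, hs, nullY_smul]
  have hc : curve (velY (stretchYc m e)) (z.1 - z.2) = curve (velY e) (m ^ 2 * (z.1 - z.2)) := by
    have := curve_map (m ^ 2 • (LinearMap.id : Mink →ₗ[ℝ] Mink)) (X := fun t => velY e (m ^ 2 * t))
      ((contDiff_velY e (n := 0)).continuous.comp (continuous_const.mul continuous_id)) (z.1 - z.2)
    rw [hY]
    refine this.trans ?_
    rw [curve_stretch (pow_ne_zero 2 hm), LinearMap.smul_apply, LinearMap.id_apply, smul_smul,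
      mul_inv_cancel₀ (pow_ne_zero 2 hm), one_smul]
  rw [cspin_eq_curve, cspin_eq_curve, hX, hc, id, add_zero]
  change _ = curve (velX e) ((z.1 + z.2 + m ^ 2 * (z.1 - z.2)) / 2 +
    (z.1 + z.2 - m ^ 2 * (z.1 - z.2)) / 2) + curve (velY e) ((z.1 + z.2 + m ^ 2 * (z.1 - z.2)) / 2 -
    (z.1 + z.2 - m ^ 2 * (z.1 - z.2)) / 2)
  congr 2 <;> ring

/-- The pairing is the polynomial a + b v + c u + d u v. If d ≠ 0, translations remove the linear
terms and the surface is of Enneper type. If d = 0, a translation removes a, and |b| is the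
invariant that gives the parameter in the family A. -/
lemma isMemberLike_of_zero (h : a * d - b * c = 1) : IsMemberLike (cspin (gramc 0 a b c d)) := by
  have hC : ∀ u, cs 0 u = 1 := fun u => by simp [cs]
  have hS : ∀ u, sn 0 u = u := fun u => by simp [sn, cs]
  by_cases hd : d = 0
  · have hb : b ≠ 0 := fun hb => by simp [hb, hd] at h
    have ht : Real.log |b| ∈ params A := mem_univ _
    have hbc : c = -b⁻¹ := by field_simp; linear_combination -h + a * hd
    have h1 : HomSimilar (cspin (gramc 0 a b c d)) (cspin (gramc 0 0 b c 0)) := by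
      refine (homSimilar_shiftc _ 0 (-a / b)).trans (homSimilar_of_gram (g := 1) (by simp [shiftc])
        one_ne_zero (by simp [wX_shiftc, wX_gramc]) ?_ (by simp [wX_shiftc, wX_gramc]))
      rw [gram_gramc, one_smul]
      simp only [gram, shiftc, gramc, Matrix.cons_val, sol, hC, hS]
      ext i; fin_cases i <;> simp [hd]
      field_simp; ring
    have hb' := abs_pos.2 hb
    have hm : |b|⁻¹ ≠ 0 := by positivity
    have he : Real.exp (Real.log |b|) = |b| := Real.exp_log hb'
    have he' : Real.exp (-Real.log |b|) = |b|⁻¹ := by rw [Real.exp_neg, he]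
    -- In the family A all Gram matrices agree, with opposite off-diagonal entries, and the
    -- parameter shows only in the Wronskians. The stretching by |b|⁻¹ makes the off-diagonal
    -- entries here opposite too, moving |b| into the Wronskians.
    have h2 : HomSimilar (cspin (stretchYc |b|⁻¹ (gramc 0 0 b c 0))) (cspin (coef0 A (Real.log |b|))) := by
      have hbb : |b| ^ 2 = b ^ 2 := sq_abs b
      refine homSimilar_of_gram (g := 2 * |b|⁻¹ / b) (by simp [stretchYc, coef0]) (by positivity)
        (by simp [wX, stretchYc, gramc]) ?_ ?_
      · simp only [gram, stretchYc, gramc, coef0, he, he', Matrix.cons_val, hbc]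
        ext i; fin_cases i <;> simp <;> field_simp
        · linear_combination -2 * hbb
        · norm_num
      · simp only [wX, stretchYc, gramc, coef0, he, he', Matrix.cons_val]
        field_simp
        linear_combination -4 * hbb
    refine IsMemberLike.of_affineSimilar (IsMemberLike.of_affineSimilar (G := cspin (stretchYc |b|⁻¹
      (gramc 0 0 b c 0))) ?_ ?_) h1.affineSimilar
    · exact IsMemberLike.of_homSimilar (isMemberLike_of_surface ht (homSimilar_surface ht)) h2
    · have := affineSimilar_stretchYc (m := |b|) (e := stretchYc |b|⁻¹ (gramc 0 0 b c 0)) hb'.ne' rfl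
      have e : stretchYc |b| (stretchYc |b|⁻¹ (gramc 0 0 b c 0)) = gramc 0 0 b c 0 := by
        ext i; fin_cases i <;> simp [stretchYc, gramc] <;> field_simp
      rwa [e] at this
  · have h1 : HomSimilar (cspin (gramc 0 a b c d)) (cspin (gramc 0 1 0 0 1)) := by
      refine (homSimilar_shiftc _ (-b / d) (-c / d)).trans (homSimilar_gramc (l := d) (g := d⁻¹)
        (by simp [shiftc]) hd (inv_ne_zero hd) ?_ ?_)
      · simp only [gram, shiftc, gramc, Matrix.cons_val, sol, hC, hS]
        ext i; fin_cases i <;> simp <;> field_simp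
        · linear_combination h
        all_goals ring
      · rw [wX_shiftc, wX_gramc]; field_simp
    have ht : Real.pi / 4 ∈ params P := by constructor <;> linarith [Real.pi_pos]
    exact (isMemberLike_of_surface ht homSimilar_P_quarter).of_homSimilar h1

theorem IsCore.isMemberLike (h : IsCore e) : IsMemberLike (cspin e) := by
  rcases h with ⟨h1, h2⟩ | ⟨h0, h2, h4, h6, h8, hne, -, -⟩
  · have hw : wX e ≠ 0 := fun h => by simp [h] at h2
    have hs : HomSimilar (cspin e) (cspin (gramc (e 0) (wX e * gram e 0) (wX e * gram e 1)
        (wX e * gram e 2) (wX e * gram e 3))) := by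
      refine homSimilar_gramc (l := 1) (g := wX e) (by simp) one_ne_zero hw ?_ (by simp)
      ext i; fin_cases i <;> simp [← mul_assoc, ← pow_two, h2]
    -- The Gram determinant is the product of the two Wronskians, which is 1 since they are equal
    -- with square 1.
    have hd : wX e * gram e 0 * (wX e * gram e 3) - wX e * gram e 1 * (wX e * gram e 2) = 1 := by
      have : gram e 0 * gram e 3 - gram e 1 * gram e 2 = wX e * wY e := by
        simp [gram, wX, wY]; ring
      rw [← h1] at this
      linear_combination wX e ^ 2 * this + (wX e ^ 2 + 1) * h2
    refine IsMemberLike.of_homSimilar ?_ hs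
    rcases lt_trichotomy (e 0) 0 with hκ | hκ | hκ
    · exact isMemberLike_of_neg hκ hd
    · rw [hκ]; exact isMemberLike_of_zero hd
    · exact isMemberLike_of_pos hκ hd
  · have ht : -(Real.pi / 4) ∈ params P := by constructor <;> linarith [Real.pi_pos]
    refine IsMemberLike.of_homSimilar (isMemberLike_of_surface ht (homSimilar_surface ht)) ?_
    have hm := ampP_pos (-(Real.pi / 4))
    have e1 : coef0 P (-(Real.pi / 4)) = ![0, 0, 0, ampP (-(Real.pi / 4)), 0, 0, 0,
        ampP (-(Real.pi / 4)), 0] := by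
      rw [coef0, show 2 * -(Real.pi / 4) = -(Real.pi / 2) by ring]
      simp
    rw [e1]
    set m := ampP (-(Real.pi / 4))
    -- The spinors of the plane in P are the constants (0, m), and these coefficients send them to
    -- the constants of `e`. The determinant is the nonzero pairing divided by m².
    refine homSimilar_of_conformalMap (a := e 3 / m) (b := -(e 5 / m)) (c := e 1 / m) (d := e 7 / m)
      ?_ (fun u => ?_) fun v => ?_
    · have : e 3 / m * (e 7 / m) - -(e 5 / m) * (e 1 / m) = (e 3 * e 7 + e 1 * e 5) / m ^ 2 := by
        field_simp; ring
      rw [this]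
      positivity
    · rw [velX, velX, conformalMap_nullX]
      simp only [Matrix.cons_val, sol_eq_const h0 h2, sol_eq_const h0 h4, sol_eq_const rfl rfl]
      congr 1 <;> field_simp <;> ring
    · rw [velY, velY, conformalMap_nullY]
      simp only [Matrix.cons_val, sol_eq_const h0 h6, sol_eq_const h0 h8, sol_eq_const rfl rfl]
      congr 1 <;> field_simp <;> ring

end PlanarCurvature
end

open PlanarCurvature in
theorem mainTheorem6 :
    -- each explicit family is a continuous deformation
    (∀ b : Branch, IsContinuousDeformation (params b) (surface b)) ∧
    -- the families are joined to each other
    (surface .BL2 0 = surface .P 0 ∧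
      surface .P (Real.pi / 4) = surface .S2 (Real.pi / 4) ∧
      surface .S2 0 = surface .CL 1 ∧
      surface .CL 0 = surface .A 0 ∧
      surface .S2 (-(Real.pi / 2)) = surface .S4 0 ∧
      surface .S4 0 = surface .M 0) ∧
    -- any two members are joined by a continuous deformation through members
    (∀ G₀ ∈ members, ∀ G₁ ∈ members, ∃ Γ : ℝ → ℝ × ℝ → Mink,
      Γ 0 = G₀ ∧ Γ 1 = G₁ ∧ (∀ t ∈ Set.Icc (0 : ℝ) 1, Γ t ∈ members) ∧
      IsContinuousDeformation (Set.Icc 0 1) Γ) ∧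
    -- every member is a generalized timelike minimal surface with planar curvature lines
    (∀ G ∈ members, IsGeneralizedPCL G Set.univ) ∧
    -- every timelike minimal surface with planar curvature lines is a piece of a member
    (∀ (U : Set (ℝ × ℝ)) (F : ℝ × ℝ → Mink), IsConnected U → IsTimelikeMinimalPCL F U →
      ∃ G ∈ members, IsPieceOf F U G) ∧
    -- so is every generalized one
    (∀ (U : Set (ℝ × ℝ)) (F : ℝ × ℝ → Mink), IsConnected U → IsGeneralizedPCL F U →
      ∃ G ∈ members, IsPieceOf F U G) ∧
    -- each named surface is a member up to similarities in the plane and in space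
    (∀ h η : Para → Para, IsNamed h η → ∃ G ∈ members, ∃ T : Mink → Mink, IsSimilarity T ∧
      ∃ (s : ℝ) (p₀ : ℝ × ℝ), s ≠ 0 ∧
        ∀ p : ℝ × ℝ, weierstrass h η p = T (G (s • p + p₀))) := by
  refine ⟨isContinuousDeformation_surface, ⟨surface_BL2_zero, surface_P_quarter, surface_S2_zero,
    surface_CL_zero, surface_S2_left, surface_S4_zero⟩, fun G₀ h₀ G₁ h₁ => exists_deformation h₀ h₁,
    fun G hG => isGeneralizedPCL_of_mem_members hG, fun U F hU hF => ?_, fun U F hU hF => ?_,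
    fun h η hn => exists_homSimilar_of_isNamed hn⟩
  · obtain ⟨c, hc, h⟩ := hF.exists_isPieceOf hU
    obtain ⟨G, hG, hs⟩ := hc.isMemberLike
    exact ⟨G, hG, h.of_affineSimilar hs⟩
  · obtain ⟨c, hc, h⟩ := hF.exists_isPieceOf hU
    obtain ⟨G, hG, hs⟩ := hc.isMemberLike
    exact ⟨G, hG, h.of_affineSimilar hs⟩
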